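/- **Setting.** For each $n$ the data $W_i=(Y_i,X_i,Z_i)$, $i\le n$, are i.i.d., $X_i\in\mathbb R$, $Z_i\in\mathbb R^{d_n}$. The law of $X_i$ does not depend on $n$; it has support $\mathcal X$ and density $f_X$, continuous and bounded away from $0$ on an open neighborhood of the cutoff $0$. The conditional law of $(Y_i,Z_i)$ given $X_i$ and the dimension $d_n$ may depend on $n$; a version of this conditional law is fixed, and $\mathbb E[\,\cdot\,|X=x]$, $\mathbb V[\,\cdot\,|X=x]$ refer to it. $\mathbb E[Y|X=x]$ exists for $x\in\mathcal X$. Write $M_i(\eta)=Y_i-\eta(Z_i)$. The sample is split, independently of the data, into a fixed number $S$ of folds $I_s$ of equal size (up to rounding); $\widehat\eta_s$ is a measurable function of $\{W_i\}_{i\notin I_s}$, $s(i)$ is the fold of $i$, and $M_i(\widehat\eta)=Y_i-\widehat\eta_{s(i)}(Z_i)$. $K$ is a bounded symmetric density, continuous on its support and zero outside $[-1,1]$. $R\ge1$ is a fixed integer. $f(0^\pm)$ are one-sided limits. **Procedure.** For $\star\in\{+,-\}$ let $\mathbf 1^+_i=\mathbf 1\{X_i\ge0\}$, $\mathbf 1^-_i=\mathbf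 1\{X_i<0\}$, $r_p(x)=(1,x,\dots,x^p)^\top$, and $$w^\star_{i,v,p}(h)=v!\,e_v^\top\Big(\sum_j \tfrac1hK(\tfrac{X_j}h)\mathbf 1^\star_j\,r_p(X_j)r_p(X_j)^\top\Big)^{-1}\tfrac1hK(\tfrac{X_i}h)\mathbf 1^\star_i\,r_p(X_i),\qquad w_{i,v,p}=w^+_{i,v,p}-w^-_{i,v,p},$$ where $e_v$ selects the coefficient on $x^v$. Put $\widehat\beta^\star_{v,p}(h)=\sum_iw^\star_{i,v,p}(h)M_i(\widehat\eta)$ and $$\widehat{se}^2_{v,p}(h)=\sum_iw_{i,v,p}(h)^2\,\frac{R}{R+1}\Big(M_i(\widehat\eta)-\frac1R\sum_{j\in\mathcal R_i}M_j(\widehat\eta)\Big)^2,$$ with $\mathcal R_i$ the $R$ nearest neighbors of $i$ (other than $i$) in terms of the running variable on the same side of the cutoff. $\widehat\gamma^\star(\eta)$ is the coefficient on $x^4/4!$ in the global fourth-order polynomial regression of $M_i(\eta)$ on $X_i$ on side $\star$. Let $\bar\nu_j=\int_0^\infty u^jK(u)\,du$, and let $\mathcal B_{v,p}=\frac{v!}{(p+1)!}(\Gamma_p^{-1}\vartheta_p)_v$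 with $\Gamma_p=(\bar\nu_{i+j})_{0\le i,j\le p}$, $\vartheta_p=(\bar\nu_{i+p+1})_{0\le i\le p}$. For bandwidths $v_n,c,b$ let $$\widehat c_n=\Big(\frac{7nv_n^7\,\widehat{se}^2_{3,3}(v_n)}{2\mathcal B_{3,3}^2(\widehat\gamma^+(\widehat\eta)-\widehat\gamma^-(\widehat\eta))^2}\Big)^{1/9}n^{-1/9},$$ $$\widehat b_n(c)=\Big(\frac{5nv_n^5\,\widehat{se}^2_{2,2}(v_n)}{2\mathcal B_{2,2}^2\{(\widehat\beta^+_{3,3}(c)+\widehat\beta^-_{3,3}(c))^2+3\widehat{se}^2_{3,3}(c)\}}\Big)^{1/7}n^{-1/7},$$ $$\widehat h_n(b)=\Big(\frac{nv_n\,\widehat{se}^2_{0,1}(v_n)}{4\mathcal B_{0,1}^2\{(\widehat\beta^+_{2,2}(b)-\widehat\beta^-_{2,2}(b))^2+3\widehat{se}^2_{2,2}(b)\}}\Big)^{1/5}n^{-1/5}.$$ **Target.** $h_{AMSE}=\big(V(\bar\eta)/(4B_{base}^2)\big)^{1/5}n^{-1/5}$, where $$B_{base}=\tfrac{\bar\nu}2\big(\partial_x^2\mathbb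 E[Y|X=x]|_{0^+}-\partial_x^2\mathbb E[Y|X=x]|_{0^-}\big),\qquad V(\bar\eta)=\tfrac{\bar\kappa}{f_X(0)}\big(\mathbb V[M(\bar\eta)|X=0^+]+\mathbb V[M(\bar\eta)|X=0^-]\big),$$ $\bar\nu=(\bar\nu_2^2-\bar\nu_1\bar\nu_3)/(\bar\nu_2\bar\nu_0-\bar\nu_1^2)$ and $\bar\kappa=\int_0^\infty(K(u)(\bar\nu_1u-\bar\nu_2))^2du/(\bar\nu_2\bar\nu_0-\bar\nu_1^2)^2$. **Assumptions.** $\mathcal X$ is bounded; $v_n>0$ is nonrandom with $v_n\to0$, $nv_n\to\infty$. For every $n$ there are a set $\mathcal T_n$ of measurable functions $\eta$ for which $\mathbb E[\eta(Z)|X=x]$ exists on $\mathcal X$ and is $C^2$ around $0$, and $\bar\eta=\bar\eta_n\in\mathcal T_n$, such that: 1. for each $s$, $\widehat\eta_s\in\mathcal T_n$ with probability approaching one, and $\sup_{\eta\in\mathcal T_n}\sup_{x\in\mathcal X}\mathbb E[(\eta(Z)-\bar\eta(Z))^2|X=x]=O(r_n^2)$ for some $r_n=o(1)$; 2. with constants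 $C,L$ and $q>2$ not depending on $n$: $g(x)=\mathbb E[M(\bar\eta)|X=x]$ is $C^4$ on $\mathcal X\setminus\{0\}$, $g''$ and $g^{(4)}$ are bounded by $C$ there; $g,g'',g^{(4)}$ and $\mathbb V[M(\bar\eta)|X=x]$ are $L$-Lipschitz on each side of the cutoff; $\mathbb V[M(\bar\eta)|X=x]\ge1/C$ on $\mathcal X\setminus\{0\}$; $\mathbb E[|M(\bar\eta)-g(x)|^q\,|X=x]\le C$ on $\mathcal X$; 3. $\mathbb E[(M(\eta)-\mathbb E[M(\eta)|X])^4|X=x]$ is bounded uniformly over $n$, $\eta\in\mathcal T_n$ and $x\in U_n\cap\mathcal X$, for some open $U_n\supset\mathcal X\cap[-v_n,v_n]$; 4. for some $C>0$, $\mathbb P[1/C\le|\widehat\gamma^+(\bar\eta)-\widehat\gamma^-(\bar\eta)|\le C]\to1$; 5. for $k\in\{2,3\}$, $|\beta_k^+-(-1)^k\beta_k^-|$ is bounded and bounded away from zero uniformly in $n$, where $\beta_k^\pm=g^{(k)}(0^\pm)$. For a sequence $h=h_n$ let $D(h)$ denote the condition that, for $1\le j\le4$, the derivatives $\partial_x^j\mathbb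 E[\eta(Z)-\bar\eta(Z)|X=x]$ exist for large $n$ and are $O(v_{j,n})$, for some $v_{j,n}=o(1)$, uniformly over $\eta\in\mathcal T_n$ and $x\in(\mathcal X\cap[-h_n,h_n])\setminus\{0\}$. **Conclusion.** - $\widehat c_n\overset p\to0$ and $n\widehat c_n^{\,7}\overset p\to\infty$. - For all nonrandom $c_n>0$ with $c_n\to0$, $nc_n^7\to\infty$ and $D(c)$: $\widehat b_n(c_n)\overset p\to0$ and $n\widehat b_n(c_n)^5\overset p\to\infty$. - For all nonrandom $b_n>0$ with $b_n\to0$, $nb_n^5\to\infty$ and $D(b)$: $\widehat h_n(b_n)/h_{AMSE}\overset p\to1$. - (Steps chained.) If $K$ has bounded variation on $[0,1]$ and $D(an^{-1/9})$ holds for every $a>0$, then $\widehat b_n=\widehat b_n(\widehat c_n)$ satisfies $\widehat b_n\overset p\to0$, $n\widehat b_n^{\,5}\overset p\to\infty$, and $\widehat h_n(\widehat b_n)/h_{AMSE}\overset p\to1$. -/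

import Mathlib

open MeasureTheory ProbabilityTheory Filter Topology

namespace RDBandwidth

/-! ### Kernels and the two sides of the cutoff -/

/-- The two sides of the cutoff, which is normalized to `0`. -/
inductive Side where
  | plus
  | minus

/-- Values of the running variable on a given side; units with running variable `0` are treated. -/
def Side.region : Side → Set ℝ
  | .plus => Set.Ici 0
  | .minus => Set.Iio 0

/-- `x ↓ 0` and `x ↑ 0`. -/
def Side.filter : Side → Filter ℝ
  | .plus => 𝓝[>] (0 : ℝ)
  | .minus => 𝓝[<] (0 : ℝ)

/-- The one-sided limit `f(0⁺)` or `f(0⁻)`. -/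
noncomputable def sideLim (s : Side) (f : ℝ → ℝ) : ℝ := limUnder s.filter f

/-- `K` is a bounded symmetric density that is continuous on its support, which is contained in
`[-1,1]`. -/
structure IsKernelFunction (K : ℝ → ℝ) : Prop where
  nonneg : ∀ u, 0 ≤ K u
  integral_eq_one : ∫ u, K u = 1
  bounded : ∃ C, ∀ u, K u ≤ C
  symm : ∀ u, K (-u) = K u
  continuousOn : ContinuousOn K (tsupport K)
  eq_zero : ∀ u, u ∉ Set.Icc (-1 : ℝ) 1 → K u = 0

/-- `∫₀^∞ u^j K(u) du`. -/
noncomputable def kernelMoment (K : ℝ → ℝ) (j : ℕ) : ℝ := ∫ u in Set.Ioi (0 : ℝ), u ^ j * K u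

/-- `ν̄ = (ν̄₂² - ν̄₁ ν̄₃) / (ν̄₂ ν̄₀ - ν̄₁²)`. -/
noncomputable def nuBar (K : ℝ → ℝ) : ℝ :=
  (kernelMoment K 2 ^ 2 - kernelMoment K 1 * kernelMoment K 3) /
    (kernelMoment K 2 * kernelMoment K 0 - kernelMoment K 1 ^ 2)

/-- `κ̄ = ∫₀^∞ (K(u) (ν̄₁ u - ν̄₂))² du / (ν̄₂ ν̄₀ - ν̄₁²)²`. -/
noncomputable def kappaBar (K : ℝ → ℝ) : ℝ :=
  (∫ u in Set.Ioi (0 : ℝ), (K u * (kernelMoment K 1 * u - kernelMoment K 2)) ^ 2) /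
    (kernelMoment K 2 * kernelMoment K 0 - kernelMoment K 1 ^ 2) ^ 2

/-- The kernel constant in the leading bias of the `p`-th order local polynomial estimator of a
`v`-th derivative at the cutoff. With `Γ = (∫₀^∞ u^(i+j) K(u) du)` and
`ϑ = (∫₀^∞ u^(i+p+1) K(u) du)` it is `v! / (p+1)! * (Γ⁻¹ ϑ)_v`: the leading bias of the right-hand
estimator is `h^(p+1-v)` times this constant times the right limit of the `(p+1)`-th derivative.
For the left-hand estimator the constant is multiplied by `(-1)^(v+p+1)`. -/
noncomputable def biasConst (K : ℝ → ℝ) (p : ℕ) (v : Fin (p + 1)) : ℝ :=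
  ((v : ℕ).factorial : ℝ) / ((p + 1).factorial : ℝ) *
    (Matrix.mulVec (Matrix.of fun i j : Fin (p + 1) => kernelMoment K ((i : ℕ) + (j : ℕ)))⁻¹
      (fun i : Fin (p + 1) => kernelMoment K ((i : ℕ) + p + 1))) v

/-! ### The bandwidth procedure for a generic data set `(x i, m i)`, `i < n` -/

section Procedure

variable {n : ℕ}

/-- `(1, x, …, x^p)`. -/
def polyVec (p : ℕ) (x : ℝ) : Fin (p + 1) → ℝ := fun k => x ^ (k : ℕ)

/-- The linear weights of the coefficient on `x^v / v!` in the least squares regression on a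
polynomial of order `p` with observation weights `k`. -/
noncomputable def wlsWeight (p : ℕ) (k x : Fin n → ℝ) (v : Fin (p + 1)) (i : Fin n) : ℝ :=
  ((v : ℕ).factorial : ℝ) *
    (Matrix.mulVec (∑ j, k j • Matrix.vecMulVec (polyVec p (x j)) (polyVec p (x j)))⁻¹
      (k i • polyVec p (x i))) v

/-- `K_h(x) = K(x/h)/h`, restricted to one side of the cutoff. -/
noncomputable def sideKernel (K : ℝ → ℝ) (h : ℝ) (s : Side) : ℝ → ℝ :=
  s.region.indicator fun x => K (x / h) / h

/-- The one-sided local polynomial weights for a `v`-th derivative. -/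
noncomputable def sideWeight (K : ℝ → ℝ) (p : ℕ) (v : Fin (p + 1)) (s : Side) (h : ℝ)
    (x : Fin n → ℝ) (i : Fin n) : ℝ :=
  wlsWeight p (fun j => sideKernel K h s (x j)) x v i

/-- The weights of the estimator of the jump in the `v`-th derivative. -/
noncomputable def jumpWeight (K : ℝ → ℝ) (p : ℕ) (v : Fin (p + 1)) (h : ℝ)
    (x : Fin n → ℝ) (i : Fin n) : ℝ :=
  sideWeight K p v .plus h x i - sideWeight K p v .minus h x i

/-- The one-sided local polynomial estimator of the `v`-th derivative at the cutoff. -/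
noncomputable def betaHat (K : ℝ → ℝ) (p : ℕ) (v : Fin (p + 1)) (s : Side) (h : ℝ)
    (x m : Fin n → ℝ) : ℝ :=
  ∑ i, sideWeight K p v s h x i * m i

/-- The coefficient on `x^4 / 4!` in the global fourth-order polynomial regression on one side. -/
noncomputable def gammaHat (s : Side) (x m : Fin n → ℝ) : ℝ :=
  ∑ i, wlsWeight 4 (fun j => s.region.indicator (fun _ => (1 : ℝ)) (x j)) x (Fin.last 4) i * m i

open Classical in
/-- The `R` nearest neighbors of unit `i` among the other units on the same side of the cutoff: those
with fewer than `R` other units on that side strictly closer to `i`. -/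
noncomputable def neighbors (R : ℕ) (x : Fin n → ℝ) (i : Fin n) : Finset (Fin n) :=
  Finset.univ.filter fun j => j ≠ i ∧ (0 ≤ x j ↔ 0 ≤ x i) ∧
    (Finset.univ.filter fun k =>
      k ≠ i ∧ (0 ≤ x k ↔ 0 ≤ x i) ∧ |x k - x i| < |x j - x i|).card < R

/-- The nearest-neighbor variance estimator. -/
noncomputable def sigmaHatSq (R : ℕ) (x m : Fin n → ℝ) (i : Fin n) : ℝ :=
  (R : ℝ) / (R + 1) * (m i - 1 / (R : ℝ) * ∑ j ∈ neighbors R x i, m j) ^ 2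

/-- The squared standard error of the estimated jump in the `v`-th derivative. -/
noncomputable def seSq (K : ℝ → ℝ) (R p : ℕ) (v : Fin (p + 1)) (h : ℝ) (x m : Fin n → ℝ) : ℝ :=
  ∑ i, jumpWeight K p v h x i ^ 2 * sigmaHatSq R x m i

/-- Step 0: the initial bandwidth `ĉ`, computed from a preliminary bandwidth `v`. -/
noncomputable def cHat (K : ℝ → ℝ) (R : ℕ) (v : ℝ) (x m : Fin n → ℝ) : ℝ :=
  (7 * n * v ^ 7 * seSq K R 3 (Fin.last 3) v x m /
      (2 * biasConst K 3 (Fin.last 3) ^ 2 *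
        (gammaHat .plus x m - gammaHat .minus x m) ^ 2)) ^ (1 / 9 : ℝ) *
    (n : ℝ) ^ (-(1 / 9) : ℝ)

/-- Step 1: the pilot bandwidth `b̂`, computed from the bandwidths `v` and `c`. -/
noncomputable def bHat (K : ℝ → ℝ) (R : ℕ) (v c : ℝ) (x m : Fin n → ℝ) : ℝ :=
  (5 * n * v ^ 5 * seSq K R 2 (Fin.last 2) v x m /
      (2 * biasConst K 2 (Fin.last 2) ^ 2 *
        ((betaHat K 3 (Fin.last 3) .plus c x m + betaHat K 3 (Fin.last 3) .minus c x m) ^ 2 +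
          3 * seSq K R 3 (Fin.last 3) c x m))) ^ (1 / 7 : ℝ) *
    (n : ℝ) ^ (-(1 / 7) : ℝ)

/-- Step 2: the main bandwidth `ĥ`, computed from the bandwidths `v` and `b`. -/
noncomputable def hHat (K : ℝ → ℝ) (R : ℕ) (v b : ℝ) (x m : Fin n → ℝ) : ℝ :=
  (n * v * seSq K R 1 0 v x m /
      (4 * biasConst K 1 0 ^ 2 *
        ((betaHat K 2 (Fin.last 2) .plus b x m - betaHat K 2 (Fin.last 2) .minus b x m) ^ 2 +
          3 * seSq K R 2 (Fin.last 2) b x m))) ^ (1 / 5 : ℝ) *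
    (n : ℝ) ^ (-(1 / 5) : ℝ)

end Procedure

/-! ### Population quantities

`κ` is the conditional distribution of `(Y, Z)` given the running variable. -/

/-- An observation `(X, (Y, Z))` with `d` covariates. -/
abbrev Obs (d : ℕ) := ℝ × (ℝ × (Fin d → ℝ))

section Population

variable {d : ℕ}

/-- The adjusted outcome `M(η) = Y - η(Z)` as a function of `(Y, Z)`. -/
def adjusted (η : (Fin d → ℝ) → ℝ) (w : ℝ × (Fin d → ℝ)) : ℝ := w.1 - η w.2

/-- `x ↦ E[g(Y,Z) | X = x]`. -/
noncomputable def condMean (κ : Kernel ℝ (ℝ × (Fin d → ℝ))) (g : ℝ × (Fin d → ℝ) → ℝ) (x : ℝ) : ℝ :=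
  ∫ w, g w ∂(κ x)

/-- `x ↦ V[g(Y,Z) | X = x]`. -/
noncomputable def condVar (κ : Kernel ℝ (ℝ × (Fin d → ℝ))) (g : ℝ × (Fin d → ℝ) → ℝ) (x : ℝ) : ℝ :=
  Var[g; κ x]

/-- The one-sided limit at the cutoff of the `v`-th derivative of `E[g(Y,Z) | X = x]`. -/
noncomputable def betaPop (κ : Kernel ℝ (ℝ × (Fin d → ℝ))) (g : ℝ × (Fin d → ℝ) → ℝ) (v : ℕ)
    (s : Side) : ℝ :=
  sideLim s (iteratedDeriv v (condMean κ g))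

/-- `B_base = ν̄/2 * (∂²E[Y|X=x] at 0⁺ - ∂²E[Y|X=x] at 0⁻)`. -/
noncomputable def biasBase (K : ℝ → ℝ) (κ : Kernel ℝ (ℝ × (Fin d → ℝ))) : ℝ :=
  nuBar K / 2 * (betaPop κ Prod.fst 2 .plus - betaPop κ Prod.fst 2 .minus)

/-- `V(η) = κ̄ / f_X(0) * (V[M(η)|X=0⁺] + V[M(η)|X=0⁻])`. -/
noncomputable def asymVar (K fX : ℝ → ℝ) (κ : Kernel ℝ (ℝ × (Fin d → ℝ)))
    (η : (Fin d → ℝ) → ℝ) : ℝ :=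
  kappaBar K / fX 0 *
    (sideLim .plus (condVar κ (adjusted η)) + sideLim .minus (condVar κ (adjusted η)))

/-- `h_AMSE = (V(η) / (4 B_base²))^(1/5) * n^(-1/5)`. -/
noncomputable def hAMSE (K fX : ℝ → ℝ) (κ : Kernel ℝ (ℝ × (Fin d → ℝ)))
    (η : (Fin d → ℝ) → ℝ) (n : ℕ) : ℝ :=
  (asymVar K fX κ η / (4 * biasBase K κ ^ 2)) ^ (1 / 5 : ℝ) * (n : ℝ) ^ (-(1 / 5) : ℝ)

/-- The class of admissible adjustment functions: `E[η(Z)|X=x]` exists and is twice continuously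
differentiable around the cutoff. Here `𝒳` is the support of the running variable. -/
def IsAdmissible (𝒳 : Set ℝ) (κ : Kernel ℝ (ℝ × (Fin d → ℝ))) (η : (Fin d → ℝ) → ℝ) : Prop :=
  Measurable η ∧ (∀ x ∈ 𝒳, Integrable (fun w => η w.2) (κ x)) ∧
    ContDiffAt ℝ 2 (condMean κ fun w => η w.2) 0

end Population

/-! ### Assumptions -/

/-- `PX` has density `fX`, which is continuous and bounded away from zero on an open neighborhood of
the cutoff. -/
def HasRegularDensity (PX : Measure ℝ) (fX : ℝ → ℝ) : Prop :=
  Measurable fX ∧ (∀ x, 0 ≤ fX x) ∧ PX = volume.withDensity (fun x => ENNReal.ofReal (fX x)) ∧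
    ∃ U : Set ℝ, IsOpen U ∧ 0 ∈ U ∧ ContinuousOn fX U ∧ ∃ ε > 0, ∀ x ∈ U, ε ≤ fX x

/-- A deterministic bandwidth sequence with `h → 0` and `n h^k → ∞`. -/
def IsBandwidth (k : ℕ) (h : ℕ → ℝ) : Prop :=
  (∀ n : ℕ, 0 < h n) ∧ Tendsto h atTop (𝓝 0) ∧ Tendsto (fun n : ℕ => (n : ℝ) * h n ^ k) atTop atTop

/-- `f` is `L`-Lipschitz on `𝒳 ∩ (-∞,0)` and on `𝒳 ∩ (0,∞)`. -/
def LipschitzOnSides (L : ℝ) (𝒳 : Set ℝ) (f : ℝ → ℝ) : Prop :=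
  ∀ x ∈ 𝒳, ∀ y ∈ 𝒳, 0 < x * y → |f x - f y| ≤ L * |x - y|

section Assumptions

variable {d : ℕ → ℕ}

/-- `sup_{η ∈ T_n} sup_{x ∈ 𝒳} E[(η(Z) - η̄(Z))² | X = x] = O(r_n²)` for some `r_n = o(1)`. -/
def FirstStageConcentration (𝒳 : Set ℝ) (κ : ∀ n, Kernel ℝ (ℝ × (Fin (d n) → ℝ)))
    (T : ∀ n, Set ((Fin (d n) → ℝ) → ℝ)) (ηbar : ∀ n, (Fin (d n) → ℝ) → ℝ) : Prop :=
  ∃ r : ℕ → ℝ, Tendsto r atTop (𝓝 0) ∧ ∃ C : ℝ, ∀ᶠ n in atTop, ∀ η ∈ T n, ∀ x ∈ 𝒳,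
    ∫⁻ w, ENNReal.ofReal ((η w.2 - ηbar n w.2) ^ 2) ∂(κ n x) ≤ ENNReal.ofReal (C * r n ^ 2)

/-- For `1 ≤ j ≤ 4`, the `j`-th derivative in `x` of `E[η(Z) - η̄(Z) | X = x]` is `O(v_{j,n})`
for some `v_{j,n} = o(1)`, uniformly over `η ∈ T_n` and `x ∈ (𝒳 ∩ [-h_n, h_n]) \ {0}`. -/
def FirstStageDerivatives (𝒳 : Set ℝ) (κ : ∀ n, Kernel ℝ (ℝ × (Fin (d n) → ℝ)))
    (T : ∀ n, Set ((Fin (d n) → ℝ) → ℝ)) (ηbar : ∀ n, (Fin (d n) → ℝ) → ℝ) (h : ℕ → ℝ) : Prop :=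
  ∃ v : ℕ → ℕ → ℝ, (∀ j ∈ Finset.Icc 1 4, Tendsto (v j) atTop (𝓝 0)) ∧ ∃ C : ℝ,
    ∀ᶠ n in atTop, ∀ η ∈ T n,
      let S := (𝒳 ∩ Set.Icc (-h n) (h n)) \ {0}
      let g := condMean (κ n) fun w => η w.2 - ηbar n w.2
      (∀ j < 4, DifferentiableOn ℝ (iteratedDerivWithin j g S) S) ∧
        ∀ j ∈ Finset.Icc 1 4, ∀ x ∈ S, |iteratedDerivWithin j g S x| ≤ C * v j n

/-- Smoothness and moment conditions on the conditional distribution of the outcome `M(η̄)` given the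
running variable, with constants `C`, `L`, `q` that do not depend on the sample size. -/
def OutcomeRegularity (𝒳 : Set ℝ) (κ : ∀ n, Kernel ℝ (ℝ × (Fin (d n) → ℝ)))
    (ηbar : ∀ n, (Fin (d n) → ℝ) → ℝ) : Prop :=
  ∃ C L q : ℝ, 0 < C ∧ 2 < q ∧ ∀ n,
    let g := condMean (κ n) (adjusted (ηbar n))
    let σsq := condVar (κ n) (adjusted (ηbar n))
    ContDiffOn ℝ 4 g (𝒳 \ {0}) ∧
    (∀ k ∈ ({2, 4} : Set ℕ), LipschitzOnSides L 𝒳 (iteratedDerivWithin k g (𝒳 \ {0})) ∧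
      ∀ x ∈ 𝒳 \ {0}, |iteratedDerivWithin k g (𝒳 \ {0}) x| ≤ C) ∧
    LipschitzOnSides L 𝒳 g ∧
    (∀ x ∈ 𝒳, ∫⁻ w, ENNReal.ofReal (|adjusted (ηbar n) w - g x| ^ q) ∂(κ n x) ≤
      ENNReal.ofReal C) ∧
    LipschitzOnSides L 𝒳 σsq ∧
    ∀ x ∈ 𝒳 \ {0}, 1 / C ≤ σsq x

/-- The conditional fourth central moments of `M(η)` given `X = x` are bounded uniformly over
`η ∈ T_n`, over `x` in an open set that contains `𝒳 ∩ [-h_n, h_n]`, and over `n`. -/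
def FourthMomentBound (𝒳 : Set ℝ) (κ : ∀ n, Kernel ℝ (ℝ × (Fin (d n) → ℝ)))
    (T : ∀ n, Set ((Fin (d n) → ℝ) → ℝ)) (h : ℕ → ℝ) : Prop :=
  ∃ B : ℝ, ∃ U : ℕ → Set ℝ, ∀ n, IsOpen (U n) ∧ 𝒳 ∩ Set.Icc (-h n) (h n) ⊆ U n ∧
    ∀ η ∈ T n, ∀ x ∈ U n ∩ 𝒳,
      ∫⁻ w, ENNReal.ofReal ((adjusted η w - condMean (κ n) (adjusted η) x) ^ 4) ∂(κ n x) ≤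
        ENNReal.ofReal B

end Assumptions

/-! ### Cross-fitting -/

section CrossFitting

variable {n d S : ℕ}

/-- The running variable in a sample. -/
def runX (w : Fin n → Obs d) : Fin n → ℝ := fun i => (w i).1

/-- The adjusted outcomes `M_i(η)` in a sample, for a fixed adjustment function. -/
def adjustedSample (η : (Fin d → ℝ) → ℝ) (w : Fin n → Obs d) : Fin n → ℝ :=
  fun i => adjusted η (w i).2

/-- The first-stage estimator that only uses the data outside fold `s`. -/
def etaHat (est : (I : Finset (Fin n)) → (I → Obs d) → (Fin d → ℝ) → ℝ) (fold : Fin n → Fin S)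
    (w : Fin n → Obs d) (s : Fin S) : (Fin d → ℝ) → ℝ :=
  est (Finset.univ.filter fun i => fold i ≠ s) fun i => w i

/-- The modified outcomes `Y_i - η̂_{s(i)}(Z_i)`, where `s(i)` is the fold of unit `i`. -/
def crossFitted (est : (I : Finset (Fin n)) → (I → Obs d) → (Fin d → ℝ) → ℝ)
    (fold : Fin n → Fin S) (w : Fin n → Obs d) : Fin n → ℝ :=
  fun i => adjusted (etaHat est fold w (fold i)) (w i).2

end CrossFitting

/-! ### Convergence in probability along a triangular array -/

section Convergence

universe u

variable {Ω : ℕ → Type u} [∀ n, MeasurableSpace (Ω n)]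

/-- `A_n` converges in probability to `a`. -/
def TendstoInProb (P : ∀ n, Measure (Ω n)) (A : ∀ n, Ω n → ℝ) (a : ℝ) : Prop :=
  ∀ ε > 0, Tendsto (fun n => P n {ω | ε ≤ |A n ω - a|}) atTop (𝓝 0)

/-- `A_n` diverges in probability to `∞`. -/
def DivergesInProb (P : ∀ n, Measure (Ω n)) (A : ∀ n, Ω n → ℝ) : Prop :=
  ∀ a : ℝ, Tendsto (fun n => P n {ω | A n ω ≤ a}) atTop (𝓝 0)

/-- The events `E_n` hold with probability approaching one. -/
def HoldsWPA1 (P : ∀ n, Measure (Ω n)) (E : ∀ n, Set (Ω n)) : Prop :=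
  Tendsto (fun n => P n (E n)ᶜ) atTop (𝓝 0)

end Convergence

end RDBandwidth

/-! Each bandwidth is a power of n times a power of a ratio: a scaled squared standard error over a
squared derivative estimate, with a multiple of a second squared standard error added in the last
two steps. It suffices that the numerators differ negligibly from population quantities bounded
above and away from zero, that the derivative estimates are consistent, and that the added standard
errors vanish. Then `ĉ` has exact order `n^(-1/9)` and `b̂` has exact order `n^(-1/7)`
(`IsModel.exists_cHat_bounds`, `IsModel.exists_bHat_bounds`). The ratio of `ĥ` to its target tends
to one (`IsModel.tendsto_hHat_div`), because the kernel constants of the local linear step are those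
of the target and because subtracting a smooth conditional mean does not change the jump in the
second derivative.

Derivative estimates. An adjusted outcome is a smooth mean plus a conditionally centered outcome
error plus a first-stage error. The regression reproduces polynomials, so the one-sided Taylor
polynomial of the mean is recovered up to a remainder that is negligible at the scale `h^p`. Given
the data outside a fold, the first-stage error in that fold is a fixed function of the outcome; it
splits into a conditionally centered part and a conditional mean. The centered parts of different
units of one fold are orthogonal, which is what cross-fitting provides. The conditional mean is
close to a polynomial that depends on the fold and whose coefficient of order p vanishes. Since
every fold carries the share `1/S` of all local moments up to `o(h^p)`, these polynomials act like a
single one with averaged coefficients. This is `IsPilot.tendsto_betaHat`, applied in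
`IsModel.tendsto_betaHat`.

Standard errors. The deviation of an outcome from its nearest neighbors is linear in the outcomes.
The smooth mean, the first-stage errors and the tails of the outcome errors contribute little in
mean square (`IsModel.tendsto_nnResid_rem`). What remains is a quadratic form in bounded centered
errors. Its terms are orthogonal for different index pairs (`lintegral_sq_quadForm_le`), and each
unit is a neighbor of at most `2R` others, so it concentrates around its conditional mean if the
truncation level grows slowly. This gives `IsModel.tendsto_sigmaHatSq`. In the global fit the first
stage is negligible by the Cauchy–Schwarz inequality (`IsModel.tendsto_gammaHat`).

Random pilots. Convergence in probability, uniform over a set of bandwidths, is convergence along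
the filter `inProb`, so an estimated bandwidth that lies in the set with probability approaching one
can be substituted (`tendsto_plugin`). Uniformity of the noise bounds over `[a δ, b δ]` comes from
bounded variation of the kernel: the weights are differences of functions whose superlevel sets are
intervals, and intervals are handled by dyadic chaining (`IsNoise.tendsto_uniform`). The price is a
squared logarithm, negligible because `n h^(2p+1)` is a positive power of n at the orders found. -/

namespace RDBandwidth

/-! ### Hankel matrices of moments -/

/-- The matrix of moments `∫ x^(i+j) w(x) dx`. -/
noncomputable def hankel (w : ℝ → ℝ) (p : ℕ) : Matrix (Fin (p + 1)) (Fin (p + 1)) ℝ :=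
  Matrix.of fun i j => ∫ x, x ^ ((i : ℕ) + (j : ℕ)) * w x

/-- Expanding the square turns the quadratic form into a weighted square norm of the polynomial with
coefficients `y`. Positivity of the Gram limits and of the variance constants is read off from this
form. -/
theorem dotProduct_hankel_mulVec {w : ℝ → ℝ} (hint : ∀ k : ℕ, Integrable fun x => x ^ k * w x)
    (p : ℕ) (y : Fin (p + 1) → ℝ) :
    y ⬝ᵥ (hankel w p).mulVec y = ∫ x, (∑ i, y i * x ^ (i : ℕ)) ^ 2 * w x := by
  have h1 : ∀ x : ℝ, (∑ i, y i * x ^ (i : ℕ)) ^ 2 * w x =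
      ∑ i, ∑ j, y i * y j * (x ^ ((i : ℕ) + (j : ℕ)) * w x) := by
    intro x
    rw [sq, Finset.sum_mul_sum, Finset.sum_mul]
    refine Finset.sum_congr rfl fun i _ => ?_
    rw [Finset.sum_mul]
    refine Finset.sum_congr rfl fun j _ => ?_
    rw [pow_add]; ring
  simp_rw [h1]
  rw [integral_finsetSum _ fun i _ => integrable_finsetSum _ fun j _ => (hint _).const_mul _]
  simp only [dotProduct, Matrix.mulVec, hankel, Matrix.of_apply]
  refine Finset.sum_congr rfl fun i _ => ?_
  rw [integral_finsetSum _ fun j _ => (hint _).const_mul _, Finset.mul_sum]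
  refine Finset.sum_congr rfl fun j _ => ?_
  rw [integral_const_mul]; ring

theorem exists_finset_of_polynomial_eq_zero {p : ℕ} {y : Fin (p + 1) → ℝ} (hy : y ≠ 0) :
    {x : ℝ | ∑ i, y i * x ^ (i : ℕ) = 0}.Finite := by
  classical
  let P : Polynomial ℝ := ∑ i : Fin (p + 1), Polynomial.monomial (i : ℕ) (y i)
  have hP : P ≠ 0 := by
    intro h
    apply hy
    ext i
    have := congrArg (fun q => Polynomial.coeff q (i : ℕ)) h
    simp only [P, Polynomial.finsetSum_coeff, Polynomial.coeff_monomial,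
      Polynomial.coeff_zero] at this
    rw [Finset.sum_eq_single i] at this
    · simpa using this
    · intro j _ hj
      rw [if_neg]
      exact fun h => hj (Fin.ext h)
    · simp
  refine (P.roots.toFinset.finite_toSet).subset fun x hx => ?_
  simp only [Finset.mem_coe, Multiset.mem_toFinset, Polynomial.mem_roots hP, Polynomial.IsRoot.def]
  simpa [P, Polynomial.eval_finsetSum, Polynomial.eval_monomial] using hx

/-- If the form vanished at a nonzero vector, the weight would vanish off the finite root set of a
polynomial, hence almost everywhere, against its positive integral. Invertibility of all limiting
Gram matrices rests on this. -/
theorem hankel_posDef {w : ℝ → ℝ} (hint : ∀ k : ℕ, Integrable fun x => x ^ k * w x)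
    (h0 : ∀ x, 0 ≤ w x) (hpos : 0 < ∫ x, w x) (p : ℕ) : (hankel w p).PosDef := by
  refine Matrix.PosDef.of_dotProduct_mulVec_pos ?_ fun y hy => ?_
  · ext i j
    simp [hankel, Matrix.conjTranspose_apply, add_comm]
  · rw [star_trivial, dotProduct_hankel_mulVec hint]
    have hnn : 0 ≤ fun x => (∑ i, y i * x ^ (i : ℕ)) ^ 2 * w x :=
      fun x => mul_nonneg (sq_nonneg _) (h0 x)
    refine lt_of_le_of_ne (integral_nonneg hnn) fun heq => hpos.ne' ?_
    have hI : Integrable fun x => (∑ i, y i * x ^ (i : ℕ)) ^ 2 * w x := by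
      have h1 : ∀ x : ℝ, (∑ i, y i * x ^ (i : ℕ)) ^ 2 * w x =
          ∑ i, ∑ j, y i * y j * (x ^ ((i : ℕ) + (j : ℕ)) * w x) := by
        intro x
        rw [sq, Finset.sum_mul_sum, Finset.sum_mul]
        refine Finset.sum_congr rfl fun i _ => ?_
        rw [Finset.sum_mul]
        refine Finset.sum_congr rfl fun j _ => ?_
        rw [pow_add]; ring
      simp_rw [h1]
      exact integrable_finsetSum _ fun i _ => integrable_finsetSum _ fun j _ =>
        (hint _).const_mul _
    have h2 := (integral_eq_zero_iff_of_nonneg hnn hI).1 heq.symm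
    have h3 : ∀ᵐ x : ℝ, ¬ (∑ i, y i * x ^ (i : ℕ) = 0) :=
      compl_mem_ae_iff.2 ((exists_finset_of_polynomial_eq_zero hy).measure_zero volume)
    refine integral_eq_zero_of_ae ?_
    filter_upwards [h2, h3] with x hx hx'
    simpa [hx'] using hx

/-- Write `B = CᵀC` with `C` invertible; cyclicity turns the trace into that of `C A⁻¹ Cᵀ`, which is
positive definite. -/
theorem trace_inv_mul_pos {m : Type*} [Fintype m] [DecidableEq m] [Nonempty m]
    {A B : Matrix m m ℝ} (hA : A.PosDef) (hB : B.PosDef) : 0 < (A⁻¹ * B).trace := by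
  obtain ⟨C, hC⟩ : ∃ C : Matrix m m ℝ, B = C.conjTranspose * C := by
    open scoped MatrixOrder in
    exact CStarAlgebra.nonneg_iff_eq_star_mul_self.mp hB.posSemidef.nonneg
  have hCu : IsUnit C := by
    have h1 : IsUnit B.det := (Matrix.isUnit_iff_isUnit_det _).1 hB.isUnit
    rw [hC, Matrix.det_mul] at h1
    exact (Matrix.isUnit_iff_isUnit_det _).2 (isUnit_of_mul_isUnit_right h1)
  rw [hC, ← Matrix.mul_assoc, Matrix.trace_mul_comm, ← Matrix.mul_assoc]
  exact (hA.inv.mul_mul_conjTranspose_same (Matrix.vecMul_injective_iff_isUnit.2 hCu)).trace_pos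

/-- The coefficient of `x^p` in the best weighted approximation of `x^(p+1)` by polynomials of
degree `p` is positive when the weight lives on the positive half line. -/
theorem inv_hankel_mulVec_last_pos {w : ℝ → ℝ} (hint : ∀ k : ℕ, Integrable fun x => x ^ k * w x)
    (h0 : ∀ x, 0 ≤ w x) (hpos : 0 < ∫ x, w x) (h0' : ∀ x ≤ 0, w x = 0) (p : ℕ) :
    0 < ((hankel w p)⁻¹.mulVec fun i => ∫ x, x ^ ((i : ℕ) + p + 1) * w x) (Fin.last p) := by
  have hG := hankel_posDef hint h0 hpos p
  -- The weight `x * w x` shifts every moment by one and is still nonnegative, since `w` lives on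
  -- the positive half line.
  have hH : (hankel (fun x => x * w x) p).PosDef := by
    refine hankel_posDef (fun k => ?_) (fun x => ?_) ?_ p
    · simpa [pow_succ, mul_assoc] using hint (k + 1)
    · rcases le_or_gt x 0 with h | h
      · simp [h0' x h]
      · exact mul_nonneg h.le (h0 x)
    · have hnn : 0 ≤ fun x => x * w x := fun x => by
        rcases le_or_gt x 0 with h | h
        · simp [h0' x h]
        · exact mul_nonneg h.le (h0 x)
      refine lt_of_le_of_ne (integral_nonneg hnn) fun heq => hpos.ne' ?_
      have h2 := (integral_eq_zero_iff_of_nonneg hnn (by simpa using hint 1)).1 heq.symm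
      refine integral_eq_zero_of_ae ?_
      filter_upwards [h2] with x hx
      rcases le_or_gt x 0 with h | h
      · exact h0' x h
      · have : x * w x = 0 := hx
        simpa [h.ne'] using this
  have htr := trace_inv_mul_pos hG hH
  have hdet : IsUnit (hankel w p).det := (Matrix.isUnit_iff_isUnit_det _).1 hG.isUnit
  -- For `i < p`, column `i` of the shifted matrix is column `i + 1` of the original one, so entry
  -- `(i, i)` of the product is an off-diagonal entry of the identity. The trace reduces to the last
  -- diagonal entry, which is the quantity in question.
  rw [Matrix.trace, Fin.sum_univ_castSucc, Finset.sum_eq_zero, zero_add] at htr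
  · convert htr using 1
    simp only [Matrix.diag_apply, Matrix.mul_apply, Matrix.mulVec, dotProduct]
    refine Finset.sum_congr rfl fun k _ => ?_
    simp [hankel, pow_succ, mul_assoc]
  · intro i _
    have h1 : ((hankel w p)⁻¹ * hankel w p) i.castSucc i.succ = 0 := by
      rw [Matrix.nonsing_inv_mul _ hdet, Matrix.one_apply_ne]
      exact (Fin.castSucc_lt_succ (i := i)).ne
    rw [← h1]
    simp only [Matrix.diag_apply, Matrix.mul_apply]
    refine Finset.sum_congr rfl fun k _ => ?_
    simp only [hankel, Matrix.of_apply, Fin.val_succ, Fin.val_castSucc]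
    congr 2
    ext x
    rw [← add_assoc, pow_succ]; ring

/-! ### The kernel -/

namespace IsKernelFunction

variable {K : ℝ → ℝ}

theorem measurable (hK : IsKernelFunction K) : Measurable K := by
  classical
  have h := hK.continuousOn.measurable_piecewise (g := fun _ => (0 : ℝ)) continuousOn_const
    (isClosed_tsupport K).measurableSet
  convert h using 1
  ext x
  by_cases hx : x ∈ tsupport K
  · simp [hx]
  · simp [hx, image_eq_zero_of_notMem_tsupport hx]

theorem integrable (hK : IsKernelFunction K) : Integrable K := by
  -- The integral of a non-integrable function is zero by convention, which the normalization to one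
  -- excludes.
  by_contra h
  have := hK.integral_eq_one
  rw [integral_undef h] at this
  exact zero_ne_one this

end IsKernelFunction

/-- A bounded measurable function that vanishes outside `[-1, 1]`. -/
structure IsWindow (B : ℝ) (f : ℝ → ℝ) : Prop where
  measurable : Measurable f
  bound : ∀ u, |f u| ≤ B
  eq_zero : ∀ u, u ∉ Set.Icc (-1 : ℝ) 1 → f u = 0

namespace IsWindow

variable {B : ℝ} {f : ℝ → ℝ}

theorem nonneg (hf : IsWindow B f) : 0 ≤ B := (abs_nonneg _).trans (hf.bound 0)

theorem mono (hf : IsWindow B f) {B' : ℝ} (h : B ≤ B') : IsWindow B' f :=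
  ⟨hf.measurable, fun u => (hf.bound u).trans h, hf.eq_zero⟩

theorem integrable (hf : IsWindow B f) : Integrable f := by
  have h1 : IntegrableOn f (Set.Icc (-1) 1) := by
    refine Measure.integrableOn_of_bounded (M := B) (by simp) hf.measurable.aestronglyMeasurable ?_
    exact Eventually.of_forall fun u => by simpa using hf.bound u
  rw [← integrable_indicator_iff measurableSet_Icc] at h1
  refine h1.congr (Eventually.of_forall fun u => ?_)
  by_cases hu : u ∈ Set.Icc (-1 : ℝ) 1
  · simp [hu]
  · simp [hu, hf.eq_zero u hu]

theorem indicator (hf : IsWindow B f) {s : Set ℝ} (hs : MeasurableSet s) :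
    IsWindow B (s.indicator f) := by
  refine ⟨hf.measurable.indicator hs, fun u => ?_, fun u hu => ?_⟩
  · by_cases h : u ∈ s
    · simpa [h] using hf.bound u
    · simpa [h] using hf.nonneg
  · by_cases h : u ∈ s
    · simpa [h] using hf.eq_zero u hu
    · simp [h]

/-- Powers are at most one in absolute value on `[-1, 1]`, so the bound `B` is not lost. -/
theorem pow_mul (hf : IsWindow B f) (k : ℕ) : IsWindow B fun u => u ^ k * f u := by
  refine ⟨by have := hf.measurable; fun_prop, fun u => ?_, fun u hu => by simp [hf.eq_zero u hu]⟩
  by_cases hu : u ∈ Set.Icc (-1 : ℝ) 1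
  · rw [abs_mul, abs_pow]
    have h1 : |u| ^ k ≤ 1 := pow_le_one₀ (abs_nonneg _) (abs_le.2 hu)
    calc |u| ^ k * |f u| ≤ 1 * B := mul_le_mul h1 (hf.bound u) (abs_nonneg _) zero_le_one
      _ = B := one_mul _
  · simpa [hf.eq_zero u hu] using hf.nonneg

theorem mul {B' : ℝ} {g : ℝ → ℝ} (hf : IsWindow B f) (hg : IsWindow B' g) :
    IsWindow (B * B') fun u => f u * g u := by
  refine ⟨by have := hf.measurable; have := hg.measurable; fun_prop, fun u => ?_,
    fun u hu => by simp [hf.eq_zero u hu]⟩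
  rw [abs_mul]
  exact mul_le_mul (hf.bound u) (hg.bound u) (abs_nonneg _) hf.nonneg

theorem abs (hf : IsWindow B f) : IsWindow B fun u => |f u| :=
  ⟨by have := hf.measurable; fun_prop, fun u => by simpa using hf.bound u,
    fun u hu => by simp [hf.eq_zero u hu]⟩

end IsWindow

theorem isWindow_one : IsWindow 1 ((Set.Icc (-1 : ℝ) 1).indicator fun _ => 1) := by
  refine ⟨measurable_const.indicator measurableSet_Icc, fun u => ?_, fun u hu => by simp [hu]⟩
  by_cases h : u ∈ Set.Icc (-1 : ℝ) 1 <;> simp [h]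

theorem IsKernelFunction.exists_isWindow {K : ℝ → ℝ} (hK : IsKernelFunction K) :
    ∃ B, 0 < B ∧ IsWindow B K := by
  obtain ⟨C, hC⟩ := hK.bounded
  refine ⟨|C| + 1, by positivity, hK.measurable, fun u => ?_, hK.eq_zero⟩
  rw [abs_of_nonneg (hK.nonneg u)]
  exact (hC u).trans ((le_abs_self C).trans (by linarith))

theorem Side.measurableSet_region (s : Side) : MeasurableSet s.region := by
  cases s
  · exact measurableSet_Ici
  · exact measurableSet_Iio

/-- The kernel restricted to one side of the cutoff. -/
noncomputable def halfKernel (K : ℝ → ℝ) (s : Side) : ℝ → ℝ := s.region.indicator K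

theorem halfKernel_nonneg {K : ℝ → ℝ} (hK : IsKernelFunction K) (s : Side) (u : ℝ) :
    0 ≤ halfKernel K s u := Set.indicator_nonneg (fun u _ => hK.nonneg u) u

/-- The sign of the running variable on a side. -/
def Side.sign : Side → ℝ
  | .plus => 1
  | .minus => -1

/-- The condition `F x 0 = 0` confines the integral to a half line. Together with the reflected
version below, it expresses quantities on either side through right-hand moments. -/
theorem integral_halfKernel_plus (F : ℝ → ℝ → ℝ) (hF : ∀ x, F x 0 = 0) (K : ℝ → ℝ) :
    ∫ x, F x (halfKernel K .plus x) = ∫ x in Set.Ioi (0 : ℝ), F x (K x) := by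
  rw [← integral_Ici_eq_integral_Ioi, ← integral_indicator measurableSet_Ici]
  congr 1
  ext x
  by_cases h : x ∈ Set.Ici (0 : ℝ) <;> simp [halfKernel, Side.region, h, hF]

theorem integral_halfKernel_minus (F : ℝ → ℝ → ℝ) (hF : ∀ x, F x 0 = 0) {K : ℝ → ℝ}
    (hK : ∀ u, K (-u) = K u) :
    ∫ x, F x (halfKernel K .minus x) = ∫ x in Set.Ioi (0 : ℝ), F (-x) (K x) := by
  rw [← integral_neg_eq_self, ← integral_indicator measurableSet_Ioi]
  congr 1
  ext x
  by_cases h : 0 < x <;> simp [halfKernel, Side.region, h, hF, hK]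

theorem integral_pow_mul_halfKernel {K : ℝ → ℝ} (hK : ∀ u, K (-u) = K u) (s : Side) (k : ℕ) :
    ∫ x, x ^ k * halfKernel K s x = s.sign ^ k * kernelMoment K k := by
  cases s
  · rw [integral_halfKernel_plus (fun x y => x ^ k * y) (by simp)]
    simp [Side.sign, kernelMoment]
  · rw [integral_halfKernel_minus (fun x y => x ^ k * y) (by simp) hK]
    simp only [Side.sign, kernelMoment]
    rw [← integral_const_mul]
    congr 1
    ext x
    rw [neg_pow]; ring

theorem kernelMoment_zero {K : ℝ → ℝ} (hK : IsKernelFunction K) : kernelMoment K 0 = 1 / 2 := by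
  have h1 := hK.integral_eq_one
  have h2 : ∫ u, K u = (∫ x, x ^ 0 * halfKernel K .plus x) + ∫ x, x ^ 0 * halfKernel K .minus x := by
    rw [← integral_add]
    · congr 1
      ext x
      rcases le_or_gt 0 x with h | h
      · simp [halfKernel, Side.region, h]
      · simp [halfKernel, Side.region, h]
    · simpa [halfKernel] using hK.integrable.indicator (Side.measurableSet_region .plus)
    · simpa [halfKernel] using hK.integrable.indicator (Side.measurableSet_region .minus)
  rw [h1, integral_pow_mul_halfKernel hK.symm, integral_pow_mul_halfKernel hK.symm] at h2
  simp only [pow_zero, one_mul] at h2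
  linarith

theorem integrable_pow_mul_halfKernel {K : ℝ → ℝ} (hK : IsKernelFunction K) (s : Side) (k : ℕ) :
    Integrable fun x => x ^ k * halfKernel K s x := by
  obtain ⟨B, -, hB⟩ := hK.exists_isWindow
  exact ((hB.indicator s.measurableSet_region).pow_mul k).integrable

theorem integral_halfKernel_pos {K : ℝ → ℝ} (hK : IsKernelFunction K) (s : Side) :
    0 < ∫ x, halfKernel K s x := by
  have := integral_pow_mul_halfKernel hK.symm s 0
  simp only [pow_zero, one_mul, kernelMoment_zero hK] at this
  rw [this]; norm_num

theorem hankel_halfKernel_posDef {K : ℝ → ℝ} (hK : IsKernelFunction K) (s : Side) (p : ℕ) :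
    (hankel (halfKernel K s) p).PosDef :=
  hankel_posDef (integrable_pow_mul_halfKernel hK s) (halfKernel_nonneg hK s)
    (integral_halfKernel_pos hK s) p

theorem hankel_halfKernel_sq_posDef {K : ℝ → ℝ} (hK : IsKernelFunction K) (s : Side) (p : ℕ) :
    (hankel (fun u => halfKernel K s u ^ 2) p).PosDef := by
  obtain ⟨B, -, hB⟩ := hK.exists_isWindow
  have hw := hB.indicator s.measurableSet_region
  have hw2 : IsWindow (B * B) fun u => halfKernel K s u ^ 2 := by
    simpa [sq, halfKernel] using hw.mul hw
  refine hankel_posDef (fun k => (hw2.pow_mul k).integrable) (fun u => sq_nonneg _) ?_ p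
  refine lt_of_le_of_ne (integral_nonneg fun u => sq_nonneg _) fun heq =>
    (integral_halfKernel_pos hK s).ne' ?_
  have h2 := (integral_eq_zero_iff_of_nonneg (fun u => sq_nonneg _) hw2.integrable).1 heq.symm
  refine integral_eq_zero_of_ae ?_
  filter_upwards [h2] with x hx
  simpa using hx

/-- These constants stand in the denominators of the first two steps. The trace argument applies to
the kernel restricted to the open half line. -/
theorem biasConst_last_pos {K : ℝ → ℝ} (hK : IsKernelFunction K) (p : ℕ) :
    0 < biasConst K p (Fin.last p) := by
  have hw : ∀ k : ℕ, ∫ x, x ^ k * (Set.Ioi (0 : ℝ)).indicator K x = kernelMoment K k := by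
    intro k
    rw [kernelMoment, ← integral_indicator measurableSet_Ioi]
    congr 1
    ext x
    by_cases h : x ∈ Set.Ioi (0 : ℝ) <;> simp [h]
  obtain ⟨B, -, hB⟩ := hK.exists_isWindow
  have h := inv_hankel_mulVec_last_pos (w := (Set.Ioi (0 : ℝ)).indicator K)
    (fun k => ((hB.indicator measurableSet_Ioi).pow_mul k).integrable)
    (fun x => Set.indicator_nonneg (fun u _ => hK.nonneg u) x)
    (by have := hw 0; simp only [pow_zero, one_mul, kernelMoment_zero hK] at this
        rw [this]; norm_num)
    (fun x hx => by simp [hx]) p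
  simp only [hankel, hw] at h
  rw [biasConst]
  exact mul_pos (by positivity) h

theorem det_two_kernelMoment {K : ℝ → ℝ} (hK : IsKernelFunction K) :
    0 < kernelMoment K 2 * kernelMoment K 0 - kernelMoment K 1 ^ 2 := by
  have h := (hankel_halfKernel_posDef hK .plus 1).det_pos
  rw [Matrix.det_fin_two] at h
  simp only [hankel, Matrix.of_apply, integral_pow_mul_halfKernel hK.symm, Side.sign] at h
  simp at h
  linarith

theorem biasConst_one_zero {K : ℝ → ℝ} : biasConst K 1 0 = nuBar K / 2 := by
  rw [biasConst, Matrix.inv_def, nuBar, Ring.inverse_eq_inv', Matrix.det_fin_two,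
    Matrix.adjugate_fin_two]
  simp [Matrix.mulVec, dotProduct, Fin.sum_univ_two, Nat.factorial]
  ring

/-- The numerator is minus the determinant of the two-by-two Hankel matrix of the weight `u K(u)` on
the right half line, hence strictly negative. -/
theorem nuBar_ne_zero {K : ℝ → ℝ} (hK : IsKernelFunction K) : nuBar K ≠ 0 := by
  obtain ⟨B, -, hB⟩ := hK.exists_isWindow
  have hw := hB.indicator (Side.measurableSet_region .plus)
  have hw1 := hw.pow_mul 1
  have hnn : ∀ u, 0 ≤ u ^ 1 * halfKernel K .plus u := fun u => by
    by_cases h : 0 ≤ u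
    · exact mul_nonneg (by simpa using h) (halfKernel_nonneg hK _ u)
    · simp [halfKernel, Side.region, h]
  have hpos : 0 < ∫ u, u ^ 1 * halfKernel K .plus u := by
    refine lt_of_le_of_ne (integral_nonneg hnn) fun heq =>
      (integral_halfKernel_pos hK .plus).ne' ?_
    have h2 := (integral_eq_zero_iff_of_nonneg hnn hw1.integrable).1 heq.symm
    refine integral_eq_zero_of_ae ?_
    have h3 : ∀ᵐ x : ℝ, x ≠ 0 := Measure.ae_ne volume 0
    filter_upwards [h2, h3] with x hx h3
    simpa [h3] using hx
  have h := (hankel_posDef (fun k => (hw1.pow_mul k).integrable) hnn hpos 1).det_pos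
  rw [Matrix.det_fin_two] at h
  have hm : ∀ k : ℕ, ∫ x, x ^ k * (x ^ 1 * (Side.region .plus).indicator K x) =
      kernelMoment K (k + 1) := by
    intro k
    have := integral_pow_mul_halfKernel hK.symm .plus (k + 1)
    simp only [Side.sign, one_pow, one_mul] at this
    rw [← this]
    congr 1; ext x; simp only [halfKernel]; ring
  simp only [hankel, Matrix.of_apply, hm] at h
  simp at h
  refine div_ne_zero ?_ (det_two_kernelMoment hK).ne'
  nlinarith

/-! ### Uniform convergence in probability as convergence along a filter -/

section InProb

universe u

variable {Ω : ℕ → Type u} [∀ n, MeasurableSpace (Ω n)]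

/-- The filter on triples `(n, ω, h)` whose convergence is convergence in probability as `n → ∞`,
uniformly over `h ∈ H n`. -/
def inProb (P : ∀ n, Measure (Ω n)) (H : ℕ → Set ℝ) : Filter (Σ n, Ω n × ℝ) where
  sets := {E | Tendsto (fun n => P n {ω | ∃ h ∈ H n, (⟨n, ω, h⟩ : Σ n, Ω n × ℝ) ∉ E}) atTop (𝓝 0)}
  univ_sets := by simp
  sets_of_superset {E F} hE hEF := by
    refine tendsto_of_tendsto_of_tendsto_of_le_of_le tendsto_const_nhds hE (fun _ => zero_le) ?_
    intro n
    exact measure_mono fun ω ⟨h, hh, hF⟩ => ⟨h, hh, fun hE => hF (hEF hE)⟩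
  inter_sets {E F} hE hF := by
    have h := Tendsto.add hE hF
    rw [add_zero] at h
    refine tendsto_of_tendsto_of_tendsto_of_le_of_le tendsto_const_nhds h (fun _ => zero_le) ?_
    intro n
    refine (measure_mono ?_).trans (measure_union_le _ _)
    rintro ω ⟨h, hh, hEF⟩
    by_cases hE' : (⟨n, ω, h⟩ : Σ n, Ω n × ℝ) ∈ E
    · exact Or.inr ⟨h, hh, fun hF' => hEF ⟨hE', hF'⟩⟩
    · exact Or.inl ⟨h, hh, hE'⟩

variable {P : ∀ n, Measure (Ω n)} {H : ℕ → Set ℝ}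

theorem eventually_inProb {p : (Σ n, Ω n × ℝ) → Prop} :
    (∀ᶠ z in inProb P H, p z) ↔
      Tendsto (fun n => P n {ω | ∃ h ∈ H n, ¬ p ⟨n, ω, h⟩}) atTop (𝓝 0) := Iff.rfl

/-- For large `n` the exceptional set is empty, so ordinary limits in `n` transfer to the filter. -/
theorem tendsto_fst_inProb : Tendsto (fun z : Σ n, Ω n × ℝ => z.1) (inProb P H) atTop := by
  refine tendsto_atTop.2 fun N => ?_
  rw [eventually_inProb]
  refine tendsto_const_nhds.congr' ?_
  filter_upwards [eventually_ge_atTop N] with n hn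
  simp [hn]

theorem eventually_inProb_of_forall {p : (Σ n, Ω n × ℝ) → Prop}
    (hp : ∀ᶠ n in atTop, ∀ ω, ∀ h ∈ H n, p ⟨n, ω, h⟩) : ∀ᶠ z in inProb P H, p z := by
  rw [eventually_inProb]
  refine tendsto_const_nhds.congr' ?_
  filter_upwards [hp] with n hn
  have : {ω | ∃ h ∈ H n, ¬ p ⟨n, ω, h⟩} = ∅ := by
    ext ω; simp only [Set.mem_ofPred_eq, Set.mem_empty_iff_false, iff_false]
    rintro ⟨h, hh, hp⟩
    exact hp (hn ω h hh)
  simp [this]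

theorem eventually_inProb_of_ae {p : (Σ n, Ω n × ℝ) → Prop}
    (hp : ∀ n, ∀ᵐ ω ∂P n, ∀ h ∈ H n, p ⟨n, ω, h⟩) : ∀ᶠ z in inProb P H, p z := by
  rw [eventually_inProb]
  refine tendsto_const_nhds.congr fun n => ?_
  have := ae_iff.1 (hp n)
  rw [← this]
  congr 1
  ext ω
  simp

theorem eventually_inProb_of_holds {E : ∀ n, Set (Ω n)} (hE : HoldsWPA1 P E) :
    ∀ᶠ z in inProb P H, z.2.1 ∈ E z.1 := by
  rw [eventually_inProb]
  refine tendsto_of_tendsto_of_tendsto_of_le_of_le tendsto_const_nhds hE (fun _ => zero_le) ?_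
  intro n
  exact measure_mono fun ω ⟨h, _, hh⟩ => hh

theorem tendsto_inProb_self {f : ℕ → ℝ} {a : ℝ} (hf : Tendsto f atTop (𝓝 a)) :
    Tendsto (fun z : Σ n, Ω n × ℝ => f z.1) (inProb P H) (𝓝 a) := hf.comp tendsto_fst_inProb

/-- Markov's inequality for a bound that is uniform over the bandwidths. -/
theorem tendsto_inProb_of_lintegral {A : (Σ n, Ω n × ℝ) → ℝ} (B : ∀ n, Ω n → ENNReal)
    (hB : ∀ n, Measurable (B n))
    (hAB : ∀ᶠ z in inProb P H, ENNReal.ofReal |A z| ≤ B z.1 z.2.1)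
    (h0 : Tendsto (fun n => ∫⁻ ω, B n ω ∂P n) atTop (𝓝 0)) :
    Tendsto A (inProb P H) (𝓝 0) := by
  rw [Metric.tendsto_nhds]
  intro ε hε
  have h1 : ∀ᶠ z in inProb P H, B z.1 z.2.1 < ENNReal.ofReal ε := by
    rw [eventually_inProb]
    have h2 : Tendsto (fun n => (∫⁻ ω, B n ω ∂P n) / ENNReal.ofReal ε) atTop (𝓝 0) := by
      have := ENNReal.Tendsto.div_const h0 (b := ENNReal.ofReal ε)
        (Or.inr (by simpa using hε))
      simpa using this
    refine tendsto_of_tendsto_of_tendsto_of_le_of_le tendsto_const_nhds h2 (fun _ => zero_le) ?_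
    intro n
    refine (measure_mono ?_).trans (meas_ge_le_lintegral_div (hB n).aemeasurable
      (by simpa using hε) ENNReal.ofReal_ne_top)
    rintro ω ⟨h, _, hh⟩
    exact not_lt.1 hh
  filter_upwards [hAB, h1] with z h1 h2
  rw [dist_zero_right, Real.norm_eq_abs]
  exact (ENNReal.ofReal_lt_ofReal_iff hε).1 (h1.trans_lt h2)

/-- The first-moment version applies to the square, and the square root is continuous at zero. -/
theorem tendsto_inProb_of_lintegral_sq {A : (Σ n, Ω n × ℝ) → ℝ} (B : ∀ n, Ω n → ENNReal)
    (hB : ∀ n, Measurable (B n))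
    (hAB : ∀ᶠ z in inProb P H, ENNReal.ofReal (A z ^ 2) ≤ B z.1 z.2.1)
    (h0 : Tendsto (fun n => ∫⁻ ω, B n ω ∂P n) atTop (𝓝 0)) :
    Tendsto A (inProb P H) (𝓝 0) := by
  have h := tendsto_inProb_of_lintegral (A := fun z => A z ^ 2) B hB
    (by simpa using hAB) h0
  have h2 := (Real.continuous_sqrt.tendsto 0).comp h
  simp only [Function.comp_def, Real.sqrt_zero, Real.sqrt_sq_eq_abs] at h2
  exact (tendsto_zero_iff_abs_tendsto_zero _).2 h2

/-- Nonemptiness matters: over empty sets of bandwidths every statement holds along the filter. -/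
theorem tendstoInProb_iff {A : ∀ n, Ω n → ℝ} {a : ℝ} (hH : ∀ n, (H n).Nonempty) :
    TendstoInProb P A a ↔ Tendsto (fun z : Σ n, Ω n × ℝ => A z.1 z.2.1) (inProb P H) (𝓝 a) := by
  rw [Metric.tendsto_nhds]
  refine forall₂_congr fun ε hε => ?_
  rw [eventually_inProb]
  have : ∀ n, {ω | ∃ h ∈ H n, ¬ dist (A n ω) a < ε} = {ω | ε ≤ |A n ω - a|} := by
    intro n
    ext ω
    simp only [Real.dist_eq, not_lt, Set.mem_ofPred_eq, exists_and_right, and_iff_right_iff_imp]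
    exact fun _ => hH n
  simp_rw [this]

theorem divergesInProb_iff {A : ∀ n, Ω n → ℝ} (hH : ∀ n, (H n).Nonempty) :
    DivergesInProb P A ↔ Tendsto (fun z : Σ n, Ω n × ℝ => A z.1 z.2.1) (inProb P H) atTop := by
  have h1 : ∀ a : ℝ, (∀ᶠ z in inProb P H, a < A z.1 z.2.1) ↔
      Tendsto (fun n => P n {ω | A n ω ≤ a}) atTop (𝓝 0) := by
    intro a
    rw [eventually_inProb]
    have : ∀ n, {ω | ∃ h ∈ H n, ¬ a < A n ω} = {ω | A n ω ≤ a} := by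
      intro n
      ext ω
      simp only [not_lt, Set.mem_ofPred_eq, exists_and_right, and_iff_right_iff_imp]
      exact fun _ => hH n
    simp_rw [this]
  constructor
  · intro h
    refine tendsto_atTop.2 fun a => ?_
    filter_upwards [(h1 a).2 (h a)] with z hz using hz.le
  · intro h a
    exact (h1 a).1 (h.eventually_gt_atTop a)

/-- Estimated bandwidths can be plugged into statements that hold uniformly. -/
theorem tendsto_plugin {H' : ℕ → Set ℝ} {c : ∀ n, Ω n → ℝ}
    (hc : ∀ᶠ z in inProb P H, c z.1 z.2.1 ∈ H' z.1) :
    Tendsto (fun z : Σ n, Ω n × ℝ => (⟨z.1, z.2.1, c z.1 z.2.1⟩ : Σ n, Ω n × ℝ))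
      (inProb P H) (inProb P H') := by
  intro E hE
  change ∀ᶠ z in inProb P H, (⟨z.1, z.2.1, c z.1 z.2.1⟩ : Σ n, Ω n × ℝ) ∈ E
  -- The exceptional event of uniform validity over `H'` involves `ω` only, so a bandwidth that
  -- depends on `ω` can be inserted afterwards.
  have hE' : ∀ᶠ z in inProb P H, ∀ h ∈ H' z.1, (⟨z.1, z.2.1, h⟩ : Σ n, Ω n × ℝ) ∈ E := by
    rw [eventually_inProb]
    refine tendsto_of_tendsto_of_tendsto_of_le_of_le tendsto_const_nhds hE (fun _ => zero_le) ?_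
    intro n
    refine measure_mono ?_
    rintro ω ⟨_, _, hh⟩
    push Not at hh
    exact hh
  filter_upwards [hc, hE'] with z h1 h2 using h2 _ h1

/-- Statements about `ω` only do not depend on the set of bandwidths. -/
theorem eventually_inProb_change {H' : ℕ → Set ℝ} {p : ∀ n, Ω n → Prop}
    (hH : ∀ n, (H n).Nonempty) (h : ∀ᶠ z in inProb P H, p z.1 z.2.1) :
    ∀ᶠ z in inProb P H', p z.1 z.2.1 := by
  rw [eventually_inProb] at h ⊢
  refine tendsto_of_tendsto_of_tendsto_of_le_of_le tendsto_const_nhds h (fun _ => zero_le) ?_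
  intro n
  refine measure_mono ?_
  rintro ω ⟨_, _, hh⟩
  obtain ⟨h, hh'⟩ := hH n
  exact ⟨h, hh', hh⟩

theorem tendsto_inProb_change {H' : ℕ → Set ℝ} {A : ∀ n, Ω n → ℝ} {l : Filter ℝ}
    (hH : ∀ n, (H n).Nonempty) (h : Tendsto (fun z : Σ n, Ω n × ℝ => A z.1 z.2.1) (inProb P H) l) :
    Tendsto (fun z : Σ n, Ω n × ℝ => A z.1 z.2.1) (inProb P H') l := by
  intro E hE
  exact eventually_inProb_change (p := fun n ω => A n ω ∈ E) hH (h hE)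

end InProb

/-! ### Weighted least squares in terms of sample moments -/

section Moments

variable {n : ℕ}

/-- `(n h)⁻¹ ∑ f(x_i / h) e_i`. -/
noncomputable def locMoment (f : ℝ → ℝ) (h : ℝ) (x e : Fin n → ℝ) : ℝ :=
  ((n : ℝ) * h)⁻¹ * ∑ i, f (x i / h) * e i

/-- The functions `u ↦ u^k K(u) 1{u on side s}`. -/
noncomputable def sidePow (K : ℝ → ℝ) (s : Side) (k : ℕ) (u : ℝ) : ℝ := u ^ k * halfKernel K s u

/-- The normalized Gram matrix of the one-sided local polynomial regression. -/
noncomputable def locGram (K : ℝ → ℝ) (s : Side) (p : ℕ) (h : ℝ) (x : Fin n → ℝ) :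
    Matrix (Fin (p + 1)) (Fin (p + 1)) ℝ :=
  Matrix.of fun i j => locMoment (sidePow K s ((i : ℕ) + (j : ℕ))) h x fun _ => 1

theorem sideKernel_eq (K : ℝ → ℝ) {h : ℝ} (hh : 0 < h) (s : Side) (x : ℝ) :
    sideKernel K h s x = halfKernel K s (x / h) / h := by
  have h1 : x ∈ s.region ↔ x / h ∈ s.region := by
    cases s
    · simp only [Side.region, Set.mem_Ici]
      rw [le_div_iff₀ hh, zero_mul]
    · simp only [Side.region, Set.mem_Iio]
      rw [div_lt_iff₀ hh, zero_mul]
  by_cases hx : x ∈ s.region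
  · simp [sideKernel, halfKernel, hx, h1.1 hx]
  · have hx' : x / h ∉ s.region := fun h' => hx (h1.2 h')
    simp [sideKernel, halfKernel, hx, hx']

/-- Rescaling the regressors by powers of `h` factors the Gram matrix as `H (N G) H` with diagonal
`H` and `N`. Inversion exposes the factor `h^(-v)` and leaves a normalized matrix with a
nondegenerate limit. -/
theorem sideWeight_eq (K : ℝ → ℝ) (p : ℕ) (v : Fin (p + 1)) (s : Side) {h : ℝ} (hh : 0 < h)
    (x : Fin n → ℝ) (i : Fin n) :
    sideWeight K p v s h x i = ((v : ℕ).factorial : ℝ) * (h ^ (v : ℕ))⁻¹ * ((n : ℝ) * h)⁻¹ *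
      ∑ k, (locGram K s p h x)⁻¹ v k * sidePow K s k (x i / h) := by
  have hn : (n : ℝ) ≠ 0 := by
    have : 0 < n := i.pos
    positivity
  set G := locGram K s p h x with hG
  set H : Matrix (Fin (p + 1)) (Fin (p + 1)) ℝ := Matrix.diagonal fun k => h ^ (k : ℕ) with hH
  set N : Matrix (Fin (p + 1)) (Fin (p + 1)) ℝ := Matrix.diagonal fun _ => (n : ℝ) with hN
  have hgram : (∑ j, sideKernel K h s (x j) •
      Matrix.vecMulVec (polyVec p (x j)) (polyVec p (x j))) = H * (N * G) * H := by
    ext a b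
    rw [hH, Matrix.mul_diagonal, Matrix.diagonal_mul, hN, Matrix.diagonal_mul, Matrix.sum_apply]
    simp only [Matrix.smul_apply, Matrix.vecMulVec_apply, polyVec, smul_eq_mul, hG, locGram,
      Matrix.of_apply, locMoment, sidePow, mul_one, sideKernel_eq K hh]
    rw [mul_inv, Finset.mul_sum, Finset.mul_sum, Finset.mul_sum, Finset.sum_mul]
    refine Finset.sum_congr rfl fun j _ => ?_
    rw [div_pow, pow_add, pow_add]
    field_simp
  have hHinv : H⁻¹ = Matrix.diagonal fun k : Fin (p + 1) => (h ^ (k : ℕ))⁻¹ := by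
    refine Matrix.inv_eq_left_inv ?_
    rw [hH, Matrix.diagonal_mul_diagonal, ← Matrix.diagonal_one]
    congr 1
    ext k
    exact inv_mul_cancel₀ (pow_ne_zero _ hh.ne')
  have hNinv : N⁻¹ = Matrix.diagonal fun _ : Fin (p + 1) => ((n : ℝ))⁻¹ := by
    refine Matrix.inv_eq_left_inv ?_
    rw [hN, Matrix.diagonal_mul_diagonal, ← Matrix.diagonal_one]
    congr 1
    ext k
    exact inv_mul_cancel₀ hn
  have hinv : (∑ j, sideKernel K h s (x j) •
      Matrix.vecMulVec (polyVec p (x j)) (polyVec p (x j)))⁻¹ =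
      H⁻¹ * (G⁻¹ * N⁻¹) * H⁻¹ := by
    -- The rule for the inverse of a product holds for singular matrices too, their inverse being
    -- zero by convention, so nothing is assumed about the Gram matrix.
    rw [hgram, Matrix.mul_inv_rev, Matrix.mul_inv_rev, Matrix.mul_inv_rev]
    simp only [Matrix.mul_assoc]
  rw [sideWeight, wlsWeight, hinv, hHinv, hNinv]
  simp only [Matrix.mulVec, dotProduct, Matrix.mul_diagonal, Matrix.diagonal_mul, Pi.smul_apply,
    smul_eq_mul, polyVec, sideKernel_eq K hh, sidePow]
  rw [Finset.mul_sum, Finset.mul_sum]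
  refine Finset.sum_congr rfl fun k _ => ?_
  rw [div_pow]
  field_simp

theorem betaHat_eq (K : ℝ → ℝ) (p : ℕ) (v : Fin (p + 1)) (s : Side) {h : ℝ} (hh : 0 < h)
    (x m : Fin n → ℝ) :
    betaHat K p v s h x m = ((v : ℕ).factorial : ℝ) * (h ^ (v : ℕ))⁻¹ *
      ((locGram K s p h x)⁻¹.mulVec fun k => locMoment (sidePow K s k) h x m) v := by
  simp only [betaHat, sideWeight_eq K p v s hh, Matrix.mulVec, dotProduct, locMoment]
  simp only [Finset.mul_sum, Finset.sum_mul]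
  rw [Finset.sum_comm]
  refine Finset.sum_congr rfl fun k _ => Finset.sum_congr rfl fun i _ => ?_
  ring

/-- Squaring the weights squares the kernel, so standard errors are governed by moments of the
squared kernel between two copies of a row of the inverse Gram matrix. -/
theorem sum_sideWeight_sq_mul (K : ℝ → ℝ) (p : ℕ) (v : Fin (p + 1)) (s : Side) {h : ℝ}
    (hh : 0 < h) (x m : Fin n → ℝ) :
    ∑ i, sideWeight K p v s h x i ^ 2 * m i = (((v : ℕ).factorial : ℝ) * (h ^ (v : ℕ))⁻¹) ^ 2 *
      ((n : ℝ) * h)⁻¹ * ∑ k, ∑ l, (locGram K s p h x)⁻¹ v k * (locGram K s p h x)⁻¹ v l *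
        locMoment (fun u => u ^ ((k : ℕ) + (l : ℕ)) * halfKernel K s u ^ 2) h x m := by
  simp only [sideWeight_eq K p v s hh, locMoment, mul_pow _ (Finset.sum _ _)]
  have h1 : ∀ i, (∑ k, (locGram K s p h x)⁻¹ v k * sidePow K s k (x i / h)) ^ 2 =
      ∑ k, ∑ l, (locGram K s p h x)⁻¹ v k * (locGram K s p h x)⁻¹ v l *
        ((x i / h) ^ ((k : ℕ) + (l : ℕ)) * halfKernel K s (x i / h) ^ 2) := by
    intro i
    rw [sq, Finset.sum_mul_sum]
    refine Finset.sum_congr rfl fun k _ => Finset.sum_congr rfl fun l _ => ?_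
    simp only [sidePow, pow_add]; ring
  simp only [h1, Finset.mul_sum, Finset.sum_mul]
  rw [Finset.sum_comm]
  refine Finset.sum_congr rfl fun k _ => ?_
  rw [Finset.sum_comm]
  refine Finset.sum_congr rfl fun l _ => Finset.sum_congr rfl fun i _ => ?_
  ring

/-- Every unit has weight zero on one of the two sides, so the cross term drops out. -/
theorem seSq_eq (K : ℝ → ℝ) (R p : ℕ) (v : Fin (p + 1)) {h : ℝ} (hh : 0 < h) (x m : Fin n → ℝ) :
    seSq K R p v h x m = ∑ i, sideWeight K p v .plus h x i ^ 2 * sigmaHatSq R x m i +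
      ∑ i, sideWeight K p v .minus h x i ^ 2 * sigmaHatSq R x m i := by
  rw [seSq, ← Finset.sum_add_distrib]
  refine Finset.sum_congr rfl fun i _ => ?_
  have h1 : sideWeight K p v .plus h x i * sideWeight K p v .minus h x i = 0 := by
    rw [sideWeight_eq K p v _ hh, sideWeight_eq K p v _ hh]
    rcases le_or_gt 0 (x i / h) with hx | hx
    · have : ∀ k, sidePow K .minus k (x i / h) = 0 := fun k => by
        simp [sidePow, halfKernel, Side.region, hx]
      simp [this]
    · have : ∀ k, sidePow K .plus k (x i / h) = 0 := fun k => by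
        simp [sidePow, halfKernel, Side.region, hx]
      simp [this]
  rw [jumpWeight, ← add_mul]
  congr 1
  linear_combination (-2) * h1

/-- The global fit is a local fit with constant kernel and bandwidth one. That kernel lacks compact
support, but the algebraic formulas for the weights do not use it. -/
theorem gammaHat_eq (s : Side) (x m : Fin n → ℝ) :
    gammaHat s x m = betaHat (fun _ => 1) 4 (Fin.last 4) s 1 x m := by
  simp [gammaHat, betaHat, sideWeight, sideKernel]

/-- Least squares reproduces polynomials of degree at most `p`, so only deviations from a polynomial
contribute to the estimation error. -/
theorem inv_locGram_mulVec {K : ℝ → ℝ} {s : Side} {p : ℕ} {h : ℝ} {x : Fin n → ℝ}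
    (hG : IsUnit (locGram K s p h x).det) (a : Fin (p + 1) → ℝ) :
    ((locGram K s p h x)⁻¹.mulVec fun k =>
      ∑ j, a j * locMoment (sidePow K s ((k : ℕ) + (j : ℕ))) h x fun _ => 1) = a := by
  have : (fun k : Fin (p + 1) =>
      ∑ j, a j * locMoment (sidePow K s ((k : ℕ) + (j : ℕ))) h x fun _ => 1) =
      (locGram K s p h x).mulVec a := by
    ext k
    simp only [Matrix.mulVec, dotProduct, locGram, Matrix.of_apply]
    exact Finset.sum_congr rfl fun j _ => mul_comm _ _
  rw [this, Matrix.mulVec_mulVec, Matrix.nonsing_inv_mul _ hG, Matrix.one_mulVec]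

theorem locMoment_add (f : ℝ → ℝ) (h : ℝ) (x e e' : Fin n → ℝ) :
    locMoment f h x (fun i => e i + e' i) = locMoment f h x e + locMoment f h x e' := by
  simp [locMoment, mul_add, Finset.sum_add_distrib]

theorem locMoment_sub (f : ℝ → ℝ) (h : ℝ) (x e e' : Fin n → ℝ) :
    locMoment f h x (fun i => e i - e' i) = locMoment f h x e - locMoment f h x e' := by
  simp [locMoment, mul_sub, Finset.sum_sub_distrib]

theorem locMoment_const_mul (f : ℝ → ℝ) (h : ℝ) (x e : Fin n → ℝ) (c : ℝ) :
    locMoment f h x (fun i => c * e i) = c * locMoment f h x e := by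
  simp only [locMoment, Finset.mul_sum]
  exact Finset.sum_congr rfl fun i _ => by ring

theorem locMoment_sum {ι : Type*} (t : Finset ι) (f : ℝ → ℝ) (h : ℝ) (x : Fin n → ℝ)
    (e : ι → Fin n → ℝ) :
    locMoment f h x (fun i => ∑ a ∈ t, e a i) = ∑ a ∈ t, locMoment f h x (e a) := by
  simp only [locMoment, Finset.mul_sum]
  rw [Finset.sum_comm]

theorem abs_locMoment_le (f : ℝ → ℝ) {h : ℝ} (hh : 0 < h) (x e : Fin n → ℝ) :
    |locMoment f h x e| ≤ locMoment (fun u => |f u|) h x fun i => |e i| := by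
  rw [locMoment, locMoment, abs_mul, abs_of_nonneg (by positivity : (0 : ℝ) ≤ ((n : ℝ) * h)⁻¹)]
  gcongr
  refine (Finset.abs_sum_le_sum_abs _ _).trans (le_of_eq ?_)
  exact Finset.sum_congr rfl fun i _ => abs_mul _ _

theorem locMoment_mono {f g : ℝ → ℝ} {h : ℝ} (hh : 0 < h) (x e e' : Fin n → ℝ)
    (hfe : ∀ i, f (x i / h) * e i ≤ g (x i / h) * e' i) :
    locMoment f h x e ≤ locMoment g h x e' := by
  rw [locMoment, locMoment]
  have : (0 : ℝ) ≤ ((n : ℝ) * h)⁻¹ := by positivity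
  exact mul_le_mul_of_nonneg_left (Finset.sum_le_sum fun i _ => hfe i) this

end Moments

/-! ### One-sided Taylor expansions at the cutoff -/

/-- A Lipschitz extension to the whole line is continuous at `a`; the value of `f` at `a` plays no
role unless `a ∈ S`. -/
theorem exists_tendsto_of_lipschitz {S : Set ℝ} {f : ℝ → ℝ} {L : ℝ}
    (hf : ∀ x ∈ S, ∀ y ∈ S, |f x - f y| ≤ L * |x - y|) (a : ℝ) :
    ∃ l, Tendsto f (𝓝[S] a) (𝓝 l) := by
  have h1 : LipschitzOnWith (Real.toNNReal L) f S := by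
    refine LipschitzOnWith.of_dist_le_mul fun x hx y hy => ?_
    rw [Real.dist_eq, Real.dist_eq]
    exact (hf x hx y hy).trans
      (mul_le_mul_of_nonneg_right (Real.le_coe_toNNReal L) (abs_nonneg _))
  obtain ⟨g, hg, hfg⟩ := h1.extend_real
  refine ⟨g a, (hg.continuous.tendsto a |>.mono_left nhdsWithin_le_nhds).congr' ?_⟩
  filter_upwards [self_mem_nhdsWithin] with x hx using (hfg hx).symm

/-- Integrating an expansion at `0` of a derivative on a convex set that does not contain `0`. -/
theorem exists_expansion_of_deriv {S : Set ℝ} (hS : Convex ℝ S) [(𝓝[S] (0 : ℝ)).NeBot]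
    {f g Q q : ℝ → ℝ} (hf : ∀ x ∈ S, HasDerivWithinAt f (g x) S x)
    (hQ : ∀ x, HasDerivAt Q (q x) x) (hQ0 : Q 0 = 0) {B : ℝ} {k : ℕ}
    (hgq : ∀ x ∈ S, |g x - q x| ≤ B * |x| ^ k) :
    ∃ l, Tendsto f (𝓝[S] 0) (𝓝 l) ∧ ∀ x ∈ S, |f x - (l + Q x)| ≤ B * |x| ^ (k + 1) := by
  obtain ⟨x₀, hx₀⟩ : S.Nonempty := by
    by_contra h
    rw [Set.not_nonempty_iff_eq_empty] at h
    have : (𝓝[S] (0 : ℝ)).NeBot := inferInstance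
    rw [h, nhdsWithin_empty] at this
    exact this.ne rfl
  have hB : ∀ x ∈ S, 0 ≤ B * |x| ^ k := fun x hx => (abs_nonneg _).trans (hgq x hx)
  -- The derivative of `f - Q` is at most `B * |x| ^ k` on the convex part of `S` within distance
  -- `|x|` of zero, so the mean value inequality applies there.
  have key : ∀ x ∈ S, ∀ y ∈ S, ∀ z ∈ S, |y| ≤ |x| → |z| ≤ |x| →
      |(f y - Q y) - (f z - Q z)| ≤ B * |x| ^ k * |y - z| := by
    intro x hx y hy z hz hyx hzx
    have hconv : Convex ℝ (S ∩ Set.Icc (-|x|) |x|) := hS.inter (convex_Icc _ _)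
    have := hconv.norm_image_sub_le_of_norm_hasDerivWithin_le (f := fun t => f t - Q t)
      (f' := fun t => g t - q t) (C := B * |x| ^ k) (x := z) (y := y)
      (fun t ht => ((hf t ht.1).mono Set.inter_subset_left).sub (hQ t).hasDerivWithinAt)
      (fun t ht => ?_) ⟨hz, abs_le.1 hzx⟩ ⟨hy, abs_le.1 hyx⟩
    · simpa [Real.norm_eq_abs] using this
    · have h1 := hgq t ht.1
      rw [Real.norm_eq_abs]
      have htx : |t| ≤ |x| := abs_le.2 ht.2
      rcases eq_or_lt_of_le (abs_nonneg x) with h0 | h0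
      · have : |t| = |x| := le_antisymm htx (h0 ▸ abs_nonneg t)
        rwa [this] at h1
      · have hB0 : 0 ≤ B := nonneg_of_mul_nonneg_left (hB x hx) (pow_pos h0 k)
        exact h1.trans (by gcongr)
  have hQc : Tendsto Q (𝓝[S] 0) (𝓝 0) := by
    have := (hQ 0).continuousAt.tendsto
    rw [hQ0] at this
    exact this.mono_left nhdsWithin_le_nhds
  -- If the chosen point of `S` is zero, the limit is the value by continuity; otherwise `key` makes
  -- `f - Q` Lipschitz near zero.
  have hlim : ∃ l, Tendsto (fun x => f x - Q x) (𝓝[S] 0) (𝓝 l) := by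
    by_cases h0 : x₀ = 0
    · refine ⟨f 0 - Q 0, ?_⟩
      subst h0
      have h1 : ContinuousWithinAt (fun x => f x - Q x) S 0 :=
        ((hf 0 hx₀).continuousWithinAt).sub (hQ 0).continuousAt.continuousWithinAt
      exact h1
    · obtain ⟨l, hl⟩ := exists_tendsto_of_lipschitz (S := S ∩ Set.Icc (-|x₀|) |x₀|)
        (f := fun x => f x - Q x) (L := B * |x₀| ^ k)
        (fun y hy z hz => key x₀ hx₀ y hy.1 z hz.1 (abs_le.2 hy.2) (abs_le.2 hz.2)) 0
      refine ⟨l, ?_⟩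
      rwa [nhdsWithin_inter_of_mem'] at hl
      refine mem_nhdsWithin_of_mem_nhds (Icc_mem_nhds ?_ ?_)
      · simpa using h0
      · simpa using h0
  obtain ⟨l, hl⟩ := hlim
  refine ⟨l, by simpa using hl.add hQc, fun x hx => ?_⟩
  rcases eq_or_ne x 0 with h0 | h0
  · subst h0
    have h1 : ContinuousWithinAt (fun x => f x - Q x) S 0 :=
      ((hf 0 hx).continuousWithinAt).sub (hQ 0).continuousAt.continuousWithinAt
    have h2 := tendsto_nhds_unique h1 hl
    simp only [hQ0, sub_zero] at h2
    simp [h2, hQ0]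
  · have h1 : Tendsto (fun y => |(f x - Q x) - (f y - Q y)|) (𝓝[S] 0) (𝓝 |(f x - Q x) - l|) :=
      (tendsto_const_nhds.sub hl).abs
    have h2 : Tendsto (fun y => B * |x| ^ k * |x - y|) (𝓝[S] 0) (𝓝 (B * |x| ^ k * |x - 0|)) := by
      have : Continuous fun y => B * |x| ^ k * |x - y| := by fun_prop
      exact (this.tendsto 0).mono_left nhdsWithin_le_nhds
    have h3 := le_of_tendsto_of_tendsto h1 h2 ?_
    · rw [sub_zero] at h3
      calc |f x - (l + Q x)| = |(f x - Q x) - l| := by congr 1; ring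
        _ ≤ _ := h3
        _ = _ := by ring
    · have : ∀ᶠ y in 𝓝[S] (0 : ℝ), |y| ≤ |x| := by
        refine mem_nhdsWithin_of_mem_nhds ?_
        filter_upwards [Icc_mem_nhds (a := -|x|) (b := |x|) (x := 0) (by simpa using h0)
          (by simpa using h0)] with y hy using abs_le.2 hy
      filter_upwards [this, self_mem_nhdsWithin] with y hy hyS
      exact key x hx x hx y hyS le_rfl hy

/-- Induction on the order: the expansion of the first derivative is integrated term by term, which
raises the power in the error by one. The coefficients are limits along `S`, so the cutoff need not
belong to `S`. -/
theorem exists_taylor_expansion {S : Set ℝ} (hS : Convex ℝ S) [(𝓝[S] (0 : ℝ)).NeBot] (p : ℕ)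
    (f : ℕ → ℝ → ℝ) (hf : ∀ j < p, ∀ x ∈ S, HasDerivWithinAt (f j) (f (j + 1) x) S x)
    {L B : ℝ} (hL : ∀ x ∈ S, |f p x - L| ≤ B * |x|) :
    ∃ c : ℕ → ℝ, c p = L ∧ (∀ j < p, Tendsto (f j) (𝓝[S] 0) (𝓝 (c j))) ∧
      ∀ x ∈ S, |f 0 x - ∑ j ∈ Finset.range (p + 1), c j / (j.factorial : ℝ) * x ^ j| ≤
        B * |x| ^ (p + 1) := by
  induction p generalizing f with
  | zero => exact ⟨fun _ => L, rfl, by simp, by simpa using hL⟩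
  | succ p ih =>
    obtain ⟨c, hc1, hc2, hc3⟩ := ih (fun j => f (j + 1))
      (fun j hj x hx => hf (j + 1) (by omega) x hx) hL
    have hQ : ∀ x, HasDerivAt
        (fun x => ∑ j ∈ Finset.range (p + 1), c j / ((j + 1).factorial : ℝ) * x ^ (j + 1))
        (∑ j ∈ Finset.range (p + 1), c j / (j.factorial : ℝ) * x ^ j) x := by
      intro x
      refine HasDerivAt.fun_sum fun j _ => ?_
      have := (hasDerivAt_pow (j + 1) x).const_mul (c j / ((j + 1).factorial : ℝ))
      refine this.congr_deriv ?_
      rw [Nat.factorial_succ]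
      push_cast
      have h1 : (j.factorial : ℝ) ≠ 0 := by positivity
      have h2 : (j : ℝ) + 1 ≠ 0 := by positivity
      field_simp
    obtain ⟨l, hl1, hl2⟩ := exists_expansion_of_deriv hS (f := f 0) (g := f 1)
      (Q := fun x => ∑ j ∈ Finset.range (p + 1), c j / ((j + 1).factorial : ℝ) * x ^ (j + 1))
      (q := fun x => ∑ j ∈ Finset.range (p + 1), c j / (j.factorial : ℝ) * x ^ j)
      (fun x hx => hf 0 (by omega) x hx) hQ (by simp) hc3
    -- The new constant term is the limit of `f 0`; the other coefficients are those of the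
    -- derivative, shifted by one place.
    · refine ⟨fun j => if j = 0 then l else c (j - 1), by simpa using hc1, ?_, ?_⟩
      · intro j hj
        rcases j with _ | j
        · simpa using hl1
        · simpa using hc2 j (by omega)
      · intro x hx
        rw [Finset.sum_range_succ']
        have := hl2 x hx
        simp only [Nat.add_eq_zero_iff, one_ne_zero, and_false, ↓reduceIte, add_tsub_cancel_right,
          Nat.factorial_zero, Nat.cast_one, div_one, pow_zero, mul_one]
        rwa [add_comm l] at this

/-! ### Functions whose superlevel sets are intervals -/

/-- A function with values in `[0, M]` and superlevel sets that are intervals in `[-1, 1]`. -/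
structure IsLayered (M : ℝ) (G : ℝ → ℝ) : Prop where
  nonneg : ∀ u, 0 ≤ G u
  le : ∀ u, G u ≤ M
  eq_zero : ∀ u, u ∉ Set.Icc (-1 : ℝ) 1 → G u = 0
  ordConnected : ∀ s > 0, Set.OrdConnected {u | s ≤ G u}

theorem IsLayered.measurable {M : ℝ} {G : ℝ → ℝ} (hG : IsLayered M G) : Measurable G := by
  refine measurable_of_Ici fun s => ?_
  rcases le_or_gt s 0 with hs | hs
  · convert MeasurableSet.univ
    ext u
    simp [hs.trans (hG.nonneg u)]
  · exact (hG.ordConnected s hs).measurableSet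

/-- A uniform approximation by steps on superlevel sets. -/
theorem IsLayered.abs_sub_steps_le {M : ℝ} {G : ℝ → ℝ} (hG : IsLayered M G) {N : ℕ} (hN : 0 < N)
    (u : ℝ) :
    |G u - M / N * ∑ k ∈ Finset.range N,
      {u | M / N * ((k : ℝ) + 1) ≤ G u}.indicator (fun _ => (1 : ℝ)) u| ≤ M / N := by
  have hN' : (0 : ℝ) < N := by exact_mod_cast hN
  have hM : 0 ≤ M := (hG.nonneg u).trans (hG.le u)
  rcases eq_or_lt_of_le hM with h0 | h0
  · have : G u = 0 := le_antisymm (h0 ▸ hG.le u) (hG.nonneg u)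
    simp [← h0, this]
  set a := M / N with ha
  have ha0 : 0 < a := by positivity
  -- Of the levels `a, 2a, …, N a = M`, those not above `G u` number the integer part of `G u / a`.
  have hcount : (∑ k ∈ Finset.range N,
      {u | a * ((k : ℝ) + 1) ≤ G u}.indicator (fun _ => (1 : ℝ)) u) = ⌊G u / a⌋₊ := by
    have h1 : ∀ k ∈ Finset.range N, {u | a * ((k : ℝ) + 1) ≤ G u}.indicator (fun _ => (1 : ℝ)) u =
        if k < ⌊G u / a⌋₊ then 1 else 0 := by
      intro k _
      have : a * ((k : ℝ) + 1) ≤ G u ↔ k < ⌊G u / a⌋₊ := by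
        rw [← Nat.succ_le_iff, Nat.le_floor_iff (div_nonneg (hG.nonneg u) ha0.le), le_div_iff₀ ha0]
        push_cast
        rw [mul_comm]
      by_cases hk : k < ⌊G u / a⌋₊
      · simp [hk, this.2 hk]
      · simp [hk, mt this.1 hk]
    rw [Finset.sum_congr rfl h1, Finset.sum_boole]
    congr 1
    have h2 : ⌊G u / a⌋₊ ≤ N := by
      refine Nat.floor_le_of_le ?_
      rw [div_le_iff₀ ha0, ha]
      field_simp
      exact hG.le u
    rw [show (Finset.range N).filter (fun k => k < ⌊G u / a⌋₊) = Finset.range ⌊G u / a⌋₊ by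
      ext k; simp; omega, Finset.card_range]
  rw [hcount]
  have h1 := Nat.floor_le (div_nonneg (hG.nonneg u) ha0.le)
  have h2 := Nat.lt_floor_add_one (G u / a)
  rw [le_div_iff₀ ha0] at h1
  rw [div_lt_iff₀ ha0] at h2
  rw [abs_le]
  constructor <;> nlinarith

/-- A function of bounded variation is a difference of monotone functions, here taken in `|u|`.
Multiplied by the increasing factor `|u|^k` and cut off at one, each part increases away from the
cutoff, so its superlevel sets on one side are intervals. -/
theorem exists_layered_sub {K : ℝ → ℝ} (hK : IsKernelFunction K)
    (hBV : BoundedVariationOn K (Set.Icc 0 1)) (s : Side) (k : ℕ) :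
    ∃ M G₁ G₂, IsLayered M G₁ ∧ IsLayered M G₂ ∧ ∀ u, sidePow K s k u = G₁ u - G₂ u := by
  obtain ⟨p, q, hp, hq, hpq⟩ :=
    hBV.locallyBoundedVariationOn.exists_monotoneOn_sub_monotoneOn
  -- Subtracting one constant from both parts leaves their difference unchanged and makes them
  -- nonnegative, so that multiplication by `|u|^k` preserves monotonicity.
  set m := min (p 0) (q 0) with hm
  have h01 : (0 : ℝ) ∈ Set.Icc (0 : ℝ) 1 := by simp
  have h11 : (1 : ℝ) ∈ Set.Icc (0 : ℝ) 1 := by simp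
  set M := max (p 1) (q 1) - m with hM
  -- the building block
  have block : ∀ r : ℝ → ℝ, MonotoneOn r (Set.Icc 0 1) → m ≤ r 0 → r 1 ≤ max (p 1) (q 1) →
      IsLayered M fun u => {u : ℝ | u ∈ s.region ∧ |u| ≤ 1}.indicator
        (fun u => |u| ^ k * (r |u| - m)) u := by
    intro r hr h0 h1
    have hpos : ∀ t ∈ Set.Icc (0 : ℝ) 1, 0 ≤ r t - m := fun t ht => by
      have := hr h01 ht ht.1; linarith
    have hle : ∀ t ∈ Set.Icc (0 : ℝ) 1, r t - m ≤ M := fun t ht => by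
      have := hr ht h11 ht.2; rw [hM]; linarith
    have hM0 : 0 ≤ M := (hpos 0 h01).trans (hle 0 h01)
    have hmono : ∀ t ∈ Set.Icc (0 : ℝ) 1, ∀ t' ∈ Set.Icc (0 : ℝ) 1, t ≤ t' →
        t ^ k * (r t - m) ≤ t' ^ k * (r t' - m) := by
      intro t ht t' ht' htt
      have h1 := hr ht ht' htt
      exact mul_le_mul (pow_le_pow_left₀ ht.1 htt k) (by linarith) (hpos t ht) (pow_nonneg ht'.1 k)
    refine ⟨fun u => Set.indicator_nonneg (fun u hu => ?_) u, fun u => ?_, fun u hu => ?_, ?_⟩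
    · exact mul_nonneg (by positivity) (hpos _ ⟨abs_nonneg u, hu.2⟩)
    · refine Set.indicator_le' (fun u hu => ?_) (fun _ _ => hM0) u
      have hu' : |u| ∈ Set.Icc (0 : ℝ) 1 := ⟨abs_nonneg u, hu.2⟩
      calc |u| ^ k * (r |u| - m) ≤ 1 * M :=
            mul_le_mul (pow_le_one₀ (abs_nonneg _) hu.2) (hle _ hu') (hpos _ hu') zero_le_one
        _ = M := one_mul M
    · refine Set.indicator_of_notMem (fun h => hu (abs_le.1 h.2)) _
    · intro t ht
      have hmem : ∀ u, t ≤ {u : ℝ | u ∈ s.region ∧ |u| ≤ 1}.indicator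
          (fun u => |u| ^ k * (r |u| - m)) u ↔
          (u ∈ s.region ∧ |u| ≤ 1) ∧ t ≤ |u| ^ k * (r |u| - m) := by
        intro u
        by_cases hu : u ∈ s.region ∧ |u| ≤ 1
        · have hu' : u ∈ {u : ℝ | u ∈ s.region ∧ |u| ≤ 1} := hu
          simp only [Set.indicator_of_mem hu', hu, true_and, and_self]
        · have hu' : u ∉ {u : ℝ | u ∈ s.region ∧ |u| ≤ 1} := hu
          simp only [Set.indicator_of_notMem hu', hu, false_and, iff_false, not_le]
          exact ht
      refine ⟨fun x hx y hy z hz => ?_⟩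
      rw [Set.mem_ofPred_eq, hmem] at hx hy ⊢
      obtain ⟨⟨hx1, hx2⟩, hx3⟩ := hx
      obtain ⟨⟨hy1, hy2⟩, hy3⟩ := hy
      cases s with
      | plus =>
        simp only [Side.region, Set.mem_Ici] at hx1 hy1 ⊢
        have hz0 : 0 ≤ z := hx1.trans hz.1
        rw [abs_of_nonneg hx1] at hx2 hx3
        rw [abs_of_nonneg hy1] at hy2
        rw [abs_of_nonneg hz0]
        exact ⟨⟨hz0, hz.2.trans hy2⟩,
          hx3.trans (hmono x ⟨hx1, hx2⟩ z ⟨hz0, hz.2.trans hy2⟩ hz.1)⟩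
      | minus =>
        simp only [Side.region, Set.mem_Iio] at hx1 hy1 ⊢
        have hz0 : z < 0 := hz.2.trans_lt hy1
        rw [abs_of_neg hx1] at hx2
        rw [abs_of_neg hy1] at hy2 hy3
        rw [abs_of_neg hz0]
        have hz1 := hz.1
        have hz2 := hz.2
        exact ⟨⟨hz0, by linarith⟩,
          hy3.trans (hmono (-y) ⟨by linarith, hy2⟩ (-z) ⟨by linarith, by linarith⟩ (by linarith))⟩
  have hb1 := block p hp (min_le_left _ _) (le_max_left _ _)
  have hb2 := block q hq (min_le_right _ _) (le_max_right _ _)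
  have hKabs : ∀ u, K |u| = K u := fun u => by
    rcases abs_choice u with h | h <;> rw [h]
    exact hK.symm u
  have hdiff : ∀ u, |u| ^ k * halfKernel K s u =
      {u : ℝ | u ∈ s.region ∧ |u| ≤ 1}.indicator (fun u => |u| ^ k * (p |u| - m)) u -
      {u : ℝ | u ∈ s.region ∧ |u| ≤ 1}.indicator (fun u => |u| ^ k * (q |u| - m)) u := by
    intro u
    by_cases hu : u ∈ s.region ∧ |u| ≤ 1
    · have hu' : u ∈ {u : ℝ | u ∈ s.region ∧ |u| ≤ 1} := hu
      have h1 : K |u| = p |u| - q |u| := congrFun hpq |u|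
      rw [Set.indicator_of_mem hu', Set.indicator_of_mem hu', halfKernel,
        Set.indicator_of_mem hu.1, ← hKabs, h1]
      ring
    · have hu' : u ∉ {u : ℝ | u ∈ s.region ∧ |u| ≤ 1} := hu
      rw [Set.indicator_of_notMem hu', Set.indicator_of_notMem hu', halfKernel]
      by_cases hs : u ∈ s.region
      · rw [Set.indicator_of_mem hs, hK.eq_zero u fun h => hu ⟨hs, abs_le.2 h⟩]; simp
      · rw [Set.indicator_of_notMem hs]; simp
  have hsgn : ∀ u, sidePow K s k u = s.sign ^ k * (|u| ^ k * halfKernel K s u) := by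
    intro u
    rw [sidePow, ← mul_assoc, ← mul_pow]
    by_cases hs : u ∈ s.region
    · congr 2
      cases s with
      | plus => simp only [Side.region, Set.mem_Ici] at hs; simp [Side.sign, abs_of_nonneg hs]
      | minus => simp only [Side.region, Set.mem_Iio] at hs; simp [Side.sign, abs_of_neg hs]
    · simp [halfKernel, hs]
  -- On the left an odd power is negative, which exchanges the roles of the two layered parts.
  have hs2 : s.sign ^ k = 1 ∨ s.sign ^ k = -1 := by
    cases s
    · simp [Side.sign]
    · exact neg_one_pow_eq_or ℝ k
  rcases hs2 with h | h
  · exact ⟨M, _, _, hb1, hb2, fun u => by rw [hsgn, h, one_mul, hdiff]⟩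
  · exact ⟨M, _, _, hb2, hb1, fun u => by rw [hsgn, h, hdiff]; ring⟩

/-! ### Samples and resampling of outcomes given the running variable -/

section Sample

variable {n : ℕ} {U : Type*}

/-- Replace the outcome of unit `j`. -/
def resample (j : Fin n) (w : Fin n → ℝ × U) (u : U) : Fin n → ℝ × U :=
  Function.update w j ((w j).1, u)

/-- `F` does not depend on the outcome of unit `j`. -/
def FreeOf {β : Type*} (j : Fin n) (F : (Fin n → ℝ × U) → β) : Prop :=
  ∀ w u, F (resample j w u) = F w

theorem resample_fst (j i : Fin n) (w : Fin n → ℝ × U) (u : U) :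
    (resample j w u i).1 = (w i).1 := by
  by_cases h : i = j
  · subst h; simp [resample]
  · simp [resample, h]

theorem resample_self (j : Fin n) (w : Fin n → ℝ × U) (u : U) :
    resample j w u j = ((w j).1, u) := by simp [resample]

theorem resample_of_ne {i j : Fin n} (h : i ≠ j) (w : Fin n → ℝ × U) (u : U) :
    resample j w u i = w i := by simp [resample, h]

theorem freeOf_comp_fst {β : Type*} (j : Fin n) (G : (Fin n → ℝ) → β) :
    FreeOf j fun w : Fin n → ℝ × U => G fun i => (w i).1 := by
  intro w u
  simp only [resample_fst]

theorem freeOf_eval {β : Type*} {i j : Fin n} (h : i ≠ j) (G : ℝ × U → β) :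
    FreeOf j fun w : Fin n → ℝ × U => G (w i) := by
  intro w u
  simp only [resample_of_ne h]

theorem FreeOf.comp₂ {β γ δ : Type*} {j : Fin n} {F : (Fin n → ℝ × U) → β}
    {G : (Fin n → ℝ × U) → γ} (hF : FreeOf j F) (hG : FreeOf j G) (op : β → γ → δ) :
    FreeOf j fun w => op (F w) (G w) := by
  intro w u
  simp only [hF w u, hG w u]

variable [MeasurableSpace U]

/-- The law of an i.i.d. sample with running variable law `PX` and conditional law `κ`. -/
noncomputable def sampleLaw (n : ℕ) (PX : Measure ℝ) (κ : Kernel ℝ U) : Measure (Fin n → ℝ × U) :=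
  Measure.pi fun _ => PX.compProd κ

theorem measurable_resample (j : Fin n) :
    Measurable fun p : (Fin n → ℝ × U) × U => resample j p.1 p.2 := by
  refine measurable_pi_lambda _ fun i => ?_
  by_cases h : i = j
  · subst h
    simp only [resample_self]
    fun_prop
  · simp only [resample_of_ne h]
    fun_prop

variable {PX : Measure ℝ} [IsProbabilityMeasure PX] {κ : Kernel ℝ U} [IsMarkovKernel κ]

instance : IsProbabilityMeasure (sampleLaw n PX κ) := by
  unfold sampleLaw; infer_instance

/-- Both sides have the same marginal once coordinate `j` is integrated out, since a second update
overwrites the first. -/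
theorem lintegral_update (j : Fin n) {F : (Fin n → ℝ × U) → ENNReal} (hF : Measurable F) :
    ∫⁻ w, F w ∂sampleLaw n PX κ =
      ∫⁻ w, ∫⁻ y, F (Function.update w j y) ∂(PX.compProd κ) ∂sampleLaw n PX κ := by
  have h1 : (fun w => ∫⁻ y, F (Function.update w j y) ∂(PX.compProd κ)) =
      lmarginal (fun _ : Fin n => PX.compProd κ) {j} F :=
    (lmarginal_singleton (μ := fun _ : Fin n => PX.compProd κ) F j).symm
  rw [h1, sampleLaw]
  refine lintegral_eq_of_lmarginal_eq {j} hF (hF.lmarginal _) ?_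
  conv_rhs => rw [lmarginal_singleton]
  rw [lmarginal_singleton]
  ext w
  simp [Function.update_idem]

/-- Drawing observation `j` anew means drawing its running variable and then its outcome from `κ`;
redrawing that outcome once more changes nothing. The inner integral plays the part of the
conditional expectation given all running variables and all other outcomes. -/
theorem lintegral_resample (j : Fin n) {F : (Fin n → ℝ × U) → ENNReal} (hF : Measurable F) :
    ∫⁻ w, F w ∂sampleLaw n PX κ =
      ∫⁻ w, ∫⁻ u, F (resample j w u) ∂(κ (w j).1) ∂sampleLaw n PX κ := by
  set κj : Kernel (Fin n → ℝ × U) U := κ.comap (fun w => (w j).1) (by fun_prop)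
  have hm : Measurable fun p : (Fin n → ℝ × U) × U => F (resample j p.1 p.2) :=
    hF.comp (measurable_resample j)
  have hG : Measurable fun w : Fin n → ℝ × U => ∫⁻ u, F (resample j w u) ∂(κ (w j).1) :=
    Measurable.lintegral_kernel_prod_right (κ := κj) hm
  rw [lintegral_update j hF, lintegral_update j hG]
  refine lintegral_congr fun w => ?_
  have hu : Measurable fun y : ℝ × U => Function.update w j y := measurable_update w
  rw [Measure.lintegral_compProd (f := fun y => F (Function.update w j y)) (hF.comp hu),
    Measure.lintegral_compProd (f := fun y => ∫⁻ u, F (resample j (Function.update w j y) u)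
      ∂(κ (Function.update w j y j).1)) (hG.comp hu)]
  refine lintegral_congr fun x => ?_
  simp [resample]

/-- Resampling maps the joint law of the sample and a fresh outcome back to the sample law, so the
identity for nonnegative functions carries over to integrable ones. -/
theorem integral_resample (j : Fin n) {F : (Fin n → ℝ × U) → ℝ}
    (hF : Integrable F (sampleLaw n PX κ)) :
    ∫ w, F w ∂sampleLaw n PX κ =
      ∫ w, ∫ u, F (resample j w u) ∂(κ (w j).1) ∂sampleLaw n PX κ := by
  set κj : Kernel (Fin n → ℝ × U) U := κ.comap (fun w => (w j).1) (by fun_prop) with hκj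
  have hmap : ((sampleLaw n PX κ).compProd κj).map
      (fun p : (Fin n → ℝ × U) × U => resample j p.1 p.2) = sampleLaw n PX κ := by
    ext s hs
    rw [← lintegral_indicator_one hs, ← lintegral_indicator_one hs,
      lintegral_map (measurable_one.indicator hs) (measurable_resample j),
      Measure.lintegral_compProd (f := fun p => s.indicator 1 (resample j p.1 p.2))
        ((measurable_one.indicator hs).comp (measurable_resample j)),
      lintegral_resample j (measurable_one.indicator hs)]
    rfl
  have hF' : Integrable F (((sampleLaw n PX κ).compProd κj).map
      (fun p : (Fin n → ℝ × U) × U => resample j p.1 p.2)) := by rwa [hmap]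
  conv_lhs => rw [← hmap]
  rw [integral_map (measurable_resample j).aemeasurable hF'.aestronglyMeasurable,
    Measure.integral_compProd (f := fun p => F (resample j p.1 p.2))
      (hF'.comp_measurable (measurable_resample j))]
  rfl

theorem ae_sampleLaw_of_ae {p : ℝ → Prop} (hp : ∀ᵐ x ∂PX, p x) (j : Fin n) :
    ∀ᵐ w ∂sampleLaw n PX κ, p (w j).1 := by
  have h1 : MeasurePreserving (fun w : Fin n → ℝ × U => w j) (sampleLaw n PX κ)
      (PX.compProd κ) := measurePreserving_eval _ j
  have h2 : MeasurePreserving (Prod.fst : ℝ × U → ℝ) (PX.compProd κ) PX :=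
    ⟨measurable_fst, Measure.fst_compProd PX κ⟩
  exact (h2.comp h1).quasiMeasurePreserving.ae hp

theorem lintegral_sampleLaw_eval {φ : ℝ → ENNReal} (hφ : Measurable φ) (j : Fin n) :
    ∫⁻ w, φ (w j).1 ∂sampleLaw n PX κ = ∫⁻ x, φ x ∂PX := by
  have h1 : MeasurePreserving (fun w : Fin n → ℝ × U => w j) (sampleLaw n PX κ)
      (PX.compProd κ) := measurePreserving_eval _ j
  have h2 : MeasurePreserving (Prod.fst : ℝ × U → ℝ) (PX.compProd κ) PX :=
    ⟨measurable_fst, Measure.fst_compProd PX κ⟩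
  exact (h2.comp h1).lintegral_comp hφ

/-- Given everything but the outcome of `j`, the factor `F` is constant and `ψ` has mean zero. -/
theorem integral_mul_eq_zero_of_resample {j : Fin n} {F ψ : (Fin n → ℝ × U) → ℝ}
    (hF : FreeOf j F) (hFψ : Integrable (fun w => F w * ψ w) (sampleLaw n PX κ))
    (hψ : ∀ᵐ w ∂sampleLaw n PX κ, ∫ u, ψ (resample j w u) ∂(κ (w j).1) = 0) :
    ∫ w, F w * ψ w ∂sampleLaw n PX κ = 0 := by
  rw [integral_resample j hFψ]
  refine integral_eq_zero_of_ae ?_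
  filter_upwards [hψ] with w hw
  simp only [hF w]
  rw [integral_const_mul, hw, mul_zero]
  rfl

theorem lintegral_mul_le_of_resample {j : Fin n} {F ψ : (Fin n → ℝ × U) → ENNReal}
    (hFm : Measurable F) (hψm : Measurable ψ) (hF : FreeOf j F) {c : ENNReal}
    (hψ : ∀ᵐ w ∂sampleLaw n PX κ, ∫⁻ u, ψ (resample j w u) ∂(κ (w j).1) ≤ c) :
    ∫⁻ w, F w * ψ w ∂sampleLaw n PX κ ≤ c * ∫⁻ w, F w ∂sampleLaw n PX κ := by
  rw [lintegral_resample j (F := fun w => F w * ψ w) (hFm.mul hψm), ← lintegral_const_mul _ hFm]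
  refine lintegral_mono_ae ?_
  filter_upwards [hψ] with w hw
  simp only [hF w]
  rw [lintegral_const_mul (f := fun u => ψ (resample j w u)) _
    (hψm.comp ((measurable_resample j).comp measurable_prodMk_left)), mul_comm]
  gcongr

/-- The second moment of a sum of pairwise orthogonal variables. -/
theorem integral_sq_sum_of_orthogonal {ι Ω : Type*} [MeasurableSpace Ω] {μ : Measure Ω}
    (t : Finset ι) (Y : ι → Ω → ℝ) (hY : ∀ i ∈ t, MemLp (Y i) 2 μ)
    (horth : ∀ i ∈ t, ∀ j ∈ t, i ≠ j → ∫ ω, Y i ω * Y j ω ∂μ = 0) :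
    ∫ ω, (∑ i ∈ t, Y i ω) ^ 2 ∂μ = ∑ i ∈ t, ∫ ω, Y i ω ^ 2 ∂μ := by
  have hint : ∀ i ∈ t, ∀ j ∈ t, Integrable (fun ω => Y i ω * Y j ω) μ := fun i hi j hj =>
    (hY i hi).integrable_mul (hY j hj)
  simp_rw [sq, Finset.sum_mul_sum]
  rw [integral_finsetSum _ fun i hi => integrable_finsetSum _ fun j hj => hint i hi j hj]
  refine Finset.sum_congr rfl fun i hi => ?_
  rw [integral_finsetSum _ fun j hj => hint i hi j hj]
  rw [Finset.sum_eq_single i (fun j hj hji => horth i hi j hj (Ne.symm hji)) (fun h => absurd hi h)]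

theorem ofReal_integral_sq {Ω : Type*} [MeasurableSpace Ω] {μ : Measure Ω} {f : Ω → ℝ}
    (hf : MemLp f 2 μ) :
    ENNReal.ofReal (∫ ω, f ω ^ 2 ∂μ) = ∫⁻ ω, ENNReal.ofReal (f ω ^ 2) ∂μ :=
  ofReal_integral_eq_lintegral_ofReal hf.integrable_sq
    (Eventually.of_forall fun _ => sq_nonneg _)

theorem memLp_two_of_lintegral {Ω : Type*} [MeasurableSpace Ω] {μ : Measure Ω} {f : Ω → ℝ}
    (hf : AEStronglyMeasurable f μ) (h : ∫⁻ ω, ENNReal.ofReal (f ω ^ 2) ∂μ < ⊤) : MemLp f 2 μ := by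
  rw [memLp_two_iff_integrable_sq hf]
  refine ⟨by fun_prop, ?_⟩
  rw [hasFiniteIntegral_iff_ofReal (Eventually.of_forall fun _ => sq_nonneg _)]
  exact h

/-- Conditional on everything else, `ζ` has mean zero and second moment at most `c`. -/
structure IsCentered (PX : Measure ℝ) (κ : Kernel ℝ U) (c : ℝ) (j : Fin n)
    (ζ : (Fin n → ℝ × U) → ℝ) : Prop where
  measurable : Measurable ζ
  mean : ∀ᵐ w ∂sampleLaw n PX κ, ∫ u, ζ (resample j w u) ∂(κ (w j).1) = 0
  sq : ∀ᵐ w ∂sampleLaw n PX κ,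
    ∫⁻ u, ENNReal.ofReal (ζ (resample j w u) ^ 2) ∂(κ (w j).1) ≤ ENNReal.ofReal c

/-- For distinct `i` and `j` in `t`, neither `a i`, `ζ i` nor `a j` involves the outcome of `j`, so
conditioning on everything else makes the cross products integrate to zero. The bound `B` only
secures square integrability. -/
theorem lintegral_sq_sum_centered (t : Finset (Fin n)) {c : ℝ}
    {ζ a : Fin n → (Fin n → ℝ × U) → ℝ} (hζ : ∀ i ∈ t, IsCentered PX κ c i (ζ i))
    (hfree : ∀ i ∈ t, ∀ j ∈ t, i ≠ j → FreeOf j (ζ i)) (ha : ∀ i, Measurable (a i))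
    (hafree : ∀ i j, FreeOf j (a i)) {B : ℝ} (hB : ∀ i w, |a i w| ≤ B) :
    ∫⁻ w, ENNReal.ofReal ((∑ i ∈ t, a i w * ζ i w) ^ 2) ∂sampleLaw n PX κ ≤
      ENNReal.ofReal c * ∑ i ∈ t, ∫⁻ w, ENNReal.ofReal (a i w ^ 2) ∂sampleLaw n PX κ := by
  have hle : ∀ i ∈ t, ∫⁻ w, ENNReal.ofReal ((a i w * ζ i w) ^ 2) ∂sampleLaw n PX κ ≤
      ENNReal.ofReal c * ∫⁻ w, ENNReal.ofReal (a i w ^ 2) ∂sampleLaw n PX κ := by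
    intro i hi
    simp_rw [mul_pow, ENNReal.ofReal_mul (sq_nonneg _)]
    exact lintegral_mul_le_of_resample ((ha i).pow_const 2).ennreal_ofReal
      ((hζ i hi).measurable.pow_const 2).ennreal_ofReal
      (fun w u => by simp only [hafree i i w u]) (hζ i hi).sq
  have hL2 : ∀ i ∈ t, MemLp (fun w => a i w * ζ i w) 2 (sampleLaw n PX κ) := by
    intro i hi
    refine memLp_two_of_lintegral
      ((ha i).mul (hζ i hi).measurable).aestronglyMeasurable ((hle i hi).trans_lt ?_)
    refine ENNReal.mul_lt_top ENNReal.ofReal_lt_top ?_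
    refine lt_of_le_of_lt (lintegral_mono (g := fun _ => ENNReal.ofReal (B ^ 2)) fun w => ?_) ?_
    · exact ENNReal.ofReal_le_ofReal (sq_le_sq' (abs_le.1 (hB i w)).1 (abs_le.1 (hB i w)).2)
    · simp
  have hsum : MemLp (fun w => ∑ i ∈ t, a i w * ζ i w) 2 (sampleLaw n PX κ) :=
    memLp_finsetSum t hL2
  rw [← ofReal_integral_sq hsum, integral_sq_sum_of_orthogonal t _ hL2,
    ENNReal.ofReal_sum_of_nonneg fun i _ => integral_nonneg fun _ => sq_nonneg _, Finset.mul_sum]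
  · refine Finset.sum_le_sum fun i hi => ?_
    rw [ofReal_integral_sq (hL2 i hi)]
    exact hle i hi
  · intro i hi j hj hij
    have := integral_mul_eq_zero_of_resample (PX := PX) (κ := κ) (j := j)
      (F := fun w => a i w * ζ i w * a j w) (ψ := ζ j) ?_ ?_ (hζ j hj).mean
    · rw [← this]
      congr 1
      ext w; ring
    · intro w u
      simp only [hafree i j w u, hafree j j w u, hfree i hi j hj hij w u]
    · refine ((hL2 i hi).integrable_mul (hL2 j hj)).congr (Eventually.of_forall fun w => ?_)
      simp only [Pi.mul_apply]; ring

/-! ### Quadratic forms in bounded centered outcomes -/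

/-- The summands of a centered quadratic form. -/
def quadTerm (c : Fin n → Fin n → (Fin n → ℝ) → ℝ) (ξ : ℝ × U → ℝ) (s : ℝ → ℝ) (j k : Fin n)
    (w : Fin n → ℝ × U) : ℝ :=
  c j k (fun i => (w i).1) * (ξ (w j) * ξ (w k) - if j = k then s (w j).1 else 0)

/-- Terms of different unordered index pairs are orthogonal: some index occurs in only one of the
pairs, and given the rest of the sample the term that contains it has mean zero. A term therefore
interacts only with itself and its transpose, which accounts for the factor two. -/
theorem lintegral_sq_quadForm_le {c : Fin n → Fin n → (Fin n → ℝ) → ℝ}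
    (hc : ∀ j k, Measurable (c j k)) {C : ℝ} (hC : ∀ j k x, |c j k x| ≤ C)
    {ξ : ℝ × U → ℝ} (hξ : Measurable ξ) {b : ℝ} (hb : ∀ y, |ξ y| ≤ b)
    (hξ0 : ∀ x, ∫ u, ξ (x, u) ∂(κ x) = 0) :
    ∫ w, (∑ j, ∑ k, quadTerm c ξ (fun x => ∫ u, ξ (x, u) ^ 2 ∂(κ x)) j k w) ^ 2
      ∂sampleLaw n PX κ ≤
      2 * b ^ 4 * ∫ w, ∑ j, ∑ k, c j k (fun i => (w i).1) ^ 2 ∂sampleLaw n PX κ := by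
  -- The conditional variance is what the diagonal terms must lose in order to be centered.
  set s : ℝ → ℝ := fun x => ∫ u, ξ (x, u) ^ 2 ∂(κ x) with hs
  have hsm : Measurable s :=
    (StronglyMeasurable.integral_kernel_prod_right (κ := κ) (f := fun x u => ξ (x, u) ^ 2)
      (by simpa [Function.uncurry_def] using (hξ.pow_const 2).stronglyMeasurable)).measurable
  have hξi : ∀ x, Integrable (fun u => ξ (x, u)) (κ x) := fun x =>
    Integrable.of_bound
      (hξ.comp measurable_prodMk_left).aestronglyMeasurable b (Eventually.of_forall fun u => by simpa using hb (x, u))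
  have hξsq : ∀ y, ξ y ^ 2 ≤ b ^ 2 := fun y => sq_le_sq' (abs_le.1 (hb y)).1 (abs_le.1 (hb y)).2
  have hξi2 : ∀ x, Integrable (fun u => ξ (x, u) ^ 2) (κ x) := fun x =>
    Integrable.of_bound
      ((hξ.comp measurable_prodMk_left).pow_const 2).aestronglyMeasurable (b ^ 2) (Eventually.of_forall fun u => by
      rw [Real.norm_eq_abs, abs_of_nonneg (sq_nonneg _)]; exact hξsq _)
  have hs0 : ∀ x, 0 ≤ s x := fun x => integral_nonneg fun _ => sq_nonneg _
  have hs1 : ∀ x, s x ≤ b ^ 2 := fun x => by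
    have := integral_mono (hξi2 x) (integrable_const (b ^ 2)) fun u => hξsq (x, u)
    simpa using this
  have hb0 : ∀ y : ℝ × U, 0 ≤ b := fun y => (abs_nonneg _).trans (hb y)
  -- bounds
  have hfac : ∀ (j k : Fin n) (w : Fin n → ℝ × U), |ξ (w j) * ξ (w k) - if j = k then s (w j).1 else 0| ≤ b ^ 2 := by
    intro j k w
    by_cases hjk : j = k
    · subst hjk
      rw [if_pos rfl, ← sq, abs_le]
      have h1 := hξsq (w j); have h2 := hs0 (w j).1; have h3 := hs1 (w j).1
      have h4 := sq_nonneg (ξ (w j))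
      constructor <;> linarith
    · rw [if_neg hjk, sub_zero, abs_mul, sq]
      exact mul_le_mul (hb _) (hb _) (abs_nonneg _) (hb0 (w j))
  have hqm : ∀ j k, Measurable (quadTerm (U := U) c ξ s j k) := by
    intro j k
    have h1 : Measurable fun w : Fin n → ℝ × U => c j k fun i => (w i).1 :=
      (hc j k).comp (by fun_prop)
    unfold quadTerm
    split_ifs <;> fun_prop
  have hqb : ∀ j k w, |quadTerm (U := U) c ξ s j k w| ≤ C * b ^ 2 := by
    intro j k w
    rw [quadTerm, abs_mul]
    exact mul_le_mul (hC _ _ _) (hfac j k w) (abs_nonneg _) ((abs_nonneg _).trans (hC j k 0))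
  have hbdd : ∀ {F : (Fin n → ℝ × U) → ℝ}, Measurable F → (∃ B, ∀ w, |F w| ≤ B) →
      Integrable F (sampleLaw n PX κ) := fun {F} hF ⟨B, hB⟩ =>
    Integrable.of_bound hF.aestronglyMeasurable B (Eventually.of_forall fun w => by simpa using hB w)
  -- centering
  have hcent : ∀ j k t, (t = j ∨ t = k) → ∀ F : (Fin n → ℝ × U) → ℝ, Measurable F →
      (∃ B, ∀ w, |F w| ≤ B) → FreeOf t F →
      ∫ w, F w * quadTerm c ξ s j k w ∂sampleLaw n PX κ = 0 := by
    intro j k t ht F hF ⟨B, hB⟩ hFt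
    have hint : Integrable (fun w => F w * quadTerm c ξ s j k w) (sampleLaw n PX κ) := by
      refine hbdd (hF.mul (hqm j k)) ⟨B * (C * b ^ 2), fun w => ?_⟩
      rw [abs_mul]
      exact mul_le_mul (hB w) (hqb j k w) (abs_nonneg _) ((abs_nonneg _).trans (hB w))
    have hcf : FreeOf t fun w : Fin n → ℝ × U => c j k fun i => (w i).1 := freeOf_comp_fst t _
    by_cases hjk : j = k
    · subst hjk
      obtain rfl : t = j := by tauto
      have h1 : ∀ w, F w * quadTerm c ξ s t t w =
          (F w * c t t fun i => (w i).1) * (ξ (w t) ^ 2 - s (w t).1) := fun w => by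
        rw [quadTerm, if_pos rfl]; ring
      simp_rw [h1] at hint ⊢
      refine integral_mul_eq_zero_of_resample (hFt.comp₂ hcf (· * ·)) hint
        (Eventually.of_forall fun w => ?_)
      simp only [resample_self]
      rw [integral_sub (hξi2 _) (integrable_const _)]
      simp [hs]
    · rcases ht with rfl | rfl
      · have h1 : ∀ w, F w * quadTerm c ξ s t k w =
            ((F w * c t k fun i => (w i).1) * ξ (w k)) * ξ (w t) := fun w => by
          rw [quadTerm, if_neg hjk]; ring
        simp_rw [h1] at hint ⊢
        refine integral_mul_eq_zero_of_resample ((hFt.comp₂ hcf (· * ·)).comp₂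
          (freeOf_eval (Ne.symm hjk) ξ) (· * ·)) hint (Eventually.of_forall fun w => ?_)
        simp only [resample_self]
        exact hξ0 _
      · have h1 : ∀ w, F w * quadTerm c ξ s j t w =
            ((F w * c j t fun i => (w i).1) * ξ (w j)) * ξ (w t) := fun w => by
          rw [quadTerm, if_neg hjk]; ring
        simp_rw [h1] at hint ⊢
        refine integral_mul_eq_zero_of_resample ((hFt.comp₂ hcf (· * ·)).comp₂
          (freeOf_eval hjk ξ) (· * ·)) hint (Eventually.of_forall fun w => ?_)
        simp only [resample_self]
        exact hξ0 _
  have hfree : ∀ j k t, t ≠ j → t ≠ k → FreeOf t (quadTerm (U := U) c ξ s j k) := by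
    intro j k t hj hk w u
    simp only [quadTerm, resample_fst, resample_of_ne (Ne.symm hj), resample_of_ne (Ne.symm hk)]
  have hqbdd : ∀ j k, ∃ B, ∀ w, |quadTerm (U := U) c ξ s j k w| ≤ B := fun j k => ⟨_, hqb j k⟩
  have horth : ∀ p q : Fin n × Fin n, q ≠ p → q ≠ p.swap →
      ∫ w, quadTerm c ξ s p.1 p.2 w * quadTerm c ξ s q.1 q.2 w ∂sampleLaw n PX κ = 0 := by
    rintro ⟨j, k⟩ ⟨l, m⟩ h1 h2
    simp only [Prod.swap_prod_mk, ne_eq, Prod.mk.injEq, not_and_or] at h1 h2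
    have key : (∃ t, (t = l ∨ t = m) ∧ t ≠ j ∧ t ≠ k) ∨ (∃ t, (t = j ∨ t = k) ∧ t ≠ l ∧ t ≠ m) := by
      by_contra! hcon
      obtain ⟨h3, h4⟩ := hcon
      have a1 := h3 l (Or.inl rfl)
      have a2 := h3 m (Or.inr rfl)
      have a3 := h4 j (Or.inl rfl)
      have a4 := h4 k (Or.inr rfl)
      grind
    rcases key with ⟨t, ht, hj, hk⟩ | ⟨t, ht, hl, hm⟩
    · exact hcent l m t ht _ (hqm j k) (hqbdd j k) (hfree j k t hj hk)
    · simp_rw [mul_comm (quadTerm c ξ s j k _)]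
      exact hcent j k t ht _ (hqm l m) (hqbdd l m) (hfree l m t hl hm)
  have hprod : ∀ p q : Fin n × Fin n, Integrable
      (fun w => quadTerm c ξ s p.1 p.2 w * quadTerm c ξ s q.1 q.2 w) (sampleLaw n PX κ) := by
    intro p q
    refine hbdd ((hqm _ _).mul (hqm _ _)) ⟨C * b ^ 2 * (C * b ^ 2), fun w => ?_⟩
    rw [abs_mul]
    exact mul_le_mul (hqb _ _ w) (hqb _ _ w) (abs_nonneg _) ((abs_nonneg _).trans (hqb p.1 p.2 w))
  have hsqi : ∀ p : Fin n × Fin n, Integrable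
      (fun w => quadTerm c ξ s p.1 p.2 w ^ 2) (sampleLaw n PX κ) := fun p => by
    simpa [sq] using hprod p p
  have hexp : ∫ w, (∑ j, ∑ k, quadTerm c ξ s j k w) ^ 2 ∂sampleLaw n PX κ =
      ∑ p : Fin n × Fin n, ∑ q : Fin n × Fin n,
        ∫ w, quadTerm c ξ s p.1 p.2 w * quadTerm c ξ s q.1 q.2 w ∂sampleLaw n PX κ := by
    simp_rw [← Fintype.sum_prod_type' (fun j k => quadTerm c ξ s j k _), sq, Finset.sum_mul_sum]
    rw [integral_finsetSum _ fun p _ => integrable_finsetSum _ fun q _ => hprod p q]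
    exact Finset.sum_congr rfl fun p _ => integral_finsetSum _ fun q _ => hprod p q
  rw [hexp]
  -- In the row of `p` only `p` and its transpose survive; the mixed product is bounded by the
  -- average of the two squares.
  have hrow : ∀ p : Fin n × Fin n, ∑ q : Fin n × Fin n,
      ∫ w, quadTerm c ξ s p.1 p.2 w * quadTerm c ξ s q.1 q.2 w ∂sampleLaw n PX κ ≤
      (∫ w, quadTerm c ξ s p.1 p.2 w ^ 2 ∂sampleLaw n PX κ) +
        ((∫ w, quadTerm c ξ s p.1 p.2 w ^ 2 ∂sampleLaw n PX κ) +
          ∫ w, quadTerm c ξ s p.2 p.1 w ^ 2 ∂sampleLaw n PX κ) / 2 := by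
    intro p
    have hsw : ∫ w, quadTerm c ξ s p.1 p.2 w * quadTerm c ξ s p.2 p.1 w ∂sampleLaw n PX κ ≤
        ((∫ w, quadTerm c ξ s p.1 p.2 w ^ 2 ∂sampleLaw n PX κ) +
          ∫ w, quadTerm c ξ s p.2 p.1 w ^ 2 ∂sampleLaw n PX κ) / 2 := by
      have hsq' : Integrable (fun w => quadTerm c ξ s p.2 p.1 w ^ 2) (sampleLaw n PX κ) :=
        hsqi p.swap
      rw [← integral_add (hsqi p) hsq', ← integral_div]
      refine integral_mono (hprod p p.swap) (((hsqi p).add hsq').div_const 2) fun w => ?_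
      nlinarith [sq_nonneg (quadTerm c ξ s p.1 p.2 w - quadTerm c ξ s p.2 p.1 w)]
    have hsub : ∑ q : Fin n × Fin n,
        ∫ w, quadTerm c ξ s p.1 p.2 w * quadTerm c ξ s q.1 q.2 w ∂sampleLaw n PX κ =
        ∑ q ∈ ({p, p.swap} : Finset (Fin n × Fin n)),
        ∫ w, quadTerm c ξ s p.1 p.2 w * quadTerm c ξ s q.1 q.2 w ∂sampleLaw n PX κ := by
      symm
      refine Finset.sum_subset (Finset.subset_univ _) fun q _ hq => ?_
      simp only [Finset.mem_insert, Finset.mem_singleton, not_or] at hq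
      exact horth p q hq.1 hq.2
    rw [hsub]
    by_cases hpp : p = p.swap
    · rw [← hpp]
      simp only [Finset.insert_eq_of_mem, Finset.mem_singleton, Finset.sum_singleton]
      have h0 : 0 ≤ ∫ w, quadTerm c ξ s p.1 p.2 w ^ 2 ∂sampleLaw n PX κ :=
        integral_nonneg fun _ => sq_nonneg _
      have h1 : 0 ≤ ∫ w, quadTerm c ξ s p.2 p.1 w ^ 2 ∂sampleLaw n PX κ :=
        integral_nonneg fun _ => sq_nonneg _
      simp_rw [← sq]
      linarith
    · rw [Finset.sum_pair hpp]
      simp_rw [← sq]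
      gcongr
      exact hsw
  refine (Finset.sum_le_sum fun p _ => hrow p).trans ?_
  have hswap : ∑ p : Fin n × Fin n, ∫ w, quadTerm c ξ s p.2 p.1 w ^ 2 ∂sampleLaw n PX κ =
      ∑ p : Fin n × Fin n, ∫ w, quadTerm c ξ s p.1 p.2 w ^ 2 ∂sampleLaw n PX κ :=
    Equiv.sum_comp (Equiv.prodComm (Fin n) (Fin n))
      (fun p => ∫ w, quadTerm c ξ s p.1 p.2 w ^ 2 ∂sampleLaw n PX κ)
  rw [Finset.sum_add_distrib, ← Finset.sum_div, Finset.sum_add_distrib, hswap]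
  have hterm : ∀ p : Fin n × Fin n, ∫ w, quadTerm c ξ s p.1 p.2 w ^ 2 ∂sampleLaw n PX κ ≤
      b ^ 4 * ∫ w, c p.1 p.2 (fun i => (w i).1) ^ 2 ∂sampleLaw n PX κ := by
    intro p
    rw [← integral_const_mul]
    have hci : Integrable (fun w : Fin n → ℝ × U => c p.1 p.2 (fun i => (w i).1) ^ 2)
        (sampleLaw n PX κ) := by
      refine hbdd (((hc p.1 p.2).comp (by fun_prop)).pow_const 2) ⟨C ^ 2, fun w => ?_⟩
      rw [abs_of_nonneg (sq_nonneg _)]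
      exact sq_le_sq' (abs_le.1 (hC _ _ _)).1 (abs_le.1 (hC _ _ _)).2
    refine integral_mono (hsqi p) (hci.const_mul _) fun w => ?_
    simp only [quadTerm, mul_pow]
    rw [mul_comm]
    have h1 := hfac p.1 p.2 w
    have h2 : (ξ (w p.1) * ξ (w p.2) - if p.1 = p.2 then s (w p.1).1 else 0) ^ 2 ≤ (b ^ 2) ^ 2 :=
      sq_le_sq' (abs_le.1 h1).1 (abs_le.1 h1).2
    calc _ ≤ (b ^ 2) ^ 2 * c p.1 p.2 (fun i => (w i).1) ^ 2 :=
          mul_le_mul_of_nonneg_right h2 (sq_nonneg _)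
      _ = _ := by ring
  have hfin : ∫ w, ∑ j, ∑ k, c j k (fun i => (w i).1) ^ 2 ∂sampleLaw n PX κ =
      ∑ p : Fin n × Fin n, ∫ w, c p.1 p.2 (fun i => (w i).1) ^ 2 ∂sampleLaw n PX κ := by
    simp_rw [← Fintype.sum_prod_type' (fun j k => c j k _ ^ 2)]
    refine integral_finsetSum _ fun p _ => ?_
    refine hbdd (((hc p.1 p.2).comp (by fun_prop)).pow_const 2) ⟨C ^ 2, fun w => ?_⟩
    rw [abs_of_nonneg (sq_nonneg _)]
    exact sq_le_sq' (abs_le.1 (hC _ _ _)).1 (abs_le.1 (hC _ _ _)).2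
  rw [hfin, mul_assoc, Finset.mul_sum]
  have := Finset.sum_le_sum fun p (_ : p ∈ Finset.univ) => hterm p
  linarith

end Sample

/-! ### Empirical functionals -/

section NoiseFun

variable {n : ℕ}

/-- The `m`-th of `2^L` cells of `[-T, T)`. -/
def cell (T : ℝ) (L m : ℕ) : Set ℝ :=
  Set.Ico (-T + m * (2 * T / 2 ^ L)) (-T + (m + 1 : ℕ) * (2 * T / 2 ^ L))

theorem measurableSet_cell (T : ℝ) (L m : ℕ) : MeasurableSet (cell T L m) := measurableSet_Ico

/-- `φ ↦ ∑ e_i φ(x_i) - c ∫ φ`. -/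
noncomputable def noiseFun (PX : Measure ℝ) (x e : Fin n → ℝ) (c : ℝ) (φ : ℝ → ℝ) : ℝ :=
  ∑ i, e i * φ (x i) - c * ∫ t, φ t ∂PX

variable {PX : Measure ℝ} {x e : Fin n → ℝ} {c : ℝ}

theorem noiseFun_add {φ ψ : ℝ → ℝ} (hφ : Integrable φ PX) (hψ : Integrable ψ PX) :
    noiseFun PX x e c (fun t => φ t + ψ t) = noiseFun PX x e c φ + noiseFun PX x e c ψ := by
  simp only [noiseFun, integral_add hφ hψ, mul_add, Finset.sum_add_distrib]; ring

theorem noiseFun_sub {φ ψ : ℝ → ℝ} (hφ : Integrable φ PX) (hψ : Integrable ψ PX) :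
    noiseFun PX x e c (fun t => φ t - ψ t) = noiseFun PX x e c φ - noiseFun PX x e c ψ := by
  simp only [noiseFun, integral_sub hφ hψ, mul_sub, Finset.sum_sub_distrib]; ring

theorem noiseFun_const_mul (a : ℝ) (φ : ℝ → ℝ) :
    noiseFun PX x e c (fun t => a * φ t) = a * noiseFun PX x e c φ := by
  simp only [noiseFun, integral_const_mul, mul_sub, Finset.mul_sum]
  congr 1
  · exact Finset.sum_congr rfl fun i _ => by ring
  · ring

theorem noiseFun_sum {ι : Type*} (t : Finset ι) {φ : ι → ℝ → ℝ}
    (hφ : ∀ k ∈ t, Integrable (φ k) PX) :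
    noiseFun PX x e c (fun y => ∑ k ∈ t, φ k y) = ∑ k ∈ t, noiseFun PX x e c (φ k) := by
  simp only [noiseFun, integral_finsetSum t hφ, Finset.mul_sum, Finset.sum_sub_distrib]
  rw [Finset.sum_comm]

/-! ### Dyadic cells -/

/-- The sum of squares of the functional over the dyadic cells of one level. -/
noncomputable def cellSq (PX : Measure ℝ) (x e : Fin n → ℝ) (c T : ℝ) (L : ℕ) : ℝ :=
  ∑ m ∈ Finset.range (2 ^ L), noiseFun PX x e c ((cell T L m).indicator fun _ => 1) ^ 2

theorem cellSq_nonneg (PX : Measure ℝ) (x e : Fin n → ℝ) (c T : ℝ) (L : ℕ) :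
    0 ≤ cellSq PX x e c T L := Finset.sum_nonneg fun _ _ => sq_nonneg _

theorem abs_noiseFun_cell_le {T : ℝ} {L m : ℕ} (hm : m < 2 ^ L) :
    |noiseFun PX x e c ((cell T L m).indicator fun _ => 1)| ≤ √(cellSq PX x e c T L) := by
  rw [← Real.sqrt_sq_eq_abs]
  refine Real.sqrt_le_sqrt ?_
  exact Finset.single_le_sum
    (f := fun m => noiseFun PX x e c ((cell T L m).indicator fun _ => 1) ^ 2)
    (fun _ _ => sq_nonneg _) (Finset.mem_range.2 hm)

variable [IsProbabilityMeasure PX]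

theorem integrable_of_abs_le {φ : ℝ → ℝ} (hφ : Measurable φ) {B : ℝ} (hB : ∀ t, |φ t| ≤ B) :
    Integrable φ PX :=
  Integrable.of_bound hφ.aestronglyMeasurable B (Eventually.of_forall fun t => by simpa using hB t)

/-- A crude bound, meant for approximation errors that can be made arbitrarily small for a fixed
sample. -/
theorem abs_noiseFun_le {φ : ℝ → ℝ} {B : ℝ} (hB : ∀ t, |φ t| ≤ B) :
    |noiseFun PX x e c φ| ≤ (∑ i, |e i| + |c|) * B := by
  have h1 : |∑ i, e i * φ (x i)| ≤ (∑ i, |e i|) * B := by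
    refine (Finset.abs_sum_le_sum_abs _ _).trans ?_
    rw [Finset.sum_mul]
    refine Finset.sum_le_sum fun i _ => ?_
    rw [abs_mul]
    exact mul_le_mul_of_nonneg_left (hB _) (abs_nonneg _)
  have h2 : |∫ t, φ t ∂PX| ≤ B := by
    have := norm_integral_le_of_norm_le_const (μ := PX) (f := φ) (C := B)
      (Eventually.of_forall fun t => by simpa using hB t)
    simpa using this
  calc |noiseFun PX x e c φ| ≤ |∑ i, e i * φ (x i)| + |c * ∫ t, φ t ∂PX| := abs_sub _ _
    _ ≤ (∑ i, |e i|) * B + |c| * B := by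
      rw [abs_mul c]
      gcongr
    _ = _ := by ring

theorem noiseFun_union {s t : Set ℝ} (hs : MeasurableSet s) (ht : MeasurableSet t)
    (hst : Disjoint s t) :
    noiseFun PX x e c ((s ∪ t).indicator fun _ => 1) =
      noiseFun PX x e c (s.indicator fun _ => 1) + noiseFun PX x e c (t.indicator fun _ => 1) := by
  rw [Set.indicator_union_of_disjoint hst, noiseFun_add]
  · exact (integrable_const 1).indicator hs
  · exact (integrable_const 1).indicator ht

theorem noiseFun_diff {s t : Set ℝ} (hs : MeasurableSet s) (ht : MeasurableSet t) (hst : s ⊆ t) :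
    noiseFun PX x e c ((t \ s).indicator fun _ => 1) =
      noiseFun PX x e c (t.indicator fun _ => 1) - noiseFun PX x e c (s.indicator fun _ => 1) := by
  have := noiseFun_union (PX := PX) (x := x) (e := e) (c := c) hs (ht.diff hs)
    Set.disjoint_sdiff_right
  rw [Set.union_sdiff_cancel hst] at this
  linarith

/-- Bounds on intervals extend to layered functions. -/
theorem abs_noiseFun_layered_le {M : ℝ} {G : ℝ → ℝ} (hG : IsLayered M G) {h : ℝ} (hh : 0 < h)
    {I : Set ℝ} (hI : Set.Icc (-h) h ⊆ I) {S : ℝ}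
    (hS : ∀ J ⊆ I, J.OrdConnected → |noiseFun PX x e c (J.indicator fun _ => 1)| ≤ S) :
    |noiseFun PX x e c fun t => G (t / h)| ≤ M * S := by
  have hM : 0 ≤ M := (hG.nonneg 0).trans (hG.le 0)
  have hGm : Measurable fun t => G (t / h) := hG.measurable.comp (measurable_id.div_const h)
  have hGi : Integrable (fun t => G (t / h)) PX := by
    refine integrable_of_abs_le hGm (B := M) fun t => ?_
    rw [abs_of_nonneg (hG.nonneg _)]; exact hG.le _
  -- Each of the `N + 1` steps has height `M / (N + 1)` and lives on an interval, so together they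
  -- contribute at most `M * S`. The approximation error carries a factor that depends on the data
  -- only, so it disappears as `N` grows with the sample held fixed.
  have key : ∀ N : ℕ, |noiseFun PX x e c fun t => G (t / h)| ≤
      M * S + (∑ i, |e i| + |c|) * (M / ((N + 1 : ℕ) : ℝ)) := by
    intro N
    set a := M / ((N + 1 : ℕ) : ℝ) with ha
    have ha0 : 0 ≤ a := by positivity
    let J : ℕ → Set ℝ := fun k => {t | a * ((k : ℝ) + 1) ≤ G (t / h)}
    let st : ℝ → ℝ := fun t => a * ∑ k ∈ Finset.range (N + 1), (J k).indicator (fun _ => (1 : ℝ)) t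
    have hJm : ∀ k, MeasurableSet (J k) := fun k => measurableSet_le measurable_const hGm
    have hst : |noiseFun PX x e c st| ≤ M * S := by
      have h1 : noiseFun PX x e c st =
          a * ∑ k ∈ Finset.range (N + 1), noiseFun PX x e c ((J k).indicator fun _ => 1) := by
        simp only [st]
        rw [noiseFun_const_mul, noiseFun_sum]
        exact fun k _ => (integrable_const 1).indicator (hJm k)
      have h2 : ∀ k ∈ Finset.range (N + 1),
          a * |noiseFun PX x e c ((J k).indicator fun _ => 1)| ≤ a * S := by
        intro k _
        rcases eq_or_lt_of_le ha0 with h0 | h0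
        · simp [← h0]
        · refine mul_le_mul_of_nonneg_left (hS _ ?_ ?_) ha0
          · intro t ht
            apply hI
            by_contra hcon
            have h3 : G (t / h) = 0 := hG.eq_zero _ fun h4 => hcon <| by
              have h5 := h4.1; have h6 := h4.2
              rw [le_div_iff₀ hh] at h5
              rw [div_le_iff₀ hh] at h6
              exact ⟨by linarith, by linarith⟩
            have h4 : a * ((k : ℝ) + 1) ≤ G (t / h) := ht
            rw [h3] at h4
            have : 0 < a * ((k : ℝ) + 1) := by positivity
            linarith
          · have h3 := hG.ordConnected (a * ((k : ℝ) + 1)) (by positivity)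
            refine ⟨fun y hy z hz t ht => ?_⟩
            exact h3.out hy hz ⟨div_le_div_of_nonneg_right ht.1 hh.le,
              div_le_div_of_nonneg_right ht.2 hh.le⟩
      rw [h1, abs_mul, abs_of_nonneg ha0]
      calc a * |∑ k ∈ Finset.range (N + 1), noiseFun PX x e c ((J k).indicator fun _ => 1)|
          ≤ a * ∑ k ∈ Finset.range (N + 1), |noiseFun PX x e c ((J k).indicator fun _ => 1)| := by
            gcongr; exact Finset.abs_sum_le_sum_abs _ _
        _ ≤ ∑ k ∈ Finset.range (N + 1), a * S := by
            rw [Finset.mul_sum]; exact Finset.sum_le_sum h2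
        _ = M * S := by
            rw [Finset.sum_const, Finset.card_range, nsmul_eq_mul, ha]
            field_simp
    have hsti : Integrable st PX :=
      (integrable_finsetSum _ fun k _ => (integrable_const 1).indicator (hJm k)).const_mul a
    have hdiff : |noiseFun PX x e c fun t => G (t / h) - st t| ≤ (∑ i, |e i| + |c|) * a := by
      refine abs_noiseFun_le fun t => ?_
      have := hG.abs_sub_steps_le (N := N + 1) (by omega) (t / h)
      exact this
    rw [noiseFun_sub hGi hsti] at hdiff
    have := abs_sub_abs_le_abs_sub (noiseFun PX x e c fun t => G (t / h)) (noiseFun PX x e c st)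
    linarith
  have hlim : Tendsto (fun N : ℕ => M * S + (∑ i, |e i| + |c|) * (M / ((N + 1 : ℕ) : ℝ))) atTop
      (𝓝 (M * S + (∑ i, |e i| + |c|) * 0)) := by
    refine tendsto_const_nhds.add (tendsto_const_nhds.mul ?_)
    exact (tendsto_const_div_atTop_nhds_zero_nat M).comp (tendsto_add_atTop_nat 1)
  have := ge_of_tendsto' hlim key
  simpa using this

/-- A maximal inequality of Rademacher–Menshov type. -/
theorem abs_noiseFun_grid_le {T : ℝ} (hT : 0 < T) (L k : ℕ) (hk : k ≤ 2 ^ L) :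
    |noiseFun PX x e c ((Set.Ico (-T) (-T + k * (2 * T / 2 ^ L))).indicator fun _ => 1)| ≤
      ∑ l ∈ Finset.range (L + 1), √(cellSq PX x e c T l) := by
  induction L generalizing k with
  | zero =>
    simp only [zero_add, Finset.range_one, Finset.sum_singleton]
    rcases Nat.eq_zero_or_pos k with rfl | h
    · simp [noiseFun]
    · obtain rfl : k = 1 := by simp at hk; omega
      have := abs_noiseFun_cell_le (PX := PX) (x := x) (e := e) (c := c) (T := T) (L := 0) (m := 0)
        (by simp)
      simpa [cell] using this
  | succ L ih =>
    rw [Finset.sum_range_succ]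
    have hw : ∀ k' : ℕ, -T + ((2 * k' : ℕ) : ℝ) * (2 * T / 2 ^ (L + 1)) =
        -T + k' * (2 * T / 2 ^ L) := by
      intro k'
      push_cast
      rw [pow_succ]
      field_simp
    -- An even grid point already belongs to the coarser grid; an odd one needs a single further
    -- cell of the current level. Each level thus contributes at most one cell.
    rcases Nat.even_or_odd' k with ⟨k', rfl | rfl⟩
    · rw [hw]
      have := ih k' (by rw [pow_succ] at hk; omega)
      exact this.trans (le_add_of_nonneg_right (Real.sqrt_nonneg _))
    · have hsplit : Set.Ico (-T) (-T + ((2 * k' + 1 : ℕ) : ℝ) * (2 * T / 2 ^ (L + 1))) =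
          Set.Ico (-T) (-T + k' * (2 * T / 2 ^ L)) ∪ cell T (L + 1) (2 * k') := by
        rw [cell, hw, Set.Ico_union_Ico_eq_Ico]
        · have : (0 : ℝ) ≤ k' * (2 * T / 2 ^ L) := by positivity
          linarith
        · rw [← hw]
          push_cast
          have : (0 : ℝ) ≤ 2 * T / 2 ^ (L + 1) := by positivity
          linarith
      rw [hsplit, noiseFun_union measurableSet_Ico (measurableSet_cell _ _ _)]
      · refine (abs_add_le _ _).trans (add_le_add (ih k' ?_) (abs_noiseFun_cell_le ?_))
        · rw [pow_succ] at hk; omega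
        · omega
      · rw [cell, hw]
        rw [Set.disjoint_left]
        intro t h1 h2
        exact absurd h1.2 (not_lt.2 h2.1)

/-- With at most one observation in the cell, the sum over `J` has at most one term, which is below
the root of the sum of all squares over `I`. The mass of the cell bounds the integral. -/
theorem abs_noiseFun_subset_cell_le {T : ℝ} {L m : ℕ} {J I : Set ℝ} (hJ : J ⊆ cell T L m)
    (hJI : J ⊆ I) (hsep : ∀ i j, x i ∈ cell T L m → x j ∈ cell T L m → i = j) :
    |noiseFun PX x e c (J.indicator fun _ => 1)| ≤
      √(∑ i, e i ^ 2 * I.indicator (fun _ => 1) (x i)) + |c| * PX.real (cell T L m) := by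
  have h1 : |∑ i, e i * J.indicator (fun _ => (1 : ℝ)) (x i)| ≤
      √(∑ i, e i ^ 2 * I.indicator (fun _ => 1) (x i)) := by
    have hnn : ∀ i ∈ Finset.univ, 0 ≤ e i ^ 2 * I.indicator (fun _ => (1 : ℝ)) (x i) := fun i _ =>
      mul_nonneg (sq_nonneg _) (Set.indicator_nonneg (fun _ _ => zero_le_one) _)
    by_cases hex : ∃ i, x i ∈ J
    · obtain ⟨i, hi⟩ := hex
      rw [Finset.sum_eq_single i]
      · rw [Set.indicator_of_mem hi, mul_one, ← Real.sqrt_sq_eq_abs]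
        refine Real.sqrt_le_sqrt ?_
        refine le_trans ?_ (Finset.single_le_sum hnn (Finset.mem_univ i))
        rw [Set.indicator_of_mem (hJI hi), mul_one]
      · intro j _ hji
        rw [Set.indicator_of_notMem, mul_zero]
        exact fun hj => hji (hsep j i (hJ hj) (hJ hi))
      · simp
    · push Not at hex
      rw [Finset.sum_eq_zero fun i _ => by rw [Set.indicator_of_notMem (hex i), mul_zero]]
      simp
  have h2 : |∫ t, J.indicator (fun _ => (1 : ℝ)) t ∂PX| ≤ PX.real (cell T L m) := by
    -- `J` need not be measurable; if its indicator is not integrable, the integral is zero by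
    -- convention.
    by_cases hJi : Integrable (J.indicator fun _ => (1 : ℝ)) PX
    · rw [abs_of_nonneg (integral_nonneg fun t => Set.indicator_nonneg (fun _ _ => zero_le_one) t),
        ← integral_indicator_one (s := cell T L m) measurableSet_Ico]
      refine integral_mono hJi ((integrable_const 1).indicator measurableSet_Ico) fun t => ?_
      exact Set.indicator_le_indicator_of_subset hJ (fun _ => zero_le_one) t
    · rw [integral_undef hJi, abs_zero]
      exact measureReal_nonneg
  calc _ ≤ |∑ i, e i * J.indicator (fun _ => (1 : ℝ)) (x i)| +
        |c * ∫ t, J.indicator (fun _ => (1 : ℝ)) t ∂PX| := abs_sub _ _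
    _ ≤ _ := by
      rw [abs_mul c]
      gcongr

/-- A bound for the functional on all intervals in `[-T, T)`. -/
theorem abs_noiseFun_interval_le {T : ℝ} (hT : 0 < T) (L : ℕ)
    (hsep : ∀ m < 2 ^ L, ∀ i j, x i ∈ cell T L m → x j ∈ cell T L m → i = j) {q : ℝ}
    (hq : ∀ m < 2 ^ L, PX.real (cell T L m) ≤ q) {J : Set ℝ} (hJ : J ⊆ Set.Ico (-T) T)
    (hJo : J.OrdConnected) :
    |noiseFun PX x e c (J.indicator fun _ => 1)| ≤
      2 * (∑ l ∈ Finset.range (L + 1), √(cellSq PX x e c T l) +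
        √(∑ i, e i ^ 2 * (Set.Ico (-T) T).indicator (fun _ => 1) (x i)) + |c| * q) := by
  set I := Set.Ico (-T) T
  -- initial segments
  have key : ∀ D : Set ℝ, MeasurableSet D → D ⊆ I → (∀ t ∈ D, ∀ y ∈ I, y ≤ t → y ∈ D) →
      |noiseFun PX x e c (D.indicator fun _ => 1)| ≤
      ∑ l ∈ Finset.range (L + 1), √(cellSq PX x e c T l) +
        √(∑ i, e i ^ 2 * I.indicator (fun _ => 1) (x i)) + |c| * q := by
    intro D hDm hD hlow
    set w := 2 * T / 2 ^ L with hw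
    have hw0 : 0 < w := by positivity
    have hfull : -T + ((2 ^ L : ℕ) : ℝ) * w = T := by
      rw [hw]; push_cast; field_simp; ring
    have hq0 : 0 ≤ |c| * q :=
      mul_nonneg (abs_nonneg _) (measureReal_nonneg.trans (hq 0 (by positivity)))
    have hV0 := Real.sqrt_nonneg (∑ i, e i ^ 2 * I.indicator (fun _ => (1 : ℝ)) (x i))
    classical
    -- the largest grid segment inside
    let p : ℕ → Prop := fun k => k ≤ 2 ^ L ∧ Set.Ico (-T) (-T + k * w) ⊆ D
    have hp0 : p 0 := ⟨by positivity, by simp⟩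
    set k := Nat.findGreatest p (2 ^ L) with hk
    have hpk : p k := Nat.findGreatest_spec (Nat.zero_le _) hp0
    rcases eq_or_lt_of_le hpk.1 with hkL | hkL
    · have hDI : D = Set.Ico (-T) (-T + k * w) := by
        refine Set.Subset.antisymm (fun t ht => ?_) hpk.2
        have := hD ht
        rw [hkL, hfull]
        exact this
      rw [hDI]
      have := abs_noiseFun_grid_le (PX := PX) (x := x) (e := e) (c := c) hT L k hpk.1
      linarith
    · have hnp : ¬ p (k + 1) := Nat.findGreatest_is_greatest (Nat.lt_succ_self k) hkL
      -- The next grid segment contains a point outside `D`. As `D` is closed downwards in `I`, it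
      -- stays below that point, so beyond the last full segment only part of one cell remains.
      have hex : ∃ y ∈ Set.Ico (-T) (-T + (k + 1 : ℕ) * w), y ∉ D := by
        by_contra! hcon
        exact hnp ⟨hkL, hcon⟩
      obtain ⟨y, hy, hyD⟩ := hex
      have hle : -T + ((k + 1 : ℕ) : ℝ) * w ≤ T := by
        have h1 : ((k + 1 : ℕ) : ℝ) ≤ ((2 ^ L : ℕ) : ℝ) := by exact_mod_cast hkL
        have h2 := mul_le_mul_of_nonneg_right h1 hw0.le
        linarith
      have hsplit : D = Set.Ico (-T) (-T + k * w) ∪ (D ∩ cell T L k) := by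
        refine Set.Subset.antisymm (fun t ht => ?_)
          (Set.union_subset hpk.2 Set.inter_subset_left)
        by_cases htk : t < -T + k * w
        · exact Or.inl ⟨(hD ht).1, htk⟩
        · refine Or.inr ⟨ht, not_lt.1 htk, ?_⟩
          by_contra hcon
          rw [not_lt] at hcon
          exact hyD (hlow t ht y ⟨hy.1, hy.2.trans_le hle⟩ (hy.2.le.trans hcon))
      rw [hsplit, noiseFun_union measurableSet_Ico (hDm.inter (measurableSet_cell _ _ _))]
      · have h1 := abs_noiseFun_grid_le (PX := PX) (x := x) (e := e) (c := c) hT L k hpk.1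
        have h2 := abs_noiseFun_subset_cell_le (PX := PX) (x := x) (e := e) (c := c)
          (J := D ∩ cell T L k) (I := I) Set.inter_subset_right
          (Set.inter_subset_left.trans hD) (hsep k hkL)
        have h3 : |c| * PX.real (cell T L k) ≤ |c| * q :=
          mul_le_mul_of_nonneg_left (hq k hkL) (abs_nonneg _)
        refine (abs_add_le _ _).trans ?_
        linarith
      · rw [Set.disjoint_left]
        intro t h1 h2
        exact absurd h1.2 (not_lt.2 h2.2.1)
  -- An interval is its downward closure minus a smaller initial segment. Bounding both segments
  -- gives the factor two.
  set D₁ : Set ℝ := {t ∈ I | ∃ y ∈ J, t ≤ y} with hD₁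
  have hD₁o : D₁.OrdConnected := by
    refine ⟨fun a ha b hb t ht => ⟨⟨ha.1.1.trans ht.1, ht.2.trans_lt hb.1.2⟩, ?_⟩⟩
    obtain ⟨y, hy, hby⟩ := hb.2
    exact ⟨y, hy, ht.2.trans hby⟩
  have hJD : J ⊆ D₁ := fun t ht => ⟨hJ ht, t, ht, le_rfl⟩
  have h1 := key D₁ hD₁o.measurableSet (fun t ht => ht.1) fun t ht y hy hyt => by
    obtain ⟨z, hz, htz⟩ := ht.2
    exact ⟨hy, z, hz, hyt.trans htz⟩
  have h2 := key (D₁ \ J) (hD₁o.measurableSet.diff hJo.measurableSet) (fun t ht => ht.1.1)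
    fun t ht y hy hyt => by
      obtain ⟨z, hz, htz⟩ := ht.1.2
      refine ⟨⟨hy, z, hz, hyt.trans htz⟩, fun hyJ => ht.2 (hJo.out hyJ hz ⟨hyt, htz⟩)⟩
  have h3 := noiseFun_diff (PX := PX) (x := x) (e := e) (c := c) hJo.measurableSet
    hD₁o.measurableSet hJD
  rw [h3] at h2
  have h4 := abs_sub_abs_le_abs_sub (noiseFun PX x e c (J.indicator fun _ => 1))
    (noiseFun PX x e c (D₁.indicator fun _ => 1))
  rw [abs_sub_comm] at h4
  linarith

end NoiseFun

/-! ### Noise functionals are negligible after localization -/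

/-- `PX` has a density bounded by `D` on `[-ρ, ρ]`. -/
structure HasDensityBound (PX : Measure ℝ) (ρ D : ℝ) : Prop where
  pos : 0 < ρ
  nonneg : 0 ≤ D
  le : ∀ s, MeasurableSet s → s ⊆ Set.Icc (-ρ) ρ → PX s ≤ ENNReal.ofReal D * volume s

theorem HasDensityBound.real_Icc_le {PX : Measure ℝ} {ρ D : ℝ} (h : HasDensityBound PX ρ D)
    {a b : ℝ} (ha : -ρ ≤ a) (hb : b ≤ ρ) (hab : a ≤ b) : PX.real (Set.Icc a b) ≤ D * (b - a) := by
  have := h.le (Set.Icc a b) measurableSet_Icc (Set.Icc_subset_Icc ha hb)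
  rw [Real.volume_Icc, ← ENNReal.ofReal_mul h.nonneg] at this
  exact ENNReal.toReal_le_of_le_ofReal (mul_nonneg h.nonneg (by linarith)) this

section Noise

universe u

variable {Ω : ℕ → Type u} [∀ n, MeasurableSpace (Ω n)]

/-- A functional `∑ e_i φ(X_i) - c ∫ φ` whose second moments are of the order of a sum of `n`
uncorrelated summands. -/
structure IsNoise (P : ∀ n, Measure (Ω n)) (X : ∀ n, Ω n → Fin n → ℝ) (PX : Measure ℝ) (A : ℝ)
    (e : ∀ n, Ω n → Fin n → ℝ) (c : ∀ n, Ω n → ℝ) : Prop where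
  nonneg : 0 ≤ A
  measurable : ∀ n i, Measurable fun ω => e n ω i
  meas_const : ∀ n, Measurable (c n)
  abs_const_le : ∀ n ω, |c n ω| ≤ n
  sq : ∀ᶠ n in atTop, ∀ φ : ℝ → ℝ, Measurable φ → (∃ B, ∀ t, |φ t| ≤ B) →
    ∫⁻ ω, ENNReal.ofReal (noiseFun PX (X n ω) (e n ω) (c n ω) φ ^ 2) ∂P n ≤
      ENNReal.ofReal (A * n * ∫ t, φ t ^ 2 ∂PX)
  diag : ∀ᶠ n in atTop, ∀ φ : ℝ → ℝ, Measurable φ → (∃ B, ∀ t, |φ t| ≤ B) →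
    ∫⁻ ω, ENNReal.ofReal (∑ i, e n ω i ^ 2 * φ (X n ω i) ^ 2) ∂P n ≤
      ENNReal.ofReal (A * n * ∫ t, φ t ^ 2 ∂PX)

variable {P : ∀ n, Measure (Ω n)} {X : ∀ n, Ω n → Fin n → ℝ} {PX : Measure ℝ}
  [IsProbabilityMeasure PX] {A : ℝ} {e : ∀ n, Ω n → Fin n → ℝ} {c : ∀ n, Ω n → ℝ}

theorem IsNoise.measurable_noiseFun (hN : IsNoise P X PX A e c) (hX : ∀ n i, Measurable fun ω => X n ω i)
    {n : ℕ} {φ : ℝ → ℝ} (hφ : Measurable φ) :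
    Measurable fun ω => noiseFun PX (X n ω) (e n ω) (c n ω) φ := by
  have h1 := hN.measurable n
  have h2 := hN.meas_const n
  have h3 := hX n
  unfold noiseFun
  fun_prop

theorem integral_window_sq_le {ρ D : ℝ} (hD : HasDensityBound PX ρ D) {B : ℝ} {f : ℝ → ℝ}
    (hf : IsWindow B f) {h : ℝ} (h0 : 0 < h) (hρ : h ≤ ρ) :
    ∫ t, f (t / h) ^ 2 ∂PX ≤ B ^ 2 * (D * (2 * h)) := by
  have h1 : ∀ t, f (t / h) ^ 2 ≤ (Set.Icc (-h) h).indicator (fun _ => B ^ 2) t := by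
    intro t
    by_cases ht : t ∈ Set.Icc (-h) h
    · rw [Set.indicator_of_mem ht]
      exact sq_le_sq' (abs_le.1 (hf.bound _)).1 (abs_le.1 (hf.bound _)).2
    · rw [Set.indicator_of_notMem ht, hf.eq_zero]
      · simp
      · rintro ⟨h2, h3⟩
        rw [le_div_iff₀ h0] at h2
        rw [div_le_iff₀ h0] at h3
        exact ht ⟨by linarith, by linarith⟩
  have hm : Measurable fun t => f (t / h) := hf.measurable.comp (measurable_id.div_const h)
  calc ∫ t, f (t / h) ^ 2 ∂PX ≤ ∫ t, (Set.Icc (-h) h).indicator (fun _ => B ^ 2) t ∂PX := by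
        refine integral_mono (integrable_of_abs_le (hm.pow_const 2) (B := B ^ 2) fun t => ?_)
          ((integrable_const _).indicator measurableSet_Icc) h1
        rw [abs_of_nonneg (sq_nonneg _)]
        exact sq_le_sq' (abs_le.1 (hf.bound _)).1 (abs_le.1 (hf.bound _)).2
    _ = B ^ 2 * PX.real (Set.Icc (-h) h) := by
        rw [integral_indicator_const _ measurableSet_Icc, smul_eq_mul, mul_comm]
    _ ≤ B ^ 2 * (D * (2 * h)) := by
        have := hD.real_Icc_le (a := -h) (b := h) (by linarith) hρ (by linarith)
        gcongr
        linarith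

/-- The localized and normalized functional. -/
noncomputable def locNoise (PX : Measure ℝ) (X : ∀ n, Ω n → Fin n → ℝ) (e : ∀ n, Ω n → Fin n → ℝ)
    (c : ∀ n, Ω n → ℝ) (f : ℝ → ℝ) (z : Σ n, Ω n × ℝ) : ℝ :=
  ((z.1 : ℝ) * z.2.2)⁻¹ * noiseFun PX (X z.1 z.2.1) (e z.1 z.2.1) (c z.1 z.2.1)
    fun t => f (t / z.2.2)

/-- At a nonrandom bandwidth Chebyshev's inequality suffices: the squared window integrates to order
`h`, so the second moment is of order `1 / (n h^(2p+1))`. -/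
theorem IsNoise.tendsto_pointwise (hN : IsNoise P X PX A e c)
    (hX : ∀ n i, Measurable fun ω => X n ω i) {ρ D : ℝ} (hD : HasDensityBound PX ρ D)
    {h : ℕ → ℝ} (hpos : ∀ᶠ n in atTop, 0 < h n) (h0 : Tendsto h atTop (𝓝 0)) {p : ℕ}
    (hrate : Tendsto (fun n : ℕ => (n : ℝ) * h n ^ (2 * p + 1)) atTop atTop)
    {B : ℝ} {f : ℝ → ℝ} (hf : IsWindow B f) :
    Tendsto (fun z => (z.2.2 ^ p)⁻¹ * locNoise PX X e c f z)
      (inProb P fun n => Set.Icc (h n) (h n)) (𝓝 0) := by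
  have hm : ∀ n, Measurable fun t => f (t / h n) := fun n =>
    hf.measurable.comp (measurable_id.div_const _)
  refine tendsto_inProb_of_lintegral_sq (fun n ω => ENNReal.ofReal
    (((h n ^ p)⁻¹ * locNoise PX X e c f ⟨n, ω, h n⟩) ^ 2)) (fun n => ?_) ?_ ?_
  · have := hN.measurable_noiseFun hX (n := n) (hm n)
    change Measurable fun ω => ENNReal.ofReal (((h n ^ p)⁻¹ * (((n : ℝ) * h n)⁻¹ *
      noiseFun PX (X n ω) (e n ω) (c n ω) fun t => f (t / h n))) ^ 2)
    exact (((this.const_mul _).const_mul _).pow_const 2).ennreal_ofReal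
  · refine eventually_inProb_of_forall (Eventually.of_forall fun n ω k hk => ?_)
    obtain rfl : k = h n := le_antisymm hk.2 hk.1
    exact le_rfl
  · have hlim : Tendsto (fun n : ℕ => ENNReal.ofReal
        (A * (B ^ 2 * D * 2) * ((n : ℝ) * h n ^ (2 * p + 1))⁻¹)) atTop (𝓝 0) := by
      rw [← ENNReal.ofReal_zero]
      refine ENNReal.tendsto_ofReal ?_
      have := hrate.inv_tendsto_atTop.const_mul (A * (B ^ 2 * D * 2))
      simpa using this
    refine tendsto_of_tendsto_of_tendsto_of_le_of_le' tendsto_const_nhds hlim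
      (Eventually.of_forall fun _ => zero_le) ?_
    filter_upwards [hN.sq, h0.eventually_le_const hD.pos, eventually_gt_atTop 0, hpos]
      with n hn hρ hn0 hh
    have hn0' : (0 : ℝ) < n := by exact_mod_cast hn0
    simp only [locNoise]
    have h1 : ∀ ω, ENNReal.ofReal (((h n ^ p)⁻¹ * (((n : ℝ) * h n)⁻¹ *
        noiseFun PX (X n ω) (e n ω) (c n ω) fun t => f (t / h n))) ^ 2) =
        ENNReal.ofReal (((h n ^ p)⁻¹ * ((n : ℝ) * h n)⁻¹) ^ 2) *
        ENNReal.ofReal ((noiseFun PX (X n ω) (e n ω) (c n ω) fun t => f (t / h n)) ^ 2) := by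
      intro ω
      rw [← ENNReal.ofReal_mul (sq_nonneg _)]
      congr 1; ring
    simp_rw [h1]
    rw [lintegral_const_mul _ ((hN.measurable_noiseFun hX (hm n)).pow_const 2).ennreal_ofReal]
    refine (mul_le_mul_right (hn _ (hm n) ⟨B, fun t => hf.bound _⟩) _).trans ?_
    rw [← ENNReal.ofReal_mul (sq_nonneg _)]
    refine ENNReal.ofReal_le_ofReal ?_
    have h2 := integral_window_sq_le hD hf hh hρ
    calc ((h n ^ p)⁻¹ * ((n : ℝ) * h n)⁻¹) ^ 2 * (A * n * ∫ t, f (t / h n) ^ 2 ∂PX)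
        ≤ ((h n ^ p)⁻¹ * ((n : ℝ) * h n)⁻¹) ^ 2 * (A * n * (B ^ 2 * (D * (2 * h n)))) := by
          have := hN.nonneg
          gcongr
      _ = _ := by
          have h3 : h n ^ (2 * p + 1) = (h n ^ p) ^ 2 * h n := by rw [pow_succ, pow_mul']
          rw [h3]
          field_simp

/-- The Cauchy–Schwarz inequality for `L + 3` summands: the levels `0` to `L` and two further terms.
-/
theorem sq_sum_sqrt_le (L : ℕ) {Z : ℕ → ℝ} (hZ : ∀ l, 0 ≤ Z l) {V q : ℝ} (hV : 0 ≤ V) :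
    (∑ l ∈ Finset.range (L + 1), √(Z l) + √V + q) ^ 2 ≤
      ((L : ℝ) + 3) * (∑ l ∈ Finset.range (L + 1), Z l + V + q ^ 2) := by
  have h1 : ∑ l ∈ Finset.range (L + 1), √(Z l) + √V + q =
      ∑ l ∈ Finset.range (L + 3), if l < L + 1 then √(Z l) else if l = L + 1 then √V else q := by
    rw [Finset.sum_range_succ _ (L + 2), Finset.sum_range_succ _ (L + 1)]
    congr 1
    · congr 1
      · exact Finset.sum_congr rfl fun l hl => by rw [if_pos (Finset.mem_range.1 hl)]
      · simp
    · simp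
  have h2 : ∑ l ∈ Finset.range (L + 1), Z l + V + q ^ 2 = ∑ l ∈ Finset.range (L + 3),
      (if l < L + 1 then √(Z l) else if l = L + 1 then √V else q) ^ 2 := by
    rw [Finset.sum_range_succ _ (L + 2), Finset.sum_range_succ _ (L + 1)]
    congr 1
    · congr 1
      · exact Finset.sum_congr rfl fun l hl => by
          rw [if_pos (Finset.mem_range.1 hl), Real.sq_sqrt (hZ l)]
      · simp [Real.sq_sqrt hV]
    · simp
  rw [h1, h2]
  have := sq_sum_le_card_mul_sum_sq (s := Finset.range (L + 3))
    (f := fun l => if l < L + 1 then √(Z l) else if l = L + 1 then √V else q)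
  simpa using this

theorem HasDensityBound.real_cell_le {ρ D : ℝ} (hD : HasDensityBound PX ρ D) {T : ℝ} (hT : 0 < T)
    (hTρ : T ≤ ρ) {L m : ℕ} (hm : m < 2 ^ L) : PX.real (cell T L m) ≤ D * (2 * T / 2 ^ L) := by
  have hw : 0 < 2 * T / 2 ^ L := by positivity
  have h1 : (((m + 1 : ℕ) : ℝ)) * (2 * T / 2 ^ L) ≤ 2 * T := by
    have : ((m + 1 : ℕ) : ℝ) ≤ 2 ^ L := by exact_mod_cast hm
    calc (((m + 1 : ℕ) : ℝ)) * (2 * T / 2 ^ L) ≤ 2 ^ L * (2 * T / 2 ^ L) := by gcongr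
      _ = 2 * T := by field_simp
  have h2 : (0 : ℝ) ≤ m * (2 * T / 2 ^ L) := by positivity
  have h3 := hD.real_Icc_le (a := -T + m * (2 * T / 2 ^ L))
    (b := -T + (m + 1 : ℕ) * (2 * T / 2 ^ L)) (by linarith) (by linarith)
    (by push_cast; nlinarith)
  refine (measureReal_mono Set.Ico_subset_Icc_self).trans (h3.trans (le_of_eq ?_))
  push_cast; ring

/-- Eventually no dyadic cell contains two observations. -/
theorem eventually_separated {ρ D : ℝ} (hD : HasDensityBound PX ρ D)
    (hpair : ∀ n (i j : Fin n), i ≠ j → ∀ s, MeasurableSet s →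
      P n {ω | X n ω i ∈ s ∧ X n ω j ∈ s} ≤ PX s ^ 2)
    {T : ℕ → ℝ} (hT : ∀ᶠ n in atTop, 0 < T n) (h0 : Tendsto T atTop (𝓝 0)) (H : ℕ → Set ℝ) :
    ∀ᶠ z in inProb P H, ∀ m < 2 ^ (3 * Nat.clog 2 z.1), ∀ i j, X z.1 z.2.1 i ∈
      cell (T z.1) (3 * Nat.clog 2 z.1) m → X z.1 z.2.1 j ∈
      cell (T z.1) (3 * Nat.clog 2 z.1) m → i = j := by
  refine eventually_inProb_of_holds (E := fun n => {ω | ∀ m < 2 ^ (3 * Nat.clog 2 n), ∀ i j,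
    X n ω i ∈ cell (T n) (3 * Nat.clog 2 n) m → X n ω j ∈ cell (T n) (3 * Nat.clog 2 n) m →
    i = j}) ?_
  have hlim : Tendsto (fun n : ℕ => ENNReal.ofReal (4 * D ^ 2 * T n ^ 2)) atTop (𝓝 0) := by
    rw [← ENNReal.ofReal_zero]
    refine ENNReal.tendsto_ofReal ?_
    have := (h0.pow 2).const_mul (4 * D ^ 2)
    simpa using this
  refine tendsto_of_tendsto_of_tendsto_of_le_of_le' tendsto_const_nhds hlim
    (Eventually.of_forall fun _ => zero_le) ?_
  filter_upwards [hT, h0.eventually_le_const hD.pos, eventually_gt_atTop 0] with n hTn hTρ hn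
  set L := 3 * Nat.clog 2 n with hL
  -- With at least `n^3` cells, the union bound over cells and pairs of units gives at most `4 D² T²
  -- · n² / 2^L`, which vanishes with `T`.
  have h2L : (n : ℝ) ^ 3 ≤ 2 ^ L := by
    have h1 : n ≤ 2 ^ Nat.clog 2 n := Nat.le_pow_clog (by norm_num) n
    rw [hL, mul_comm, pow_mul]
    have h2 : (n : ℝ) ≤ 2 ^ Nat.clog 2 n := by exact_mod_cast h1
    gcongr
  have hsub : {ω | ∀ m < 2 ^ L, ∀ i j, X n ω i ∈ cell (T n) L m → X n ω j ∈ cell (T n) L m →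
      i = j}ᶜ ⊆ ⋃ m ∈ Finset.range (2 ^ L), ⋃ p ∈ (Finset.univ : Finset (Fin n × Fin n)).filter
      (fun p => p.1 ≠ p.2), {ω | X n ω p.1 ∈ cell (T n) L m ∧ X n ω p.2 ∈ cell (T n) L m} := by
    intro ω hω
    simp only [Set.mem_compl_iff, Set.mem_ofPred_eq, not_forall] at hω
    obtain ⟨m, hm, i, j, hi, hj, hij⟩ := hω
    simp only [Set.mem_iUnion]
    exact ⟨m, Finset.mem_range.2 hm, (i, j), by simpa using hij, hi, hj⟩
  have hn' : (0 : ℝ) < n := by exact_mod_cast hn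
  have hcell : ∀ m < 2 ^ L, PX (cell (T n) L m) ≤ ENNReal.ofReal (D * (2 * T n / 2 ^ L)) := by
    intro m hm
    rw [← ofReal_measureReal]
    exact ENNReal.ofReal_le_ofReal (hD.real_cell_le hTn hTρ hm)
  calc P n _ ≤ ∑ m ∈ Finset.range (2 ^ L), ∑ p ∈ (Finset.univ : Finset (Fin n × Fin n)).filter
        (fun p => p.1 ≠ p.2), P n {ω | X n ω p.1 ∈ cell (T n) L m ∧ X n ω p.2 ∈ cell (T n) L m} := by
        refine (measure_mono hsub).trans ((measure_biUnion_finset_le _ _).trans ?_)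
        exact Finset.sum_le_sum fun m _ => measure_biUnion_finset_le _ _
    _ ≤ ∑ m ∈ Finset.range (2 ^ L), ∑ p ∈ (Finset.univ : Finset (Fin n × Fin n)).filter
        (fun p => p.1 ≠ p.2), ENNReal.ofReal (D * (2 * T n / 2 ^ L)) ^ 2 := by
        refine Finset.sum_le_sum fun m hm => Finset.sum_le_sum fun p hp => ?_
        refine (hpair n p.1 p.2 (by simpa using hp) _ (measurableSet_cell _ _ _)).trans ?_
        gcongr
        exact hcell m (Finset.mem_range.1 hm)
    _ ≤ ∑ m ∈ Finset.range (2 ^ L), ∑ p ∈ (Finset.univ : Finset (Fin n × Fin n)),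
        ENNReal.ofReal (D * (2 * T n / 2 ^ L)) ^ 2 := by
        gcongr
        exact Finset.filter_subset _ _
    _ = ENNReal.ofReal ((2 ^ L * (n * n)) * (D * (2 * T n / 2 ^ L)) ^ 2) := by
        have hD0 := hD.nonneg
        rw [Finset.sum_const, Finset.sum_const, Finset.card_range, Finset.card_univ,
          Fintype.card_prod, Fintype.card_fin, ← ENNReal.ofReal_pow (by positivity),
          nsmul_eq_mul, nsmul_eq_mul, ENNReal.ofReal_mul (by positivity),
          ENNReal.ofReal_mul (by positivity), mul_assoc]
        congr 1
        · rw [← ENNReal.ofReal_natCast]; push_cast; rfl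
        · congr 1
          rw [← ENNReal.ofReal_natCast]; push_cast; rfl
    _ ≤ ENNReal.ofReal (4 * D ^ 2 * T n ^ 2) := by
        refine ENNReal.ofReal_le_ofReal ?_
        have h1 : (2 ^ L * ((n : ℝ) * n)) * (D * (2 * T n / 2 ^ L)) ^ 2 =
            4 * D ^ 2 * T n ^ 2 * ((n : ℝ) ^ 2 / 2 ^ L) := by
          field_simp; ring
        rw [h1]
        refine mul_le_of_le_one_right (by positivity) ?_
        rw [div_le_one (by positivity)]
        have : (n : ℝ) ^ 2 ≤ (n : ℝ) ^ 3 :=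
          pow_le_pow_right₀ (by exact_mod_cast hn) (by norm_num)
        linarith

/-- Layered functions reduce all bandwidths at once to intervals in one nonrandom window `[-T, T)`,
and dyadic chaining reduces intervals to cells. The cells of each level have a total second moment
of order `n T`. The number of levels and the Cauchy–Schwarz inequality cost two factors of order
`log n`, which `hrate` absorbs. -/
theorem IsNoise.tendsto_uniform [∀ n, IsProbabilityMeasure (P n)] (hN : IsNoise P X PX A e c)
    (hX : ∀ n i, Measurable fun ω => X n ω i) {ρ D : ℝ} (hD : HasDensityBound PX ρ D)
    (hpair : ∀ n (i j : Fin n), i ≠ j → ∀ s, MeasurableSet s →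
      P n {ω | X n ω i ∈ s ∧ X n ω j ∈ s} ≤ PX s ^ 2)
    {δ : ℕ → ℝ} (hδ : ∀ᶠ n in atTop, 0 < δ n) (h0 : Tendsto δ atTop (𝓝 0)) {a b : ℝ} (ha : 0 < a)
    (hab : a ≤ b) {p : ℕ}
    (hrate : Tendsto (fun n : ℕ => ((3 * Nat.clog 2 n : ℕ) + 3 : ℝ) ^ 2 /
      ((n : ℝ) * δ n ^ (2 * p + 1))) atTop (𝓝 0))
    {f : ℝ → ℝ} (hf : ∃ M G₁ G₂, IsLayered M G₁ ∧ IsLayered M G₂ ∧ ∀ u, f u = G₁ u - G₂ u) :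
    Tendsto (fun z => (z.2.2 ^ p)⁻¹ * locNoise PX X e c f z)
      (inProb P fun n => Set.Icc (a * δ n) (b * δ n)) (𝓝 0) := by
  obtain ⟨M, G₁, G₂, hG₁, hG₂, hfG⟩ := hf
  have hb : 0 < b := ha.trans_le hab
  have hA := hN.nonneg
  have hD0 := hD.nonneg
  -- The factor two lets the half-open window contain the closed interval `[-k, k]` for every
  -- admissible `k`.
  set T : ℕ → ℝ := fun n => 2 * b * δ n with hTdef
  set L : ℕ → ℕ := fun n => 3 * Nat.clog 2 n with hLdef
  have hT0 : Tendsto T atTop (𝓝 0) := by simpa using h0.const_mul (2 * b)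
  have hTpos : ∀ᶠ n in atTop, 0 < T n := by
    filter_upwards [hδ] with n hn
    positivity
  set q : ℕ → ℝ := fun n => D * (2 * T n / 2 ^ L n) with hq
  let Z : ∀ n, Ω n → ℕ → ℝ := fun n ω l => cellSq PX (X n ω) (e n ω) (c n ω) (T n) l
  let V : ∀ n, Ω n → ℝ := fun n ω =>
    ∑ i, e n ω i ^ 2 * (Set.Ico (-T n) (T n)).indicator (fun _ => (1 : ℝ)) (X n ω i) ^ 2
  have hind : ∀ (s : Set ℝ) t, s.indicator (fun _ => (1 : ℝ)) t ^ 2 = s.indicator (fun _ => 1) t := by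
    intro s t
    by_cases ht : t ∈ s <;> simp [ht]
  -- The scaling is taken at the smallest admissible bandwidth, where it is largest. The factor `16
  -- M²` is the square of `4 M`: two layered parts, and the factor two from passing to intervals.
  let κ : ℕ → ℝ := fun n => (((a * δ n) ^ p)⁻¹ * ((n : ℝ) * (a * δ n))⁻¹) ^ 2 *
    (16 * M ^ 2 * ((L n : ℝ) + 3))
  have hκ : ∀ n, 0 ≤ κ n := fun n => by positivity
  have hZm : ∀ n l, Measurable fun ω => Z n ω l := fun n l => by
    refine Finset.measurable_fun_sum _ fun m _ => ?_
    exact (hN.measurable_noiseFun hX (measurable_const.indicator (measurableSet_cell _ _ _))).pow_const 2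
  have hVm : ∀ n, Measurable (V n) := fun n => by
    refine Finset.measurable_fun_sum _ fun i _ => ?_
    exact ((hN.measurable n i).pow_const 2).mul
      (((measurable_const.indicator measurableSet_Ico).comp (hX n i)).pow_const 2)
  have hV0 : ∀ n ω, 0 ≤ V n ω := fun n ω => Finset.sum_nonneg fun i _ => by positivity
  refine tendsto_inProb_of_lintegral_sq (fun n ω => ENNReal.ofReal (κ n) *
    (∑ l ∈ Finset.range (L n + 1), ENNReal.ofReal (Z n ω l) + ENNReal.ofReal (V n ω) +
      ENNReal.ofReal ((n * q n) ^ 2))) (fun n => ?_) ?_ ?_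
  · have h1 := hZm n
    have h2 := hVm n
    fun_prop
  · have hdet : ∀ᶠ z in inProb P fun n => Set.Icc (a * δ n) (b * δ n),
        0 < δ z.1 ∧ z.2.2 ∈ Set.Icc (a * δ z.1) (b * δ z.1) ∧ 0 < T z.1 ∧ T z.1 ≤ ρ ∧ 0 < z.1 := by
      refine eventually_inProb_of_forall ?_
      filter_upwards [hδ, hTpos, hT0.eventually_le_const hD.pos, eventually_gt_atTop 0]
        with n h1 h2 h3 h4 ω k hk using ⟨h1, hk, h2, h3, h4⟩
    filter_upwards [hdet, eventually_separated hD hpair hTpos hT0 _] with z hz hsep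
    obtain ⟨n, ω, k⟩ := z
    obtain ⟨hδn, hk, hTn, hTρ, hn⟩ := hz
    simp only at hδn hk hTn hTρ hn hsep ⊢
    have hn' : (0 : ℝ) < n := by exact_mod_cast hn
    have hk0 : 0 < k := lt_of_lt_of_le (by positivity) hk.1
    set S := 2 * (∑ l ∈ Finset.range (L n + 1), √(Z n ω l) + √(V n ω) + n * q n) with hS
    have hint : ∀ J ⊆ Set.Ico (-T n) (T n), J.OrdConnected →
        |noiseFun PX (X n ω) (e n ω) (c n ω) (J.indicator fun _ => 1)| ≤ S := by
      intro J hJ hJo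
      refine (abs_noiseFun_interval_le hTn (L n) hsep (q := q n)
        (fun m hm => hD.real_cell_le hTn hTρ hm) hJ hJo).trans ?_
      have hc := hN.abs_const_le n ω
      have hq0 : 0 ≤ q n := by positivity
      simp only [hS, V, hind]
      gcongr
    have hI : Set.Icc (-k) k ⊆ Set.Ico (-T n) (T n) := by
      intro t ht
      have h3 : k ≤ b * δ n := hk.2
      have h4 : 0 < b * δ n := by positivity
      have h5 : T n = 2 * (b * δ n) := by simp only [hTdef]; ring
      exact ⟨by linarith [ht.1], by linarith [ht.2]⟩
    have hf1 := abs_noiseFun_layered_le hG₁ hk0 hI hint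
    have hf2 := abs_noiseFun_layered_le hG₂ hk0 hI hint
    have hGi : ∀ {G : ℝ → ℝ}, IsLayered M G → Integrable (fun t => G (t / k)) PX := fun {G} hG =>
      integrable_of_abs_le (hG.measurable.comp (measurable_id.div_const k)) (B := M) fun t => by
        rw [abs_of_nonneg (hG.nonneg _)]; exact hG.le _
    have hfΛ : |noiseFun PX (X n ω) (e n ω) (c n ω) fun t => f (t / k)| ≤ 2 * M * S := by
      simp_rw [hfG]
      rw [noiseFun_sub (hGi hG₁) (hGi hG₂)]
      have := abs_sub (noiseFun PX (X n ω) (e n ω) (c n ω) fun t => G₁ (t / k))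
        (noiseFun PX (X n ω) (e n ω) (c n ω) fun t => G₂ (t / k))
      linarith
    have hsum := sq_sum_sqrt_le (L n) (Z := Z n ω) (fun l => cellSq_nonneg _ _ _ _ _ _)
      (hV0 n ω) (q := n * q n)
    rw [← ENNReal.ofReal_sum_of_nonneg fun l _ => cellSq_nonneg _ _ _ _ _ _,
      ← ENNReal.ofReal_add (Finset.sum_nonneg fun l _ => cellSq_nonneg _ _ _ _ _ _) (hV0 n ω),
      ← ENNReal.ofReal_add (add_nonneg (Finset.sum_nonneg fun l _ => cellSq_nonneg _ _ _ _ _ _)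
        (hV0 n ω)) (sq_nonneg _), ← ENNReal.ofReal_mul (hκ n)]
    refine ENNReal.ofReal_le_ofReal ?_
    have h1 : |(k ^ p)⁻¹ * locNoise PX X e c f ⟨n, ω, k⟩| ≤
        ((a * δ n) ^ p)⁻¹ * ((n : ℝ) * (a * δ n))⁻¹ * (2 * M * S) := by
      rw [locNoise, abs_mul, abs_mul, abs_of_nonneg (by positivity : 0 ≤ (k ^ p)⁻¹),
        abs_of_nonneg (by positivity : 0 ≤ ((n : ℝ) * k)⁻¹), ← mul_assoc]
      have h3 : a * δ n ≤ k := hk.1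
      have h4 : 0 < a * δ n := by positivity
      gcongr
    calc ((k ^ p)⁻¹ * locNoise PX X e c f ⟨n, ω, k⟩) ^ 2
        = |(k ^ p)⁻¹ * locNoise PX X e c f ⟨n, ω, k⟩| ^ 2 := (sq_abs _).symm
      _ ≤ (((a * δ n) ^ p)⁻¹ * ((n : ℝ) * (a * δ n))⁻¹ * (2 * M * S)) ^ 2 := by gcongr
      _ = (((a * δ n) ^ p)⁻¹ * ((n : ℝ) * (a * δ n))⁻¹) ^ 2 * (16 * M ^ 2 *
          (∑ l ∈ Finset.range (L n + 1), √(Z n ω l) + √(V n ω) + n * q n) ^ 2) := by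
          rw [hS]; ring
      _ ≤ (((a * δ n) ^ p)⁻¹ * ((n : ℝ) * (a * δ n))⁻¹) ^ 2 * (16 * M ^ 2 *
          (((L n : ℝ) + 3) * (∑ l ∈ Finset.range (L n + 1), Z n ω l + V n ω + (n * q n) ^ 2))) := by
          gcongr
      _ = _ := by simp only [κ]; ring
  · set C := 2 * b * (A * D * 2 + 4 * D ^ 2 * ρ) with hC
    have hρ0 := hD.pos
    have hlim : Tendsto (fun n : ℕ => ENNReal.ofReal
        ((16 * M ^ 2 * ((a ^ p * a) ^ 2)⁻¹ * C) * (((3 * Nat.clog 2 n : ℕ) + 3 : ℝ) ^ 2 /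
      ((n : ℝ) * δ n ^ (2 * p + 1))))) atTop (𝓝 0) := by
      rw [← ENNReal.ofReal_zero]
      refine ENNReal.tendsto_ofReal ?_
      have := hrate.const_mul (16 * M ^ 2 * ((a ^ p * a) ^ 2)⁻¹ * C)
      simpa using this
    refine tendsto_of_tendsto_of_tendsto_of_le_of_le' tendsto_const_nhds hlim
      (Eventually.of_forall fun _ => zero_le) ?_
    filter_upwards [hN.sq, hN.diag, hδ, hTpos, hT0.eventually_le_const hD.pos,
      eventually_gt_atTop 0] with n hsq hdiag hδn hTn hTρ hn
    have hn' : (0 : ℝ) < n := by exact_mod_cast hn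
    have hn1 : (1 : ℝ) ≤ n := by exact_mod_cast hn
    have hbd1 : ∀ s : Set ℝ, ∃ B, ∀ t, |s.indicator (fun _ => (1 : ℝ)) t| ≤ B := fun s =>
      ⟨1, fun t => by by_cases ht : t ∈ s <;> simp [ht]⟩
    have hintind : ∀ s, MeasurableSet s →
        ∫ t, s.indicator (fun _ => (1 : ℝ)) t ^ 2 ∂PX = PX.real s := by
      intro s hs
      simp_rw [hind]
      exact integral_indicator_one hs
    -- Halving the cells doubles their number, so the bound does not depend on the level.
    have hZl : ∀ l, ∫⁻ ω, ENNReal.ofReal (Z n ω l) ∂P n ≤ ENNReal.ofReal (A * n * (D * (2 * T n))) := by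
      intro l
      simp only [Z, cellSq]
      simp_rw [ENNReal.ofReal_sum_of_nonneg fun m _ => sq_nonneg _]
      rw [lintegral_finsetSum _ fun m _ => ((hN.measurable_noiseFun hX
        (measurable_const.indicator (measurableSet_cell _ _ _))).pow_const 2).ennreal_ofReal]
      calc _ ≤ ∑ m ∈ Finset.range (2 ^ l), ENNReal.ofReal (A * n * (D * (2 * T n / 2 ^ l))) := by
            refine Finset.sum_le_sum fun m hm => ?_
            refine (hsq _ (measurable_const.indicator (measurableSet_cell _ _ _)) (hbd1 _)).trans ?_
            rw [hintind _ (measurableSet_cell _ _ _)]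
            refine ENNReal.ofReal_le_ofReal ?_
            have := hD.real_cell_le hTn hTρ (Finset.mem_range.1 hm)
            gcongr
        _ = _ := by
            rw [Finset.sum_const, Finset.card_range, nsmul_eq_mul, ← ENNReal.ofReal_natCast,
              ← ENNReal.ofReal_mul (by positivity)]
            congr 1
            push_cast
            field_simp
    have hVl : ∫⁻ ω, ENNReal.ofReal (V n ω) ∂P n ≤ ENNReal.ofReal (A * n * (D * (2 * T n))) := by
      refine (hdiag _ (measurable_const.indicator measurableSet_Ico) (hbd1 _)).trans ?_
      rw [hintind _ measurableSet_Ico]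
      refine ENNReal.ofReal_le_ofReal ?_
      have h1 := hD.real_Icc_le (a := -T n) (b := T n) (by linarith) hTρ (by linarith)
      have h2 : PX.real (Set.Ico (-T n) (T n)) ≤ PX.real (Set.Icc (-T n) (T n)) :=
        measureReal_mono Set.Ico_subset_Icc_self
      have h3 : PX.real (Set.Ico (-T n) (T n)) ≤ D * (2 * T n) := by linarith
      gcongr
    have hqn : (n * q n) ^ 2 ≤ 4 * D ^ 2 * ρ * (n * T n) := by
      have h2L : (n : ℝ) ≤ 2 ^ L n := by
        have h1 : n ≤ 2 ^ Nat.clog 2 n := Nat.le_pow_clog (by norm_num) n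
        have h2 : n ≤ 2 ^ L n := h1.trans (Nat.pow_le_pow_right (by norm_num) (by simp [hLdef]; omega))
        exact_mod_cast h2
      have h3 : n * q n ≤ 2 * D * T n := by
        have : n * q n = 2 * D * T n * (n / 2 ^ L n) := by simp only [hq]; field_simp
        rw [this]
        refine mul_le_of_le_one_right (by positivity) ?_
        rwa [div_le_one (by positivity)]
      have h4 : 0 ≤ n * q n := by positivity
      calc (n * q n) ^ 2 ≤ (2 * D * T n) ^ 2 := by gcongr
        _ = 4 * D ^ 2 * T n * T n := by ring
        _ ≤ 4 * D ^ 2 * ρ * (n * T n) := by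
            have : T n ≤ n * T n := le_mul_of_one_le_left hTn.le hn1
            gcongr
    have hm1 := hZm n
    have hm2 := hVm n
    rw [lintegral_const_mul _ (by fun_prop), lintegral_add_right _ measurable_const,
      lintegral_add_left (by fun_prop), lintegral_finsetSum _ (fun l _ => by fun_prop),
      lintegral_const]
    rw [measure_univ, mul_one]
    have hy : 0 ≤ A * n * (D * (2 * T n)) := by positivity
    calc _ ≤ ENNReal.ofReal (κ n) * (∑ l ∈ Finset.range (L n + 1),
          ENNReal.ofReal (A * n * (D * (2 * T n))) + ENNReal.ofReal (A * n * (D * (2 * T n))) +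
          ENNReal.ofReal (4 * D ^ 2 * ρ * (n * T n))) := by
          gcongr with l _
          exact hZl l
      _ = ENNReal.ofReal (κ n * (((L n + 1 : ℕ) : ℝ) * (A * n * (D * (2 * T n))) +
          A * n * (D * (2 * T n)) + 4 * D ^ 2 * ρ * (n * T n))) := by
          rw [Finset.sum_const, Finset.card_range, nsmul_eq_mul, ENNReal.ofReal_mul (hκ n),
            ENNReal.ofReal_add (by positivity) (by positivity),
            ENNReal.ofReal_add (by positivity) (by positivity),
            ENNReal.ofReal_mul (p := ((L n + 1 : ℕ) : ℝ)) (by positivity), ENNReal.ofReal_natCast]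
      _ ≤ _ := by
          refine ENNReal.ofReal_le_ofReal ?_
          have hL0 : (0 : ℝ) ≤ L n := by positivity
          calc κ n * (((L n + 1 : ℕ) : ℝ) * (A * n * (D * (2 * T n))) +
                A * n * (D * (2 * T n)) + 4 * D ^ 2 * ρ * (n * T n))
              ≤ κ n * (((L n : ℝ) + 3) * (n * T n * (A * D * 2 + 4 * D ^ 2 * ρ))) := by
                refine mul_le_mul_of_nonneg_left ?_ (hκ n)
                push_cast
                have h1 : 0 ≤ (n : ℝ) * T n * (A * D * 2) := by positivity
                have h2 : 0 ≤ (n : ℝ) * T n * (4 * D ^ 2 * ρ) := by positivity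
                nlinarith [mul_nonneg hL0 h2]
            _ = _ := by
                have h3 : δ n ^ (2 * p + 1) = (δ n ^ p) ^ 2 * δ n := by rw [pow_succ, pow_mul']
                simp only [κ, hTdef, hC, hLdef, h3, mul_pow]
                field_simp

end Noise

/-! ### Outcome errors that depend on the units outside a fold -/

section FirstStage

variable {n : ℕ} {U : Type*} [MeasurableSpace U] {PX : Measure ℝ} [IsProbabilityMeasure PX]
  {κ : Kernel ℝ U} [IsMarkovKernel κ]

/-- The conditional second moment of `Δ w` given the running variable of unit `i`. -/
noncomputable def condSq (κ : Kernel ℝ U) (Δ : (Fin n → ℝ × U) → U → ℝ) (i : Fin n)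
    (w : Fin n → ℝ × U) : ENNReal := ∫⁻ u, ENNReal.ofReal (Δ w u ^ 2) ∂(κ (w i).1)

open Classical in
/-- The error of unit `i`, truncated where the conditional second moment exceeds `c`. -/
noncomputable def truncErr (κ : Kernel ℝ U) (c : ℝ) (Δ : (Fin n → ℝ × U) → U → ℝ) (i : Fin n)
    (w : Fin n → ℝ × U) : ℝ := if condSq κ Δ i w ≤ ENNReal.ofReal c then Δ w (w i).2 else 0

open Classical in
/-- The conditionally centered version of `truncErr`. -/
noncomputable def centErr (κ : Kernel ℝ U) (c : ℝ) (Δ : (Fin n → ℝ × U) → U → ℝ) (i : Fin n)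
    (w : Fin n → ℝ × U) : ℝ :=
  if condSq κ Δ i w ≤ ENNReal.ofReal c then Δ w (w i).2 - ∫ u, Δ w u ∂(κ (w i).1) else 0

variable {Δ : (Fin n → ℝ × U) → U → ℝ}

theorem measurable_condSq (hΔ : Measurable (Function.uncurry Δ)) (i : Fin n) :
    Measurable (condSq κ Δ i) := by
  set κi : Kernel (Fin n → ℝ × U) U := κ.comap (fun w => (w i).1) (by fun_prop)
  exact Measurable.lintegral_kernel_prod_right (κ := κi) (hΔ.pow_const 2).ennreal_ofReal

theorem measurable_truncErr (hΔ : Measurable (Function.uncurry Δ)) (c : ℝ) (i : Fin n) :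
    Measurable (truncErr κ c Δ i) := by
  refine Measurable.ite (measurableSet_le (measurable_condSq hΔ i) measurable_const) ?_
    measurable_const
  have : Measurable fun w : Fin n → ℝ × U => (w, (w i).2) := by fun_prop
  exact hΔ.comp this

theorem measurable_centErr (hΔ : Measurable (Function.uncurry Δ)) (c : ℝ) (i : Fin n) :
    Measurable (centErr κ c Δ i) := by
  refine Measurable.ite (measurableSet_le (measurable_condSq hΔ i) measurable_const)
    (Measurable.sub ?_ ?_) measurable_const
  · have : Measurable fun w : Fin n → ℝ × U => (w, (w i).2) := by fun_prop
    exact hΔ.comp this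
  · set κi : Kernel (Fin n → ℝ × U) U := κ.comap (fun w => (w i).1) (by fun_prop)
    exact (StronglyMeasurable.integral_kernel_prod_right (κ := κi) (f := Δ)
      hΔ.stronglyMeasurable).measurable

theorem memLp_of_condSq_le (hΔ : Measurable (Function.uncurry Δ)) {c : ℝ} {i : Fin n}
    {w : Fin n → ℝ × U} (h : condSq κ Δ i w ≤ ENNReal.ofReal c) : MemLp (Δ w) 2 (κ (w i).1) :=
  memLp_two_of_lintegral (hΔ.comp measurable_prodMk_left).aestronglyMeasurable
    (h.trans_lt ENNReal.ofReal_lt_top)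

theorem condSq_resample {i j : Fin n} (hfree : FreeOf j Δ) (w : Fin n → ℝ × U) (u : U) :
    condSq κ Δ i (resample j w u) = condSq κ Δ i w := by
  simp only [condSq, hfree w u, resample_fst]

theorem freeOf_centErr {i j : Fin n} (hij : i ≠ j) (hfree : FreeOf j Δ) (c : ℝ) :
    FreeOf j (centErr κ c Δ i) := by
  intro w u
  simp only [centErr, condSq_resample hfree w u, hfree w u, resample_of_ne hij]

/-- Redrawing the outcome of `i` leaves the truncation event alone, because `Δ` does not use that
outcome; off the event the truncated error is zero. The bound therefore holds for every sample. -/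
theorem lintegral_truncErr_sq_le {i : Fin n} (hfree : FreeOf i Δ) (c : ℝ) (w : Fin n → ℝ × U) :
    ∫⁻ u, ENNReal.ofReal (truncErr κ c Δ i (resample i w u) ^ 2) ∂(κ (w i).1) ≤
      ENNReal.ofReal c := by
  simp only [truncErr, condSq_resample hfree, hfree w, resample_self]
  by_cases h : condSq κ Δ i w ≤ ENNReal.ofReal c
  · simp only [if_pos h]
    exact h
  · simp [if_neg h]

theorem lintegral_sub_integral_sq_le {μ : Measure U} [IsProbabilityMeasure μ] {f : U → ℝ}
    (hf : MemLp f 2 μ) :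
    ∫⁻ u, ENNReal.ofReal ((f u - ∫ v, f v ∂μ) ^ 2) ∂μ ≤ ∫⁻ u, ENNReal.ofReal (f u ^ 2) ∂μ := by
  have h1 := hf.sub (memLp_const (∫ v, f v ∂μ))
  rw [← ofReal_integral_sq hf, ← ofReal_integral_sq (f := fun u => f u - ∫ v, f v ∂μ) h1]
  refine ENNReal.ofReal_le_ofReal ?_
  have := variance_le_expectation_sq (μ := μ) (X := f) hf.aestronglyMeasurable
  rwa [variance_eq_integral hf.aestronglyMeasurable.aemeasurable] at this

/-- When only the outcome of `i` is redrawn, `Δ w` is a fixed function, and subtracting its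
conditional mean centers it. Because of the truncation, the second-moment bound does not presuppose
an accurate first stage. -/
theorem isCentered_centErr (hΔ : Measurable (Function.uncurry Δ)) {i : Fin n}
    (hfree : FreeOf i Δ) (c : ℝ) : IsCentered PX κ c i (centErr κ c Δ i) where
  measurable := measurable_centErr hΔ c i
  mean := Eventually.of_forall fun w => by
    simp only [centErr, condSq_resample hfree, hfree w, resample_self]
    by_cases h : condSq κ Δ i w ≤ ENNReal.ofReal c
    · simp only [if_pos h]
      have := (memLp_of_condSq_le hΔ h).integrable one_le_two
      rw [integral_sub this (integrable_const _)]
      simp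
    · simp [if_neg h]
  sq := Eventually.of_forall fun w => by
    simp only [centErr, condSq_resample hfree, hfree w, resample_self]
    by_cases h : condSq κ Δ i w ≤ ENNReal.ofReal c
    · simp only [if_pos h]
      exact (lintegral_sub_integral_sq_le (memLp_of_condSq_le hΔ h)).trans h
    · simp [if_neg h]

/-- If the conditional second moment of `ψ` is at most `c`, then weighting by functions of the
running variable gives a sum of second moments of the same order. -/
theorem lintegral_sum_weighted_sq_le {c : ℝ} {ψ : Fin n → (Fin n → ℝ × U) → ℝ}
    (hψ : ∀ i, Measurable (ψ i)) (hc : ∀ i, ∀ᵐ w ∂sampleLaw n PX κ,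
      ∫⁻ u, ENNReal.ofReal (ψ i (resample i w u) ^ 2) ∂(κ (w i).1) ≤ ENNReal.ofReal c)
    {a : Fin n → (Fin n → ℝ) → ℝ} (ha : ∀ i, Measurable (a i)) (ha0 : ∀ i x, 0 ≤ a i x) :
    ∫⁻ w, ENNReal.ofReal (∑ i, a i (fun k => (w k).1) * ψ i w ^ 2) ∂sampleLaw n PX κ ≤
      ENNReal.ofReal c * ∫⁻ w, ENNReal.ofReal (∑ i, a i fun k => (w k).1) ∂sampleLaw n PX κ := by
  have ham : ∀ i, Measurable fun w : Fin n → ℝ × U => a i fun k => (w k).1 := fun i =>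
    (ha i).comp (by fun_prop)
  simp_rw [ENNReal.ofReal_sum_of_nonneg fun i _ => ha0 i _,
    ENNReal.ofReal_sum_of_nonneg fun i (_ : i ∈ Finset.univ) =>
      mul_nonneg (ha0 i _) (sq_nonneg (ψ i _)), ENNReal.ofReal_mul (ha0 _ _)]
  rw [lintegral_finsetSum (f := fun i w => ENNReal.ofReal (a i fun k => (w k).1) *
      ENNReal.ofReal (ψ i w ^ 2)) _ fun i _ =>
      (ham i).ennreal_ofReal.mul ((hψ i).pow_const 2).ennreal_ofReal,
    lintegral_finsetSum _ fun i _ => (ham i).ennreal_ofReal, Finset.mul_sum]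
  exact Finset.sum_le_sum fun i _ => lintegral_mul_le_of_resample (ham i).ennreal_ofReal
    ((hψ i).pow_const 2).ennreal_ofReal
    (fun w u => by simp only [resample_fst]) (hc i)

theorem lintegral_sum_comp_fst {φ : ℝ → ℝ} (hφ : Measurable φ) (hφ0 : ∀ t, 0 ≤ φ t)
    {B : ℝ} (hB : ∀ t, φ t ≤ B) (t : Finset (Fin n)) :
    ∫⁻ w, ENNReal.ofReal (∑ i ∈ t, φ (w i).1) ∂sampleLaw n PX κ ≤
      ENNReal.ofReal (n * ∫ t, φ t ∂PX) := by
  have hint : Integrable φ PX := integrable_of_abs_le hφ fun t => by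
    rw [abs_of_nonneg (hφ0 t)]; exact hB t
  simp_rw [ENNReal.ofReal_sum_of_nonneg fun i _ => hφ0 _]
  rw [lintegral_finsetSum (f := fun i (w : Fin n → ℝ × U) => ENNReal.ofReal (φ (w i).1)) _
    fun i _ => (hφ.comp (by fun_prop)).ennreal_ofReal]
  have : ∀ i : Fin n, ∫⁻ w, ENNReal.ofReal (φ (w i).1) ∂sampleLaw n PX κ =
      ENNReal.ofReal (∫ t, φ t ∂PX) := fun i => by
    rw [ofReal_integral_eq_lintegral_ofReal hint (Eventually.of_forall hφ0)]
    exact lintegral_sampleLaw_eval (φ := fun t => ENNReal.ofReal (φ t)) hφ.ennreal_ofReal i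
  simp_rw [this]
  rw [Finset.sum_const, nsmul_eq_mul, ENNReal.ofReal_mul (by positivity), ENNReal.ofReal_natCast]
  gcongr
  simpa using Finset.card_le_univ t

theorem lintegral_sq_sum_mul_centered_le {c : ℝ} (hc : 0 ≤ c) (t : Finset (Fin n))
    {ζ : Fin n → (Fin n → ℝ × U) → ℝ} (hζ : ∀ i ∈ t, IsCentered PX κ c i (ζ i))
    (hfree : ∀ i ∈ t, ∀ j ∈ t, i ≠ j → FreeOf j (ζ i)) {φ : ℝ → ℝ} (hφ : Measurable φ)
    {B : ℝ} (hB : ∀ t, |φ t| ≤ B) :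
    ∫⁻ w, ENNReal.ofReal ((∑ i ∈ t, φ (w i).1 * ζ i w) ^ 2) ∂sampleLaw n PX κ ≤
      ENNReal.ofReal (c * n * ∫ t, φ t ^ 2 ∂PX) := by
  refine (lintegral_sq_sum_centered t hζ hfree (a := fun i w => φ (w i).1)
    (fun i => hφ.comp (by fun_prop)) (fun i j w u => by simp only [resample_fst])
    (fun i w => hB _)).trans ?_
  rw [mul_assoc, ENNReal.ofReal_mul hc]
  gcongr
  rw [← lintegral_finsetSum (f := fun i (w : Fin n → ℝ × U) => ENNReal.ofReal (φ (w i).1 ^ 2)) _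
    fun i _ => ((hφ.comp (by fun_prop)).pow_const 2).ennreal_ofReal]
  simp_rw [← ENNReal.ofReal_sum_of_nonneg fun i (_ : i ∈ t) => sq_nonneg (φ _)]
  exact lintegral_sum_comp_fst (hφ.pow_const 2) (fun _ => sq_nonneg _) (B := B ^ 2)
    (fun s => sq_le_sq' (abs_le.1 (hB s)).1 (abs_le.1 (hB s)).2) t

/-- Variances of independent summands add, and each is at most the second moment of `φ`. -/
theorem lintegral_sq_sum_sub_integral_le (t : Finset (Fin n)) {φ : ℝ → ℝ} (hφ : Measurable φ)
    {B : ℝ} (hB : ∀ t, |φ t| ≤ B) :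
    ∫⁻ w, ENNReal.ofReal ((∑ i ∈ t, φ (w i).1 - t.card * ∫ t, φ t ∂PX) ^ 2) ∂sampleLaw n PX κ ≤
      ENNReal.ofReal (n * ∫ t, φ t ^ 2 ∂PX) := by
  set μ := sampleLaw n PX κ with hμ
  have hev : ∀ i : Fin n, MeasurePreserving (fun w : Fin n → ℝ × U => (w i).1) μ PX := fun i =>
    (⟨measurable_fst, Measure.fst_compProd PX κ⟩ :
      MeasurePreserving (Prod.fst : ℝ × U → ℝ) (PX.compProd κ) PX).comp (measurePreserving_eval _ i)
  have hL : ∀ i, MemLp (fun w : Fin n → ℝ × U => φ (w i).1) 2 μ := fun i =>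
    MemLp.of_bound (hφ.comp (by fun_prop)).aestronglyMeasurable B
      (Eventually.of_forall fun w => hB _)
  have hind : iIndepFun (fun i (w : Fin n → ℝ × U) => φ (w i).1) μ :=
    iIndepFun_pi (X := fun _ (y : ℝ × U) => φ y.1) fun i => (hφ.comp measurable_fst).aemeasurable
  have hmean : ∫ w, ∑ i ∈ t, φ (w i).1 ∂μ = t.card * ∫ t, φ t ∂PX := by
    rw [integral_finsetSum _ fun i _ => (hL i).integrable one_le_two]
    have : ∀ i : Fin n, ∫ w, φ (w i).1 ∂μ = ∫ t, φ t ∂PX := fun i => by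
      rw [← (hev i).map_eq, integral_map (hev i).measurable.aemeasurable hφ.aestronglyMeasurable]
    simp [this]
  have hsum : MemLp (fun w : Fin n → ℝ × U => ∑ i ∈ t, φ (w i).1) 2 μ := memLp_finsetSum t fun i _ => hL i
  rw [← ofReal_integral_sq (f := fun w : Fin n → ℝ × U =>
    ∑ i ∈ t, φ (w i).1 - t.card * ∫ t, φ t ∂PX)
    (hsum.sub (memLp_const _))]
  refine ENNReal.ofReal_le_ofReal ?_
  have hvar := variance_eq_integral (μ := μ) (X := fun w : Fin n → ℝ × U => ∑ i ∈ t, φ (w i).1)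
    hsum.aestronglyMeasurable.aemeasurable
  rw [hmean] at hvar
  rw [← hvar]
  have h1 : (fun w : Fin n → ℝ × U => ∑ i ∈ t, φ (w i).1) =
      ∑ i ∈ t, fun w : Fin n → ℝ × U => φ (w i).1 := by ext w; simp
  rw [h1, IndepFun.variance_sum (fun i _ => hL i) fun i _ j _ hij => hind.indepFun hij]
  have h2 : ∀ i ∈ t, Var[fun w : Fin n → ℝ × U => φ (w i).1; μ] ≤ ∫ t, φ t ^ 2 ∂PX := by
    intro i _
    refine (variance_le_expectation_sq (hL i).aestronglyMeasurable).trans (le_of_eq ?_)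
    have := integral_map (hev i).measurable.aemeasurable
      (hφ.pow_const 2).aestronglyMeasurable (μ := μ) (f := fun t => φ t ^ 2)
    rw [(hev i).map_eq] at this
    rw [this]; rfl
  refine (Finset.sum_le_sum h2).trans ?_
  rw [Finset.sum_const, nsmul_eq_mul]
  have h3 : 0 ≤ ∫ t, φ t ^ 2 ∂PX := integral_nonneg fun _ => sq_nonneg _
  have h4 : (t.card : ℝ) ≤ n := by exact_mod_cast (by simpa using Finset.card_le_univ t)
  gcongr

/-- A unit's running variable almost surely differs from any function of the other units. -/
theorem ae_fst_ne [NullSingletonClass PX] (j : Fin n) {F : (Fin n → ℝ) → ℝ} (hF : Measurable F)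
    (hfree : ∀ x y, F (Function.update x j y) = F x) :
    ∀ᵐ w ∂sampleLaw n PX κ, (w j).1 ≠ F fun i => (w i).1 := by
  have hm : MeasurableSet {w : Fin n → ℝ × U | (w j).1 = F fun i => (w i).1} :=
    measurableSet_eq_fun (by fun_prop) (hF.comp (by fun_prop))
  rw [ae_iff]
  simp only [ne_eq, not_not]
  rw [← lintegral_indicator_one hm, lintegral_update j (measurable_one.indicator hm)]
  refine (lintegral_congr fun w => ?_).trans lintegral_zero
  have h1 : ∀ y : ℝ × U, (fun i => (Function.update w j y i).1) =
      Function.update (fun i => (w i).1) j y.1 := by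
    intro y
    ext i
    by_cases h : i = j
    · subst h; simp
    · simp [h]
  have h2 : ∀ y : ℝ × U, {w : Fin n → ℝ × U | (w j).1 = F fun i => (w i).1}.indicator
      (1 : (Fin n → ℝ × U) → ENNReal) (Function.update w j y) =
      ({F fun i => (w i).1} : Set ℝ).indicator 1 y.1 := by
    intro y
    simp only [Set.indicator_apply, Set.mem_ofPred_eq, h1, hfree, Function.update_self,
      Set.mem_singleton_iff]
    rfl
  simp_rw [h2]
  have h3 : MeasurePreserving (Prod.fst : ℝ × U → ℝ) (PX.compProd κ) PX :=
    ⟨measurable_fst, Measure.fst_compProd PX κ⟩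
  rw [h3.lintegral_comp (f := ({F fun i => (w i).1} : Set ℝ).indicator 1)
    (measurable_one.indicator (measurableSet_singleton _)),
    lintegral_indicator_one (measurableSet_singleton _)]
  exact measure_singleton _

end FirstStage

/-! ### The sampling model -/

theorem IsCentered.mono {n : ℕ} {U : Type*} [MeasurableSpace U] {PX : Measure ℝ} {κ : Kernel ℝ U}
    {c c' : ℝ} {j : Fin n} {ζ : (Fin n → ℝ × U) → ℝ} (h : IsCentered PX κ c j ζ) (hc : c ≤ c') :
    IsCentered PX κ c' j ζ :=
  ⟨h.measurable, h.mean, h.sq.mono fun _ hw => hw.trans (ENNReal.ofReal_le_ofReal hc)⟩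

section Sampling

universe u

variable {Ω : ℕ → Type u} [∀ n, MeasurableSpace (Ω n)]

/-- Independent observations with running variable law `PX` and conditional law `κ`, and a fold
assignment that is independent of the data. -/
structure IsSample (P : ∀ n, Measure (Ω n)) (PX : Measure ℝ) {d : ℕ → ℕ}
    (κ : ∀ n, Kernel ℝ (ℝ × (Fin (d n) → ℝ))) (W : ∀ n, Fin n → Ω n → Obs (d n)) {S : ℕ}
    (fold : ∀ n, Ω n → Fin n → Fin S) : Prop where
  meas : ∀ n i, Measurable (W n i)
  indep : ∀ n, iIndepFun (W n) (P n)
  law : ∀ n i, (P n).map (W n i) = PX.compProd (κ n)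
  fold_meas : ∀ n, Measurable (fold n)
  fold_indep : ∀ n, IndepFun (fold n) (fun ω i => W n i ω) (P n)

/-- The running variables of the samples. -/
def sampleX {d : ℕ → ℕ} (W : ∀ n, Fin n → Ω n → Obs (d n)) (n : ℕ) (ω : Ω n) : Fin n → ℝ :=
  runX fun i => W n i ω

variable {P : ∀ n, Measure (Ω n)} [∀ n, IsProbabilityMeasure (P n)] {PX : Measure ℝ}
  [IsProbabilityMeasure PX] {d : ℕ → ℕ} {κ : ∀ n, Kernel ℝ (ℝ × (Fin (d n) → ℝ))}
  [∀ n, IsMarkovKernel (κ n)] {W : ∀ n, Fin n → Ω n → Obs (d n)} {S : ℕ}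
  {fold : ∀ n, Ω n → Fin n → Fin S}

theorem IsSample.measurable_sample (h : IsSample P PX κ W fold) (n : ℕ) :
    Measurable fun ω i => W n i ω := measurable_pi_lambda _ fun i => h.meas n i

theorem IsSample.measurable_sampleX (h : IsSample P PX κ W fold) (n : ℕ) (i : Fin n) :
    Measurable fun ω => sampleX W n ω i := measurable_fst.comp (h.meas n i)

theorem IsSample.map_eq (h : IsSample P PX κ W fold) (n : ℕ) :
    (P n).map (fun ω i => W n i ω) = sampleLaw n PX (κ n) := by
  rw [(iIndepFun_iff_map_fun_eq_pi_map fun i => (h.meas n i).aemeasurable).1 (h.indep n), sampleLaw]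
  simp_rw [h.law]

theorem IsSample.ae (h : IsSample P PX κ W fold) {n : ℕ} {p : (Fin n → Obs (d n)) → Prop}
    (hp : ∀ᵐ w ∂sampleLaw n PX (κ n), p w) : ∀ᵐ ω ∂P n, p fun i => W n i ω := by
  rw [← h.map_eq n] at hp
  exact ae_of_ae_map (h.measurable_sample n).aemeasurable hp

/-- There are finitely many fold assignments, so measurability can be checked for each of them
separately. -/
theorem measurable_comp_fold (h : IsSample P PX κ W fold) {n : ℕ} {β : Type*} [MeasurableSpace β]
    {F : (Fin n → Fin S) → (Fin n → Obs (d n)) → β} (hF : ∀ φ, Measurable (F φ)) :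
    Measurable fun ω => F (fold n ω) fun i => W n i ω := by
  have h1 : Measurable fun p : (Fin n → Fin S) × (Fin n → Obs (d n)) => F p.1 p.2 :=
    measurable_from_prod_countable_right fun φ => hF φ
  exact h1.comp ((h.fold_meas n).prodMk (h.measurable_sample n))

/-- By independence the sample keeps its law when the fold assignment is held fixed, so bounds that
are uniform over assignments carry over to the random split. -/
theorem IsSample.lintegral_le (h : IsSample P PX κ W fold) {n : ℕ}
    {F : (Fin n → Fin S) → (Fin n → Obs (d n)) → ENNReal} (hF : ∀ φ, Measurable (F φ))
    {c : ENNReal} (hc : ∀ φ, ∫⁻ w, F φ w ∂sampleLaw n PX (κ n) ≤ c) :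
    ∫⁻ ω, F (fold n ω) (fun i => W n i ω) ∂P n ≤ c := by
  have h1 : Measurable fun p : (Fin n → Fin S) × (Fin n → Obs (d n)) => F p.1 p.2 :=
    measurable_from_prod_countable_right fun φ => hF φ
  have h2 := (indepFun_iff_map_prod_eq_prod_map_map (h.fold_meas n).aemeasurable
    (h.measurable_sample n).aemeasurable).1 (h.fold_indep n)
  rw [h.map_eq n] at h2
  have : IsProbabilityMeasure ((P n).map (fold n)) :=
    Measure.isProbabilityMeasure_map (h.fold_meas n).aemeasurable
  calc ∫⁻ ω, F (fold n ω) (fun i => W n i ω) ∂P n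
      = ∫⁻ p, F p.1 p.2 ∂((P n).map fun ω => (fold n ω, fun i => W n i ω)) :=
        (lintegral_map h1 ((h.fold_meas n).prodMk (h.measurable_sample n))).symm
    _ = ∫⁻ φ, ∫⁻ w, F φ w ∂sampleLaw n PX (κ n) ∂((P n).map (fold n)) := by
        rw [h2, lintegral_prod _ h1.aemeasurable]
    _ ≤ ∫⁻ _, c ∂((P n).map (fold n)) := lintegral_mono hc
    _ = c := by simp

theorem IsSample.pair_le (h : IsSample P PX κ W fold) (n : ℕ) (i j : Fin n) (hij : i ≠ j)
    (s : Set ℝ) (hs : MeasurableSet s) :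
    P n {ω | sampleX W n ω i ∈ s ∧ sampleX W n ω j ∈ s} ≤ PX s ^ 2 := by
  have h1 := ((h.indep n).indepFun hij).comp measurable_fst measurable_fst
  have h2 : ∀ k, P n ((Prod.fst ∘ W n k) ⁻¹' s) = PX s := by
    intro k
    rw [Set.preimage_comp, ← Measure.map_apply (h.meas n k) (measurable_fst hs), h.law,
      ← Measure.map_apply measurable_fst hs]
    change (PX.compProd (κ n)).fst s = _
    rw [Measure.fst_compProd]
  have h3 := h1.measure_inter_preimage_eq_mul s s hs hs
  rw [h2, h2, ← sq] at h3
  exact h3.le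

/-- Conditional orthogonality is required only within a set `t` of units, such as a fold; outside it
the errors vanish. Since they have mean zero, no centering constant is needed. -/
theorem IsSample.isNoise_of_centered (h : IsSample P PX κ W fold) {A : ℝ} (hA : 0 ≤ A)
    {ζ : ∀ n, (Fin n → Fin S) → Fin n → (Fin n → Obs (d n)) → ℝ}
    (hm : ∀ n φ i, Measurable (ζ n φ i))
    (hζ : ∀ᶠ n in atTop, ∀ φ, ∃ t : Finset (Fin n), (∀ i ∈ t, IsCentered PX (κ n) A i (ζ n φ i)) ∧
      (∀ i ∈ t, ∀ j ∈ t, i ≠ j → FreeOf j (ζ n φ i)) ∧ ∀ i ∉ t, ∀ w, ζ n φ i w = 0) :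
    IsNoise P (sampleX W) PX A (fun n ω i => ζ n (fold n ω) i fun k => W n k ω)
      (fun _ _ => 0) where
  nonneg := hA
  measurable n i := measurable_comp_fold h fun φ => hm n φ i
  meas_const _ := measurable_const
  abs_const_le n ω := by simp
  sq := by
    filter_upwards [hζ] with n hn ψ hψ ⟨B, hB⟩
    refine h.lintegral_le (F := fun φ w => ENNReal.ofReal
      (noiseFun PX (fun i => (w i).1) (fun i => ζ n φ i w) 0 ψ ^ 2)) (fun φ => ?_) fun φ => ?_
    · have := hm n φ
      unfold noiseFun
      fun_prop
    · obtain ⟨t, h1, h2, h3⟩ := hn φ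
      refine le_trans (le_of_eq (lintegral_congr fun w => ?_))
        (lintegral_sq_sum_mul_centered_le hA t h1 h2 hψ hB)
      rw [noiseFun, zero_mul, sub_zero, ← Finset.sum_subset (Finset.subset_univ t)
        fun i _ hi => by simp only [h3 i hi, zero_mul]]
      simp_rw [mul_comm]
  diag := by
    filter_upwards [hζ] with n hn ψ hψ ⟨B, hB⟩
    refine h.lintegral_le (F := fun φ w => ENNReal.ofReal
      (∑ i, ζ n φ i w ^ 2 * ψ (w i).1 ^ 2)) (fun φ => ?_) fun φ => ?_
    · have := hm n φ
      fun_prop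
    · obtain ⟨t, h1, h2, h3⟩ := hn φ
      have h4 : ∀ i, ∀ᵐ w ∂sampleLaw n PX (κ n),
          ∫⁻ u, ENNReal.ofReal (ζ n φ i (resample i w u) ^ 2) ∂(κ n (w i).1) ≤
            ENNReal.ofReal A := by
        intro i
        by_cases hi : i ∈ t
        · exact (h1 i hi).sq
        · simp [h3 i hi]
      have h5 := lintegral_sum_weighted_sq_le (PX := PX) (hm n φ) h4
        (a := fun i x => ψ (x i) ^ 2) (fun i => by fun_prop) fun i x => sq_nonneg _
      simp_rw [mul_comm (ζ n φ _ _ ^ 2)]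
      refine h5.trans ?_
      rw [mul_assoc, ENNReal.ofReal_mul hA]
      gcongr
      exact lintegral_sum_comp_fst (hψ.pow_const 2) (fun _ => sq_nonneg _) (B := B ^ 2)
        (fun s => sq_le_sq' (abs_le.1 (hB s)).1 (abs_le.1 (hB s)).2) Finset.univ

/-- The number of units in a fold. -/
noncomputable def foldCard {n S : ℕ} (φ : Fin n → Fin S) (s : Fin S) : ℝ :=
  (Finset.univ.filter fun i => φ i = s).card

/-- Given the assignment, the running variables of a fold are an i.i.d. sample, centered by the fold
size times the population integral. -/
theorem IsSample.isNoise_fold (h : IsSample P PX κ W fold) (s : Fin S) :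
    IsNoise P (sampleX W) PX 1 (fun n ω i => if fold n ω i = s then 1 else 0)
      (fun n ω => foldCard (fold n ω) s) where
  nonneg := zero_le_one
  measurable n i := measurable_comp_fold h (F := fun φ _ => if φ i = s then (1 : ℝ) else 0)
    fun φ => measurable_const
  meas_const n := measurable_comp_fold h (F := fun φ _ => foldCard φ s) fun φ => measurable_const
  abs_const_le n ω := by
    rw [foldCard, Nat.abs_cast]
    exact_mod_cast (Finset.card_le_univ _).trans (by simp)
  sq := by
    refine Eventually.of_forall fun n ψ hψ ⟨B, hB⟩ => ?_
    refine h.lintegral_le (F := fun φ w => ENNReal.ofReal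
      (noiseFun PX (fun i => (w i).1) (fun i => if φ i = s then 1 else 0) (foldCard φ s) ψ ^ 2))
      (fun φ => ?_) fun φ => ?_
    · unfold noiseFun
      fun_prop
    · rw [one_mul]
      refine le_trans (le_of_eq (lintegral_congr fun w => ?_))
        (lintegral_sq_sum_sub_integral_le (κ := κ n) (Finset.univ.filter fun i => φ i = s) hψ hB)
      simp only [noiseFun, foldCard, ite_mul, one_mul, zero_mul, Finset.sum_ite,
        Finset.sum_const_zero, add_zero]
  diag := by
    refine Eventually.of_forall fun n ψ hψ ⟨B, hB⟩ => ?_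
    refine h.lintegral_le (F := fun φ w => ENNReal.ofReal
      (∑ i, (if φ i = s then (1 : ℝ) else 0) ^ 2 * ψ (w i).1 ^ 2)) (fun φ => ?_) fun φ => ?_
    · fun_prop
    · rw [one_mul]
      refine le_trans (lintegral_mono fun w => ENNReal.ofReal_le_ofReal
        (Finset.sum_le_sum fun i _ => ?_)) (lintegral_sum_comp_fst (κ := κ n) (hψ.pow_const 2)
        (fun _ => sq_nonneg _) (B := B ^ 2)
        (fun s => sq_le_sq' (abs_le.1 (hB s)).1 (abs_le.1 (hB s)).2) Finset.univ)
      split_ifs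
      · simp
      · simpa using sq_nonneg _

/-! ### Outcome noise and first-stage noise -/

/-- The deviation of the adjusted outcome from its conditional mean. -/
noncomputable def outcomeErr {e : ℕ} (κ : Kernel ℝ (ℝ × (Fin e → ℝ))) (η : (Fin e → ℝ) → ℝ)
    (y : Obs e) : ℝ := adjusted η y.2 - condMean κ (adjusted η) y.1

theorem measurable_condMean {e : ℕ} {κ : Kernel ℝ (ℝ × (Fin e → ℝ))} [IsMarkovKernel κ]
    {f : ℝ × (Fin e → ℝ) → ℝ} (hf : Measurable f) : Measurable (condMean κ f) :=
  (StronglyMeasurable.integral_kernel_prod_right (κ := κ) (f := fun _ => f)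
    (hf.comp measurable_snd).stronglyMeasurable).measurable

theorem measurable_adjusted {e : ℕ} {η : (Fin e → ℝ) → ℝ} (hη : Measurable η) :
    Measurable (adjusted η) := measurable_fst.sub (hη.comp measurable_snd)

theorem measurable_outcomeErr {e : ℕ} {κ : Kernel ℝ (ℝ × (Fin e → ℝ))} [IsMarkovKernel κ]
    {η : (Fin e → ℝ) → ℝ} (hη : Measurable η) : Measurable (outcomeErr κ η) :=
  ((measurable_adjusted hη).comp measurable_snd).sub
    ((measurable_condMean (measurable_adjusted hη)).comp measurable_fst)

/-- Moment conditions on the outcome error that hold on the support of the running variable. -/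
structure HasOutcomeMoments (𝒳 : Set ℝ) {e : ℕ} (κ : Kernel ℝ (ℝ × (Fin e → ℝ)))
    (η : (Fin e → ℝ) → ℝ) (C q : ℝ) : Prop where
  meas : Measurable η
  integrable : ∀ x ∈ 𝒳, Integrable (adjusted η) (κ x)
  moment : ∀ x ∈ 𝒳, ∫⁻ u, ENNReal.ofReal (|outcomeErr κ η (x, u)| ^ q) ∂(κ x) ≤ ENNReal.ofReal C
  two_lt : 2 < q
  nonneg : 0 ≤ C

/-- Since `q > 2`, one has `t² ≤ 1 + |t|^q`. -/
theorem HasOutcomeMoments.sq_le {𝒳 : Set ℝ} {e : ℕ} {κ : Kernel ℝ (ℝ × (Fin e → ℝ))}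
    [IsMarkovKernel κ] {η : (Fin e → ℝ) → ℝ} {C q : ℝ} (h : HasOutcomeMoments 𝒳 κ η C q) {x : ℝ}
    (hx : x ∈ 𝒳) :
    ∫⁻ u, ENNReal.ofReal (outcomeErr κ η (x, u) ^ 2) ∂(κ x) ≤ ENNReal.ofReal (1 + C) := by
  have h1 : ∀ t : ℝ, t ^ 2 ≤ 1 + |t| ^ q := by
    intro t
    rcases le_total |t| 1 with ht | ht
    · have h2 : t ^ 2 ≤ 1 := by rw [← sq_abs]; exact pow_le_one₀ (abs_nonneg _) ht
      have : 0 ≤ |t| ^ q := by positivity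
      linarith
    · have h2 : t ^ 2 ≤ |t| ^ q := by
        rw [← sq_abs, ← Real.rpow_two]
        exact Real.rpow_le_rpow_of_exponent_le ht h.two_lt.le
      linarith
  calc _ ≤ ∫⁻ u, (ENNReal.ofReal 1 + ENNReal.ofReal (|outcomeErr κ η (x, u)| ^ q)) ∂(κ x) := by
        refine lintegral_mono fun u => ?_
        rw [← ENNReal.ofReal_add zero_le_one (by positivity)]
        exact ENNReal.ofReal_le_ofReal (h1 _)
    _ ≤ ENNReal.ofReal 1 + ENNReal.ofReal C := by
        rw [lintegral_add_left measurable_const]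
        gcongr
        · simp
        · exact h.moment x hx
    _ = _ := (ENNReal.ofReal_add zero_le_one h.nonneg).symm

theorem HasOutcomeMoments.isCentered {e n : ℕ} {κ : Kernel ℝ (ℝ × (Fin e → ℝ))}
    [IsMarkovKernel κ] {η : (Fin e → ℝ) → ℝ} {C q : ℝ} (h : HasOutcomeMoments PX.support κ η C q)
    (i : Fin n) : IsCentered PX κ (1 + C) i fun w => outcomeErr κ η (w i) where
  measurable := (measurable_outcomeErr h.meas).comp (measurable_pi_apply i)
  mean := by
    filter_upwards [ae_sampleLaw_of_ae (κ := κ) PX.support_mem_ae i] with w hw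
    simp only [resample_self, outcomeErr]
    rw [integral_sub (h.integrable _ hw) (integrable_const _)]
    simp [condMean]
  sq := by
    filter_upwards [ae_sampleLaw_of_ae (κ := κ) PX.support_mem_ae i] with w hw
    simp only [resample_self]
    exact h.sq_le hw

theorem IsSample.isNoise_outcomeErr (h : IsSample P PX κ W fold)
    {ηbar : ∀ n, (Fin (d n) → ℝ) → ℝ} {C q : ℝ}
    (hm : ∀ n, HasOutcomeMoments PX.support (κ n) (ηbar n) C q) :
    IsNoise P (sampleX W) PX (1 + C) (fun n ω i => outcomeErr (κ n) (ηbar n) (W n i ω))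
      (fun _ _ => 0) :=
  h.isNoise_of_centered (ζ := fun n _ i w => outcomeErr (κ n) (ηbar n) (w i))
    (by have := (hm 0).nonneg; linarith)
    (fun n _ i => ((hm n).isCentered i).measurable)
    (Eventually.of_forall fun n _ => ⟨Finset.univ, fun i _ => (hm n).isCentered i,
      fun i _ j _ hij => freeOf_eval hij _, fun i hi => absurd (Finset.mem_univ i) hi⟩)

/-- The error of the adjusted outcomes that the first stage causes. -/
noncomputable def stageErr {n e S : ℕ} (est : (I : Finset (Fin n)) → (I → Obs e) → (Fin e → ℝ) → ℝ)
    (η : (Fin e → ℝ) → ℝ) (φ : Fin n → Fin S) (s : Fin S) (w : Fin n → Obs e)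
    (u : ℝ × (Fin e → ℝ)) : ℝ := η u.2 - etaHat est φ w s u.2

theorem measurable_stageErr {n e S : ℕ}
    {est : (I : Finset (Fin n)) → (I → Obs e) → (Fin e → ℝ) → ℝ}
    (hest : ∀ I, Measurable (Function.uncurry (est I))) {η : (Fin e → ℝ) → ℝ} (hη : Measurable η)
    (φ : Fin n → Fin S) (s : Fin S) : Measurable (Function.uncurry (stageErr est η φ s)) := by
  refine (hη.comp (by fun_prop)).sub ?_
  have : Measurable fun p : (Fin n → Obs e) × (ℝ × (Fin e → ℝ)) =>
      ((fun i : (Finset.univ.filter fun i => φ i ≠ s : Finset (Fin n)) => p.1 i), p.2.2) := by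
    fun_prop
  exact (hest _).comp this

/-- Cross-fitting enters here: the estimator for a fold is computed from the units outside it. -/
theorem freeOf_stageErr {n e S : ℕ}
    (est : (I : Finset (Fin n)) → (I → Obs e) → (Fin e → ℝ) → ℝ) (η : (Fin e → ℝ) → ℝ)
    {φ : Fin n → Fin S} {s : Fin S} {j : Fin n} (hj : φ j = s) :
    FreeOf j (stageErr est η φ s) := by
  intro w u
  ext v
  simp only [stageErr, etaHat]
  congr 2
  ext i : 1
  refine resample_of_ne ?_ w u
  rintro rfl
  have := (Finset.mem_filter.1 i.2).2
  exact this hj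

/-- Within one fold the estimated function uses none of the outcomes of that fold, so the centered
errors of its units are conditionally orthogonal. Across folds this argument is not available, so
each fold is treated as a noise of its own. -/
theorem IsSample.isNoise_centErr (h : IsSample P PX κ W fold)
    {est : ∀ n, (I : Finset (Fin n)) → (I → Obs (d n)) → (Fin (d n) → ℝ) → ℝ}
    (hest : ∀ n I, Measurable (Function.uncurry (est n I)))
    {ηbar : ∀ n, (Fin (d n) → ℝ) → ℝ} (hη : ∀ n, Measurable (ηbar n)) {c : ℕ → ℝ}
    (hc : ∀ᶠ n in atTop, c n ≤ 1) (s : Fin S) :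
    IsNoise P (sampleX W) PX 1 (fun n ω i => if fold n ω i = s then
      centErr (κ n) (c n) (stageErr (est n) (ηbar n) (fold n ω) s) i (fun k => W n k ω) else 0)
      (fun _ _ => 0) := by
  refine h.isNoise_of_centered (ζ := fun n φ i w => if φ i = s then
    centErr (κ n) (c n) (stageErr (est n) (ηbar n) φ s) i w else 0) zero_le_one ?_ ?_
  · intro n φ i
    have := measurable_centErr (κ := κ n) (measurable_stageErr (hest n) (hη n) φ s) (c n) i
    split_ifs
    · exact this
    · exact measurable_const
  · filter_upwards [hc] with n hn φ
    refine ⟨Finset.univ.filter fun i => φ i = s, fun i hi => ?_, fun i hi j hj hij => ?_,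
      fun i hi w => ?_⟩
    · have hi' := (Finset.mem_filter.1 hi).2
      simp only [hi', if_true]
      exact (isCentered_centErr (measurable_stageErr (hest n) (hη n) φ s)
        (freeOf_stageErr _ _ hi') _).mono hn
    · have hi' := (Finset.mem_filter.1 hi).2
      have hj' := (Finset.mem_filter.1 hj).2
      simp only [hi', if_true]
      exact freeOf_centErr hij (freeOf_stageErr _ _ hj') _
    · have : ¬ φ i = s := by simpa using hi
      simp [this]

end Sampling

/-! ### The density of the running variable near the cutoff -/

section Density

variable {PX : Measure ℝ} {fX : ℝ → ℝ}

theorem HasRegularDensity.pos (h : HasRegularDensity PX fX) : 0 < fX 0 := by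
  obtain ⟨-, -, -, U, -, h0, -, ε, hε, hU⟩ := h
  exact hε.trans_le (hU 0 h0)

theorem HasRegularDensity.nullSingletonClass (h : HasRegularDensity PX fX) :
    NullSingletonClass PX := by
  obtain ⟨-, -, rfl, -⟩ := h
  infer_instance

theorem HasRegularDensity.continuousAt (h : HasRegularDensity PX fX) : ContinuousAt fX 0 := by
  obtain ⟨-, -, -, U, hUo, h0, hc, -⟩ := h
  exact hc.continuousAt (hUo.mem_nhds h0)

theorem HasRegularDensity.exists_densityBound (h : HasRegularDensity PX fX) :
    ∃ ρ D, HasDensityBound PX ρ D := by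
  have h1 : ∀ᶠ x in 𝓝 (0 : ℝ), fX x < fX 0 + 1 := h.continuousAt.eventually_lt_const (by linarith)
  obtain ⟨ρ, hρ, hball⟩ := Metric.nhds_basis_closedBall.mem_iff.1 h1
  refine ⟨ρ, fX 0 + 1, hρ, by linarith [h.pos], fun s hs hsub => ?_⟩
  rw [h.2.2.1, withDensity_apply _ hs, ← setLIntegral_const]
  refine setLIntegral_mono measurable_const fun x hx => ENNReal.ofReal_le_ofReal ?_
  have : x ∈ Metric.closedBall (0 : ℝ) ρ := by
    rw [Real.closedBall_eq_Icc]; simpa using hsub hx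
  exact (hball this).le

/-- Where the density is bounded below, every neighborhood has positive mass. -/
theorem HasRegularDensity.exists_Icc_subset_support (h : HasRegularDensity PX fX) :
    ∃ ρ > 0, Set.Icc (-ρ) ρ ⊆ PX.support := by
  obtain ⟨hm, h0, rfl, U, hUo, hU0, -, ε, hε, hU⟩ := h
  obtain ⟨ρ, hρ, hball⟩ := Metric.nhds_basis_closedBall.mem_iff.1 (hUo.mem_nhds hU0)
  refine ⟨ρ, hρ, fun x hx => (Measure.mem_support_iff_forall x).2 fun V hV => ?_⟩
  have hxU : x ∈ U := hball (by rw [Real.closedBall_eq_Icc]; simpa using hx)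
  obtain ⟨O, hOV, hOo, hxO⟩ := mem_nhds_iff.1 (inter_mem hV (hUo.mem_nhds hxU))
  refine lt_of_lt_of_le ?_ (measure_mono (hOV.trans Set.inter_subset_left))
  rw [withDensity_apply _ hOo.measurableSet]
  calc 0 < ENNReal.ofReal ε * volume O :=
        ENNReal.mul_pos (by simpa using hε) (hOo.measure_pos volume ⟨x, hxO⟩).ne'
    _ = ∫⁻ _ in O, ENNReal.ofReal ε := (setLIntegral_const _ _).symm
    _ ≤ ∫⁻ x in O, ENNReal.ofReal (fX x) :=
        setLIntegral_mono hm.ennreal_ofReal fun x hx => ENNReal.ofReal_le_ofReal (hU x (hOV hx).2)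

theorem HasRegularDensity.integral_eq (h : HasRegularDensity PX fX) (g : ℝ → ℝ) :
    ∫ t, g t ∂PX = ∫ t, fX t * g t := by
  obtain ⟨hm, h0, rfl, -⟩ := h
  rw [integral_withDensity_eq_integral_toReal_smul hm.ennreal_ofReal (by simp)]
  simp [ENNReal.toReal_ofReal (h0 _)]

/-- Only points within `k` of the cutoff matter, where continuity makes the density close to `fX 0`;
rescaling does the rest. -/
theorem HasRegularDensity.tendsto_integral_window [IsProbabilityMeasure PX]
    (h : HasRegularDensity PX fX) {B : ℝ}
    {f : ℝ → ℝ} (hf : IsWindow B f) :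
    Tendsto (fun k => k⁻¹ * ∫ t, f (t / k) ∂PX) (𝓝[>] 0) (𝓝 (fX 0 * ∫ u, f u)) := by
  have hi := hf.integrable
  set I := ∫ u, |f u| with hI
  have hI0 : 0 ≤ I := integral_nonneg fun _ => abs_nonneg _
  rw [Metric.tendsto_nhds]
  intro ε hε
  -- Using `I + 1` avoids division by zero and leaves room for the strict inequality.
  have h1 : ∀ᶠ x in 𝓝 (0 : ℝ), |fX x - fX 0| < ε / (I + 1) := by
    have := Metric.tendsto_nhds.1 h.continuousAt (ε / (I + 1)) (by positivity)
    simpa only [Real.dist_eq] using this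
  obtain ⟨ρ, hρ, hball⟩ := Metric.nhds_basis_closedBall.mem_iff.1 h1
  filter_upwards [Ioc_mem_nhdsGT hρ] with k hk
  have hk0 : 0 < k := hk.1
  have hcomp : ∀ g : ℝ → ℝ, ∫ t, g (t / k) = k * ∫ u, g u := fun g => by
    rw [Measure.integral_comp_div, abs_of_pos hk0, smul_eq_mul]
  have hint : Integrable fun t => f (t / k) := hi.comp_div hk0.ne'
  have hle : ∀ t, |(fX t - fX 0) * f (t / k)| ≤ ε / (I + 1) * |f (t / k)| := by
    intro t
    rw [abs_mul]
    by_cases ht : t / k ∈ Set.Icc (-1 : ℝ) 1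
    · have h2 : t ∈ Metric.closedBall (0 : ℝ) ρ := by
        rw [Real.closedBall_eq_Icc]
        have h3 := (le_div_iff₀ hk0).1 ht.1
        have h4 := (div_le_iff₀ hk0).1 ht.2
        exact ⟨by linarith [hk.2], by linarith [hk.2]⟩
      have h5 : |fX t - fX 0| < ε / (I + 1) := hball h2
      gcongr
    · simp [hf.eq_zero _ ht]
  have hmm : AEStronglyMeasurable (fun t => (fX t - fX 0) * f (t / k)) volume :=
    ((h.1.sub measurable_const).mul (hf.measurable.comp (measurable_id.div_const k))).aestronglyMeasurable
  have hint2 : Integrable fun t => (fX t - fX 0) * f (t / k) :=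
    (hint.abs.const_mul (ε / (I + 1))).mono' hmm (Eventually.of_forall hle)
  have hdiff : k⁻¹ * ∫ t, f (t / k) ∂PX - fX 0 * ∫ u, f u =
      k⁻¹ * ∫ t, (fX t - fX 0) * f (t / k) := by
    have h2 : ∫ t, fX t * f (t / k) =
        (∫ t, (fX t - fX 0) * f (t / k)) + ∫ t, fX 0 * f (t / k) := by
      rw [← integral_add hint2 (hint.const_mul _)]
      congr 1; ext t; ring
    rw [h.integral_eq, h2, integral_const_mul, hcomp]
    field_simp
    ring
  rw [Real.dist_eq, hdiff, abs_mul, abs_of_pos (inv_pos.2 hk0)]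
  calc k⁻¹ * |∫ t, (fX t - fX 0) * f (t / k)|
      ≤ k⁻¹ * ∫ t, ε / (I + 1) * |f (t / k)| := by
        gcongr
        exact (abs_integral_le_integral_abs).trans
          (integral_mono hint2.abs (hint.abs.const_mul _) hle)
    _ = ε / (I + 1) * I := by
        rw [integral_const_mul, hcomp fun u => |f u|, ← hI]
        field_simp
    _ < ε := by
        rw [div_mul_eq_mul_div, div_lt_iff₀ (by positivity)]
        nlinarith

end Density

/-! ### Pilot bandwidths -/

section Pilot

universe u

variable {Ω : ℕ → Type u} [∀ n, MeasurableSpace (Ω n)] {P : ∀ n, Measure (Ω n)}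
  {PX : Measure ℝ} {d : ℕ → ℕ} {W : ∀ n, Fin n → Ω n → Obs (d n)}

/-- Sets of bandwidths over which the noise in local polynomial regressions of order `p` is
uniformly negligible for the estimation of a `p`-th derivative. -/
structure IsPilot (P : ∀ n, Measure (Ω n)) (PX : Measure ℝ) (W : ∀ n, Fin n → Ω n → Obs (d n))
    (K : ℝ → ℝ) (p : ℕ) (H : ℕ → Set ℝ) : Prop where
  bandwidth : Tendsto (fun z : Σ n, Ω n × ℝ => z.2.2) (inProb P H) (𝓝[>] 0)
  rate : Tendsto (fun z : Σ n, Ω n × ℝ => (z.1 : ℝ) * z.2.2 ^ (2 * p + 1)) (inProb P H) atTop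
  noise : ∀ A e c, IsNoise P (sampleX W) PX A e c → ∀ s k,
    Tendsto (fun z => (z.2.2 ^ p)⁻¹ * locNoise PX (sampleX W) e c (sidePow K s k) z)
      (inProb P H) (𝓝 0)

theorem isWindow_sidePow {K : ℝ → ℝ} {B : ℝ} (hB : IsWindow B K) (s : Side) (k : ℕ) :
    IsWindow B (sidePow K s k) := (hB.indicator s.measurableSet_region).pow_mul k

theorem tendsto_bandwidth_Icc {a b : ℕ → ℝ} (ha : ∀ᶠ n in atTop, 0 < a n)
    (hb : Tendsto b atTop (𝓝 0)) :
    Tendsto (fun z : Σ n, Ω n × ℝ => z.2.2) (inProb P fun n => Set.Icc (a n) (b n)) (𝓝[>] 0) := by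
  have hpos : ∀ᶠ z in inProb P fun n => Set.Icc (a n) (b n), 0 < z.2.2 ∧ z.2.2 ≤ b z.1 :=
    eventually_inProb_of_forall (ha.mono fun n hn ω h hh => ⟨hn.trans_le hh.1, hh.2⟩)
  refine tendsto_nhdsWithin_iff.2 ⟨?_, hpos.mono fun z hz => hz.1⟩
  exact tendsto_of_tendsto_of_tendsto_of_le_of_le' tendsto_const_nhds (tendsto_inProb_self hb)
    (hpos.mono fun z hz => hz.1.le) (hpos.mono fun z hz => hz.2)

theorem tendsto_rate_Icc {a b : ℕ → ℝ} {k : ℕ} (ha : ∀ᶠ n in atTop, 0 < a n)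
    (hr : Tendsto (fun n : ℕ => (n : ℝ) * a n ^ k) atTop atTop) :
    Tendsto (fun z : Σ n, Ω n × ℝ => (z.1 : ℝ) * z.2.2 ^ k)
      (inProb P fun n => Set.Icc (a n) (b n)) atTop := by
  refine tendsto_atTop_mono' _ ?_ (hr.comp tendsto_fst_inProb)
  refine eventually_inProb_of_forall (ha.mono fun n hn ω h hh => ?_)
  have := hh.1
  simp only [Function.comp]
  gcongr

/-- A nonrandom bandwidth is a degenerate interval, for which no condition on the variation of the
kernel is needed. -/
theorem isPilot_singleton [IsProbabilityMeasure PX] {K : ℝ → ℝ} (hK : IsKernelFunction K)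
    (hX : ∀ n i, Measurable fun ω => sampleX W n ω i) {ρ D : ℝ} (hD : HasDensityBound PX ρ D)
    {h : ℕ → ℝ} (hpos : ∀ᶠ n in atTop, 0 < h n) (h0 : Tendsto h atTop (𝓝 0)) {p : ℕ}
    (hrate : Tendsto (fun n : ℕ => (n : ℝ) * h n ^ (2 * p + 1)) atTop atTop) :
    IsPilot P PX W K p fun n => Set.Icc (h n) (h n) where
  bandwidth := tendsto_bandwidth_Icc hpos h0
  rate := tendsto_rate_Icc hpos hrate
  noise A e c hN s k := by
    obtain ⟨B, -, hB⟩ := hK.exists_isWindow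
    exact hN.tendsto_pointwise hX hD hpos h0 hrate (isWindow_sidePow hB s k)

variable [IsProbabilityMeasure PX] [∀ n, IsProbabilityMeasure (P n)]
  {κ : ∀ n, Kernel ℝ (ℝ × (Fin (d n) → ℝ))} [∀ n, IsMarkovKernel (κ n)] {S : ℕ}
  {fold : ∀ n, Ω n → Fin n → Fin S} {K fX : ℝ → ℝ} {p : ℕ} {H : ℕ → Set ℝ}

/-- Bounded variation of the kernel makes the moment functions differences of layered functions, to
which the uniform noise bound applies. -/
theorem isPilot_uniform (hS : IsSample P PX κ W fold) (hK : IsKernelFunction K)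
    (hBV : BoundedVariationOn K (Set.Icc 0 1)) {ρ D : ℝ} (hD : HasDensityBound PX ρ D)
    {δ : ℕ → ℝ} (hδ : ∀ᶠ n in atTop, 0 < δ n) (h0 : Tendsto δ atTop (𝓝 0)) {a b : ℝ} (ha : 0 < a)
    (hab : a ≤ b) {p : ℕ}
    (hr : Tendsto (fun n : ℕ => (n : ℝ) * δ n ^ (2 * p + 1)) atTop atTop)
    (hrate : Tendsto (fun n : ℕ => ((3 * Nat.clog 2 n : ℕ) + 3 : ℝ) ^ 2 /
      ((n : ℝ) * δ n ^ (2 * p + 1))) atTop (𝓝 0)) :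
    IsPilot P PX W K p fun n => Set.Icc (a * δ n) (b * δ n) where
  bandwidth := tendsto_bandwidth_Icc (hδ.mono fun n hn => by positivity)
    (by simpa using h0.const_mul b)
  rate := by
    refine tendsto_rate_Icc (hδ.mono fun n hn => by positivity) ?_
    have := hr.const_mul_atTop (by positivity : 0 < a ^ (2 * p + 1))
    refine this.congr fun n => ?_
    rw [mul_pow]; ring
  noise A e c hN s k := hN.tendsto_uniform hS.measurable_sampleX hD hS.pair_le hδ h0 ha hab hrate
    (exists_layered_sub hK hBV s k)

theorem IsPilot.eventually_pos (h : IsPilot P PX W K p H) :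
    ∀ᶠ z in inProb P H, 0 < z.2.2 ∧ z.2.2 ≤ 1 ∧ 0 < z.1 := by
  filter_upwards [h.bandwidth (Ioc_mem_nhdsGT zero_lt_one),
    tendsto_fst_inProb.eventually (eventually_gt_atTop 0)] with z h1 h2
  exact ⟨h1.1, h1.2, h2⟩

/-- Bandwidths are eventually at most one, so dropping the factor `h^(-p)` only decreases absolute
values. -/
theorem IsPilot.locNoise_tendsto (h : IsPilot P PX W K p H) {A : ℝ}
    {e : ∀ n, Ω n → Fin n → ℝ} {c : ∀ n, Ω n → ℝ} (hN : IsNoise P (sampleX W) PX A e c)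
    (s : Side) (k : ℕ) :
    Tendsto (fun z => locNoise PX (sampleX W) e c (sidePow K s k) z) (inProb P H) (𝓝 0) := by
  have h1 := h.noise A e c hN s k
  rw [tendsto_zero_iff_abs_tendsto_zero] at h1 ⊢
  refine squeeze_zero' (Eventually.of_forall fun _ => abs_nonneg _) ?_ h1
  filter_upwards [h.eventually_pos] with z ⟨hz, hz1, _⟩
  simp only [Function.comp, abs_mul]
  refine le_mul_of_one_le_left (abs_nonneg _) ?_
  rw [abs_of_pos (by positivity)]
  exact one_le_inv_iff₀.2 ⟨by positivity, pow_le_one₀ hz.le hz1⟩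

/-- For `h ≤ 1` one has `n h^p ≥ n h^(2p+1)`. This controls the effect of rounding in the fold
sizes. -/
theorem IsPilot.tendsto_inv_rate (h : IsPilot P PX W K p H) :
    Tendsto (fun z : Σ n, Ω n × ℝ => (z.2.2 ^ p)⁻¹ * (z.1 : ℝ)⁻¹) (inProb P H) (𝓝 0) := by
  refine squeeze_zero' ?_ ?_ h.rate.inv_tendsto_atTop
  · filter_upwards [h.eventually_pos] with z ⟨hz, hz1, hn⟩
    positivity
  · filter_upwards [h.eventually_pos] with z ⟨hz, hz1, hn⟩
    have hn' : (0 : ℝ) < z.1 := by exact_mod_cast hn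
    simp only [Pi.inv_apply]
    rw [← mul_inv]
    refine inv_anti₀ (by positivity) ?_
    rw [mul_comm]
    gcongr ?_ * ?_
    exact pow_le_pow_of_le_one hz.le hz1 (by omega)

theorem locMoment_eq_locNoise (e : ∀ n, Ω n → Fin n → ℝ) (c : ∀ n, Ω n → ℝ) (f : ℝ → ℝ)
    (z : Σ n, Ω n × ℝ) :
    locMoment f z.2.2 (sampleX W z.1 z.2.1) (e z.1 z.2.1) =
      locNoise PX (sampleX W) e c f z +
        c z.1 z.2.1 / z.1 * (z.2.2⁻¹ * ∫ t, f (t / z.2.2) ∂PX) := by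
  simp only [locMoment, locNoise, noiseFun, mul_inv]
  simp_rw [mul_comm (f _)]
  ring

theorem locMoment_sum_fold {n S : ℕ} (φ : Fin n → Fin S) (f : ℝ → ℝ) (h : ℝ) (x e : Fin n → ℝ) :
    locMoment f h x e = ∑ s, locMoment f h x fun i => if φ i = s then e i else 0 := by
  rw [← locMoment_sum]
  simp

theorem sum_foldCard {n S : ℕ} (φ : Fin n → Fin S) : ∑ s, foldCard φ s = n := by
  have := Finset.card_eq_sum_card_fiberwise (f := φ) (s := Finset.univ) (t := Finset.univ)
    (fun _ _ => Finset.mem_univ _)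
  rw [Finset.card_univ, Fintype.card_fin] at this
  simp only [foldCard]
  exact_mod_cast this.symm

variable (hS : IsSample P PX κ W fold) (hf : HasRegularDensity PX fX) (hK : IsKernelFunction K)

include hS hf hK in
-- The constant one is the sum of the fold indicators. Their noise parts vanish and their centering
-- constants add up to `n`, which leaves the population integral of the window.
theorem IsPilot.tendsto_locMoment_one (h : IsPilot P PX W K p H) (s : Side) (k : ℕ) :
    Tendsto (fun z => locMoment (sidePow K s k) z.2.2 (sampleX W z.1 z.2.1) fun _ => 1)
      (inProb P H) (𝓝 (fX 0 * ∫ u, sidePow K s k u)) := by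
  obtain ⟨B, -, hB⟩ := hK.exists_isWindow
  have h1 := tendsto_finsetSum (Finset.univ : Finset (Fin S)) fun r _ =>
    h.locNoise_tendsto (hS.isNoise_fold r) s k
  have h2 := (hf.tendsto_integral_window (isWindow_sidePow hB s k)).comp h.bandwidth
  have h3 := h1.add h2
  simp only [Finset.sum_const_zero, zero_add] at h3
  refine h3.congr' ?_
  filter_upwards [h.eventually_pos] with z ⟨_, _, hn⟩
  have hn' : (z.1 : ℝ) ≠ 0 := by positivity
  rw [locMoment_sum_fold (fold z.1 z.2.1)]
  have h4 := fun r => locMoment_eq_locNoise (PX := PX) (W := W)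
    (fun n ω i => if fold n ω i = r then 1 else 0) (fun n ω => foldCard (fold n ω) r)
    (sidePow K s k) z
  simp only [h4, Finset.sum_add_distrib, ← Finset.sum_mul, ← Finset.sum_div, sum_foldCard,
    div_self hn', one_mul, Function.comp]

include hS hf hK in
/-- The Gram matrix of a fold is close to a fixed fraction of the full Gram matrix. -/
theorem IsPilot.tendsto_fold (h : IsPilot P PX W K p H)
    (hsize : ∀ n ω s, |foldCard (fold n ω) s - (n : ℝ) / S| < 1) (r : Fin S) (s : Side) (k : ℕ) :
    Tendsto (fun z : Σ n, Ω n × ℝ => (z.2.2 ^ p)⁻¹ *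
      (locMoment (sidePow K s k) z.2.2 (sampleX W z.1 z.2.1)
        (fun i => if fold z.1 z.2.1 i = r then 1 else 0) -
      (S : ℝ)⁻¹ * locMoment (sidePow K s k) z.2.2 (sampleX W z.1 z.2.1) fun _ => 1))
      (inProb P H) (𝓝 0) := by
  obtain ⟨B, -, hB⟩ := hK.exists_isWindow
  have h2 := (hf.tendsto_integral_window (isWindow_sidePow hB s k)).comp h.bandwidth
  have h4 := fun r => locMoment_eq_locNoise (PX := PX) (W := W)
    (fun n ω i => if fold n ω i = r then 1 else 0) (fun n ω => foldCard (fold n ω) r)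
    (sidePow K s k)
  -- Fold sizes are within one of `n / S`, so the fractions are off by at most `1 / n`, which is
  -- negligible even after division by `h^p`.
  have h5 : Tendsto (fun z : Σ n, Ω n × ℝ => (z.2.2 ^ p)⁻¹ *
      (foldCard (fold z.1 z.2.1) r / z.1 - (S : ℝ)⁻¹)) (inProb P H) (𝓝 0) := by
    rw [tendsto_zero_iff_abs_tendsto_zero]
    refine squeeze_zero' (Eventually.of_forall fun _ => abs_nonneg _) ?_ h.tendsto_inv_rate
    filter_upwards [h.eventually_pos] with z ⟨hz, _, hn⟩
    have hn' : (0 : ℝ) < z.1 := by exact_mod_cast hn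
    simp only [Function.comp, abs_mul]
    rw [abs_of_pos (by positivity)]
    gcongr
    have : foldCard (fold z.1 z.2.1) r / z.1 - (S : ℝ)⁻¹ =
        (z.1 : ℝ)⁻¹ * (foldCard (fold z.1 z.2.1) r - (z.1 : ℝ) / S) := by
      field_simp
    rw [this, abs_mul, abs_of_pos (by positivity)]
    exact mul_le_of_le_one_right (by positivity) (hsize _ _ _).le
  have h6 := ((h.noise _ _ _ (hS.isNoise_fold r) s k).sub ((tendsto_finsetSum
    (Finset.univ : Finset (Fin S)) fun r _ => h.noise _ _ _ (hS.isNoise_fold r) s k).const_mul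
      (S : ℝ)⁻¹)).add (h5.mul h2)
  simp only [Finset.sum_const_zero, mul_zero, sub_zero, zero_mul, add_zero] at h6
  refine h6.congr' ?_
  filter_upwards [h.eventually_pos] with z ⟨_, _, hn⟩
  have hn' : (z.1 : ℝ) ≠ 0 := by positivity
  rw [locMoment_sum_fold (fold z.1 z.2.1) (e := fun _ => 1)]
  simp only [h4, Finset.sum_add_distrib, ← Finset.sum_mul, ← Finset.sum_div, sum_foldCard,
    div_self hn', one_mul, Function.comp, ← Finset.mul_sum]
  ring

/-- The population version of the one-sided Gram matrix. -/
noncomputable def popGram (K : ℝ → ℝ) (s : Side) (p : ℕ) : Matrix (Fin (p + 1)) (Fin (p + 1)) ℝ :=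
  hankel (halfKernel K s) p

/-- Determinant and adjugate are continuous in the entries, so inversion is continuous wherever the
determinant does not vanish. -/
theorem tendsto_matrix_inv {ι m : Type*} [Fintype m] [DecidableEq m] {l : Filter ι}
    {G : ι → Matrix m m ℝ} {G₀ : Matrix m m ℝ} (h : ∀ i j, Tendsto (fun z => G z i j) l (𝓝 (G₀ i j)))
    (h0 : G₀.det ≠ 0) :
    (∀ i j, Tendsto (fun z => (G z)⁻¹ i j) l (𝓝 (G₀⁻¹ i j))) ∧
      ∀ᶠ z in l, IsUnit (G z).det := by
  have h1 : Tendsto G l (𝓝 G₀) := tendsto_pi_nhds.2 fun i => tendsto_pi_nhds.2 fun j => h i j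
  have hdet : Tendsto (fun z => (G z).det) l (𝓝 G₀.det) :=
    ((continuous_id.matrix_det (n := m) (R := ℝ)).tendsto G₀).comp h1
  have hadj : Tendsto (fun z => (G z).adjugate) l (𝓝 G₀.adjugate) :=
    ((continuous_id.matrix_adjugate (n := m) (R := ℝ)).tendsto G₀).comp h1
  refine ⟨fun i j => ?_, (hdet.eventually_ne h0).mono fun z hz => hz.isUnit⟩
  simp only [Matrix.inv_def, Ring.inverse_eq_inv', Matrix.smul_apply, smul_eq_mul]
  exact (hdet.inv₀ h0).mul (tendsto_pi_nhds.1 (tendsto_pi_nhds.1 hadj i) j)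

include hS hf hK in
theorem IsPilot.tendsto_inv_locGram (h : IsPilot P PX W K p H) (s : Side) (r : ℕ) :
    (∀ i j, Tendsto (fun z => (locGram K s r z.2.2 (sampleX W z.1 z.2.1))⁻¹ i j)
      (inProb P H) (𝓝 ((fX 0)⁻¹ * (popGram K s r)⁻¹ i j))) ∧
      ∀ᶠ z in inProb P H, IsUnit (locGram K s r z.2.2 (sampleX W z.1 z.2.1)).det := by
  have hpos : 0 < (popGram K s r).det := (hankel_halfKernel_posDef hK s r).det_pos
  have h1 := tendsto_matrix_inv (l := inProb P H)
    (G := fun z => locGram K s r z.2.2 (sampleX W z.1 z.2.1)) (G₀ := fX 0 • popGram K s r)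
    (fun i j => h.tendsto_locMoment_one hS hf hK s _)
    (by
      rw [Matrix.det_smul]
      exact mul_ne_zero (pow_ne_zero _ hf.pos.ne') hpos.ne')
  refine ⟨fun i j => ?_, h1.2⟩
  have h2 := h1.1 i j
  have h3 : (fX 0 • popGram K s r)⁻¹ = (fX 0)⁻¹ • (popGram K s r)⁻¹ := by
    refine Matrix.inv_eq_left_inv ?_
    rw [Matrix.smul_mul, Matrix.mul_smul, Matrix.nonsing_inv_mul _ hpos.ne'.isUnit, smul_smul,
      inv_mul_cancel₀ hf.pos.ne', one_smul]
  simpa [h3] using h2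

end Pilot

/-! ### Consistency of derivative estimators given a polynomial expansion -/

section Consistency

universe u

variable {Ω : ℕ → Type u} [∀ n, MeasurableSpace (Ω n)] {P : ∀ n, Measure (Ω n)}
  {PX : Measure ℝ} {d : ℕ → ℕ} {W : ∀ n, Fin n → Ω n → Obs (d n)}
  [IsProbabilityMeasure PX] [∀ n, IsProbabilityMeasure (P n)]
  {κ : ∀ n, Kernel ℝ (ℝ × (Fin (d n) → ℝ))} [∀ n, IsMarkovKernel (κ n)] {S : ℕ}
  {fold : ∀ n, Ω n → Fin n → Fin S} {K fX : ℝ → ℝ} {p : ℕ} {H : ℕ → Set ℝ}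

theorem sidePow_eq_zero {K : ℝ → ℝ} (hK : IsKernelFunction K) {s : Side} {k : ℕ} {h x : ℝ}
    (hh : 0 < h) (hx : ¬ (x ∈ s.region ∧ |x| ≤ h)) : sidePow K s k (x / h) = 0 := by
  simp only [sidePow, halfKernel, Set.indicator_apply]
  by_cases h1 : x / h ∈ s.region
  · have h2 : x ∈ s.region := by
      cases s
      · simp only [Side.region, Set.mem_Ici] at h1 ⊢
        rwa [le_div_iff₀ hh, zero_mul] at h1
      · simp only [Side.region, Set.mem_Iio] at h1 ⊢
        rwa [div_lt_iff₀ hh, zero_mul] at h1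
    have h3 : x / h ∉ Set.Icc (-1 : ℝ) 1 := by
      intro h4
      refine hx ⟨h2, ?_⟩
      have := abs_le.2 h4
      rwa [abs_div, abs_of_pos hh, div_le_one hh] at this
    simp [hK.eq_zero _ h3]
  · simp [h1]

theorem abs_sidePow {K : ℝ → ℝ} (hK : IsKernelFunction K) (s : Side) (k : ℕ) (u : ℝ) :
    |sidePow K s k u| = s.sign ^ k * sidePow K s k u := by
  simp only [sidePow, halfKernel]
  by_cases h : u ∈ s.region
  · rw [Set.indicator_of_mem h]
    have hK0 := hK.nonneg u
    rw [abs_mul, abs_of_nonneg hK0, abs_pow, ← mul_assoc, ← mul_pow]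
    congr 2
    cases s
    · simpa [Side.sign, Side.region] using h
    · simp only [Side.region, Set.mem_Iio] at h
      simp [Side.sign, abs_of_neg h]
  · simp [h]

variable (hS : IsSample P PX κ W fold) (hf : HasRegularDensity PX fX) (hK : IsKernelFunction K)

include hS hf hK in
theorem IsPilot.tendsto_locMoment_abs (h : IsPilot P PX W K p H) (s : Side) (k : ℕ) :
    Tendsto (fun z => locMoment (fun u => |sidePow K s k u|) z.2.2 (sampleX W z.1 z.2.1) fun _ => 1)
      (inProb P H) (𝓝 (s.sign ^ k * (fX 0 * ∫ u, sidePow K s k u))) := by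
  refine ((h.tendsto_locMoment_one hS hf hK s k).const_mul _).congr fun z => ?_
  simp only [abs_sidePow hK, locMoment, Finset.mul_sum]
  exact Finset.sum_congr rfl fun i _ => by ring

include hS hf hK in
/-- Errors that are uniformly small on the window make small moments. -/
theorem IsPilot.tendsto_locMoment_of_le (h : IsPilot P PX W K p H) (s : Side) (k : ℕ)
    {e : ∀ z : Σ n, Ω n × ℝ, Fin z.1 → ℝ} {τ : (Σ n, Ω n × ℝ) → ℝ}
    (hτ : Tendsto τ (inProb P H) (𝓝 0))
    (he : ∀ᶠ z in inProb P H, ∀ i, sampleX W z.1 z.2.1 i ∈ s.region →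
      |sampleX W z.1 z.2.1 i| ≤ z.2.2 → |e z i| ≤ τ z) :
    Tendsto (fun z => locMoment (sidePow K s k) z.2.2 (sampleX W z.1 z.2.1) (e z))
      (inProb P H) (𝓝 0) := by
  have h1 := hτ.mul (h.tendsto_locMoment_abs hS hf hK s k)
  rw [zero_mul] at h1
  rw [tendsto_zero_iff_abs_tendsto_zero]
  refine squeeze_zero' (Eventually.of_forall fun _ => abs_nonneg _) ?_ h1
  filter_upwards [he, h.eventually_pos] with z hz ⟨hz0, _, _⟩
  refine (abs_locMoment_le _ hz0 _ _).trans ?_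
  rw [← locMoment_const_mul]
  refine locMoment_mono hz0 _ _ _ fun i => ?_
  by_cases hx : sampleX W z.1 z.2.1 i ∈ s.region ∧ |sampleX W z.1 z.2.1 i| ≤ z.2.2
  · rw [mul_one]
    exact mul_le_mul_of_nonneg_left (hz i hx.1 hx.2) (abs_nonneg _)
  · simp [sidePow_eq_zero hK hz0 hx]

include hS hf hK in
-- The common polynomial `c` is reproduced; the noises and the remainder are negligible at the scale
-- `h^p`. The fold-specific polynomials `a` do not form one polynomial, but the moments of each fold
-- are the share `1 / S` of the full moments up to `o(h^p)`, so they act like a polynomial with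
-- averaged coefficients. Their lower coefficients need only be bounded; the coefficient of order
-- `p` reaches the estimate and has to vanish.
theorem IsPilot.tendsto_betaHat (h : IsPilot P PX W K p H)
    (hsize : ∀ n ω s, |foldCard (fold n ω) s - (n : ℝ) / S| < 1) (s : Side)
    {M : ∀ n, Ω n → Fin n → ℝ} {A₀ A₁ : ℝ} {ε : ∀ n, Ω n → Fin n → ℝ}
    (hε : IsNoise P (sampleX W) PX A₀ ε fun _ _ => 0) {ζ : Fin S → ∀ n, Ω n → Fin n → ℝ}
    (hζ : ∀ r, IsNoise P (sampleX W) PX A₁ (ζ r) fun _ _ => 0)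
    {c : ℕ → ℕ → ℝ} {a : (Σ n, Ω n × ℝ) → Fin S → ℕ → ℝ} {A B : ℝ}
    (hB : 0 ≤ B) (ha : ∀ᶠ z in inProb P H, ∀ r, ∀ j ≤ p, |a z r j| ≤ A)
    (hap : ∀ r, Tendsto (fun z => a z r p) (inProb P H) (𝓝 0))
    (hdec : ∀ᶠ z in inProb P H, ∀ i, sampleX W z.1 z.2.1 i ∈ s.region →
      |sampleX W z.1 z.2.1 i| ≤ z.2.2 →
      |M z.1 z.2.1 i - (∑ j : Fin (p + 1), c z.1 j * sampleX W z.1 z.2.1 i ^ (j : ℕ) +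
        ε z.1 z.2.1 i + ∑ r, ζ r z.1 z.2.1 i + ∑ r, if fold z.1 z.2.1 i = r then
          ∑ j : Fin (p + 1), a z r j * sampleX W z.1 z.2.1 i ^ (j : ℕ) else 0)| ≤
        B * |sampleX W z.1 z.2.1 i| ^ (p + 1)) :
    Tendsto (fun z => betaHat K p (Fin.last p) s z.2.2 (sampleX W z.1 z.2.1) (M z.1 z.2.1) -
      p.factorial * c z.1 p) (inProb P H) (𝓝 0) := by
  set x : ∀ z : Σ n, Ω n × ℝ, Fin z.1 → ℝ := fun z => sampleX W z.1 z.2.1 with hx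
  set D : ℕ → (Σ n, Ω n × ℝ) → ℝ := fun k z => locMoment (sidePow K s k) z.2.2 (x z) fun _ => 1
    with hD
  set Dr : Fin S → ℕ → (Σ n, Ω n × ℝ) → ℝ := fun r k z => locMoment (sidePow K s k) z.2.2 (x z)
    fun i => if fold z.1 z.2.1 i = r then 1 else 0 with hDr
  set b : (Σ n, Ω n × ℝ) → ℕ → ℝ := fun z j => c z.1 j + (S : ℝ)⁻¹ * ∑ r, a z r j with hb
  set R : ∀ z : Σ n, Ω n × ℝ, Fin z.1 → ℝ := fun z i =>
    M z.1 z.2.1 i - (∑ j : Fin (p + 1), c z.1 j * x z i ^ (j : ℕ) +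
        ε z.1 z.2.1 i + ∑ r, ζ r z.1 z.2.1 i + ∑ r, if fold z.1 z.2.1 i = r then
          ∑ j : Fin (p + 1), a z r j * x z i ^ (j : ℕ) else 0) with hR
  -- The deviation of the moments from those of the averaged polynomial, divided by `h^p` because
  -- the estimator of a `p`-th derivative magnifies it by that factor.
  set T : ℕ → (Σ n, Ω n × ℝ) → ℝ := fun k z => (z.2.2 ^ p)⁻¹ *
    (locMoment (sidePow K s k) z.2.2 (x z) (M z.1 z.2.1) -
      ∑ j : Fin (p + 1), b z j * z.2.2 ^ (j : ℕ) * D (k + j) z) with hT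
  have hbw : Tendsto (fun z : Σ n, Ω n × ℝ => z.2.2) (inProb P H) (𝓝 0) :=
    h.bandwidth.mono_right nhdsWithin_le_nhds
  -- powers of the running variable shift the moments
  have hpow : ∀ z : Σ n, Ω n × ℝ, 0 < z.2.2 → ∀ (k j : ℕ) (e : Fin z.1 → ℝ),
      locMoment (sidePow K s k) z.2.2 (x z) (fun i => x z i ^ j * e i) =
        z.2.2 ^ j * locMoment (sidePow K s (k + j)) z.2.2 (x z) e := by
    intro z hz k j e
    simp only [locMoment, Finset.mul_sum]
    refine Finset.sum_congr rfl fun i _ => ?_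
    simp only [sidePow, pow_add, div_pow]
    field_simp
  have hRem : ∀ k, Tendsto (fun z => (z.2.2 ^ p)⁻¹ * locMoment (sidePow K s k) z.2.2 (x z) (R z))
      (inProb P H) (𝓝 0) := by
    intro k
    have := h.tendsto_locMoment_of_le hS hf hK s k (e := fun z i => (z.2.2 ^ p)⁻¹ * R z i)
      (τ := fun z => B * z.2.2) (by simpa using hbw.const_mul B) (by
        filter_upwards [hdec, h.eventually_pos] with z hz ⟨hz0, _, _⟩ i h1 h2
        rw [abs_mul, abs_of_pos (by positivity : 0 < (z.2.2 ^ p)⁻¹), inv_mul_le_iff₀ (by positivity)]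
        refine (hz i h1 h2).trans ?_
        calc B * |x z i| ^ (p + 1) ≤ B * z.2.2 ^ (p + 1) := by gcongr
          _ = z.2.2 ^ p * (B * z.2.2) := by ring)
    simpa only [locMoment_const_mul] using this
  have hTk : ∀ k, Tendsto (T k) (inProb P H) (𝓝 0) := by
    intro k
    have hlim : ∀ (e : ∀ n, Ω n → Fin n → ℝ) {A' : ℝ},
        IsNoise P (sampleX W) PX A' e (fun _ _ => 0) →
        Tendsto (fun z : Σ n, Ω n × ℝ => (z.2.2 ^ p)⁻¹ *
          locMoment (sidePow K s k) z.2.2 (x z) (e z.1 z.2.1)) (inProb P H) (𝓝 0) := by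
      intro e A' he
      refine (h.noise _ _ _ he s k).congr fun z => ?_
      rw [hx, locMoment_eq_locNoise (PX := PX) e (fun _ _ => 0)]
      simp
    -- The gap between fold moments and their share of the full moments is multiplied by
    -- coefficients that stay bounded.
    have hν : ∀ r (j : Fin (p + 1)), Tendsto (fun z : Σ n, Ω n × ℝ => a z r j * z.2.2 ^ (j : ℕ) *
        ((z.2.2 ^ p)⁻¹ * (Dr r (k + j) z - (S : ℝ)⁻¹ * D (k + j) z))) (inProb P H) (𝓝 0) := by
      intro r j
      have h1 := h.tendsto_fold hS hf hK hsize r s (k + j)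
      have h2 := h1.abs.const_mul A
      rw [abs_zero, mul_zero] at h2
      rw [tendsto_zero_iff_abs_tendsto_zero]
      refine squeeze_zero' (Eventually.of_forall fun _ => abs_nonneg _) ?_ h2
      filter_upwards [ha, h.eventually_pos] with z hz ⟨hz0, hz1, _⟩
      simp only [Function.comp]
      rw [abs_mul, abs_mul, abs_of_pos (by positivity : 0 < z.2.2 ^ (j : ℕ))]
      refine mul_le_mul_of_nonneg_right ?_ (abs_nonneg _)
      calc |a z r j| * z.2.2 ^ (j : ℕ) ≤ A * 1 :=
            mul_le_mul (hz r j j.is_le) (pow_le_one₀ hz0.le hz1) (by positivity)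
              ((abs_nonneg _).trans (hz r j j.is_le))
        _ = A := mul_one _
    have hall := (((hlim ε hε).add (tendsto_finsetSum (Finset.univ : Finset (Fin S)) fun r _ =>
      hlim (ζ r) (hζ r))).add (tendsto_finsetSum (Finset.univ : Finset (Fin S)) fun r _ =>
        tendsto_finsetSum (Finset.univ : Finset (Fin (p + 1))) fun j _ => hν r j)).add (hRem k)
    simp only [Finset.sum_const_zero, add_zero] at hall
    refine hall.congr' ?_
    filter_upwards [h.eventually_pos] with z ⟨hz0, _, _⟩
    have hMdec : locMoment (sidePow K s k) z.2.2 (x z) (M z.1 z.2.1) =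
        ∑ j : Fin (p + 1), c z.1 j * z.2.2 ^ (j : ℕ) * D (k + j) z +
        locMoment (sidePow K s k) z.2.2 (x z) (ε z.1 z.2.1) +
        ∑ r, locMoment (sidePow K s k) z.2.2 (x z) (ζ r z.1 z.2.1) +
        ∑ r, ∑ j : Fin (p + 1), a z r j * z.2.2 ^ (j : ℕ) * Dr r (k + j) z +
        locMoment (sidePow K s k) z.2.2 (x z) (R z) := by
      have e1 : M z.1 z.2.1 = fun i => (∑ j : Fin (p + 1), c z.1 j * (x z i ^ (j : ℕ) * 1) +
        ε z.1 z.2.1 i + ∑ r, ζ r z.1 z.2.1 i + ∑ r, ∑ j : Fin (p + 1), a z r j *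
          (x z i ^ (j : ℕ) * if fold z.1 z.2.1 i = r then 1 else 0)) + R z i := by
        ext i
        simp only [hR, mul_one, mul_ite, mul_zero, Finset.sum_ite_irrel, Finset.sum_const_zero]
        ring
      conv_lhs => rw [e1]
      simp only [locMoment_add, locMoment_sum, locMoment_const_mul, hpow z hz0]
      simp only [hD, hDr, mul_assoc]
    simp only [hT]
    rw [hMdec]
    simp only [hb, add_mul, mul_add, mul_sub, Finset.sum_add_distrib, Finset.mul_sum,
      Finset.sum_mul, Finset.sum_sub_distrib]
    rw [Finset.sum_comm (s := (Finset.univ : Finset (Fin (p + 1))))]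
    simp only [mul_comm, mul_left_comm, mul_assoc]
    ring
  have hinv := h.tendsto_inv_locGram hS hf hK s p
  have hfin := ((tendsto_finsetSum (Finset.univ : Finset (Fin (p + 1))) fun k _ =>
    (hinv.1 (Fin.last p) k).mul (hTk k)).add ((tendsto_finsetSum (Finset.univ : Finset (Fin S))
      fun r _ => hap r).const_mul (S : ℝ)⁻¹)).const_mul (p.factorial : ℝ)
  simp only [mul_zero, Finset.sum_const_zero, add_zero] at hfin
  refine hfin.congr' ?_
  filter_upwards [hinv.2, h.eventually_pos] with z hu ⟨hz0, _, _⟩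
  rw [betaHat_eq K p _ s hz0]
  -- By exactness on polynomials the regression returns the rescaled coefficients, of which only the
  -- one of order `p` is read off.
  have h1 := inv_locGram_mulVec hu fun j : Fin (p + 1) => b z j * z.2.2 ^ (j : ℕ)
  have h2 : (fun k : Fin (p + 1) => locMoment (sidePow K s k) z.2.2 (x z) (M z.1 z.2.1)) =
      (fun k : Fin (p + 1) => ∑ j : Fin (p + 1), b z j * z.2.2 ^ (j : ℕ) * D (k + j) z) +
        fun k : Fin (p + 1) => z.2.2 ^ p * T k z := by
    ext k
    simp only [hT, Pi.add_apply]
    field_simp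
    ring
  rw [h2, Matrix.mulVec_add, h1]
  simp only [Pi.add_apply, Matrix.mulVec, dotProduct, Fin.val_last, hb]
  have h3 : ∑ k : Fin (p + 1), (locGram K s p z.2.2 (x z))⁻¹ (Fin.last p) k * (z.2.2 ^ p * T k z) =
      z.2.2 ^ p * ∑ k : Fin (p + 1), (locGram K s p z.2.2 (x z))⁻¹ (Fin.last p) k * T k z := by
    rw [Finset.mul_sum]
    exact Finset.sum_congr rfl fun k _ => by ring
  rw [h3]
  field_simp
  ring

end Consistency

/-! ### One-sided polynomial expansions -/

/-- Points other than the cutoff on one side and at distance at most `h`. -/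
def sideSet (s : Side) (h : ℝ) : Set ℝ := {x | x ∈ s.region ∧ x ≠ 0 ∧ |x| ≤ h}

theorem sideSet_plus (h : ℝ) : sideSet .plus h = Set.Ioc 0 h := by
  ext x
  simp only [sideSet, Side.region, Set.mem_Ici, Set.mem_ofPred_eq, Set.mem_Ioc]
  constructor
  · rintro ⟨h1, h2, h3⟩
    exact ⟨lt_of_le_of_ne h1 (Ne.symm h2), (le_abs_self x).trans h3⟩
  · rintro ⟨h1, h2⟩
    exact ⟨h1.le, h1.ne', by rwa [abs_of_pos h1]⟩

theorem sideSet_minus (h : ℝ) : sideSet .minus h = Set.Ico (-h) 0 := by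
  ext x
  simp only [sideSet, Side.region, Set.mem_Iio, Set.mem_ofPred_eq, Set.mem_Ico]
  constructor
  · rintro ⟨h1, h2, h3⟩
    exact ⟨(abs_le.1 h3).1, h1⟩
  · rintro ⟨h1, h2⟩
    exact ⟨h2, h2.ne, by rw [abs_of_neg h2]; linarith⟩

theorem convex_sideSet (s : Side) (h : ℝ) : Convex ℝ (sideSet s h) := by
  cases s
  · rw [sideSet_plus]; exact convex_Ioc _ _
  · rw [sideSet_minus]; exact convex_Ico _ _

theorem nhdsWithin_sideSet (s : Side) {h : ℝ} (hh : 0 < h) : 𝓝[sideSet s h] (0 : ℝ) = s.filter := by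
  cases s
  · rw [sideSet_plus, Side.filter, nhdsWithin_Ioc_eq_nhdsGT hh]
  · rw [sideSet_minus, Side.filter, nhdsWithin_Ico_eq_nhdsLT (by linarith)]

instance (s : Side) : s.filter.NeBot := by
  cases s
  · exact inferInstanceAs (𝓝[>] (0 : ℝ)).NeBot
  · exact inferInstanceAs (𝓝[<] (0 : ℝ)).NeBot

theorem sideSet_mem_filter (s : Side) {h : ℝ} (hh : 0 < h) : sideSet s h ∈ s.filter := by
  rw [← nhdsWithin_sideSet s hh]
  exact self_mem_nhdsWithin

theorem mul_pos_of_mem_region {s : Side} {x y : ℝ} (hx : x ∈ s.region) (hx0 : x ≠ 0)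
    (hy : y ∈ s.region) (hy0 : y ≠ 0) : 0 < x * y := by
  cases s
  · exact mul_pos (lt_of_le_of_ne hx (Ne.symm hx0)) (lt_of_le_of_ne hy (Ne.symm hy0))
  · exact mul_pos_of_neg_of_neg hx hy

/-- A function that is Lipschitz on a side has a one-sided limit at the cutoff. -/
theorem LipschitzOnSides.tendsto {L : ℝ} {𝒳 : Set ℝ} {f : ℝ → ℝ} (hf : LipschitzOnSides L 𝒳 f)
    (s : Side) {ρ : ℝ} (hρ : 0 < ρ) (hsub : Set.Icc (-ρ) ρ ⊆ 𝒳) :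
    Tendsto f s.filter (𝓝 (sideLim s f)) ∧
      ∀ x ∈ 𝒳, x ∈ s.region → x ≠ 0 → |f x - sideLim s f| ≤ L * |x| := by
  have hmem : ∀ x ∈ sideSet s ρ, x ∈ 𝒳 := fun x hx => hsub (abs_le.1 hx.2.2)
  have : (𝓝[sideSet s ρ] (0 : ℝ)).NeBot := by rw [nhdsWithin_sideSet s hρ]; infer_instance
  obtain ⟨l, hl⟩ := exists_tendsto_of_lipschitz (S := sideSet s ρ) (f := f) (L := L)
    (fun x hx y hy => hf x (hmem x hx) y (hmem y hy)
      (mul_pos_of_mem_region hx.1 hx.2.1 hy.1 hy.2.1)) 0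
  rw [nhdsWithin_sideSet s hρ] at hl
  have hl' : sideLim s f = l := hl.limUnder_eq
  rw [hl']
  refine ⟨hl, fun x hx hxs hx0 => ?_⟩
  have h1 : Tendsto (fun y => |f x - f y|) s.filter (𝓝 |f x - l|) := (tendsto_const_nhds.sub hl).abs
  have h2 : Tendsto (fun y => L * |x - y|) s.filter (𝓝 (L * |x|)) := by
    have h3 : Tendsto (fun y : ℝ => y) s.filter (𝓝 0) := by
      rw [← nhdsWithin_sideSet s hρ]
      exact tendsto_id.mono_left nhdsWithin_le_nhds
    simpa using ((tendsto_const_nhds (x := x)).sub h3).abs.const_mul L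
  refine le_of_tendsto_of_tendsto h1 h2 ?_
  filter_upwards [sideSet_mem_filter s hρ] with y hy
  exact hf x hx y (hmem y hy) (mul_pos_of_mem_region hxs hx0 hy.1 hy.2.1)

/-- A bounded derivative of order `p + 1` gives the `p`-th derivative a one-sided limit with linear
error; integrating `p` times yields the expansion. -/
theorem exists_expansion_of_bound (s : Side) {h : ℝ} (hh : 0 < h) (p : ℕ) {f : ℕ → ℝ → ℝ}
    (hf : ∀ j ≤ p, ∀ x ∈ sideSet s h, HasDerivWithinAt (f j) (f (j + 1) x) (sideSet s h) x)
    {B : ℝ} (hB : ∀ x ∈ sideSet s h, |f (p + 1) x| ≤ B) :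
    ∃ c : ℕ → ℝ, (∀ j ≤ p, Tendsto (f j) s.filter (𝓝 (c j))) ∧
      ∀ x ∈ sideSet s h, |f 0 x - ∑ j ∈ Finset.range (p + 1), c j / (j.factorial : ℝ) * x ^ j| ≤
        B * |x| ^ (p + 1) := by
  have : (𝓝[sideSet s h] (0 : ℝ)).NeBot := by rw [nhdsWithin_sideSet s hh]; infer_instance
  obtain ⟨l, hl, hlB⟩ := exists_expansion_of_deriv (convex_sideSet s h) (hf p le_rfl) (Q := fun _ => 0)
    (q := fun _ => 0) (fun x => hasDerivAt_const x 0) rfl (B := B) (k := 0)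
    (fun x hx => by simpa using hB x hx)
  obtain ⟨c, hc1, hc2, hc3⟩ := exists_taylor_expansion (convex_sideSet s h) p f
    (fun j hj => hf j hj.le) (L := l) (B := B) (fun x hx => by simpa using hlB x hx)
  rw [nhdsWithin_sideSet s hh] at hl hc2
  refine ⟨c, fun j hj => ?_, hc3⟩
  rcases hj.lt_or_eq with hj | rfl
  · exact hc2 j hj
  · rw [hc1]; exact hl

theorem iteratedDerivWithin_eq_of_nhds {f : ℝ → ℝ} {S : Set ℝ} {x : ℝ} (hS : S ∈ 𝓝 x) (j : ℕ) :
    iteratedDerivWithin j f S x = iteratedDeriv j f x := by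
  rw [← iteratedDerivWithin_univ, iteratedDerivWithin, iteratedDerivWithin]
  rw [iteratedFDerivWithin_congr_set]
  filter_upwards [hS] with y hy
  exact propext ⟨fun _ => trivial, fun _ => hy⟩

/-- Expansion of the conditional mean of the adjusted outcome on one side of the cutoff. -/
theorem exists_outcome_expansion {𝒳 : Set ℝ} {g : ℝ → ℝ} {C L : ℝ}
    (hg : ContDiffOn ℝ 4 g (𝒳 \ {0}))
    (h2 : LipschitzOnSides L 𝒳 (iteratedDerivWithin 2 g (𝒳 \ {0})))
    (h4 : ∀ x ∈ 𝒳 \ {0}, |iteratedDerivWithin 4 g (𝒳 \ {0}) x| ≤ C) {ρ : ℝ} (hρ : 0 < ρ)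
    (hsub : Set.Icc (-ρ) ρ ⊆ 𝒳) (s : Side) {p : ℕ} (hp : p = 2 ∨ p = 3) :
    ∃ c : ℕ → ℝ, p.factorial * c p = sideLim s (iteratedDeriv p g) ∧
      Tendsto (iteratedDeriv p g) s.filter (𝓝 (sideLim s (iteratedDeriv p g))) ∧
      ∀ x ∈ sideSet s (ρ / 2), |g x - ∑ j : Fin (p + 1), c j * x ^ (j : ℕ)| ≤
        max C L * |x| ^ (p + 1) := by
  -- Half the radius keeps the window in the interior of `𝒳`, where derivatives within the set are
  -- ordinary derivatives.
  set O := sideSet s (ρ / 2) with hO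
  have hρ2 : 0 < ρ / 2 := by linarith
  have hnhds : ∀ x ∈ O, 𝒳 \ {0} ∈ 𝓝 x := by
    intro x hx
    have h1 : Set.Ioo (-ρ) ρ \ {0} ∈ 𝓝 x := by
      refine (isOpen_Ioo.sdiff isClosed_singleton).mem_nhds ⟨?_, hx.2.1⟩
      have := abs_le.1 hx.2.2
      exact ⟨by linarith, by linarith⟩
    exact mem_of_superset h1 (Set.sdiff_subset_sdiff_left (Set.Ioo_subset_Icc_self.trans hsub))
  have hder : ∀ j < 4, ∀ x ∈ O,
      HasDerivWithinAt (iteratedDeriv j g) (iteratedDeriv (j + 1) g x) O x := by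
    intro j hj x hx
    have h1 : ContDiffAt ℝ 4 g x := hg.contDiffAt (hnhds x hx)
    have h2 : DifferentiableAt ℝ (iteratedDeriv j g) x := by
      have := ContDiffWithinAt.differentiableWithinAt_iteratedDerivWithin
        (contDiffWithinAt_univ.2 h1) (m := j) (by exact_mod_cast hj) (by simp [uniqueDiffOn_univ])
      rwa [iteratedDerivWithin_univ, differentiableWithinAt_univ] at this
    rw [iteratedDeriv_succ]
    exact h2.hasDerivAt.hasDerivWithinAt
  have hmem : ∀ x ∈ O, x ∈ 𝒳 \ {0} := fun x hx => mem_of_mem_nhds (hnhds x hx)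
  have key : ∃ c : ℕ → ℝ, Tendsto (iteratedDeriv p g) s.filter (𝓝 (c p)) ∧
      ∀ x ∈ O, |g x - ∑ j ∈ Finset.range (p + 1), c j / (j.factorial : ℝ) * x ^ j| ≤
        max C L * |x| ^ (p + 1) := by
    -- For `p = 2` the linear error comes from the Lipschitz second derivative, for `p = 3` from the
    -- bounded fourth derivative.
    rcases hp with rfl | rfl
    · have : (𝓝[O] (0 : ℝ)).NeBot := by rw [hO, nhdsWithin_sideSet s hρ2]; infer_instance
      have h1 := h2.tendsto s hρ hsub
      set l := sideLim s (iteratedDerivWithin 2 g (𝒳 \ {0}))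
      obtain ⟨c, hc1, hc2, hc3⟩ := exists_taylor_expansion (convex_sideSet s (ρ / 2)) 2
        (fun j => iteratedDeriv j g) (fun j hj => hder j (by omega)) (L := l) (B := L)
        (fun x hx => by
          rw [← iteratedDerivWithin_eq_of_nhds (hnhds x hx)]
          exact h1.2 x (hmem x hx).1 hx.1 hx.2.1)
      refine ⟨c, ?_, fun x hx => ?_⟩
      · rw [hc1]
        refine h1.1.congr' ?_
        filter_upwards [sideSet_mem_filter s hρ2] with x hx
        exact iteratedDerivWithin_eq_of_nhds (hnhds x hx) 2
      · refine le_trans (by simpa using hc3 x hx) ?_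
        gcongr
        exact le_max_right _ _
    · obtain ⟨c, hc1, hc2⟩ := exists_expansion_of_bound s hρ2 3 (f := fun j => iteratedDeriv j g)
        (fun j hj => hder j (by omega)) (B := C) (fun x hx => by
          rw [← iteratedDerivWithin_eq_of_nhds (hnhds x hx)]
          exact h4 x (hmem x hx))
      refine ⟨c, hc1 3 le_rfl, fun x hx => ?_⟩
      refine le_trans (by simpa using hc2 x hx) ?_
      gcongr
      exact le_max_left _ _
  obtain ⟨c, hc1, hc2⟩ := key
  have hlim : sideLim s (iteratedDeriv p g) = c p := hc1.limUnder_eq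
  refine ⟨fun j => c j / j.factorial, ?_, by rwa [hlim], fun x hx => ?_⟩
  · rw [hlim]; field_simp
  · rw [Fin.sum_univ_eq_sum_range (fun j => c j / (j.factorial : ℝ) * x ^ j)]
    exact hc2 x hx

/-- From `|t| ≤ 1/2 + t²/2`. -/
theorem abs_integral_le_one {U : Type*} [MeasurableSpace U] {μ : Measure U} [IsProbabilityMeasure μ]
    {f : U → ℝ} (h : ∫⁻ u, ENNReal.ofReal (f u ^ 2) ∂μ ≤ 1) : |∫ u, f u ∂μ| ≤ 1 := by
  have h1 : ∫⁻ u, ENNReal.ofReal ‖f u‖ ∂μ ≤ 1 := by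
    calc _ ≤ ∫⁻ u, (ENNReal.ofReal (1 / 2) + ENNReal.ofReal (1 / 2) * ENNReal.ofReal (f u ^ 2)) ∂μ := by
          refine lintegral_mono fun u => ?_
          rw [← ENNReal.ofReal_mul (by norm_num), ← ENNReal.ofReal_add (by norm_num) (by positivity)]
          refine ENNReal.ofReal_le_ofReal ?_
          rw [Real.norm_eq_abs, ← sq_abs (f u)]
          nlinarith [sq_nonneg (|f u| - 1)]
      _ ≤ ENNReal.ofReal (1 / 2) + ENNReal.ofReal (1 / 2) * 1 := by
          rw [lintegral_add_left measurable_const, lintegral_const_mul' _ _ ENNReal.ofReal_ne_top]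
          gcongr
          simp
      _ = 1 := by
          rw [mul_one, ← ENNReal.ofReal_add (by norm_num) (by norm_num)]
          norm_num
  have h2 := norm_integral_le_lintegral_norm (μ := μ) f
  rw [Real.norm_eq_abs] at h2
  refine h2.trans ?_
  have := ENNReal.toReal_mono ENNReal.one_ne_top h1
  simpa using this

section StageExpansion

variable {d : ℕ → ℕ} {κ : ∀ n, Kernel ℝ (ℝ × (Fin (d n) → ℝ))} [∀ n, IsMarkovKernel (κ n)]
  {𝒳 : Set ℝ} {T : ∀ n, Set ((Fin (d n) → ℝ) → ℝ)} {ηbar : ∀ n, (Fin (d n) → ℝ) → ℝ}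

theorem FirstStageConcentration.exists_bound (h : FirstStageConcentration 𝒳 κ T ηbar) :
    ∃ c : ℕ → ℝ, Tendsto c atTop (𝓝 0) ∧ (∀ n, 0 ≤ c n) ∧ ∀ᶠ n in atTop, ∀ η ∈ T n, ∀ x ∈ 𝒳,
      ∫⁻ w, ENNReal.ofReal ((ηbar n w.2 - η w.2) ^ 2) ∂(κ n x) ≤ ENNReal.ofReal (c n) := by
  obtain ⟨r, hr, C, hC⟩ := h
  refine ⟨fun n => |C| * r n ^ 2, by simpa using (hr.pow 2).const_mul |C|,
    fun n => by positivity, hC.mono fun n hn η hη x hx => ?_⟩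
  simp_rw [← sub_sq_comm (η _)]
  refine (hn η hη x hx).trans (ENNReal.ofReal_le_ofReal ?_)
  gcongr
  exact le_abs_self C

/-- Expansion of the conditional mean of the first-stage error, uniformly over the realization
set. -/
theorem FirstStageDerivatives.exists_expansion (hconc : FirstStageConcentration 𝒳 κ T ηbar)
    {h : ℕ → ℝ} (hD : FirstStageDerivatives 𝒳 κ T ηbar h) (hpos : ∀ᶠ n in atTop, 0 < h n)
    (h0 : Tendsto h atTop (𝓝 0)) {ρ : ℝ} (hρ : 0 < ρ) (hsub : Set.Icc (-ρ) ρ ⊆ 𝒳) (s : Side)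
    {p : ℕ} (hp1 : 1 ≤ p) (hp3 : p ≤ 3) :
    ∃ δ : ℕ → ℝ, Tendsto δ atTop (𝓝 0) ∧ ∀ᶠ n in atTop, ∀ η ∈ T n, ∃ a : ℕ → ℝ,
      (∀ j ≤ p, |a j| ≤ 1) ∧ |a p| ≤ δ n ∧ ∀ x ∈ sideSet s (h n),
        |condMean (κ n) (fun w => ηbar n w.2 - η w.2) x - ∑ j : Fin (p + 1), a j * x ^ (j : ℕ)| ≤
          1 * |x| ^ (p + 1) := by
  obtain ⟨v, hv, C, hC⟩ := hD
  obtain ⟨r, hr0, hr1, hr⟩ := hconc.exists_bound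
  -- A single rate for the four derivatives: the sum dominates each of them.
  set δ : ℕ → ℝ := fun n => ∑ j ∈ Finset.Icc 1 4, |C * v j n| with hδ
  have hδ0 : Tendsto δ atTop (𝓝 0) := by
    have := tendsto_finsetSum (Finset.Icc 1 4) fun j hj => ((hv j hj).const_mul C).abs
    simpa only [mul_zero, abs_zero, Finset.sum_const_zero] using this
  have hδj : ∀ n, ∀ j ∈ Finset.Icc 1 4, C * v j n ≤ δ n := fun n j hj =>
    (le_abs_self _).trans (Finset.single_le_sum (f := fun j => |C * v j n|)
      (fun _ _ => abs_nonneg _) hj)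
  refine ⟨δ, hδ0, ?_⟩
  filter_upwards [hC, hr, hpos, h0.eventually_le_const hρ, hδ0.eventually_le_const one_pos,
    hr0.eventually_le_const one_pos] with n hCn hrn hhn hhρ hδ1 hr1n η hη
  obtain ⟨hdiff, hbd⟩ := hCn η hη
  set S := (𝒳 ∩ Set.Icc (-h n) (h n)) \ {0} with hS
  set g := condMean (κ n) fun w => η w.2 - ηbar n w.2 with hg
  have hsubS : sideSet s (h n) ⊆ S := fun x hx =>
    ⟨⟨hsub ⟨by linarith [(abs_le.1 hx.2.2).1], by linarith [(abs_le.1 hx.2.2).2]⟩,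
      abs_le.1 hx.2.2⟩, hx.2.1⟩
  obtain ⟨c, hc1, hc2⟩ := exists_expansion_of_bound s hhn p (f := fun j => iteratedDerivWithin j g S)
    (fun j hj x hx => by
      have h1 := (hdiff j (by omega) x (hsubS hx)).hasDerivWithinAt.mono hsubS
      rwa [← iteratedDerivWithin_succ] at h1) (B := δ n)
    (fun x hx => (hbd (p + 1) (by simp; omega) x (hsubS hx)).trans
      (hδj n _ (by simp; omega)))
  simp only [iteratedDerivWithin_zero] at hc2
  have hcj : ∀ j ≤ p, 1 ≤ j → |c j| ≤ δ n := by
    intro j hj hj1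
    refine le_of_tendsto (hc1 j hj).abs ?_
    filter_upwards [sideSet_mem_filter s hhn] with x hx
    exact (hbd j (by simp; omega) x (hsubS hx)).trans (hδj n _ (by simp; omega))
  -- No derivative bound controls the level of the first-stage error; the mean square concentration
  -- does.
  have hc0 : |c 0| ≤ 1 := by
    refine le_of_tendsto (hc1 0 (by omega)).abs ?_
    filter_upwards [sideSet_mem_filter s hhn] with x hx
    simp only [iteratedDerivWithin_zero]
    refine abs_integral_le_one ?_
    simp_rw [sub_sq_comm (η _)]
    refine (hrn η hη x (hsubS hx).1.1).trans ?_
    rw [← ENNReal.ofReal_one]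
    exact ENNReal.ofReal_le_ofReal hr1n
  have hdivle : ∀ (j : ℕ) (t : ℝ), |-(t / (j.factorial : ℝ))| ≤ |t| := by
    intro j t
    rw [abs_neg, abs_div, Nat.abs_cast]
    exact div_le_self (abs_nonneg _) (by exact_mod_cast j.factorial_pos)
  refine ⟨fun j => -(c j / j.factorial), fun j hj => (hdivle j _).trans ?_,
    (hdivle p _).trans (hcj p le_rfl hp1), fun x hx => ?_⟩
  · rcases Nat.eq_zero_or_pos j with rfl | hj0
    · exact hc0
    · exact (hcj j hj hj0).trans hδ1
  · have h1 : condMean (κ n) (fun w => ηbar n w.2 - η w.2) x = -g x := by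
      simp only [hg, condMean]
      rw [← integral_neg]
      simp
    rw [h1, Fin.sum_univ_eq_sum_range (fun j => -(c j / (j.factorial : ℝ)) * x ^ j)]
    have h2 : -g x - ∑ j ∈ Finset.range (p + 1), -(c j / (j.factorial : ℝ)) * x ^ j =
        -(g x - ∑ j ∈ Finset.range (p + 1), c j / (j.factorial : ℝ) * x ^ j) := by
      simp only [neg_mul, Finset.sum_neg_distrib]; ring
    rw [h2, abs_neg]
    refine (hc2 x hx).trans ?_
    gcongr

end StageExpansion

/-! ### The model and its consequences for derivative estimators -/

section Model

universe u

variable {Ω : ℕ → Type u} [∀ n, MeasurableSpace (Ω n)]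

/-- The assumptions that are maintained throughout, apart from those on bandwidths. -/
structure IsModel (P : ∀ n, Measure (Ω n)) (PX : Measure ℝ) (fX K : ℝ → ℝ) {d : ℕ → ℕ}
    (κ : ∀ n, Kernel ℝ (ℝ × (Fin (d n) → ℝ))) (W : ∀ n, Fin n → Ω n → Obs (d n)) {S : ℕ}
    (fold : ∀ n, Ω n → Fin n → Fin S)
    (est : ∀ n, (I : Finset (Fin n)) → (I → Obs (d n)) → (Fin (d n) → ℝ) → ℝ)
    (T : ∀ n, Set ((Fin (d n) → ℝ) → ℝ)) (ηbar : ∀ n, (Fin (d n) → ℝ) → ℝ) : Prop where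
  kernel : IsKernelFunction K
  density : HasRegularDensity PX fX
  bdd : Bornology.IsBounded PX.support
  integrable : ∀ n, ∀ x ∈ PX.support, Integrable (fun w => w.1) (κ n x)
  sample : IsSample P PX κ W fold
  size : ∀ n ω s, |foldCard (fold n ω) s - (n : ℝ) / S| < 1
  est_meas : ∀ n I, Measurable (Function.uncurry (est n I))
  admissible : ∀ n, ∀ η ∈ T n, IsAdmissible PX.support (κ n) η
  mem : ∀ n, ηbar n ∈ T n
  hat : ∀ s, HoldsWPA1 P fun n => {ω | etaHat (est n) (fold n ω) (fun i => W n i ω) s ∈ T n}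
  conc : FirstStageConcentration PX.support κ T ηbar
  reg : OutcomeRegularity PX.support κ ηbar

variable {P : ∀ n, Measure (Ω n)} [∀ n, IsProbabilityMeasure (P n)] {PX : Measure ℝ}
  [IsProbabilityMeasure PX] {fX K : ℝ → ℝ} {d : ℕ → ℕ}
  {κ : ∀ n, Kernel ℝ (ℝ × (Fin (d n) → ℝ))} [∀ n, IsMarkovKernel (κ n)]
  {W : ∀ n, Fin n → Ω n → Obs (d n)} {S : ℕ} {fold : ∀ n, Ω n → Fin n → Fin S}
  {est : ∀ n, (I : Finset (Fin n)) → (I → Obs (d n)) → (Fin (d n) → ℝ) → ℝ}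
  {T : ∀ n, Set ((Fin (d n) → ℝ) → ℝ)} {ηbar : ∀ n, (Fin (d n) → ℝ) → ℝ}

/-- The cross-fitted outcomes of the samples. -/
noncomputable def sampleM (est : ∀ n, (I : Finset (Fin n)) → (I → Obs (d n)) → (Fin (d n) → ℝ) → ℝ)
    (fold : ∀ n, Ω n → Fin n → Fin S) (W : ∀ n, Fin n → Ω n → Obs (d n)) (n : ℕ) (ω : Ω n) :
    Fin n → ℝ := crossFitted (est n) (fold n ω) fun i => W n i ω

/-- The conditional mean of the adjusted outcome. -/
noncomputable def popMean (κ : ∀ n, Kernel ℝ (ℝ × (Fin (d n) → ℝ)))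
    (ηbar : ∀ n, (Fin (d n) → ℝ) → ℝ) (n : ℕ) : ℝ → ℝ := condMean (κ n) (adjusted (ηbar n))

theorem IsModel.exists_moments (h : IsModel P PX fX K κ W fold est T ηbar) :
    ∃ C q, ∀ n, HasOutcomeMoments PX.support (κ n) (ηbar n) C q := by
  obtain ⟨C, L, q, hC, hq, hreg⟩ := h.reg
  refine ⟨C, q, fun n => ⟨(h.admissible n _ (h.mem n)).1, fun x hx => ?_, fun x hx => ?_, hq, hC.le⟩⟩
  · exact (h.integrable n x hx).sub ((h.admissible n _ (h.mem n)).2.1 x hx)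
  · exact (hreg n).2.2.2.1 x hx

/-- The running variable almost surely lies in its support and, having no atoms, avoids zero; the
first-stage condition concerns finitely many folds. -/
theorem IsModel.eventually_good (h : IsModel P PX fX K κ W fold est T ηbar) (H : ℕ → Set ℝ) :
    ∀ᶠ z in inProb P H,
      (∀ r, etaHat (est z.1) (fold z.1 z.2.1) (fun i => W z.1 i z.2.1) r ∈ T z.1) ∧
      ∀ i, sampleX W z.1 z.2.1 i ∈ PX.support ∧ sampleX W z.1 z.2.1 i ≠ 0 := by
  have h1 : ∀ᶠ z in inProb P H,
      ∀ r, etaHat (est z.1) (fold z.1 z.2.1) (fun i => W z.1 i z.2.1) r ∈ T z.1 :=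
    eventually_all.2 fun r => eventually_inProb_of_holds (h.hat r)
  have h2 : ∀ᶠ z in inProb P H,
      ∀ i, sampleX W z.1 z.2.1 i ∈ PX.support ∧ sampleX W z.1 z.2.1 i ≠ 0 := by
    refine eventually_inProb_of_ae fun n => ?_
    have := h.density.nullSingletonClass
    have h3 : ∀ᵐ x ∂PX, x ∈ PX.support ∧ x ≠ 0 :=
      (show ∀ᵐ x ∂PX, x ∈ PX.support from PX.support_mem_ae).and
        (by simp [ae_iff])
    have h4 := h.sample.ae (n := n) (p := fun w => ∀ i, (w i).1 ∈ PX.support ∧ (w i).1 ≠ 0)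
      (ae_all_iff.2 fun i => ae_sampleLaw_of_ae h3 i)
    filter_upwards [h4] with ω hω _ _ using hω
  exact h1.and h2

/-- The first-stage error of unit `i`. -/
noncomputable def errAt (est : ∀ n, (I : Finset (Fin n)) → (I → Obs (d n)) → (Fin (d n) → ℝ) → ℝ)
    (ηbar : ∀ n, (Fin (d n) → ℝ) → ℝ) (fold : ∀ n, Ω n → Fin n → Fin S)
    (W : ∀ n, Fin n → Ω n → Obs (d n)) (n : ℕ) (ω : Ω n) (i : Fin n) : ℝ :=
  stageErr (est n) (ηbar n) (fold n ω) (fold n ω i) (fun k => W n k ω) (W n i ω).2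

theorem sampleM_eq (n : ℕ) (ω : Ω n) (i : Fin n) :
    sampleM est fold W n ω i = popMean κ ηbar n (sampleX W n ω i) +
      outcomeErr (κ n) (ηbar n) (W n i ω) + errAt est ηbar fold W n ω i := by
  simp only [sampleM, crossFitted, popMean, sampleX, runX, outcomeErr, errAt, stageErr, adjusted]
  ring

/-- The outcome is a smooth mean plus an outcome error plus a first-stage error. The last splits
fold by fold into a conditionally centered part and a conditional mean whose expansion has a
vanishing coefficient of order `p`. -/
theorem IsModel.tendsto_betaHat (h : IsModel P PX fX K κ W fold est T ηbar) {H : ℕ → Set ℝ} {hi : ℕ → ℝ}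
    {p : ℕ} (hp : p = 2 ∨ p = 3) (hpilot : IsPilot P PX W K p H)
    (hH : ∀ᶠ n in atTop, ∀ k ∈ H n, k ≤ hi n) (hpos : ∀ᶠ n in atTop, 0 < hi n) (h0 : Tendsto hi atTop (𝓝 0))
    (hD : FirstStageDerivatives PX.support κ T ηbar hi) (s : Side) :
    Tendsto (fun z => betaHat K p (Fin.last p) s z.2.2 (sampleX W z.1 z.2.1)
      (sampleM est fold W z.1 z.2.1) - betaPop (κ z.1) (adjusted (ηbar z.1)) p s)
      (inProb P H) (𝓝 0) := by
  obtain ⟨ρ, hρ, hsub⟩ := h.density.exists_Icc_subset_support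
  obtain ⟨Cm, q, hmom⟩ := h.exists_moments
  obtain ⟨c, hc0, hc1, hc⟩ := h.conc.exists_bound
  obtain ⟨C, L, _, hC, -, hreg⟩ := h.reg
  have hg := fun n => exists_outcome_expansion (hreg n).1 ((hreg n).2.1 2 (by simp)).1
    ((hreg n).2.1 4 (by simp)).2 hρ hsub s hp
  choose cg hcg1 hcg2 hcg3 using hg
  obtain ⟨δ, hδ, hst⟩ := hD.exists_expansion h.conc hpos h0 hρ hsub s (p := p)
    (by omega) (by omega)
  have hgood := h.eventually_good H
  have hev : ∀ᶠ z in inProb P H, ∃ a : Fin S → ℕ → ℝ, ∀ r, (∀ j ≤ p, |a r j| ≤ 1) ∧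
      |a r p| ≤ δ z.1 ∧ ∀ x ∈ sideSet s (hi z.1),
        |condMean (κ z.1) (stageErr (est z.1) (ηbar z.1) (fold z.1 z.2.1) r
          fun k => W z.1 k z.2.1) x - ∑ j : Fin (p + 1), a r j * x ^ (j : ℕ)| ≤
          1 * |x| ^ (p + 1) := by
    filter_upwards [hgood, tendsto_fst_inProb.eventually hst] with z hz hst
    choose a ha using fun r => hst _ (hz.1 r)
    exact ⟨a, ha⟩
  -- The coefficients may be chosen pointwise, since convergence along the filter requires no
  -- measurability.
  obtain ⟨a, ha⟩ := skolem.1 hev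
  have hhi : ∀ᶠ z in inProb P H, z.2.2 ≤ hi z.1 ∧ hi z.1 ≤ ρ / 2 :=
    eventually_inProb_of_forall (((h0.eventually_le_const (by linarith)).and hH).mono
      fun n hn ω k hk => ⟨hn.2 k hk, hn.1⟩)
  have key := hpilot.tendsto_betaHat h.sample h.density h.kernel h.size s
    (M := fun n ω => sampleM est fold W n ω)
    (h.sample.isNoise_outcomeErr hmom)
    (fun r => h.sample.isNoise_centErr h.est_meas (fun n => (hmom n).meas)
      (hc0.eventually_le_const one_pos) r) (c := cg) (a := a) (A := 1) (B := max C L + 1)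
    (by have := le_max_left C L; linarith)
    (ha.mono fun z hz r => (hz r).1)
    (fun r => by
      rw [tendsto_zero_iff_abs_tendsto_zero]
      exact squeeze_zero' (Eventually.of_forall fun _ => abs_nonneg _)
        (ha.mono fun z hz => (hz r).2.1) (tendsto_inProb_self hδ))
    (by
      filter_upwards [ha, hgood, hhi, tendsto_fst_inProb.eventually hc] with z hz ⟨hT, hX⟩
        ⟨hzh, hhρ⟩ hcz i hi1 hi2
      obtain ⟨n, ω, k⟩ := z
      simp only at hz hT hX hzh hhρ hcz hi1 hi2 ⊢
      set x := sampleX W n ω i with hx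
      have hxs : x ∈ sideSet s (hi n) := ⟨hi1, (hX i).2, hi2.trans hzh⟩
      have hxs' : x ∈ sideSet s (ρ / 2) := ⟨hi1, (hX i).2, (hi2.trans hzh).trans hhρ⟩
      have e1 := (hz (fold n ω i)).2.2 x hxs
      have e2 := hcg3 n x hxs'
      -- On the good event the truncation is inactive, so the centered error is the actual one minus
      -- its conditional mean.
      have hcs : condSq (κ n) (stageErr (est n) (ηbar n) (fold n ω) (fold n ω i)) i
          (fun k => W n k ω) ≤ ENNReal.ofReal (c n) := hcz _ (hT _) x (hX i).1
      have e3 : (∑ r, if fold n ω i = r then centErr (κ n) (c n)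
          (stageErr (est n) (ηbar n) (fold n ω) r) i (fun k => W n k ω) else 0) =
          errAt est ηbar fold W n ω i - condMean (κ n) (stageErr (est n) (ηbar n) (fold n ω)
            (fold n ω i) fun k => W n k ω) x := by
        rw [Finset.sum_ite_eq, if_pos (Finset.mem_univ _), centErr, if_pos hcs]
        rfl
      rw [e3, Finset.sum_ite_eq, if_pos (Finset.mem_univ _), sampleM_eq (κ := κ) (ηbar := ηbar)]
      rw [add_mul]
      refine le_trans (le_of_eq ?_) ((abs_add_le _ _).trans (add_le_add e2 e1))
      congr 1
      simp only [popMean]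
      ring)
  refine key.congr fun z => ?_
  rw [hcg1]
  rfl

end Model

/-! ### Nearest neighbors -/

section Neighbors

variable {n R : ℕ}

/-- No two running variables coincide, and no two units are equally far from a third one. -/
def TieFree (x : Fin n → ℝ) : Prop :=
  ∀ i j k, (j ≠ i → x j ≠ x i) ∧ (j ≠ i → j ≠ k → x j ≠ 2 * x i - x k)

theorem TieFree.abs_ne {x : Fin n → ℝ} (hx : TieFree x) {i j k : Fin n} (hji : j ≠ i) (hjk : j ≠ k) :
    |x j - x i| ≠ |x k - x i| := by
  intro h
  rcases abs_eq_abs.1 h with h | h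
  · exact (hx k j k).1 hjk (by linarith)
  · exact (hx i j k).2 hji hjk (by linarith)

open Classical in
/-- The units on the side of `i` that are closer to `i` than `j` is. -/
noncomputable def closer (x : Fin n → ℝ) (i j : Fin n) : Finset (Fin n) :=
  Finset.univ.filter fun k => k ≠ i ∧ (0 ≤ x k ↔ 0 ≤ x i) ∧ |x k - x i| < |x j - x i|

theorem mem_neighbors {x : Fin n → ℝ} {i j : Fin n} : j ∈ neighbors R x i ↔
    j ≠ i ∧ (0 ≤ x j ↔ 0 ≤ x i) ∧ (closer x i j).card < R := by
  simp [neighbors, closer]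

theorem mem_closer {x : Fin n → ℝ} {i j k : Fin n} : k ∈ closer x i j ↔
    k ≠ i ∧ (0 ≤ x k ↔ 0 ≤ x i) ∧ |x k - x i| < |x j - x i| := by
  simp [closer]

/-- Without ties, all neighbors other than the farthest one are strictly closer to `i` than that
one, so there are fewer than `R` of them. -/
theorem card_neighbors_le {x : Fin n → ℝ} (hx : TieFree x) (i : Fin n) :
    (neighbors R x i).card ≤ R := by
  rcases (neighbors R x i).eq_empty_or_nonempty with h | h
  · simp [h]
  obtain ⟨j, hj, hmax⟩ := Finset.exists_max_image _ (fun j => |x j - x i|) h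
  have hsub : (neighbors R x i).erase j ⊆ closer x i j := by
    intro k hk
    obtain ⟨hkj, hk⟩ := Finset.mem_erase.1 hk
    have h1 := mem_neighbors.1 hk
    exact mem_closer.2 ⟨h1.1, h1.2.1, lt_of_le_of_ne (hmax k hk) (hx.abs_ne h1.1 hkj)⟩
  have h1 := Finset.card_le_card hsub
  rw [Finset.card_erase_of_mem hj] at h1
  have := (mem_neighbors.1 hj).2.2
  omega

/-- With fewer than `R` neighbors, take the nearest unit on the same side that is not one of them:
only neighbors are closer to `i`, so it would itself qualify. -/
theorem card_neighbors_eq {x : Fin n → ℝ} (hx : TieFree x) {i : Fin n} {t : Finset (Fin n)}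
    (ht : ∀ k ∈ t, k ≠ i ∧ (0 ≤ x k ↔ 0 ≤ x i)) (hcard : R ≤ t.card) :
    (neighbors R x i).card = R := by
  refine le_antisymm (card_neighbors_le hx i) ?_
  by_contra! hlt
  have hne : (t \ neighbors R x i).Nonempty := by
    rw [← Finset.card_pos]
    have := Finset.le_card_sdiff (neighbors R x i) t
    omega
  obtain ⟨j, hj, hmin⟩ := Finset.exists_min_image
    (Finset.univ.filter fun k => k ∉ neighbors R x i ∧ k ≠ i ∧ (0 ≤ x k ↔ 0 ≤ x i))
    (fun j => |x j - x i|) (by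
      obtain ⟨k, hk⟩ := hne
      obtain ⟨h1, h2⟩ := Finset.mem_sdiff.1 hk
      exact ⟨k, by simpa using ⟨h2, ht k h1⟩⟩)
  simp only [Finset.mem_filter, Finset.mem_univ, true_and] at hj hmin
  refine hj.1 (mem_neighbors.2 ⟨hj.2.1, hj.2.2, lt_of_le_of_lt (Finset.card_le_card ?_) hlt⟩)
  intro k hk
  have h1 := mem_closer.1 hk
  by_contra hkn
  exact absurd (hmin k ⟨hkn, h1.1, h1.2.1⟩) (not_le.2 h1.2.2)

theorem abs_sub_le_of_mem_neighbors {x : Fin n → ℝ} {i j : Fin n} {t : Finset (Fin n)} {r : ℝ}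
    (ht : ∀ k ∈ t, k ≠ i ∧ (0 ≤ x k ↔ 0 ≤ x i) ∧ |x k - x i| ≤ r) (hcard : R ≤ t.card)
    (hj : j ∈ neighbors R x i) : |x j - x i| ≤ r := by
  by_contra! hlt
  have h1 : t ⊆ closer x i j := fun k hk =>
    mem_closer.2 ⟨(ht k hk).1, (ht k hk).2.1, (ht k hk).2.2.trans_lt hlt⟩
  have h2 := Finset.card_le_card h1
  have h3 := (mem_neighbors.1 hj).2.2
  omega

/-- Among the units in one direction that have `j` as a neighbor, take the farthest. The others lie
between it and `j`, hence are closer to it than `j` is, so in each of the two directions there are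
at most `R`. -/
theorem card_neighbor_of_le {x : Fin n → ℝ} (hx : TieFree x) (j : Fin n) :
    (Finset.univ.filter fun i => j ∈ neighbors R x i).card ≤ 2 * R := by
  classical
  have key : ∀ σ : ℝ, σ ≠ 0 →
      (Finset.univ.filter fun i => j ∈ neighbors R x i ∧ σ * x j < σ * x i).card ≤ R := by
    intro σ hσ
    set t := Finset.univ.filter fun i => j ∈ neighbors R x i ∧ σ * x j < σ * x i with ht
    rcases t.eq_empty_or_nonempty with h | h
    · simp [h]
    obtain ⟨i, hi, hmax⟩ := Finset.exists_max_image t (fun i => σ * x i) h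
    have hi' := (Finset.mem_filter.1 hi).2
    have hsub : t.erase i ⊆ closer x i j := by
      intro k hk
      obtain ⟨hki, hk⟩ := Finset.mem_erase.1 hk
      have hk' := (Finset.mem_filter.1 hk).2
      refine mem_closer.2 ⟨hki, ?_, ?_⟩
      · rw [← (mem_neighbors.1 hk'.1).2.1, (mem_neighbors.1 hi'.1).2.1]
      · have h1 : σ * x k < σ * x i := lt_of_le_of_ne (hmax k hk) fun h2 =>
          (hx i k i).1 hki (mul_left_cancel₀ hσ h2)
        have h3 : |σ| * |x k - x i| < |σ| * |x j - x i| := by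
          rw [← abs_mul, ← abs_mul, abs_of_neg (by linarith), abs_of_neg (by linarith)]
          linarith
        exact lt_of_mul_lt_mul_left h3 (abs_nonneg _)
    have h1 := Finset.card_le_card hsub
    rw [Finset.card_erase_of_mem hi] at h1
    have := (mem_neighbors.1 hi'.1).2.2
    omega
  have hunion : (Finset.univ.filter fun i => j ∈ neighbors R x i) ⊆
      (Finset.univ.filter fun i => j ∈ neighbors R x i ∧ 1 * x j < 1 * x i) ∪
      (Finset.univ.filter fun i => j ∈ neighbors R x i ∧ -1 * x j < -1 * x i) := by
    intro i hi
    have hi' := (Finset.mem_filter.1 hi).2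
    have hne : x j ≠ x i := (hx i j i).1 (mem_neighbors.1 hi').1
    rcases lt_or_gt_of_ne hne with h | h
    · exact Finset.mem_union_left _ (by simpa using ⟨hi', h⟩)
    · exact Finset.mem_union_right _ (by simpa using ⟨hi', h⟩)
  refine (Finset.card_le_card hunion).trans ((Finset.card_union_le _ _).trans ?_)
  have h1 := key 1 one_ne_zero
  have h2 := key (-1) (by norm_num)
  omega

/-- The deviation of `m i` from the average over the nearest neighbors. -/
noncomputable def nnResid (R : ℕ) (x m : Fin n → ℝ) (i : Fin n) : ℝ :=
  m i - 1 / (R : ℝ) * ∑ j ∈ neighbors R x i, m j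

open Classical in
/-- The coefficients of `nnResid`. -/
noncomputable def nnCoef (R : ℕ) (x : Fin n → ℝ) (i j : Fin n) : ℝ :=
  (if j = i then 1 else 0) - if j ∈ neighbors R x i then 1 / (R : ℝ) else 0

theorem nnResid_eq (x m : Fin n → ℝ) (i : Fin n) :
    nnResid R x m i = ∑ j, nnCoef R x i j * m j := by
  simp only [nnResid, nnCoef, sub_mul, ite_mul, one_mul, zero_mul, Finset.sum_sub_distrib,
    Finset.sum_ite_eq', Finset.mem_univ, if_true, ← Finset.sum_filter, Finset.mul_sum]
  congr 1
  exact Finset.sum_congr (by ext; simp) fun _ _ => rfl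

theorem nnResid_add (x m m' : Fin n → ℝ) (i : Fin n) :
    nnResid R x (fun j => m j + m' j) i = nnResid R x m i + nnResid R x m' i := by
  simp only [nnResid_eq, mul_add, Finset.sum_add_distrib]

theorem abs_nnCoef_le (x : Fin n → ℝ) (i j : Fin n) : |nnCoef R x i j| ≤
    (if j = i then 1 else 0) + if j ∈ neighbors R x i then 1 / (R : ℝ) else 0 := by
  rw [nnCoef]
  refine (abs_sub _ _).trans (le_of_eq ?_)
  rw [abs_of_nonneg, abs_of_nonneg] <;> split_ifs <;> positivity

theorem abs_nnCoef_le_two (hR : 0 < R) (x : Fin n → ℝ) (i j : Fin n) : |nnCoef R x i j| ≤ 2 := by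
  refine (abs_nnCoef_le x i j).trans ?_
  have h1 : 1 / (R : ℝ) ≤ 1 := by
    rw [div_le_one (by positivity)]; exact_mod_cast hR
  split_ifs <;> linarith [show (0 : ℝ) ≤ 1 / (R : ℝ) by positivity]

theorem sum_abs_nnCoef_le (hR : 0 < R) {x : Fin n → ℝ} (hx : TieFree x) (i : Fin n) :
    ∑ j, |nnCoef R x i j| ≤ 2 := by
  classical
  refine (Finset.sum_le_sum fun j _ => abs_nnCoef_le x i j).trans ?_
  rw [Finset.sum_add_distrib, Finset.sum_ite_eq', if_pos (Finset.mem_univ _), ← Finset.sum_filter,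
    Finset.sum_const, nsmul_eq_mul]
  have h1 : (Finset.univ.filter fun j => j ∈ neighbors R x i).card ≤ R := by
    refine le_trans (le_of_eq ?_) (card_neighbors_le hx i)
    congr 1; ext; simp
  have h2 : ((Finset.univ.filter fun j => j ∈ neighbors R x i).card : ℝ) * (1 / (R : ℝ)) ≤ 1 := by
    rw [mul_one_div, div_le_one (by positivity)]
    exact_mod_cast h1
  linarith

/-- A unit enters its own deviation with weight one and at most `2 R` other deviations with weight
`1 / R`. -/
theorem sum_abs_nnCoef_le' (hR : 0 < R) {x : Fin n → ℝ} (hx : TieFree x) (j : Fin n) :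
    ∑ i, |nnCoef R x i j| ≤ 3 := by
  classical
  refine (Finset.sum_le_sum fun i _ => abs_nnCoef_le x i j).trans ?_
  rw [Finset.sum_add_distrib, Finset.sum_ite_eq, if_pos (Finset.mem_univ _), ← Finset.sum_filter,
    Finset.sum_const, nsmul_eq_mul]
  have h2 : ((Finset.univ.filter fun i => j ∈ neighbors R x i).card : ℝ) * (1 / (R : ℝ)) ≤ 2 := by
    rw [mul_one_div, div_le_iff₀ (by positivity)]
    exact_mod_cast card_neighbor_of_le hx j
  linarith

theorem nnResid_sq_le (hR : 0 < R) {x : Fin n → ℝ} (hx : TieFree x) (m : Fin n → ℝ) (i : Fin n) :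
    nnResid R x m i ^ 2 ≤ 2 * ∑ j, |nnCoef R x i j| * m j ^ 2 := by
  rw [nnResid_eq]
  have h1 := Finset.sum_mul_sq_le_sq_mul_sq Finset.univ (fun j => √|nnCoef R x i j|)
    (fun j => √|nnCoef R x i j| * |m j|)
  simp only [mul_pow, Real.sq_sqrt (abs_nonneg _), sq_abs, ← mul_assoc,
    Real.mul_self_sqrt (abs_nonneg _)] at h1
  have h2 : (∑ j, nnCoef R x i j * m j) ^ 2 ≤ (∑ j, |nnCoef R x i j| * |m j|) ^ 2 := by
    refine sq_le_sq' ?_ ?_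
    · have := Finset.abs_sum_le_sum_abs (fun j => nnCoef R x i j * m j) Finset.univ
      simp only [abs_mul] at this
      linarith [neg_abs_le (∑ j, nnCoef R x i j * m j)]
    · exact Finset.sum_le_sum fun j _ => by rw [← abs_mul]; exact le_abs_self _
  refine h2.trans (h1.trans ?_)
  exact mul_le_mul_of_nonneg_right (sum_abs_nnCoef_le hR hx i)
    (Finset.sum_nonneg fun j _ => by positivity)

/-- One for the unit itself and `R` times `1 / R²` for its neighbors; the factor `R / (R + 1)` of
the variance estimator undoes this. -/
theorem sum_nnCoef_sq (hR : 0 < R) {x : Fin n → ℝ} {i : Fin n} (hcard : (neighbors R x i).card = R) :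
    ∑ j, nnCoef R x i j ^ 2 = (R + 1 : ℝ) / R := by
  classical
  have h1 : ∀ j, nnCoef R x i j ^ 2 = (if j = i then 1 else 0) +
      if j ∈ neighbors R x i then (1 / (R : ℝ)) ^ 2 else 0 := by
    intro j
    by_cases hj : j = i
    · have : j ∉ neighbors R x i := fun h => (mem_neighbors.1 h).1 hj
      simp [nnCoef, hj] at this ⊢
      simp [this]
    · by_cases h : j ∈ neighbors R x i <;> simp [nnCoef, hj, h]
  simp only [h1, Finset.sum_add_distrib, Finset.sum_ite_eq', Finset.mem_univ, if_true,
    Finset.sum_ite_mem, Finset.univ_inter, Finset.sum_const, nsmul_eq_mul, hcard]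
  field_simp

theorem measurable_nnCoef (i j : Fin n) : Measurable fun x : Fin n → ℝ => nnCoef R x i j := by
  classical
  refine measurable_const.sub (Measurable.ite ?_ measurable_const measurable_const)
  have hside : ∀ k, MeasurableSet {x : Fin n → ℝ | 0 ≤ x k ↔ 0 ≤ x i} := fun k =>
    (measurableSet_le measurable_const (measurable_pi_apply k)).iff
      (measurableSet_le measurable_const (measurable_pi_apply i))
  have hclo : Measurable fun x : Fin n → ℝ => (closer x i j).card := by
    have : (fun x : Fin n → ℝ => (closer x i j).card) = fun x => ∑ k : Fin n,
        if k ≠ i ∧ (0 ≤ x k ↔ 0 ≤ x i) ∧ |x k - x i| < |x j - x i| then 1 else 0 := by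
      ext x
      rw [closer, Finset.card_filter]
    rw [this]
    refine Finset.measurable_fun_sum _ fun k _ => Measurable.ite ?_ measurable_const measurable_const
    have hlt : MeasurableSet {x : Fin n → ℝ | |x k - x i| < |x j - x i|} :=
      measurableSet_lt (by fun_prop) (by fun_prop)
    exact (MeasurableSet.const _).inter ((hside k).inter hlt)
  have hset : {x : Fin n → ℝ | j ∈ neighbors R x i} =
      {x | j ≠ i} ∩ ({x | 0 ≤ x j ↔ 0 ≤ x i} ∩ {x | (closer x i j).card < R}) := by
    ext x; exact mem_neighbors
  rw [hset]
  exact (MeasurableSet.const _).inter ((hside j).inter (measurableSet_lt hclo measurable_const))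

/-- Each excluded coincidence makes one running variable a function of the others, which has
probability zero in the absence of atoms. -/
theorem ae_tieFree {U : Type*} [MeasurableSpace U] {PX : Measure ℝ} [IsProbabilityMeasure PX]
    [NullSingletonClass PX] {κ : Kernel ℝ U} [IsMarkovKernel κ] :
    ∀ᵐ w ∂sampleLaw n PX κ, TieFree fun i => (w i).1 := by
  unfold TieFree
  refine ae_all_iff.2 fun i => ae_all_iff.2 fun j => ae_all_iff.2 fun k => ?_
  have h1 : ∀ᵐ w ∂sampleLaw n PX κ, j ≠ i → (w j).1 ≠ (w i).1 := by
    by_cases hji : j = i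
    · simp [hji]
    · filter_upwards [ae_fst_ne (κ := κ) j (F := fun x => x i) (measurable_pi_apply i)
        (fun x y => by simp [Ne.symm hji])] with w hw _ using hw
  have h2 : ∀ᵐ w ∂sampleLaw n PX κ, j ≠ i → j ≠ k → (w j).1 ≠ 2 * (w i).1 - (w k).1 := by
    by_cases hji : j = i
    · simp [hji]
    by_cases hjk : j = k
    · simp [hjk]
    filter_upwards [ae_fst_ne (κ := κ) j (F := fun x => 2 * x i - x k) (by fun_prop)
      (fun x y => by simp [Ne.symm hji, Ne.symm hjk])] with w hw _ _ using hw
  exact h1.and h2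

/-- Squared deviations from neighbors have second moments of the same order as the outcomes. -/
theorem lintegral_sum_nnResid_sq_le {U : Type*} [MeasurableSpace U] {PX : Measure ℝ}
    [IsProbabilityMeasure PX] [NullSingletonClass PX] {κ : Kernel ℝ U} [IsMarkovKernel κ]
    (hR : 0 < R) {c : ℝ} {ψ : Fin n → (Fin n → ℝ × U) → ℝ}
    (hψ : ∀ i, Measurable (ψ i)) (hc : ∀ i, ∀ᵐ w ∂sampleLaw n PX κ,
      ∫⁻ u, ENNReal.ofReal (ψ i (resample i w u) ^ 2) ∂(κ (w i).1) ≤ ENNReal.ofReal c)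
    {b : ℝ → ℝ} (hb : Measurable b) (hb0 : ∀ t, 0 ≤ b t) {B : ℝ} (hB : ∀ t, b t ≤ B) :
    ∫⁻ w, ENNReal.ofReal (∑ i, b (w i).1 * nnResid R (fun k => (w k).1) (fun k => ψ k w) i ^ 2)
      ∂sampleLaw n PX κ ≤ ENNReal.ofReal c * ENNReal.ofReal (4 * (n * ∫ t, b t ∂PX)) := by
  have ham : ∀ j, Measurable fun x : Fin n → ℝ => ∑ i, b (x i) * (2 * |nnCoef R x i j|) := fun j =>
    Finset.measurable_fun_sum _ fun i _ => (hb.comp (measurable_pi_apply i)).mul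
      (((measurable_nnCoef i j).abs).const_mul 2)
  -- Exchanging sums gives unit `j` the total weight with which it enters all deviations. This
  -- weight depends on the running variables only, so the conditional second moments of `ψ` can be
  -- pulled out.
  have h1 := lintegral_sum_weighted_sq_le (PX := PX) hψ hc
    (a := fun j x => ∑ i, b (x i) * (2 * |nnCoef R x i j|)) ham
    (fun j x => Finset.sum_nonneg fun i _ => mul_nonneg (hb0 _) (by positivity))
  have htf : ∀ᵐ w ∂sampleLaw n PX κ, TieFree fun i => (w i).1 := ae_tieFree
  refine (lintegral_mono_ae ?_).trans (h1.trans ?_)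
  · filter_upwards [htf] with w hw
    refine ENNReal.ofReal_le_ofReal ?_
    simp only [Finset.sum_mul]
    rw [Finset.sum_comm]
    refine Finset.sum_le_sum fun i _ => ?_
    refine (mul_le_mul_of_nonneg_left (nnResid_sq_le hR hw _ i) (hb0 _)).trans (le_of_eq ?_)
    rw [Finset.mul_sum, Finset.mul_sum]
    exact Finset.sum_congr rfl fun j _ => by ring
  · gcongr
    have h2 : ∫⁻ w, ENNReal.ofReal (∑ i, 4 * b (w i).1) ∂sampleLaw n PX κ ≤
        ENNReal.ofReal (4 * (n * ∫ t, b t ∂PX)) := by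
      refine (lintegral_sum_comp_fst (κ := κ) (φ := fun t => 4 * b t) (by fun_prop)
        (fun t => by have := hb0 t; positivity) (B := 4 * B) (fun t => by have := hB t; linarith)
        Finset.univ).trans (le_of_eq ?_)
      rw [integral_const_mul]
      congr 1; ring
    refine (lintegral_mono_ae ?_).trans h2
    filter_upwards [htf] with w hw
    refine ENNReal.ofReal_le_ofReal ?_
    rw [Finset.sum_comm]
    refine Finset.sum_le_sum fun i _ => ?_
    rw [← Finset.mul_sum, ← Finset.mul_sum, mul_comm]
    refine mul_le_mul_of_nonneg_right ?_ (hb0 _)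
    linarith [sum_abs_nnCoef_le hR hw i]

end Neighbors

/-! ### Truncation of the outcome errors -/

section Truncation

/-- Truncation to `[-τ, τ]`. -/
def clip (τ t : ℝ) : ℝ := max (-τ) (min τ t)

theorem abs_clip_le {τ : ℝ} (hτ : 0 ≤ τ) (t : ℝ) : |clip τ t| ≤ τ :=
  abs_le.2 ⟨le_max_left _ _, max_le (by linarith) (min_le_left _ _)⟩

theorem measurable_clip (τ : ℝ) : Measurable (clip τ) := by unfold clip; fun_prop

/-- Beyond the level `τ` one has `t² = |t|^(2-q) |t|^q`, and the exponent `2 - q` is negative. -/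
theorem sub_clip_sq_le {τ q : ℝ} (hτ : 0 < τ) (hq : 2 < q) (t : ℝ) :
    (t - clip τ t) ^ 2 ≤ τ ^ (2 - q) * |t| ^ q := by
  by_cases ht : |t| ≤ τ
  · have : clip τ t = t := by
      obtain ⟨h1, h2⟩ := abs_le.1 ht
      rw [clip, min_eq_right h2, max_eq_right h1]
    rw [this, sub_self, zero_pow two_ne_zero]
    positivity
  · push Not at ht
    have h1 : |t - clip τ t| ≤ |t| := by
      rcases lt_abs.1 ht with h | h
      · have h2 : clip τ t = τ := by rw [clip, min_eq_left h.le, max_eq_right (by linarith)]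
        rw [h2, abs_of_pos (sub_pos.2 h), abs_of_pos (hτ.trans h)]
        linarith
      · have h2 : clip τ t = -τ := by
          rw [clip, min_eq_right (by linarith), max_eq_left (by linarith)]
        rw [h2, abs_of_neg (by linarith : t - -τ < 0), abs_of_neg (by linarith : t < 0)]
        linarith
    have ht0 : 0 < |t| := hτ.trans ht
    calc (t - clip τ t) ^ 2 = |t - clip τ t| ^ 2 := (sq_abs _).symm
      _ ≤ |t| ^ 2 := by gcongr
      _ = |t| ^ (2 - q) * |t| ^ q := by
          rw [← Real.rpow_add ht0, ← Real.rpow_two]; congr 1; ring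
      _ ≤ τ ^ (2 - q) * |t| ^ q := by
          have h2 : (2 : ℝ) - q ≤ 0 := by linarith
          exact mul_le_mul_of_nonneg_right (Real.rpow_le_rpow_of_nonpos hτ ht.le h2) (by positivity)

variable {e : ℕ} {κ : Kernel ℝ (ℝ × (Fin e → ℝ))} [IsMarkovKernel κ] {η : (Fin e → ℝ) → ℝ}

/-- The truncated and recentered outcome error. -/
noncomputable def clipErr (κ : Kernel ℝ (ℝ × (Fin e → ℝ))) (η : (Fin e → ℝ) → ℝ) (τ : ℝ)
    (y : Obs e) : ℝ :=
  clip τ (outcomeErr κ η y) - ∫ u, clip τ (outcomeErr κ η (y.1, u)) ∂(κ y.1)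

/-- The conditional second moment of `clipErr`. -/
noncomputable def clipVar (κ : Kernel ℝ (ℝ × (Fin e → ℝ))) (η : (Fin e → ℝ) → ℝ) (τ : ℝ)
    (x : ℝ) : ℝ := ∫ u, clipErr κ η τ (x, u) ^ 2 ∂(κ x)

theorem measurable_clipErr (hη : Measurable η) (τ : ℝ) : Measurable (clipErr κ η τ) := by
  have h1 : Measurable fun y => clip τ (outcomeErr κ η y) :=
    (measurable_clip τ).comp (measurable_outcomeErr hη)
  have h2 : Measurable fun x => ∫ u, clip τ (outcomeErr κ η (x, u)) ∂(κ x) :=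
    (StronglyMeasurable.integral_kernel_prod_right (κ := κ)
      (f := fun x u => clip τ (outcomeErr κ η (x, u))) h1.stronglyMeasurable).measurable
  exact h1.sub (h2.comp measurable_fst)

theorem integrable_clip (hη : Measurable η) {τ : ℝ} (hτ : 0 ≤ τ) (x : ℝ) :
    Integrable (fun u => clip τ (outcomeErr κ η (x, u))) (κ x) :=
  Integrable.of_bound ((measurable_clip τ).comp ((measurable_outcomeErr hη).comp
    measurable_prodMk_left)).aestronglyMeasurable τ
    (Eventually.of_forall fun u => by simpa using abs_clip_le hτ _)

theorem abs_clipErr_le {τ : ℝ} (hτ : 0 ≤ τ) (y : Obs e) : |clipErr κ η τ y| ≤ 2 * τ := by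
  have h1 := abs_clip_le hτ (outcomeErr κ η y)
  have h2 : |∫ u, clip τ (outcomeErr κ η (y.1, u)) ∂(κ y.1)| ≤ τ := by
    have := norm_integral_le_of_norm_le_const (μ := κ y.1) (C := τ)
      (f := fun u => clip τ (outcomeErr κ η (y.1, u)))
      (Eventually.of_forall fun u => by simpa using abs_clip_le hτ _)
    simpa using this
  rw [clipErr]
  refine (abs_sub _ _).trans ?_
  linarith

theorem integral_clipErr (hη : Measurable η) {τ : ℝ} (hτ : 0 ≤ τ) (x : ℝ) :
    ∫ u, clipErr κ η τ (x, u) ∂(κ x) = 0 := by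
  simp only [clipErr]
  rw [integral_sub (integrable_clip hη hτ x) (integrable_const _)]
  simp

variable {𝒳 : Set ℝ} {C q : ℝ}

theorem HasOutcomeMoments.integrable_outcomeErr (h : HasOutcomeMoments 𝒳 κ η C q) {x : ℝ}
    (hx : x ∈ 𝒳) : Integrable (fun u => outcomeErr κ η (x, u)) (κ x) ∧
      ∫ u, outcomeErr κ η (x, u) ∂(κ x) = 0 := by
  have h1 := h.integrable x hx
  refine ⟨h1.sub (integrable_const (condMean κ (adjusted η) x)), ?_⟩
  simp only [outcomeErr]
  rw [integral_sub h1 (integrable_const _)]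
  simp [condMean]

/-- As the outcome error has conditional mean zero, it differs from its truncated and recentered
version by the centered truncation residual. Centering does not increase second moments, and the
moment of order `q` bounds the tail. -/
theorem HasOutcomeMoments.lintegral_sub_clipErr_sq_le (h : HasOutcomeMoments 𝒳 κ η C q) {x : ℝ}
    (hx : x ∈ 𝒳) {τ : ℝ} (hτ : 0 < τ) :
    ∫⁻ u, ENNReal.ofReal ((outcomeErr κ η (x, u) - clipErr κ η τ (x, u)) ^ 2) ∂(κ x) ≤
      ENNReal.ofReal ((C + 1) * τ ^ (2 - q)) := by
  set r : ℝ × (Fin e → ℝ) → ℝ := fun u =>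
    outcomeErr κ η (x, u) - clip τ (outcomeErr κ η (x, u)) with hr
  have hεm : Measurable fun u => outcomeErr κ η (x, u) :=
    (measurable_outcomeErr h.meas).comp measurable_prodMk_left
  have hrm : Measurable r := hεm.sub ((measurable_clip τ).comp hεm)
  have h1 : ∫⁻ u, ENNReal.ofReal (r u ^ 2) ∂(κ x) ≤ ENNReal.ofReal ((C + 1) * τ ^ (2 - q)) := by
    calc _ ≤ ∫⁻ u, ENNReal.ofReal (τ ^ (2 - q)) *
          ENNReal.ofReal (|outcomeErr κ η (x, u)| ^ q) ∂(κ x) := by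
          refine lintegral_mono fun u => ?_
          rw [← ENNReal.ofReal_mul (by positivity)]
          exact ENNReal.ofReal_le_ofReal (sub_clip_sq_le hτ h.two_lt _)
      _ ≤ ENNReal.ofReal (τ ^ (2 - q)) * ENNReal.ofReal C := by
          rw [lintegral_const_mul' _ _ ENNReal.ofReal_ne_top]
          gcongr
          exact h.moment x hx
      _ ≤ _ := by
          rw [← ENNReal.ofReal_mul (by positivity)]
          refine ENNReal.ofReal_le_ofReal ?_
          have : 0 ≤ τ ^ (2 - q) := by positivity
          nlinarith
  have hL : MemLp r 2 (κ x) :=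
    memLp_two_of_lintegral hrm.aestronglyMeasurable (h1.trans_lt ENNReal.ofReal_lt_top)
  refine le_trans (le_of_eq (lintegral_congr fun u => ?_)) ((lintegral_sub_integral_sq_le hL).trans h1)
  have h2 : ∫ v, r v ∂(κ x) = -∫ v, clip τ (outcomeErr κ η (x, v)) ∂(κ x) := by
    rw [hr, integral_sub (h.integrable_outcomeErr hx).1 (integrable_clip h.meas hτ.le x),
      (h.integrable_outcomeErr hx).2, zero_sub]
  rw [h2, clipErr]
  congr 2
  simp only [hr]
  ring

theorem HasOutcomeMoments.abs_clipVar_sub_le (h : HasOutcomeMoments 𝒳 κ η C q) {x : ℝ}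
    (hx : x ∈ 𝒳) {τ θ : ℝ} (hτ : 0 < τ) (hθ : θ = (C + 1) * τ ^ (2 - q)) :
    |clipVar κ η τ x - condVar κ (adjusted η) x| ≤ √θ * (2 + C) + θ := by
  have hC := h.nonneg
  have hθ0 : 0 < θ := by rw [hθ]; positivity
  set ε : ℝ × (Fin e → ℝ) → ℝ := fun u => outcomeErr κ η (x, u) with hε
  set ξ : ℝ × (Fin e → ℝ) → ℝ := fun u => clipErr κ η τ (x, u) with hξ
  have hεm : Measurable ε := (measurable_outcomeErr h.meas).comp measurable_prodMk_left
  have hξm : Measurable ξ := (measurable_clipErr h.meas τ).comp measurable_prodMk_left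
  have hεL : MemLp ε 2 (κ x) :=
    memLp_two_of_lintegral hεm.aestronglyMeasurable ((h.sq_le hx).trans_lt ENNReal.ofReal_lt_top)
  have hδL : MemLp (fun u => ε u - ξ u) 2 (κ x) :=
    memLp_two_of_lintegral (hεm.sub hξm).aestronglyMeasurable
      ((h.lintegral_sub_clipErr_sq_le hx hτ).trans_lt ENNReal.ofReal_lt_top)
  have hξL : MemLp ξ 2 (κ x) := MemLp.of_bound hξm.aestronglyMeasurable (2 * τ)
    (Eventually.of_forall fun u => by simpa using abs_clipErr_le hτ.le _)
  have e1 : ∫ u, ε u ^ 2 ∂(κ x) ≤ 1 + C := by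
    have := h.sq_le hx
    rw [← ofReal_integral_sq hεL] at this
    exact (ENNReal.ofReal_le_ofReal_iff (by positivity)).1 this
  have e2 : ∫ u, (ε u - ξ u) ^ 2 ∂(κ x) ≤ θ := by
    have := h.lintegral_sub_clipErr_sq_le hx hτ
    rw [← hθ, ← ofReal_integral_sq hδL] at this
    exact (ENNReal.ofReal_le_ofReal_iff hθ0.le).1 this
  have e3 : condVar κ (adjusted η) x = ∫ u, ε u ^ 2 ∂(κ x) :=
    variance_eq_integral (measurable_adjusted h.meas).aemeasurable
  rw [e3, clipVar, ← integral_sub hξL.integrable_sq hεL.integrable_sq]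
  -- Weighting by `√θ` balances the cross term between a square with bounded integral and one with
  -- integral at most `θ`.
  set l := √θ with hl
  have hl0 : 0 < l := Real.sqrt_pos.2 hθ0
  calc |∫ u, (ξ u ^ 2 - ε u ^ 2) ∂(κ x)| ≤ ∫ u, |ξ u ^ 2 - ε u ^ 2| ∂(κ x) :=
        abs_integral_le_integral_abs
    _ ≤ ∫ u, (l * ε u ^ 2 + (l⁻¹ + 1) * (ε u - ξ u) ^ 2) ∂(κ x) := by
        refine integral_mono (hξL.integrable_sq.sub hεL.integrable_sq).abs
          ((hεL.integrable_sq.const_mul _).add (hδL.integrable_sq.const_mul _)) fun u => ?_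
        have h3 : 2 * |ε u * (ε u - ξ u)| ≤ l * ε u ^ 2 + l⁻¹ * (ε u - ξ u) ^ 2 := by
          have h4 : l * ε u ^ 2 + l⁻¹ * (ε u - ξ u) ^ 2 - 2 * |ε u * (ε u - ξ u)| =
              l⁻¹ * (l * |ε u| - |ε u - ξ u|) ^ 2 := by
            rw [abs_mul, ← sq_abs (ε u), ← sq_abs (ε u - ξ u)]
            field_simp
            ring
          have : 0 ≤ l⁻¹ * (l * |ε u| - |ε u - ξ u|) ^ 2 := by positivity
          linarith
        have h5 : ξ u ^ 2 - ε u ^ 2 = (ε u - ξ u) ^ 2 - 2 * (ε u * (ε u - ξ u)) := by ring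
        simp only [h5]
        refine (abs_sub _ _).trans ?_
        rw [abs_of_nonneg (sq_nonneg _), abs_mul, abs_two]
        linarith
    _ = l * ∫ u, ε u ^ 2 ∂(κ x) + (l⁻¹ + 1) * ∫ u, (ε u - ξ u) ^ 2 ∂(κ x) := by
        rw [integral_add (hεL.integrable_sq.const_mul _) (hδL.integrable_sq.const_mul _),
          integral_const_mul, integral_const_mul]
    _ ≤ l * (1 + C) + (l⁻¹ + 1) * θ := by gcongr
    _ = l * (2 + C) + θ := by
        have : l⁻¹ * θ = l := by
          rw [← Real.mul_self_sqrt hθ0.le, ← hl]; field_simp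
        linear_combination this

end Truncation

/-! ### Quadratic forms in neighbor deviations -/

section QuadForm

variable {n R : ℕ} {U : Type*} [MeasurableSpace U] {PX : Measure ℝ} [IsProbabilityMeasure PX]
  [NullSingletonClass PX] {κ : Kernel ℝ U} [IsMarkovKernel κ]

/-- Exchanging sums gives a quadratic form with coefficients `∑ b_i c_ij c_ik`. The bounds on row
and column sums of the neighbor coefficients make each coefficient at most `6 B` and their absolute
sum at most `4 ∑ |b_i|`; the orthogonality bound contributes the factor `2 c^4`. -/
theorem lintegral_sq_nnResid_quad_le (hR : 0 < R) {ξ : ℝ × U → ℝ} (hξ : Measurable ξ) {c : ℝ}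
    (hb : ∀ y, |ξ y| ≤ c) (hξ0 : ∀ x, ∫ u, ξ (x, u) ∂(κ x) = 0) {b : ℝ → ℝ} (hbm : Measurable b)
    {B : ℝ} (hB : ∀ t, |b t| ≤ B) :
    ∫⁻ w, ENNReal.ofReal ((∑ i, b (w i).1 * (nnResid R (fun k => (w k).1) (fun k => ξ (w k)) i ^ 2 -
      ∑ j, nnCoef R (fun k => (w k).1) i j ^ 2 * ∫ u, ξ ((w j).1, u) ^ 2 ∂(κ (w j).1))) ^ 2)
      ∂sampleLaw n PX κ ≤ ENNReal.ofReal (48 * c ^ 4 * B * (n * ∫ t, |b t| ∂PX)) := by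
  have hB0 : 0 ≤ B := (abs_nonneg _).trans (hB 0)
  set s : ℝ → ℝ := fun x => ∫ u, ξ (x, u) ^ 2 ∂(κ x) with hs
  set C : Fin n → Fin n → (Fin n → ℝ) → ℝ := fun j k x =>
    ∑ i, b (x i) * (nnCoef R x i j * nnCoef R x i k) with hC
  have hCm : ∀ j k, Measurable (C j k) := fun j k => Finset.measurable_fun_sum _ fun i _ =>
    (hbm.comp (measurable_pi_apply i)).mul ((measurable_nnCoef i j).mul (measurable_nnCoef i k))
  have hCb : ∀ j k x, |C j k x| ≤ n * (B * 4) := by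
    intro j k x
    refine (Finset.abs_sum_le_sum_abs _ _).trans ?_
    have : ∀ i ∈ (Finset.univ : Finset (Fin n)),
        |b (x i) * (nnCoef R x i j * nnCoef R x i k)| ≤ B * 4 := by
      intro i _
      rw [abs_mul, abs_mul]
      have h1 := abs_nnCoef_le_two hR x i j
      have h2 := abs_nnCoef_le_two hR x i k
      have h3 : |nnCoef R x i j| * |nnCoef R x i k| ≤ 2 * 2 :=
        mul_le_mul h1 h2 (abs_nonneg _) (by norm_num)
      exact mul_le_mul (hB _) (by linarith) (by positivity) hB0
    simpa using Finset.sum_le_card_nsmul _ _ _ this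
  have hrw : ∀ w : Fin n → ℝ × U, ∑ i, b (w i).1 *
      (nnResid R (fun k => (w k).1) (fun k => ξ (w k)) i ^ 2 -
      ∑ j, nnCoef R (fun k => (w k).1) i j ^ 2 * s (w j).1) =
      ∑ j, ∑ k, quadTerm C ξ s j k w := by
    intro w
    have h1 : ∀ j k, quadTerm C ξ s j k w = ∑ i, b (w i).1 *
        (nnCoef R (fun k => (w k).1) i j * nnCoef R (fun k => (w k).1) i k *
        (ξ (w j) * ξ (w k) - if j = k then s (w j).1 else 0)) := by
      intro j k
      simp only [quadTerm, hC, Finset.sum_mul]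
      exact Finset.sum_congr rfl fun i _ => by ring
    simp only [h1]
    have h2 : ∀ j, ∑ k, ∑ i, b (w i).1 *
        (nnCoef R (fun k => (w k).1) i j * nnCoef R (fun k => (w k).1) i k *
        (ξ (w j) * ξ (w k) - if j = k then s (w j).1 else 0)) = ∑ i, ∑ k, b (w i).1 *
        (nnCoef R (fun k => (w k).1) i j * nnCoef R (fun k => (w k).1) i k *
        (ξ (w j) * ξ (w k) - if j = k then s (w j).1 else 0)) := fun j => Finset.sum_comm
    simp only [h2]
    rw [Finset.sum_comm]
    refine Finset.sum_congr rfl fun i _ => ?_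
    simp only [← Finset.mul_sum]
    congr 1
    rw [nnResid_eq, sq, Finset.sum_mul_sum, ← Finset.sum_sub_distrib]
    refine Finset.sum_congr rfl fun j _ => ?_
    simp only [mul_sub, Finset.sum_sub_distrib, mul_ite, mul_zero, Finset.sum_ite_eq,
      Finset.mem_univ, if_true]
    congr 1
    · exact Finset.sum_congr rfl fun k _ => by ring
    · ring
  refine le_trans (le_of_eq (lintegral_congr fun w => congrArg _ (congrArg (· ^ 2) (hrw w)))) ?_
  have hsm : Measurable s :=
    (StronglyMeasurable.integral_kernel_prod_right (κ := κ) (f := fun x u => ξ (x, u) ^ 2)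
      (by simpa [Function.uncurry_def] using (hξ.pow_const 2).stronglyMeasurable)).measurable
  have hquad := lintegral_sq_quadForm_le (PX := PX) hCm hCb hξ hb hξ0
  rw [← hs] at hquad
  have hCi : ∀ j k, Integrable (fun w : Fin n → ℝ × U => C j k (fun i => (w i).1) ^ 2)
      (sampleLaw n PX κ) := fun j k => by
    refine Integrable.of_bound (((hCm j k).comp (by fun_prop)).pow_const 2).aestronglyMeasurable
      ((n * (B * 4)) ^ 2) (Eventually.of_forall fun w => ?_)
    rw [Real.norm_eq_abs, abs_of_nonneg (sq_nonneg _)]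
    exact sq_le_sq' (abs_le.1 (hCb _ _ _)).1 (abs_le.1 (hCb _ _ _)).2
  have hbi : Integrable (fun w : Fin n → ℝ × U => ∑ i, |b (w i).1|) (sampleLaw n PX κ) :=
    integrable_finsetSum _ fun i _ => Integrable.of_bound
      (hbm.abs.comp (by fun_prop)).aestronglyMeasurable B
      (Eventually.of_forall fun w => by simpa using hB _)
  have hCsum : ∫ w, ∑ j, ∑ k, C j k (fun i => (w i).1) ^ 2 ∂sampleLaw n PX κ ≤
      24 * B * (n * ∫ t, |b t| ∂PX) := by
    have h1 : ∫ w, ∑ j, ∑ k, C j k (fun i => (w i).1) ^ 2 ∂sampleLaw n PX κ ≤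
        ∫ w, 24 * B * ∑ i, |b (w i).1| ∂sampleLaw n PX κ := by
      refine integral_mono_ae (integrable_finsetSum _ fun j _ => integrable_finsetSum _ fun k _ =>
        hCi j k) (hbi.const_mul _) ?_
      filter_upwards [ae_tieFree (PX := PX) (κ := κ) (n := n)] with w hw
      set x : Fin n → ℝ := fun i => (w i).1
      have h2 : ∀ j k, C j k x ^ 2 ≤
          3 * B * 2 * ∑ i, |b (x i)| * (|nnCoef R x i j| * |nnCoef R x i k|) := by
        intro j k
        have h3 : |C j k x| ≤ ∑ i, |b (x i)| * (|nnCoef R x i j| * |nnCoef R x i k|) :=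
          (Finset.abs_sum_le_sum_abs _ _).trans (le_of_eq (Finset.sum_congr rfl fun i _ => by
            rw [abs_mul, abs_mul]))
        have h4 : |C j k x| ≤ 3 * B * 2 := by
          refine h3.trans ?_
          calc _ ≤ ∑ i, B * (|nnCoef R x i j| * 2) := by
                refine Finset.sum_le_sum fun i _ => ?_
                exact mul_le_mul (hB _) (mul_le_mul_of_nonneg_left (abs_nnCoef_le_two hR x i k)
                  (abs_nonneg _)) (by positivity) hB0
            _ = B * (∑ i, |nnCoef R x i j|) * 2 := by
                rw [← Finset.mul_sum, ← Finset.sum_mul]; ring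
            _ ≤ B * 3 * 2 := by
                gcongr
                exact sum_abs_nnCoef_le' hR hw j
            _ = _ := by ring
        calc C j k x ^ 2 = |C j k x| * |C j k x| := by rw [← sq_abs, sq]
          _ ≤ _ := mul_le_mul h4 h3 (abs_nonneg _) (by positivity)
      calc ∑ j, ∑ k, C j k x ^ 2
          ≤ ∑ j, ∑ k, 3 * B * 2 * ∑ i, |b (x i)| * (|nnCoef R x i j| * |nnCoef R x i k|) :=
            Finset.sum_le_sum fun j _ => Finset.sum_le_sum fun k _ => h2 j k
        _ = 3 * B * 2 * ∑ i, |b (x i)| * ((∑ j, |nnCoef R x i j|) * ∑ k, |nnCoef R x i k|) := by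
            simp only [← Finset.mul_sum]
            congr 1
            rw [Finset.sum_congr rfl fun j _ => Finset.sum_comm, Finset.sum_comm]
            refine Finset.sum_congr rfl fun i _ => ?_
            rw [Finset.sum_mul_sum, Finset.mul_sum]
            simp only [Finset.mul_sum]
        _ ≤ 3 * B * 2 * ∑ i, |b (x i)| * (2 * 2) := by
            gcongr with i
            · exact sum_abs_nnCoef_le hR hw i
            · exact sum_abs_nnCoef_le hR hw i
        _ = 24 * B * ∑ i, |b (x i)| := by rw [← Finset.sum_mul]; ring
    refine h1.trans (le_of_eq ?_)
    have hbi' : ∀ i : Fin n, Integrable (fun w : Fin n → ℝ × U => |b (w i).1|)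
        (sampleLaw n PX κ) := fun i => Integrable.of_bound
      (hbm.abs.comp (measurable_fst.comp (measurable_pi_apply i))).aestronglyMeasurable B
      (Eventually.of_forall fun w => by simpa using hB _)
    rw [integral_const_mul, integral_finsetSum _ fun i _ => hbi' i]
    congr 1
    have : ∀ i : Fin n, ∫ w, |b (w i).1| ∂sampleLaw n PX κ = ∫ t, |b t| ∂PX := fun i => by
      have h2 : MeasurePreserving (fun w : Fin n → ℝ × U => (w i).1) (sampleLaw n PX κ) PX :=
        (⟨measurable_fst, Measure.fst_compProd PX κ⟩ :
          MeasurePreserving (Prod.fst : ℝ × U → ℝ) (PX.compProd κ) PX).comp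
          (measurePreserving_eval _ i)
      have h3 := integral_map (μ := sampleLaw n PX κ) (f := fun t => |b t|)
        h2.measurable.aemeasurable hbm.abs.aestronglyMeasurable
      rw [h2.map_eq] at h3
      exact h3.symm
    simp [this]
  have hqm : ∀ j k, Measurable (quadTerm (U := U) C ξ s j k) := by
    intro j k
    have h1 := hCm j k
    unfold quadTerm
    split_ifs <;> fun_prop
  have hsb : ∀ x, |s x| ≤ c ^ 2 := fun x => by
    rw [abs_of_nonneg (integral_nonneg fun u => sq_nonneg _)]
    refine (integral_mono_of_nonneg (Eventually.of_forall fun u => sq_nonneg _)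
      (integrable_const (c ^ 2)) (Eventually.of_forall fun u =>
      sq_le_sq' (abs_le.1 (hb (x, u))).1 (abs_le.1 (hb (x, u))).2)).trans ?_
    simp
  have hqL : MemLp (fun w : Fin n → ℝ × U => ∑ j, ∑ k, quadTerm C ξ s j k w) 2
      (sampleLaw n PX κ) := by
    refine memLp_finsetSum _ fun j _ => memLp_finsetSum _ fun k _ =>
      MemLp.of_bound (hqm j k).aestronglyMeasurable (n * (B * 4) * (c * c + c ^ 2))
        (Eventually.of_forall fun w => ?_)
    rw [Real.norm_eq_abs, quadTerm, abs_mul]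
    refine mul_le_mul (hCb _ _ _) ((abs_sub _ _).trans (add_le_add ?_ ?_)) (abs_nonneg _)
      (by positivity)
    · rw [abs_mul]
      exact mul_le_mul (hb _) (hb _) (abs_nonneg _) ((abs_nonneg _).trans (hb (w j)))
    · split_ifs
      · exact hsb _
      · simpa using sq_nonneg c
  rw [← ofReal_integral_sq hqL]
  refine ENNReal.ofReal_le_ofReal (hquad.trans ?_)
  calc _ ≤ 2 * c ^ 4 * (24 * B * (n * ∫ t, |b t| ∂PX)) := by gcongr
    _ = _ := by ring

end QuadForm

/-! ### Convergence of neighbor-based moments -/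

section VarianceEstimator

universe u

variable {Ω : ℕ → Type u} [∀ n, MeasurableSpace (Ω n)] {P : ∀ n, Measure (Ω n)}
  [∀ n, IsProbabilityMeasure (P n)] {PX : Measure ℝ} [IsProbabilityMeasure PX] {fX K : ℝ → ℝ}
  {d : ℕ → ℕ} {κ : ∀ n, Kernel ℝ (ℝ × (Fin (d n) → ℝ))} [∀ n, IsMarkovKernel (κ n)]
  {W : ∀ n, Fin n → Ω n → Obs (d n)} {S : ℕ} {fold : ∀ n, Ω n → Fin n → Fin S}
  {est : ∀ n, (I : Finset (Fin n)) → (I → Obs (d n)) → (Fin (d n) → ℝ) → ℝ}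
  {T : ∀ n, Set ((Fin (d n) → ℝ) → ℝ)} {ηbar : ∀ n, (Fin (d n) → ℝ) → ℝ}

theorem IsSample.tendsto_of_lintegral_abs (hS : IsSample P PX κ W fold)
    {F : ∀ n, (Fin n → Fin S) → (Fin n → Obs (d n)) → ℝ} (hF : ∀ n φ, Measurable (F n φ))
    {β : ℕ → ℝ} (hβ : Tendsto β atTop (𝓝 0)) (hb : ∀ᶠ n in atTop, ∀ φ,
      ∫⁻ w, ENNReal.ofReal |F n φ w| ∂sampleLaw n PX (κ n) ≤ ENNReal.ofReal (β n)) (H : ℕ → Set ℝ) :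
    Tendsto (fun z => F z.1 (fold z.1 z.2.1) fun i => W z.1 i z.2.1) (inProb P H) (𝓝 0) := by
  refine tendsto_inProb_of_lintegral
    (fun n ω => ENNReal.ofReal |F n (fold n ω) fun i => W n i ω|)
    (fun n => measurable_comp_fold hS (F := fun φ w => ENNReal.ofReal |F n φ w|)
      fun φ => (hF n φ).abs.ennreal_ofReal) (Eventually.of_forall fun _ => le_rfl) ?_
  refine tendsto_of_tendsto_of_tendsto_of_le_of_le' tendsto_const_nhds
    (by simpa using ENNReal.tendsto_ofReal hβ) (Eventually.of_forall fun _ => bot_le) ?_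
  filter_upwards [hb] with n hn
  exact hS.lintegral_le (F := fun φ w => ENNReal.ofReal |F n φ w|)
    (fun φ => (hF n φ).abs.ennreal_ofReal) hn

theorem IsSample.tendsto_of_lintegral_sq (hS : IsSample P PX κ W fold)
    {F : ∀ n, (Fin n → Fin S) → (Fin n → Obs (d n)) → ℝ} (hF : ∀ n φ, Measurable (F n φ))
    {β : ℕ → ℝ} (hβ : Tendsto β atTop (𝓝 0)) (hb : ∀ᶠ n in atTop, ∀ φ,
      ∫⁻ w, ENNReal.ofReal (F n φ w ^ 2) ∂sampleLaw n PX (κ n) ≤ ENNReal.ofReal (β n))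
    (H : ℕ → Set ℝ) :
    Tendsto (fun z => F z.1 (fold z.1 z.2.1) fun i => W z.1 i z.2.1) (inProb P H) (𝓝 0) := by
  have h1 := hS.tendsto_of_lintegral_abs (F := fun n φ w => F n φ w ^ 2)
    (fun n φ => (hF n φ).pow_const 2) hβ
    (hb.mono fun n hn φ => by simpa only [abs_pow, sq_abs] using hn φ) H
  have h2 := (Real.continuous_sqrt.tendsto 0).comp h1
  rw [Real.sqrt_zero] at h2
  rw [tendsto_zero_iff_abs_tendsto_zero]
  exact h2.congr fun z => Real.sqrt_sq_eq_abs _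

/-- A nonrandom bandwidth with `δ → 0` and `n δ → ∞`. -/
structure IsLocalSeq (δ : ℕ → ℝ) : Prop where
  pos : ∀ᶠ n in atTop, 0 < δ n
  zero : Tendsto δ atTop (𝓝 0)
  rate : Tendsto (fun n : ℕ => (n : ℝ) * δ n) atTop atTop

variable {δ : ℕ → ℝ}

theorem IsLocalSeq.tendsto_integral (hδ : IsLocalSeq δ) (hf : HasRegularDensity PX fX) {B : ℝ}
    {b : ℝ → ℝ} (hb : IsWindow B b) :
    Tendsto (fun n => (δ n)⁻¹ * ∫ t, b (t / δ n) ∂PX) atTop (𝓝 (fX 0 * ∫ u, b u)) :=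
  (hf.tendsto_integral_window hb).comp
    (tendsto_nhdsWithin_iff.2 ⟨hδ.zero, hδ.pos.mono fun _ h => h⟩)

/-- Chebyshev's inequality with a variance of order `1 / (n δ)`, followed by the limit of the window
integral. In contrast to the version for pilots, arbitrary windows are allowed. -/
theorem IsLocalSeq.tendsto_locMoment_one (hδ : IsLocalSeq δ) (hS : IsSample P PX κ W fold)
    (hf : HasRegularDensity PX fX) {B : ℝ} {b : ℝ → ℝ} (hb : IsWindow B b) (H : ℕ → Set ℝ) :
    Tendsto (fun z => locMoment b (δ z.1) (sampleX W z.1 z.2.1) fun _ => 1)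
      (inProb P H) (𝓝 (fX 0 * ∫ u, b u)) := by
  have h1 := hδ.tendsto_integral hf hb
  have h2 := hδ.tendsto_integral hf (hb.mul hb)
  have h3 := hS.tendsto_of_lintegral_sq (F := fun n _ w => ((n : ℝ) * δ n)⁻¹ *
      (∑ i, b ((w i).1 / δ n) - n * ∫ t, b (t / δ n) ∂PX))
    (fun n _ => by
      refine ((Finset.measurable_fun_sum _ fun i _ => hb.measurable.comp ?_).sub_const _).const_mul _
      fun_prop)
    (β := fun n => ((n : ℝ) * δ n)⁻¹ * ((δ n)⁻¹ * ∫ t, b (t / δ n) * b (t / δ n) ∂PX))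
    (by simpa using hδ.rate.inv_tendsto_atTop.mul h2) (by
      filter_upwards [hδ.pos, eventually_gt_atTop 0] with n hn hn0 _
      have hn' : (0 : ℝ) < n := by exact_mod_cast hn0
      have h4 := lintegral_sq_sum_sub_integral_le (n := n) (PX := PX) (κ := κ n) Finset.univ
        (φ := fun t => b (t / δ n)) (hb.measurable.comp (measurable_id.div_const _))
        (fun t => hb.bound _)
      simp only [Finset.card_univ, Fintype.card_fin] at h4
      simp only [mul_pow]
      simp_rw [ENNReal.ofReal_mul (sq_nonneg ((n : ℝ) * δ n)⁻¹)]
      rw [lintegral_const_mul' _ _ ENNReal.ofReal_ne_top]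
      refine (mul_le_mul_right h4 _).trans ?_
      rw [← ENNReal.ofReal_mul (by positivity)]
      refine ENNReal.ofReal_le_ofReal (le_of_eq ?_)
      simp only [sq]
      field_simp) H
  have h4 := h3.add (tendsto_inProb_self (P := P) (H := H) h1)
  rw [zero_add] at h4
  refine h4.congr' ?_
  filter_upwards [tendsto_fst_inProb.eventually hδ.pos,
    tendsto_fst_inProb.eventually (eventually_gt_atTop 0)] with z hz hz0
  have hn' : (z.1 : ℝ) ≠ 0 := by positivity
  simp only [locMoment, sampleX, runX, mul_one]
  field_simp
  ring

/-- Deviations from neighbors are negligible for variables with small second moments. -/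
theorem IsLocalSeq.tendsto_nnResid_sq (hδ : IsLocalSeq δ) (hS : IsSample P PX κ W fold)
    (hf : HasRegularDensity PX fX) {R : ℕ} (hR : 0 < R) {B : ℝ} {b : ℝ → ℝ} (hb : IsWindow B b)
    (hb0 : ∀ t, 0 ≤ b t) {ψ : ∀ n, (Fin n → Fin S) → Fin n → (Fin n → Obs (d n)) → ℝ}
    (hψ : ∀ n φ i, Measurable (ψ n φ i)) {θ : ℕ → ℝ} (hθ : Tendsto θ atTop (𝓝 0))
    (hθ0 : ∀ᶠ n in atTop, 0 ≤ θ n)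
    (hc : ∀ᶠ n in atTop, ∀ φ i, ∀ᵐ w ∂sampleLaw n PX (κ n),
      ∫⁻ u, ENNReal.ofReal (ψ n φ i (resample i w u) ^ 2) ∂(κ n (w i).1) ≤ ENNReal.ofReal (θ n))
    (H : ℕ → Set ℝ) :
    Tendsto (fun z => locMoment b (δ z.1) (sampleX W z.1 z.2.1) fun i =>
      nnResid R (sampleX W z.1 z.2.1)
        (fun k => ψ z.1 (fold z.1 z.2.1) k fun i => W z.1 i z.2.1) i ^ 2) (inProb P H) (𝓝 0) := by
  have := hf.nullSingletonClass
  refine hS.tendsto_of_lintegral_abs (F := fun n φ w => locMoment b (δ n) (fun i => (w i).1) fun i =>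
      nnResid R (fun i => (w i).1) (fun k => ψ n φ k w) i ^ 2) (fun n φ => ?_)
    (β := fun n => 4 * (θ n * ((δ n)⁻¹ * ∫ t, b (t / δ n) ∂PX)))
    (by simpa using (hθ.mul (hδ.tendsto_integral hf hb)).const_mul 4) ?_ H
  · simp only [locMoment, nnResid_eq]
    refine (Finset.measurable_fun_sum _ fun i _ => ?_).const_mul _
    refine (hb.measurable.comp (by fun_prop)).mul ((Finset.measurable_fun_sum _ fun j _ => ?_).pow_const 2)
    exact ((measurable_nnCoef i j).comp (by fun_prop)).mul (hψ n φ j)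
  · filter_upwards [hδ.pos, eventually_gt_atTop 0, hc, hθ0] with n hn hn0 hcn hθn φ
    have hn' : (0 : ℝ) < n := by exact_mod_cast hn0
    have h4 := lintegral_sum_nnResid_sq_le (PX := PX) (κ := κ n) hR (hψ n φ) (hcn φ)
      (b := fun t => b (t / δ n)) (hb.measurable.comp (measurable_id.div_const _))
      (fun t => hb0 _) (fun t => (le_abs_self _).trans (hb.bound _))
    have h5 : ∀ w : Fin n → Obs (d n), |locMoment b (δ n) (fun i => (w i).1) fun i =>
        nnResid R (fun i => (w i).1) (fun k => ψ n φ k w) i ^ 2| = ((n : ℝ) * δ n)⁻¹ *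
        ∑ i, b ((w i).1 / δ n) * nnResid R (fun i => (w i).1) (fun k => ψ n φ k w) i ^ 2 := fun w =>
      abs_of_nonneg (mul_nonneg (by positivity) (Finset.sum_nonneg fun i _ =>
        mul_nonneg (hb0 _) (sq_nonneg _)))
    simp_rw [h5, ENNReal.ofReal_mul (show (0 : ℝ) ≤ ((n : ℝ) * δ n)⁻¹ by positivity)]
    rw [lintegral_const_mul' _ _ ENNReal.ofReal_ne_top]
    refine (mul_le_mul_right h4 _).trans ?_
    rw [← ENNReal.ofReal_mul hθn, ← ENNReal.ofReal_mul (by positivity)]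
    refine ENNReal.ofReal_le_ofReal (le_of_eq ?_)
    field_simp

/-- The truncation level for the outcome errors. -/
noncomputable def truncLevel (δ : ℕ → ℝ) (n : ℕ) : ℝ := ((n : ℝ) * δ n) ^ (1 / 8 : ℝ)

theorem IsLocalSeq.tendsto_truncLevel (hδ : IsLocalSeq δ) :
    Tendsto (truncLevel δ) atTop atTop :=
  (tendsto_rpow_atTop (by norm_num)).comp hδ.rate

/-- The truncated errors are bounded by `2 τ`, so the second moment is of order `τ^4 / (n δ)`, which
vanishes for `τ = (n δ)^(1/8)`. The constant is `768 = 48 · 2^4`. -/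
theorem IsLocalSeq.tendsto_nnResid_quad (hδ : IsLocalSeq δ) (hS : IsSample P PX κ W fold)
    (hf : HasRegularDensity PX fX) {R : ℕ} (hR : 0 < R) (hη : ∀ n, Measurable (ηbar n))
    {B : ℝ} {b : ℝ → ℝ} (hb : IsWindow B b) (H : ℕ → Set ℝ) :
    Tendsto (fun z => locMoment b (δ z.1) (sampleX W z.1 z.2.1) fun i =>
      nnResid R (sampleX W z.1 z.2.1)
        (fun k => clipErr (κ z.1) (ηbar z.1) (truncLevel δ z.1) (W z.1 k z.2.1)) i ^ 2 -
      ∑ j, nnCoef R (sampleX W z.1 z.2.1) i j ^ 2 *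
        clipVar (κ z.1) (ηbar z.1) (truncLevel δ z.1) (sampleX W z.1 z.2.1 j))
      (inProb P H) (𝓝 0) := by
  have := hf.nullSingletonClass
  have hm : ∀ n, Measurable (clipErr (κ n) (ηbar n) (truncLevel δ n)) :=
    fun n => measurable_clipErr (hη n) _
  have hvm : ∀ n, Measurable (clipVar (κ n) (ηbar n) (truncLevel δ n)) := fun n =>
    (StronglyMeasurable.integral_kernel_prod_right (κ := κ n)
      (f := fun x u => clipErr (κ n) (ηbar n) (truncLevel δ n) (x, u) ^ 2)
      (by simpa [Function.uncurry_def] using ((hm n).pow_const 2).stronglyMeasurable)).measurable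
  refine hS.tendsto_of_lintegral_sq (F := fun n _ w => locMoment b (δ n) (fun i => (w i).1) fun i =>
      nnResid R (fun i => (w i).1)
        (fun k => clipErr (κ n) (ηbar n) (truncLevel δ n) (w k)) i ^ 2 -
      ∑ j, nnCoef R (fun i => (w i).1) i j ^ 2 *
        clipVar (κ n) (ηbar n) (truncLevel δ n) (w j).1) (fun n φ => ?_)
    (β := fun n => 768 * B * (((n : ℝ) * δ n) ^ (-(1 / 2) : ℝ) *
      ((δ n)⁻¹ * ∫ t, |b (t / δ n)| ∂PX)))
    (by simpa using (((tendsto_rpow_neg_atTop (show (0 : ℝ) < 1 / 2 by norm_num)).comp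
      hδ.rate).mul (hδ.tendsto_integral hf hb.abs)).const_mul (768 * B)) ?_ H
  · simp only [locMoment, nnResid_eq]
    have hc : ∀ i j, Measurable fun w : Fin n → Obs (d n) => nnCoef R (fun i => (w i).1) i j :=
      fun i j => (measurable_nnCoef i j).comp (by fun_prop)
    refine (Finset.measurable_fun_sum _ fun i _ => ?_).const_mul _
    refine (hb.measurable.comp (by fun_prop)).mul (Measurable.sub
      ((Finset.measurable_fun_sum _ fun j _ => ?_).pow_const 2)
      (Finset.measurable_fun_sum _ fun j _ => ?_))
    · exact (hc i j).mul ((hm n).comp (by fun_prop))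
    · exact ((hc i j).pow_const 2).mul ((hvm n).comp (by fun_prop))
  · filter_upwards [hδ.pos, eventually_gt_atTop 0] with n hn hn0 _
    have hn' : (0 : ℝ) < n := by exact_mod_cast hn0
    have hτ : 0 ≤ truncLevel δ n := Real.rpow_nonneg (by positivity) _
    have h4 := lintegral_sq_nnResid_quad_le (n := n) (PX := PX) (κ := κ n) hR (hm n)
      (abs_clipErr_le hτ) (integral_clipErr (hη n) hτ)
      (b := fun t => b (t / δ n)) (hb.measurable.comp (measurable_id.div_const _))
      (fun t => hb.bound _)
    simp only [locMoment, mul_pow]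
    simp_rw [ENNReal.ofReal_mul (sq_nonneg ((n : ℝ) * δ n)⁻¹)]
    rw [lintegral_const_mul' _ _ ENNReal.ofReal_ne_top]
    refine (mul_le_mul_right h4 _).trans ?_
    rw [← ENNReal.ofReal_mul (by positivity)]
    refine ENNReal.ofReal_le_ofReal (le_of_eq ?_)
    have h6 : truncLevel δ n ^ 4 = ((n : ℝ) * δ n) * ((n : ℝ) * δ n) ^ (-(1 / 2) : ℝ) := by
      rw [truncLevel, ← Real.rpow_natCast, ← Real.rpow_mul (by positivity)]
      nth_rw 2 [← Real.rpow_one ((n : ℝ) * δ n)]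
      rw [← Real.rpow_add (by positivity)]
      norm_num
    rw [mul_pow, h6]
    field_simp
    ring

end VarianceEstimator

/-! ### Deterministic bounds for local moments and neighbor averages -/

section Deterministic

variable {n R : ℕ}

theorem IsWindow.eq_zero_of_side {B : ℝ} {b : ℝ → ℝ} (hb : IsWindow B b) {s : Side}
    (hbs : ∀ u ∉ s.region, b u = 0) {h x : ℝ} (hh : 0 < h) (hx : ¬ (x ∈ s.region ∧ |x| ≤ h)) :
    b (x / h) = 0 := by
  by_cases h1 : x / h ∈ s.region
  · refine hb.eq_zero _ fun h2 => hx ⟨?_, ?_⟩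
    · cases s
      · simp only [Side.region, Set.mem_Ici] at h1 ⊢
        rwa [le_div_iff₀ hh, zero_mul] at h1
      · simp only [Side.region, Set.mem_Iio] at h1 ⊢
        rwa [div_lt_iff₀ hh, zero_mul] at h1
    · have h3 : |x / h| ≤ 1 := abs_le.2 h2
      rwa [abs_div, abs_of_pos hh, div_le_one hh] at h3
  · exact hbs _ h1

/-- From `(α + ρ)² - α² = 2 α ρ + ρ²` and the weighted Cauchy–Schwarz inequality: a remainder that
is small in mean square does not affect averages of squares. -/
theorem abs_locMoment_sq_add_sub_le (b : ℝ → ℝ) {h : ℝ} (hh : 0 < h) (x α ρ : Fin n → ℝ) :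
    |locMoment b h x (fun i => (α i + ρ i) ^ 2) - locMoment b h x fun i => α i ^ 2| ≤
      2 * √((locMoment (fun u => |b u|) h x fun i => α i ^ 2) *
        locMoment (fun u => |b u|) h x fun i => ρ i ^ 2) +
      locMoment (fun u => |b u|) h x fun i => ρ i ^ 2 := by
  have h1 : locMoment b h x (fun i => (α i + ρ i) ^ 2) - locMoment b h x (fun i => α i ^ 2) =
      2 * locMoment b h x (fun i => α i * ρ i) + locMoment b h x fun i => ρ i ^ 2 := by
    rw [← locMoment_sub, ← locMoment_const_mul, ← locMoment_add]
    congr 1; funext i; ring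
  have hc : (0 : ℝ) ≤ ((n : ℝ) * h)⁻¹ := by positivity
  have h2 : |locMoment b h x fun i => α i * ρ i| ≤
      √((locMoment (fun u => |b u|) h x fun i => α i ^ 2) *
        locMoment (fun u => |b u|) h x fun i => ρ i ^ 2) := by
    refine (abs_locMoment_le b hh x _).trans (Real.le_sqrt_of_sq_le ?_)
    simp only [locMoment]
    have h3 := Finset.sum_mul_sq_le_sq_mul_sq Finset.univ
      (fun i => √|b (x i / h)| * |α i|) (fun i => √|b (x i / h)| * |ρ i|)
    have h4 : ∀ i, √|b (x i / h)| * |α i| * (√|b (x i / h)| * |ρ i|) =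
        |b (x i / h)| * |α i * ρ i| := fun i => by
      rw [abs_mul]
      linear_combination |α i| * |ρ i| * Real.mul_self_sqrt (abs_nonneg (b (x i / h)))
    simp only [h4, mul_pow, Real.sq_sqrt (abs_nonneg _), sq_abs] at h3
    rw [mul_pow]
    calc _ ≤ (((n : ℝ) * h)⁻¹) ^ 2 * _ := mul_le_mul_of_nonneg_left h3 (sq_nonneg _)
      _ = _ := by ring
  have h5 : |locMoment b h x fun i => ρ i ^ 2| ≤ locMoment (fun u => |b u|) h x fun i => ρ i ^ 2 := by
    refine (abs_locMoment_le b hh x _).trans (le_of_eq ?_)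
    simp only [abs_pow, sq_abs]
  rw [h1]
  refine (abs_add_le _ _).trans (add_le_add ?_ h5)
  rw [abs_mul, abs_two]
  exact mul_le_mul_of_nonneg_left h2 two_pos.le

theorem Side.mem_region_iff {s : Side} {x : ℝ} (hx : x ∈ s.region) (y : ℝ) :
    y ∈ s.region ↔ (0 ≤ y ↔ 0 ≤ x) := by
  cases s
  · simp only [Side.region, Set.mem_Ici] at hx ⊢
    simp [hx]
  · simp only [Side.region, Set.mem_Iio] at hx ⊢
    simp [hx.not_ge]

/-- If a side has more than `R` units within distance `r` of the cutoff, then each such unit has `R`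
neighbors, none of which is further away than `r`. -/
theorem neighbors_of_card_lt {x : Fin n → ℝ} (hx : TieFree x) {s : Side} {r : ℝ}
    {t : Finset (Fin n)} (ht : ∀ k ∈ t, x k ∈ s.region ∧ |x k| ≤ r) (hcard : R < t.card) {i : Fin n}
    (hi : x i ∈ s.region) (hir : |x i| ≤ r) :
    (neighbors R x i).card = R ∧ ∀ j ∈ neighbors R x i, x j ∈ s.region ∧ |x j - x i| ≤ r := by
  classical
  have h1 : ∀ k ∈ t.erase i, k ≠ i ∧ (0 ≤ x k ↔ 0 ≤ x i) ∧ |x k - x i| ≤ r := by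
    intro k hk
    obtain ⟨hki, hk⟩ := Finset.mem_erase.1 hk
    obtain ⟨h2, h3⟩ := ht k hk
    refine ⟨hki, (Side.mem_region_iff hi _).1 h2, ?_⟩
    rw [abs_le] at h3 hir ⊢
    cases s
    · simp only [Side.region, Set.mem_Ici] at hi h2
      constructor <;> linarith
    · simp only [Side.region, Set.mem_Iio] at hi h2
      constructor <;> linarith
  have h2 : R ≤ (t.erase i).card := by
    have := Finset.pred_card_le_card_erase (s := t) (a := i)
    omega
  refine ⟨card_neighbors_eq hx (fun k hk => ⟨(h1 k hk).1, (h1 k hk).2.1⟩) h2, fun j hj => ?_⟩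
  exact ⟨(Side.mem_region_iff hi _).2 (mem_neighbors.1 hj).2.1,
    abs_sub_le_of_mem_neighbors h1 h2 hj⟩

theorem abs_nnResid_le (hR : 0 < R) {x m : Fin n → ℝ} {i : Fin n}
    (hcard : (neighbors R x i).card = R) {c : ℝ} (hc : ∀ j ∈ neighbors R x i, |m i - m j| ≤ c) :
    |nnResid R x m i| ≤ c := by
  have hR' : (0 : ℝ) < R := by exact_mod_cast hR
  have h1 : nnResid R x m i = 1 / (R : ℝ) * ∑ j ∈ neighbors R x i, (m i - m j) := by
    rw [nnResid, Finset.sum_sub_distrib, Finset.sum_const, hcard, nsmul_eq_mul]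
    field_simp
  rw [h1, abs_mul, abs_of_pos (by positivity)]
  have h2 : |∑ j ∈ neighbors R x i, (m i - m j)| ≤ R * c := by
    refine (Finset.abs_sum_le_sum_abs _ _).trans ((Finset.sum_le_card_nsmul _ _ _ hc).trans ?_)
    rw [hcard, nsmul_eq_mul]
  calc 1 / (R : ℝ) * |∑ j ∈ neighbors R x i, (m i - m j)| ≤ 1 / (R : ℝ) * (R * c) := by gcongr
    _ = c := by field_simp

/-- The squared coefficients sum to `(R + 1) / R` and live on the unit and its neighbors, so only
the values of `V` there matter. -/
theorem abs_sum_nnCoef_sq_sub_le (hR : 0 < R) {x V : Fin n → ℝ} {i : Fin n}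
    (hcard : (neighbors R x i).card = R) {σ E : ℝ} (hi : |V i - σ| ≤ E)
    (hE : ∀ j ∈ neighbors R x i, |V j - σ| ≤ E) :
    |∑ j, nnCoef R x i j ^ 2 * V j - (R + 1 : ℝ) / R * σ| ≤ (R + 1 : ℝ) / R * E := by
  rw [← sum_nnCoef_sq hR hcard, Finset.sum_mul, Finset.sum_mul, ← Finset.sum_sub_distrib]
  refine (Finset.abs_sum_le_sum_abs _ _).trans (Finset.sum_le_sum fun j _ => ?_)
  rw [← mul_sub, abs_mul, abs_of_nonneg (sq_nonneg _)]
  by_cases hj : j = i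
  · subst hj; exact mul_le_mul_of_nonneg_left hi (sq_nonneg _)
  by_cases hjN : j ∈ neighbors R x i
  · exact mul_le_mul_of_nonneg_left (hE j hjN) (sq_nonneg _)
  · simp [nnCoef, hj, hjN]

end Deterministic

/-! ### Existence of close neighbors -/

section VarianceEstimator

universe u

variable {Ω : ℕ → Type u} [∀ n, MeasurableSpace (Ω n)] {P : ∀ n, Measure (Ω n)}
  [∀ n, IsProbabilityMeasure (P n)] {PX : Measure ℝ} [IsProbabilityMeasure PX] {fX K : ℝ → ℝ}
  {d : ℕ → ℕ} {κ : ∀ n, Kernel ℝ (ℝ × (Fin (d n) → ℝ))} [∀ n, IsMarkovKernel (κ n)]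
  {W : ∀ n, Fin n → Ω n → Obs (d n)} {S : ℕ} {fold : ∀ n, Ω n → Fin n → Fin S}
  {est : ∀ n, (I : Finset (Fin n)) → (I → Obs (d n)) → (Fin (d n) → ℝ) → ℝ}
  {T : ∀ n, Set ((Fin (d n) → ℝ) → ℝ)} {ηbar : ∀ n, (Fin (d n) → ℝ) → ℝ} {δ : ℕ → ℝ}

theorem integral_indicator_side (s : Side) :
    ∫ u, s.region.indicator ((Set.Icc (-1 : ℝ) 1).indicator fun _ => (1 : ℝ)) u = 1 := by
  have h1 : s.region.indicator ((Set.Icc (-1 : ℝ) 1).indicator fun _ => (1 : ℝ)) =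
      (s.region ∩ Set.Icc (-1 : ℝ) 1).indicator fun _ => 1 := by
    rw [Set.indicator_indicator]
  rw [h1, integral_indicator (s.measurableSet_region.inter measurableSet_Icc)]
  cases s
  · have : Side.plus.region ∩ Set.Icc (-1 : ℝ) 1 = Set.Icc 0 1 := by
      ext u; simp only [Side.region, Set.mem_inter_iff, Set.mem_Ici, Set.mem_Icc]
      constructor
      · rintro ⟨a, b, c⟩; exact ⟨a, c⟩
      · rintro ⟨a, c⟩; exact ⟨a, by linarith, c⟩
    simp [this]
  · have : Side.minus.region ∩ Set.Icc (-1 : ℝ) 1 = Set.Ico (-1) 0 := by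
      ext u; simp only [Side.region, Set.mem_inter_iff, Set.mem_Iio, Set.mem_Icc, Set.mem_Ico]
      constructor
      · rintro ⟨a, b, c⟩; exact ⟨b, a⟩
      · rintro ⟨a, c⟩; exact ⟨c, a, by linarith⟩
    simp [this]

/-- With probability approaching one, units close to the cutoff have `R` close neighbors. -/
theorem IsLocalSeq.eventually_neighbors (hδ : IsLocalSeq δ) (hS : IsSample P PX κ W fold)
    (hf : HasRegularDensity PX fX) (R : ℕ) (s : Side) (H : ℕ → Set ℝ) :
    ∀ᶠ z in inProb P H, TieFree (sampleX W z.1 z.2.1) ∧ ∀ i,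
      sampleX W z.1 z.2.1 i ∈ s.region → |sampleX W z.1 z.2.1 i| ≤ δ z.1 →
      (neighbors R (sampleX W z.1 z.2.1) i).card = R ∧
      ∀ j : Fin z.1, j ∈ neighbors R (sampleX W z.1 z.2.1) i → sampleX W z.1 z.2.1 j ∈ s.region ∧
        |sampleX W z.1 z.2.1 j - sampleX W z.1 z.2.1 i| ≤ δ z.1 := by
  classical
  have := hf.nullSingletonClass
  have htf : ∀ᶠ z in inProb P H, TieFree (sampleX W z.1 z.2.1) :=
    eventually_inProb_of_ae fun n =>
      (hS.ae (ae_tieFree (PX := PX) (κ := κ n) (n := n))).mono fun ω hω _ _ => hω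
  have hw := isWindow_one.indicator s.measurableSet_region
  have hbs : ∀ u ∉ s.region,
      s.region.indicator ((Set.Icc (-1 : ℝ) 1).indicator fun _ => (1 : ℝ)) u = 0 :=
    fun u hu => Set.indicator_of_notMem hu _
  have h1 := hδ.tendsto_locMoment_one hS hf hw H
  rw [integral_indicator_side, mul_one] at h1
  -- The number of units of the side within `δ` is at least `n δ` times a moment with positive
  -- limit, so it exceeds any fixed `R`.
  have h2 := h1.pos_mul_atTop hf.pos (hδ.rate.comp tendsto_fst_inProb)
  filter_upwards [htf, h2.eventually_gt_atTop (R : ℝ), tendsto_fst_inProb.eventually hδ.pos,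
    tendsto_fst_inProb.eventually (eventually_gt_atTop 0)] with z hz hcard hpos hn
  refine ⟨hz, fun i hi hir => neighbors_of_card_lt (t := Finset.univ.filter fun k =>
    sampleX W z.1 z.2.1 k ∈ s.region ∧ |sampleX W z.1 z.2.1 k| ≤ δ z.1) hz
    (fun k hk => (Finset.mem_filter.1 hk).2) ?_ hi hir⟩
  have hn' : (0 : ℝ) < z.1 := by exact_mod_cast hn
  have h3 : (locMoment (s.region.indicator ((Set.Icc (-1 : ℝ) 1).indicator fun _ => (1 : ℝ)))
      (δ z.1) (sampleX W z.1 z.2.1) fun _ => 1) * ((z.1 : ℝ) * δ z.1) ≤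
      ((Finset.univ.filter fun k =>
        sampleX W z.1 z.2.1 k ∈ s.region ∧ |sampleX W z.1 z.2.1 k| ≤ δ z.1).card : ℝ) := by
    rw [locMoment, mul_comm, ← mul_assoc, mul_inv_cancel₀ (by positivity), one_mul,
      Finset.card_filter, Nat.cast_sum]
    refine Finset.sum_le_sum fun k _ => ?_
    rw [mul_one]
    split_ifs with hk
    · exact (le_abs_self _).trans ((hw.bound _).trans (by simp))
    · exact (hw.eq_zero_of_side hbs hpos hk).le.trans (by simp)
  exact_mod_cast hcard.trans_le h3

end VarianceEstimator

theorem HasOutcomeMoments.condVar_le {e : ℕ} {κ : Kernel ℝ (ℝ × (Fin e → ℝ))} [IsMarkovKernel κ]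
    {η : (Fin e → ℝ) → ℝ} {𝒳 : Set ℝ} {C q : ℝ} (h : HasOutcomeMoments 𝒳 κ η C q) {x : ℝ}
    (hx : x ∈ 𝒳) : condVar κ (adjusted η) x ≤ 1 + C := by
  have hεm : Measurable fun u => outcomeErr κ η (x, u) :=
    (measurable_outcomeErr h.meas).comp measurable_prodMk_left
  have hεL : MemLp (fun u => outcomeErr κ η (x, u)) 2 (κ x) :=
    memLp_two_of_lintegral hεm.aestronglyMeasurable ((h.sq_le hx).trans_lt ENNReal.ofReal_lt_top)
  have h1 := h.sq_le hx
  rw [← ofReal_integral_sq hεL] at h1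
  have e3 : condVar κ (adjusted η) x = ∫ u, outcomeErr κ η (x, u) ^ 2 ∂(κ x) :=
    variance_eq_integral (measurable_adjusted h.meas).aemeasurable
  rw [e3]
  exact (ENNReal.ofReal_le_ofReal_iff (by have := h.nonneg; positivity)).1 h1

/-! ### Consistency of the nearest-neighbor variance estimator -/

section VarianceEstimator

universe u

variable {Ω : ℕ → Type u} [∀ n, MeasurableSpace (Ω n)] {P : ∀ n, Measure (Ω n)}
  [∀ n, IsProbabilityMeasure (P n)] {PX : Measure ℝ} [IsProbabilityMeasure PX] {fX K : ℝ → ℝ}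
  {d : ℕ → ℕ} {κ : ∀ n, Kernel ℝ (ℝ × (Fin (d n) → ℝ))} [∀ n, IsMarkovKernel (κ n)]
  {W : ∀ n, Fin n → Ω n → Obs (d n)} {S : ℕ} {fold : ∀ n, Ω n → Fin n → Fin S}
  {est : ∀ n, (I : Finset (Fin n)) → (I → Obs (d n)) → (Fin (d n) → ℝ) → ℝ}
  {T : ∀ n, Set ((Fin (d n) → ℝ) → ℝ)} {ηbar : ∀ n, (Fin (d n) → ℝ) → ℝ} {δ : ℕ → ℝ}

/-- The one-sided limit of the conditional variance of the adjusted outcome. -/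
noncomputable def sideVar (κ : ∀ n, Kernel ℝ (ℝ × (Fin (d n) → ℝ)))
    (ηbar : ∀ n, (Fin (d n) → ℝ) → ℝ) (s : Side) (n : ℕ) : ℝ :=
  sideLim s (condVar (κ n) (adjusted (ηbar n)))

theorem IsModel.exists_sideVar_bounds (h : IsModel P PX fX K κ W fold est T ηbar) :
    ∃ C > 0, ∀ n s, 1 / C ≤ sideVar κ ηbar s n ∧ sideVar κ ηbar s n ≤ C := by
  obtain ⟨ρ, hρ, hsub⟩ := h.density.exists_Icc_subset_support
  obtain ⟨C', q', hmom⟩ := h.exists_moments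
  obtain ⟨C, L, q, hC, -, hreg⟩ := h.reg
  have hC' := (hmom 0).nonneg
  refine ⟨max C (1 + C'), by positivity, fun n s => ?_⟩
  have h1 := ((hreg n).2.2.2.2.1.tendsto s hρ hsub).1
  have h2 : ∀ᶠ x in s.filter, x ∈ PX.support ∧ x ≠ 0 :=
    (show ∀ᶠ x in s.filter, x ∈ sideSet s ρ from sideSet_mem_filter s hρ).mono fun x hx => ⟨hsub (abs_le.1 hx.2.2), hx.2.1⟩
  constructor
  · refine (one_div_le_one_div_of_le hC (le_max_left _ _)).trans (ge_of_tendsto h1 ?_)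
    filter_upwards [h2] with x hx using (hreg n).2.2.2.2.2 x hx
  · refine le_trans (le_of_tendsto h1 ?_) (le_max_right C (1 + C'))
    filter_upwards [h2] with x hx using (hmom n).condVar_le hx.1

theorem tendsto_mul_bounded {ι : Type*} {l : Filter ι} {f g : ι → ℝ} {C : ℝ}
    (hf : ∀ᶠ z in l, |f z| ≤ C) (hg : Tendsto g l (𝓝 0)) : Tendsto (fun z => f z * g z) l (𝓝 0) := by
  rw [tendsto_zero_iff_abs_tendsto_zero] at hg ⊢
  refine squeeze_zero' (Eventually.of_forall fun _ => abs_nonneg _) ?_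
    (by simpa using hg.const_mul C)
  filter_upwards [hf] with z hz
  simp only [Function.comp, abs_mul]
  exact mul_le_mul_of_nonneg_right hz (abs_nonneg _)

/-- The leading term of the neighbor-based variance estimator. -/
theorem IsModel.tendsto_nnResid_clipErr (h : IsModel P PX fX K κ W fold est T ηbar)
    (hδ : IsLocalSeq δ) {R : ℕ} (hR : 0 < R) {B : ℝ} {b : ℝ → ℝ} (hb : IsWindow B b) {s : Side}
    (hbs : ∀ u ∉ s.region, b u = 0) (H : ℕ → Set ℝ) :
    Tendsto (fun z => locMoment b (δ z.1) (sampleX W z.1 z.2.1) (fun i =>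
      nnResid R (sampleX W z.1 z.2.1)
        (fun k => clipErr (κ z.1) (ηbar z.1) (truncLevel δ z.1) (W z.1 k z.2.1)) i ^ 2) -
      (R + 1 : ℝ) / R * (sideVar κ ηbar s z.1 * (fX 0 * ∫ u, b u))) (inProb P H) (𝓝 0) := by
  obtain ⟨ρ, hρ, hsub⟩ := h.density.exists_Icc_subset_support
  obtain ⟨C, q, hmom⟩ := h.exists_moments
  obtain ⟨Cs, hCs, hσ⟩ := h.exists_sideVar_bounds
  obtain ⟨_, L, _, _, _, hreg⟩ := h.reg
  have hq := (hmom 0).two_lt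
  have hC := (hmom 0).nonneg
  -- A bound for the mean square truncation error; it vanishes because the level diverges and `2 -
  -- q` is negative.
  set θ : ℕ → ℝ := fun n => (C + 1) * truncLevel δ n ^ (2 - q) with hθ
  have hθ0 : Tendsto θ atTop (𝓝 0) := by
    have := (tendsto_rpow_neg_atTop (show 0 < q - 2 by linarith)).comp hδ.tendsto_truncLevel
    simpa [hθ, Function.comp_def] using this.const_mul (C + 1)
  -- Truncation error plus the variation of the conditional variance over the distance `2 δ`, the
  -- farthest from the cutoff that a neighbor of a unit in the window can be.
  set E : ℕ → ℝ := fun n => √(θ n) * (2 + C) + θ n + |L| * (2 * δ n) with hE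
  have hE0 : Tendsto E atTop (𝓝 0) := by
    have h1 := (Real.continuous_sqrt.tendsto 0).comp hθ0
    rw [Real.sqrt_zero] at h1
    simpa [hE, Function.comp_def] using ((h1.mul_const (2 + C)).add hθ0).add
      ((hδ.zero.const_mul 2).const_mul |L|)
  have h1 := hδ.tendsto_nnResid_quad h.sample h.density hR
    (fun n => (hmom n).meas) hb H
  have hone := hδ.tendsto_locMoment_one h.sample h.density hb H
  have honeabs := hδ.tendsto_locMoment_one h.sample h.density hb.abs H
  have h2 : Tendsto (fun z => locMoment b (δ z.1) (sampleX W z.1 z.2.1) (fun i =>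
      ∑ j, nnCoef R (sampleX W z.1 z.2.1) i j ^ 2 *
        clipVar (κ z.1) (ηbar z.1) (truncLevel δ z.1) (sampleX W z.1 z.2.1 j) -
      (R + 1 : ℝ) / R * sideVar κ ηbar s z.1)) (inProb P H) (𝓝 0) := by
    rw [tendsto_zero_iff_abs_tendsto_zero]
    refine squeeze_zero' (Eventually.of_forall fun _ => abs_nonneg _) ?_
      (g := fun z => (R + 1 : ℝ) / R * E z.1 *
        locMoment (fun u => |b u|) (δ z.1) (sampleX W z.1 z.2.1) fun _ => 1)
      (by simpa using ((tendsto_inProb_self (P := P) (H := H) hE0).const_mul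
        ((R + 1 : ℝ) / R)).mul honeabs)
    filter_upwards [hδ.eventually_neighbors h.sample h.density R s H, h.eventually_good H,
      tendsto_fst_inProb.eventually hδ.pos,
      tendsto_fst_inProb.eventually (hδ.tendsto_truncLevel.eventually_gt_atTop 0)]
      with z ⟨_, hnb⟩ ⟨_, hX⟩ hpos hτ
    obtain ⟨n, ω, k⟩ := z
    simp only at hnb hX hpos hτ ⊢
    set x := sampleX W n ω with hx
    refine (abs_locMoment_le b hpos x _).trans ?_
    rw [← locMoment_const_mul]
    refine locMoment_mono hpos x _ _ fun i => ?_
    by_cases hi : x i ∈ s.region ∧ |x i| ≤ δ n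
    · refine mul_le_mul_of_nonneg_left ?_ (abs_nonneg _)
      rw [mul_one]
      obtain ⟨hcard, hN⟩ := hnb i hi.1 hi.2
      have hV : ∀ j, x j ∈ s.region → |x j| ≤ 2 * δ n →
          |clipVar (κ n) (ηbar n) (truncLevel δ n) (x j) - sideVar κ ηbar s n| ≤ E n := by
        intro j hj1 hj2
        have h3 := (hmom n).abs_clipVar_sub_le (hX j).1 hτ (θ := θ n) rfl
        have h4 := ((hreg n).2.2.2.2.1.tendsto s hρ hsub).2 (x j) (hX j).1 hj1 (hX j).2
        have h5 : L * |x j| ≤ |L| * (2 * δ n) :=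
          mul_le_mul (le_abs_self L) hj2 (abs_nonneg _) (abs_nonneg _)
        calc _ ≤ _ := abs_sub_le _ (condVar (κ n) (adjusted (ηbar n)) (x j)) _
          _ ≤ _ := add_le_add h3 (h4.trans h5)
      refine abs_sum_nnCoef_sq_sub_le hR hcard (hV i hi.1 (hi.2.trans (by linarith)))
        fun j hj => hV j (hN j hj).1 ?_
      have h6 := abs_add_le (x j - x i) (x i)
      rw [sub_add_cancel] at h6
      linarith [(hN j hj).2, hi.2]
    · have h7 := hb.eq_zero_of_side hbs hpos hi
      simp [h7]
  have h3 : Tendsto (fun z => (R + 1 : ℝ) / R * (sideVar κ ηbar s z.1 *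
      ((locMoment b (δ z.1) (sampleX W z.1 z.2.1) fun _ => 1) - fX 0 * ∫ u, b u)))
      (inProb P H) (𝓝 0) := by
    have h4 := tendsto_mul_bounded (f := fun z : Σ n, Ω n × ℝ => sideVar κ ηbar s z.1) (C := Cs)
      (Eventually.of_forall fun z => abs_le.2 ⟨?_, (hσ z.1 s).2⟩) (by simpa using hone.sub_const (fX 0 * ∫ u, b u))
    · simpa using h4.const_mul ((R + 1 : ℝ) / R)
    · have := (hσ z.1 s).1
      have : 0 < 1 / Cs := by positivity
      linarith
  have h4 := (h1.add h2).add h3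
  simp only [add_zero] at h4
  refine h4.congr fun z => ?_
  rw [locMoment_sub, locMoment_sub]
  have h5 := locMoment_const_mul b (δ z.1) (sampleX W z.1 z.2.1) (fun _ => 1)
    ((R + 1 : ℝ) / R * sideVar κ ηbar s z.1)
  simp only [mul_one] at h5
  rw [h5]
  ring

/-- The remainder of the outcomes after removal of the truncated errors. -/
theorem IsModel.tendsto_nnResid_rem (h : IsModel P PX fX K κ W fold est T ηbar)
    (hδ : IsLocalSeq δ) {R : ℕ} (hR : 0 < R) {B : ℝ} {b : ℝ → ℝ} (hb : IsWindow B b)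
    (hb0 : ∀ t, 0 ≤ b t) {s : Side} (hbs : ∀ u ∉ s.region, b u = 0) (H : ℕ → Set ℝ) :
    Tendsto (fun z => locMoment b (δ z.1) (sampleX W z.1 z.2.1) fun i =>
      nnResid R (sampleX W z.1 z.2.1) (fun k => sampleM est fold W z.1 z.2.1 k -
        clipErr (κ z.1) (ηbar z.1) (truncLevel δ z.1) (W z.1 k z.2.1)) i ^ 2)
      (inProb P H) (𝓝 0) := by
  obtain ⟨C, q, hmom⟩ := h.exists_moments
  obtain ⟨c, hc0, hc1, hc⟩ := h.conc.exists_bound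
  obtain ⟨_, L, _, _, _, hreg⟩ := h.reg
  have hq := (hmom 0).two_lt
  have hC := (hmom 0).nonneg
  have hone := hδ.tendsto_locMoment_one h.sample h.density hb H
  -- Neighbors are within `δ` on the same side, so the Lipschitz conditional mean causes deviations
  -- of order `δ`.
  have e1 : Tendsto (fun z => locMoment b (δ z.1) (sampleX W z.1 z.2.1) fun i =>
      nnResid R (sampleX W z.1 z.2.1)
        (fun k => popMean κ ηbar z.1 (sampleX W z.1 z.2.1 k)) i ^ 2) (inProb P H) (𝓝 0) := by
    refine squeeze_zero' (g := fun z => (|L| * δ z.1) ^ 2 *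
      locMoment b (δ z.1) (sampleX W z.1 z.2.1) fun _ => 1) ?_ ?_ ?_
    · filter_upwards [tendsto_fst_inProb.eventually hδ.pos] with z hz
      exact mul_nonneg (by positivity) (Finset.sum_nonneg fun i _ =>
        mul_nonneg (hb0 _) (sq_nonneg _))
    · filter_upwards [hδ.eventually_neighbors h.sample h.density R s H, h.eventually_good H,
        tendsto_fst_inProb.eventually hδ.pos] with z ⟨_, hnb⟩ ⟨_, hX⟩ hpos
      obtain ⟨n, ω, k⟩ := z
      simp only at hnb hX hpos ⊢
      rw [← locMoment_const_mul]
      refine locMoment_mono hpos _ _ _ fun i => ?_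
      by_cases hi : sampleX W n ω i ∈ s.region ∧ |sampleX W n ω i| ≤ δ n
      · refine mul_le_mul_of_nonneg_left ?_ (hb0 _)
        rw [mul_one]
        obtain ⟨hcard, hN⟩ := hnb i hi.1 hi.2
        have h1 : |nnResid R (sampleX W n ω)
            (fun k => popMean κ ηbar n (sampleX W n ω k)) i| ≤ |L| * δ n := by
          refine abs_nnResid_le hR hcard fun j hj => ?_
          refine ((hreg n).2.2.1 _ (hX i).1 _ (hX j).1
            (mul_pos_of_mem_region hi.1 (hX i).2 (hN j hj).1 (hX j).2)).trans ?_
          rw [abs_sub_comm]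
          exact mul_le_mul (le_abs_self L) (hN j hj).2 (abs_nonneg _) (abs_nonneg _)
        exact sq_le_sq' (abs_le.1 h1).1 (abs_le.1 h1).2
      · simp [hb.eq_zero_of_side hbs hpos hi]
    · simpa using ((tendsto_inProb_self (P := P) (H := H) (hδ.zero.const_mul |L|)).pow 2).mul hone
  have e2 := hδ.tendsto_nnResid_sq h.sample h.density hR hb hb0
    (ψ := fun n _ i w => outcomeErr (κ n) (ηbar n) (w i) -
      clipErr (κ n) (ηbar n) (truncLevel δ n) (w i))
    (fun n _ i => ((measurable_outcomeErr (hmom n).meas).comp (measurable_pi_apply i)).sub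
      ((measurable_clipErr (hmom n).meas _).comp (measurable_pi_apply i)))
    (θ := fun n => (C + 1) * truncLevel δ n ^ (2 - q))
    (by
      have := (tendsto_rpow_neg_atTop (show 0 < q - 2 by linarith)).comp hδ.tendsto_truncLevel
      simpa [Function.comp_def] using this.const_mul (C + 1))
    (by
      filter_upwards [hδ.tendsto_truncLevel.eventually_gt_atTop 0] with n hn
      positivity)
    (by
      filter_upwards [hδ.tendsto_truncLevel.eventually_gt_atTop 0] with n hn φ i
      filter_upwards [ae_sampleLaw_of_ae (n := n) (κ := κ n)
        (show ∀ᵐ x ∂PX, x ∈ PX.support from PX.support_mem_ae) i] with w hw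
      simp only [resample_self]
      exact (hmom n).lintegral_sub_clipErr_sq_le hw hn) H
  -- The error of unit `i` is computed with the estimator for its own fold, hence without the
  -- outcome of `i`. A small conditional second moment is enough; orthogonality is not used.
  have e3 := hδ.tendsto_nnResid_sq h.sample h.density hR hb hb0
    (ψ := fun n φ i => truncErr (κ n) (c n) (stageErr (est n) (ηbar n) φ (φ i)) i)
    (fun n φ i => measurable_truncErr (measurable_stageErr (h.est_meas n) (hmom n).meas φ _) _ i)
    hc0 (Eventually.of_forall hc1)
    (Eventually.of_forall fun n φ i => Eventually.of_forall fun w =>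
      lintegral_truncErr_sq_le (freeOf_stageErr (est n) (ηbar n) rfl) _ w) H
  have e4 := ((e1.add e2).add e3).const_mul 3
  simp only [add_zero, mul_zero] at e4
  refine squeeze_zero' ?_ ?_ e4
  · filter_upwards [tendsto_fst_inProb.eventually hδ.pos] with z hz
    exact mul_nonneg (by positivity) (Finset.sum_nonneg fun i _ =>
      mul_nonneg (hb0 _) (sq_nonneg _))
  · filter_upwards [h.eventually_good H, tendsto_fst_inProb.eventually hδ.pos,
      tendsto_fst_inProb.eventually hc] with z ⟨hT, hX⟩ hpos hcz
    obtain ⟨n, ω, k⟩ := z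
    simp only at hT hX hpos hcz ⊢
    have h1 : ∀ i, truncErr (κ n) (c n) (stageErr (est n) (ηbar n) (fold n ω) (fold n ω i)) i
        (fun k => W n k ω) = errAt est ηbar fold W n ω i := by
      intro i
      have hcs : condSq (κ n) (stageErr (est n) (ηbar n) (fold n ω) (fold n ω i)) i
          (fun k => W n k ω) ≤ ENNReal.ofReal (c n) := hcz _ (hT _) _ (hX i).1
      rw [truncErr, if_pos hcs]
      rfl
    simp only [h1]
    rw [← locMoment_add, ← locMoment_add, ← locMoment_const_mul]
    refine locMoment_mono hpos _ _ _ fun i => mul_le_mul_of_nonneg_left ?_ (hb0 _)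
    have h2 : (fun k => sampleM est fold W n ω k -
        clipErr (κ n) (ηbar n) (truncLevel δ n) (W n k ω)) = fun k =>
        popMean κ ηbar n (sampleX W n ω k) + (outcomeErr (κ n) (ηbar n) (W n k ω) -
          clipErr (κ n) (ηbar n) (truncLevel δ n) (W n k ω)) + errAt est ηbar fold W n ω k := by
      funext k
      rw [sampleM_eq (κ := κ) (ηbar := ηbar)]
      ring
    rw [h2, nnResid_add, nnResid_add]
    set a := nnResid R (sampleX W n ω) (fun k => popMean κ ηbar n (sampleX W n ω k)) i
    set a' := nnResid R (sampleX W n ω) (fun k => outcomeErr (κ n) (ηbar n) (W n k ω) -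
          clipErr (κ n) (ηbar n) (truncLevel δ n) (W n k ω)) i
    set a'' := nnResid R (sampleX W n ω) (fun k => errAt est ηbar fold W n ω k) i
    nlinarith [sq_nonneg (a - a'), sq_nonneg (a - a''), sq_nonneg (a' - a'')]

/-- Consistency of weighted averages of the nearest-neighbor variance estimators. -/
theorem IsModel.tendsto_sigmaHatSq (h : IsModel P PX fX K κ W fold est T ηbar)
    (hδ : IsLocalSeq δ) {R : ℕ} (hR : 0 < R) {B : ℝ} {b : ℝ → ℝ} (hb : IsWindow B b) {s : Side}
    (hbs : ∀ u ∉ s.region, b u = 0) (H : ℕ → Set ℝ) :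
    Tendsto (fun z => locMoment b (δ z.1) (sampleX W z.1 z.2.1)
      (sigmaHatSq R (sampleX W z.1 z.2.1) (sampleM est fold W z.1 z.2.1)) -
      sideVar κ ηbar s z.1 * (fX 0 * ∫ u, b u)) (inProb P H) (𝓝 0) := by
  obtain ⟨Cs, hCs, hσ⟩ := h.exists_sideVar_bounds
  have hσ0 : ∀ n, 0 ≤ sideVar κ ηbar s n := fun n => (by positivity : 0 ≤ 1 / Cs).trans (hσ n s).1
  have hbs' : ∀ u ∉ s.region, |b u| = 0 := fun u hu => by rw [hbs u hu, abs_zero]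
  have h1 := h.tendsto_nnResid_clipErr hδ hR hb hbs H
  have h2 := h.tendsto_nnResid_clipErr hδ hR hb.abs hbs' H
  have h3 := h.tendsto_nnResid_rem hδ hR hb.abs (fun _ => abs_nonneg _) hbs' H
  -- This leading part is bounded in probability, so its product with the vanishing remainder in the
  -- Cauchy–Schwarz bound vanishes.
  set Qa : (Σ n, Ω n × ℝ) → ℝ := fun z => locMoment (fun u => |b u|) (δ z.1)
    (sampleX W z.1 z.2.1) (fun i => nnResid R (sampleX W z.1 z.2.1)
        (fun k => clipErr (κ z.1) (ηbar z.1) (truncLevel δ z.1) (W z.1 k z.2.1)) i ^ 2) with hQa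
  have hQab : ∀ᶠ z in inProb P H, |Qa z| ≤ 1 + (R + 1 : ℝ) / R * (Cs * |fX 0 * ∫ u, (|b u|)|) := by
    filter_upwards [h2.abs.eventually_le_const (show |(0 : ℝ)| < 1 by simp)] with z hz
    have h4 := abs_sub_abs_le_abs_sub (Qa z)
      ((R + 1 : ℝ) / R * (sideVar κ ηbar s z.1 * (fX 0 * ∫ u, |b u|)))
    have h5 : |(R + 1 : ℝ) / R * (sideVar κ ηbar s z.1 * (fX 0 * ∫ u, |b u|))| ≤
        (R + 1 : ℝ) / R * (Cs * |fX 0 * ∫ u, (|b u|)|) := by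
      rw [abs_mul, abs_mul (sideVar κ ηbar s z.1), abs_of_nonneg (by positivity),
        abs_of_nonneg (hσ0 z.1)]
      gcongr
      exact (hσ z.1 s).2
    linarith
  have h4 := (Real.continuous_sqrt.tendsto 0).comp (tendsto_mul_bounded hQab h3)
  rw [Real.sqrt_zero] at h4
  have h5 := (h4.const_mul 2).add h3
  simp only [mul_zero, add_zero] at h5
  have h6 : Tendsto (fun z => locMoment b (δ z.1) (sampleX W z.1 z.2.1) (fun i =>
      nnResid R (sampleX W z.1 z.2.1) (sampleM est fold W z.1 z.2.1) i ^ 2) -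
      locMoment b (δ z.1) (sampleX W z.1 z.2.1) fun i => nnResid R (sampleX W z.1 z.2.1)
        (fun k => clipErr (κ z.1) (ηbar z.1) (truncLevel δ z.1) (W z.1 k z.2.1)) i ^ 2)
      (inProb P H) (𝓝 0) := by
    rw [tendsto_zero_iff_abs_tendsto_zero]
    refine squeeze_zero' (Eventually.of_forall fun _ => abs_nonneg _) ?_ h5
    filter_upwards [tendsto_fst_inProb.eventually hδ.pos] with z hz
    have h7 := abs_locMoment_sq_add_sub_le b hz (sampleX W z.1 z.2.1)
      (nnResid R (sampleX W z.1 z.2.1)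
        (fun k => clipErr (κ z.1) (ηbar z.1) (truncLevel δ z.1) (W z.1 k z.2.1)))
      (nnResid R (sampleX W z.1 z.2.1) (fun k => sampleM est fold W z.1 z.2.1 k -
        clipErr (κ z.1) (ηbar z.1) (truncLevel δ z.1) (W z.1 k z.2.1)))
    simp only [← nnResid_add, add_sub_cancel] at h7
    exact h7
  have h8 := (h6.add h1).const_mul ((R : ℝ) / (R + 1))
  simp only [mul_zero, add_zero] at h8
  refine h8.congr fun z => ?_
  have h9 : sigmaHatSq R (sampleX W z.1 z.2.1) (sampleM est fold W z.1 z.2.1) = fun i =>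
      (R : ℝ) / (R + 1) * nnResid R (sampleX W z.1 z.2.1) (sampleM est fold W z.1 z.2.1) i ^ 2 := rfl
  rw [h9, locMoment_const_mul]
  have hR' : (0 : ℝ) < R := by exact_mod_cast hR
  field_simp
  ring

end VarianceEstimator

/-! ### Standard errors -/

theorem integrable_pow_mul_halfKernel_sq {K : ℝ → ℝ} (hK : IsKernelFunction K) (s : Side) (k : ℕ) :
    Integrable fun u => u ^ k * halfKernel K s u ^ 2 := by
  obtain ⟨B, -, hB⟩ := hK.exists_isWindow
  have h1 : IsWindow B (halfKernel K s) := hB.indicator s.measurableSet_region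
  simpa only [sq] using ((h1.mul h1).pow_mul k).integrable

/-- The kernel constant in the asymptotic variance of the `p`-th order local polynomial estimator of
a `v`-th derivative. -/
noncomputable def varConst (K : ℝ → ℝ) (p : ℕ) (v : Fin (p + 1)) (s : Side) : ℝ :=
  ((v : ℕ).factorial : ℝ) ^ 2 *
    ∫ u, (∑ i, (popGram K s p)⁻¹ v i * u ^ (i : ℕ)) ^ 2 * halfKernel K s u ^ 2

theorem varConst_eq {K : ℝ → ℝ} (hK : IsKernelFunction K) (p : ℕ) (v : Fin (p + 1)) (s : Side) :
    varConst K p v s = ((v : ℕ).factorial : ℝ) ^ 2 *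
      ∑ k, ∑ l, (popGram K s p)⁻¹ v k * (popGram K s p)⁻¹ v l *
        ∫ u, u ^ ((k : ℕ) + (l : ℕ)) * halfKernel K s u ^ 2 := by
  rw [varConst, ← dotProduct_hankel_mulVec (w := fun u => halfKernel K s u ^ 2)
    (integrable_pow_mul_halfKernel_sq hK s)]
  simp only [dotProduct, Matrix.mulVec, Finset.mul_sum, hankel, Matrix.of_apply]
  refine Finset.sum_congr rfl fun k _ => Finset.sum_congr rfl fun l _ => ?_
  ring

/-- A row of an invertible matrix is nonzero, and the Hankel matrix of the squared kernel is
positive definite. -/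
theorem varConst_pos {K : ℝ → ℝ} (hK : IsKernelFunction K) (p : ℕ) (v : Fin (p + 1)) (s : Side) :
    0 < varConst K p v s := by
  have hG : (popGram K s p).PosDef := hankel_halfKernel_posDef hK s p
  have hy : (popGram K s p)⁻¹ v ≠ 0 := by
    intro h0
    have h1 : ((popGram K s p)⁻¹ * popGram K s p) v v = 1 := by
      rw [Matrix.nonsing_inv_mul _ ((Matrix.isUnit_iff_isUnit_det _).1 hG.isUnit), Matrix.one_apply_eq]
    rw [Matrix.mul_apply] at h1
    simp [congrFun h0] at h1
  rw [varConst, ← dotProduct_hankel_mulVec (w := fun u => halfKernel K s u ^ 2)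
    (integrable_pow_mul_halfKernel_sq hK s)]
  refine mul_pos (by positivity) ?_
  have := (hankel_halfKernel_sq_posDef hK s p).dotProduct_mulVec_pos hy
  simpa using this

/-- Reflection changes the sign of odd moments, and the signs cancel in the squared weights. Both
sides therefore share the constant of the target variance. -/
theorem varConst_one_zero {K : ℝ → ℝ} (hK : IsKernelFunction K) (s : Side) :
    varConst K 1 0 s = kappaBar K := by
  have hD := det_two_kernelMoment hK
  set D := kernelMoment K 2 * kernelMoment K 0 - kernelMoment K 1 ^ 2 with hDdef
  have hs : s.sign ^ 2 = 1 := by cases s <;> simp [Side.sign]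
  have hent : ∀ i j : Fin 2, popGram K s 1 i j =
      s.sign ^ ((i : ℕ) + (j : ℕ)) * kernelMoment K ((i : ℕ) + (j : ℕ)) := fun i j =>
    integral_pow_mul_halfKernel hK.symm s _
  have hdet : (popGram K s 1).det = D := by
    rw [Matrix.det_fin_two]
    simp only [hent]
    simp only [Fin.val_zero, Fin.val_one, add_zero, zero_add, pow_zero, pow_one, one_mul,
      one_add_one_eq_two, hDdef]
    linear_combination (kernelMoment K 0 * kernelMoment K 2 - kernelMoment K 1 ^ 2) * hs
  have hi0 : (popGram K s 1)⁻¹ 0 0 = D⁻¹ * kernelMoment K 2 := by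
    rw [Matrix.inv_def, Matrix.adjugate_fin_two, hdet]
    simp [hent, hs]
  have hi1 : (popGram K s 1)⁻¹ 0 1 = -(D⁻¹ * (s.sign * kernelMoment K 1)) := by
    rw [Matrix.inv_def, Matrix.adjugate_fin_two, hdet]
    simp [hent]
  have h1 : ∀ u, (∑ i, (popGram K s 1)⁻¹ 0 i * u ^ (i : ℕ)) ^ 2 * halfKernel K s u ^ 2 =
      (halfKernel K s u * (kernelMoment K 1 * (s.sign * u) - kernelMoment K 2)) ^ 2 / D ^ 2 := by
    intro u
    rw [Fin.sum_univ_two, hi0, hi1]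
    simp only [Fin.val_zero, Fin.val_one, pow_zero, pow_one]
    field_simp
    ring
  rw [varConst]
  simp only [h1]
  rw [integral_div, kappaBar, ← hDdef]
  simp only [Fin.val_zero, Nat.factorial_zero, Nat.cast_one, one_pow, one_mul]
  congr 1
  cases s
  · rw [integral_halfKernel_plus
      (fun u k => (k * (kernelMoment K 1 * (Side.plus.sign * u) - kernelMoment K 2)) ^ 2) (by simp)]
    simp [Side.sign]
  · rw [integral_halfKernel_minus
      (fun u k => (k * (kernelMoment K 1 * (Side.minus.sign * u) - kernelMoment K 2)) ^ 2) (by simp)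
      hK.symm]
    simp [Side.sign]

section VarianceEstimator

universe u

variable {Ω : ℕ → Type u} [∀ n, MeasurableSpace (Ω n)] {P : ∀ n, Measure (Ω n)}
  [∀ n, IsProbabilityMeasure (P n)] {PX : Measure ℝ} [IsProbabilityMeasure PX] {fX K : ℝ → ℝ}
  {d : ℕ → ℕ} {κ : ∀ n, Kernel ℝ (ℝ × (Fin (d n) → ℝ))} [∀ n, IsMarkovKernel (κ n)]
  {W : ∀ n, Fin n → Ω n → Obs (d n)} {S : ℕ} {fold : ∀ n, Ω n → Fin n → Fin S}
  {est : ∀ n, (I : Finset (Fin n)) → (I → Obs (d n)) → (Fin (d n) → ℝ) → ℝ}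
  {T : ∀ n, Set ((Fin (d n) → ℝ) → ℝ)} {ηbar : ∀ n, (Fin (d n) → ℝ) → ℝ} {δ : ℕ → ℝ}

theorem halfKernel_sq_window {K : ℝ → ℝ} {B : ℝ} (hB : IsWindow B K) (s : Side) (k : ℕ) :
    IsWindow (B * B) fun u => u ^ k * halfKernel K s u ^ 2 := by
  have h1 : IsWindow B (halfKernel K s) := hB.indicator s.measurableSet_region
  simpa only [sq] using (h1.mul h1).pow_mul k

theorem halfKernel_sq_eq_zero {K : ℝ → ℝ} (s : Side) (k : ℕ) :
    ∀ u ∉ s.region, u ^ k * halfKernel K s u ^ 2 = 0 := fun u hu => by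
  rw [halfKernel, Set.indicator_of_notMem hu]; simp

/-- The limit of the one-sided standard errors at a nonrandom bandwidth. -/
theorem IsModel.tendsto_sideSe (h : IsModel P PX fX K κ W fold est T ηbar)
    (hδ : IsLocalSeq δ) {R : ℕ} (hR : 0 < R) (p : ℕ) (v : Fin (p + 1)) (s : Side) :
    Tendsto (fun z => (z.1 : ℝ) * δ z.1 ^ (2 * (v : ℕ) + 1) *
      (∑ i, sideWeight K p v s (δ z.1) (sampleX W z.1 z.2.1) i ^ 2 *
        sigmaHatSq R (sampleX W z.1 z.2.1) (sampleM est fold W z.1 z.2.1) i) -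
      varConst K p v s / fX 0 * sideVar κ ηbar s z.1)
      (inProb P fun n => Set.Icc (δ n) (δ n)) (𝓝 0) := by
  obtain ⟨B, -, hB⟩ := h.kernel.exists_isWindow
  obtain ⟨ρ, D, hD⟩ := h.density.exists_densityBound
  obtain ⟨Cs, hCs, hσ⟩ := h.exists_sideVar_bounds
  have hσ' : ∀ n, |sideVar κ ηbar s n| ≤ Cs := fun n => by
    have := (hσ n s).1
    have h2 : 0 < 1 / Cs := by positivity
    exact abs_le.2 ⟨by linarith, (hσ n s).2⟩
  have hf := h.density.pos
  -- Order zero suffices for the limit of the Gram matrix and only requires `n δ → ∞`.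
  have hpilot : IsPilot P PX W K 0 fun n => Set.Icc (δ n) (δ n) :=
    isPilot_singleton h.kernel h.sample.measurable_sampleX hD hδ.pos hδ.zero (by simpa using hδ.rate)
  have hG := (hpilot.tendsto_inv_locGram h.sample h.density h.kernel s p).1
  have hQ := fun k : ℕ => h.tendsto_sigmaHatSq hδ hR (halfKernel_sq_window hB s k)
    (halfKernel_sq_eq_zero s k) (fun n => Set.Icc (δ n) (δ n))
  set F := inProb P fun n => Set.Icc (δ n) (δ n) with hF
  have hkl : ∀ k l : Fin (p + 1), Tendsto (fun z =>
      (locGram K s p z.2.2 (sampleX W z.1 z.2.1))⁻¹ v k *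
      (locGram K s p z.2.2 (sampleX W z.1 z.2.1))⁻¹ v l *
      locMoment (fun u => u ^ ((k : ℕ) + (l : ℕ)) * halfKernel K s u ^ 2) (δ z.1)
        (sampleX W z.1 z.2.1)
        (sigmaHatSq R (sampleX W z.1 z.2.1) (sampleM est fold W z.1 z.2.1)) -
      (popGram K s p)⁻¹ v k * (popGram K s p)⁻¹ v l *
        (∫ u, u ^ ((k : ℕ) + (l : ℕ)) * halfKernel K s u ^ 2) / fX 0 * sideVar κ ηbar s z.1)
      F (𝓝 0) := by
    intro k l
    have h1 := (hG v k).mul (hG v l)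
    set I := ∫ u, u ^ ((k : ℕ) + (l : ℕ)) * halfKernel K s u ^ 2
    set a := (popGram K s p)⁻¹ v k
    set a' := (popGram K s p)⁻¹ v l
    have h2 := h1.mul (hQ ((k : ℕ) + (l : ℕ)))
    have h3 := tendsto_mul_bounded (f := fun z : Σ n, Ω n × ℝ => sideVar κ ηbar s z.1 * (fX 0 * I))
      (C := Cs * |fX 0 * I|) (l := F) (Eventually.of_forall fun z => by
        rw [abs_mul]; exact mul_le_mul_of_nonneg_right (hσ' _) (abs_nonneg _))
      (tendsto_sub_nhds_zero_iff.2 h1)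
    have h4 := h2.add h3
    simp only [mul_zero, add_zero] at h4
    refine h4.congr fun z => ?_
    field_simp
    ring
  have h5 := (tendsto_finsetSum Finset.univ fun k _ =>
    tendsto_finsetSum Finset.univ fun l _ => hkl k l).const_mul (((v : ℕ).factorial : ℝ) ^ 2)
  simp only [Finset.sum_const_zero, mul_zero] at h5
  refine h5.congr' ?_
  filter_upwards [tendsto_fst_inProb.eventually hδ.pos,
    tendsto_fst_inProb.eventually (eventually_gt_atTop 0),
    eventually_inProb_of_forall (P := P) (H := fun n => Set.Icc (δ n) (δ n))
      (p := fun z => z.2.2 = δ z.1)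
      (Eventually.of_forall fun n ω k hk => le_antisymm hk.2 hk.1)] with z hz hn hzz
  have hn' : (0 : ℝ) < z.1 := by exact_mod_cast hn
  rw [hzz, sum_sideWeight_sq_mul K p v s hz, varConst_eq h.kernel]
  simp only [Finset.sum_sub_distrib, mul_sub]
  congr 1
  · have hpow : δ z.1 ^ (2 * (v : ℕ) + 1) = (δ z.1 ^ (v : ℕ)) ^ 2 * δ z.1 := by ring
    rw [hpow]
    field_simp
  · simp only [Finset.mul_sum, Finset.sum_mul, Finset.sum_div]
    refine Finset.sum_congr rfl fun k _ => Finset.sum_congr rfl fun l _ => ?_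
    ring

/-- The limit of the standard errors at a nonrandom bandwidth. -/
theorem IsModel.tendsto_seSq (h : IsModel P PX fX K κ W fold est T ηbar)
    (hδ : IsLocalSeq δ) {R : ℕ} (hR : 0 < R) (p : ℕ) (v : Fin (p + 1)) {H : ℕ → Set ℝ} :
    Tendsto (fun z => (z.1 : ℝ) * δ z.1 ^ (2 * (v : ℕ) + 1) *
      seSq K R p v (δ z.1) (sampleX W z.1 z.2.1) (sampleM est fold W z.1 z.2.1) -
      (varConst K p v .plus / fX 0 * sideVar κ ηbar .plus z.1 +
        varConst K p v .minus / fX 0 * sideVar κ ηbar .minus z.1)) (inProb P H) (𝓝 0) := by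
  have h1 := (h.tendsto_sideSe hδ hR p v .plus).add (h.tendsto_sideSe hδ hR p v .minus)
  rw [add_zero] at h1
  have h2 : Tendsto (fun z : Σ n, Ω n × ℝ => (z.1 : ℝ) * δ z.1 ^ (2 * (v : ℕ) + 1) *
      seSq K R p v (δ z.1) (sampleX W z.1 z.2.1) (sampleM est fold W z.1 z.2.1) -
      (varConst K p v .plus / fX 0 * sideVar κ ηbar .plus z.1 +
        varConst K p v .minus / fX 0 * sideVar κ ηbar .minus z.1))
      (inProb P fun n => Set.Icc (δ n) (δ n)) (𝓝 0) := by
    refine h1.congr' ?_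
    filter_upwards [tendsto_fst_inProb.eventually hδ.pos] with z hz
    rw [seSq_eq K R p v hz]
    ring
  -- The expression does not involve the bandwidth coordinate, so the set over which uniformity is
  -- stated can be replaced.
  exact tendsto_inProb_change (A := fun n ω => (n : ℝ) * δ n ^ (2 * (v : ℕ) + 1) *
      seSq K R p v (δ n) (sampleX W n ω) (sampleM est fold W n ω) -
      (varConst K p v .plus / fX 0 * sideVar κ ηbar .plus n +
        varConst K p v .minus / fX 0 * sideVar κ ηbar .minus n))
    (fun n => Set.nonempty_Icc.2 le_rfl) h2

theorem sigmaHatSq_nonneg {n : ℕ} (R : ℕ) (x m : Fin n → ℝ) (i : Fin n) : 0 ≤ sigmaHatSq R x m i := by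
  rw [sigmaHatSq]; positivity

/-- Standard errors vanish along pilot bandwidths of a nonrandom order of magnitude. -/
theorem IsModel.tendsto_seSq_zero (h : IsModel P PX fX K κ W fold est T ηbar)
    (hδ : IsLocalSeq δ) {R : ℕ} (hR : 0 < R) {p : ℕ} {H : ℕ → Set ℝ} (hpilot : IsPilot P PX W K p H)
    {r : ℝ} (hr : 0 < r) (hH : ∀ᶠ n in atTop, ∀ k ∈ H n, r * δ n ≤ k ∧ k ≤ δ n) :
    Tendsto (fun z => seSq K R p (Fin.last p) z.2.2 (sampleX W z.1 z.2.1)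
      (sampleM est fold W z.1 z.2.1)) (inProb P H) (𝓝 0) := by
  obtain ⟨B, hB0, hB⟩ := h.kernel.exists_isWindow
  obtain ⟨Cs, hCs, hσ⟩ := h.exists_sideVar_bounds
  have hσ' : ∀ n s, |sideVar κ ηbar s n| ≤ Cs := fun n s => by
    have := (hσ n s).1
    have h2 : 0 < 1 / Cs := by positivity
    exact abs_le.2 ⟨by linarith, (hσ n s).2⟩
  have hHz : ∀ᶠ z in inProb P H, r * δ z.1 ≤ z.2.2 ∧ z.2.2 ≤ δ z.1 :=
    eventually_inProb_of_forall (hH.mono fun n hn ω k hk => hn k hk)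
  have side : ∀ s, Tendsto (fun z => ∑ i,
      sideWeight K p (Fin.last p) s z.2.2 (sampleX W z.1 z.2.1) i ^ 2 *
        sigmaHatSq R (sampleX W z.1 z.2.1) (sampleM est fold W z.1 z.2.1) i) (inProb P H) (𝓝 0) := by
    intro s
    -- Up to constants the indicator of the widest window dominates the squared kernels at all
    -- bandwidths between `r * δ` and `δ`, so one limit at `δ` controls all of them.
    set b := s.region.indicator ((Set.Icc (-1 : ℝ) 1).indicator fun _ => (1 : ℝ)) with hb
    have hw : IsWindow 1 b := isWindow_one.indicator s.measurableSet_region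
    have hQ := h.tendsto_sigmaHatSq hδ hR hw (fun u hu => Set.indicator_of_notMem hu _) H
    rw [integral_indicator_side, mul_one] at hQ
    have hQb : ∀ᶠ z in inProb P H, locMoment b (δ z.1) (sampleX W z.1 z.2.1)
        (sigmaHatSq R (sampleX W z.1 z.2.1) (sampleM est fold W z.1 z.2.1)) ≤
        1 + Cs * fX 0 := by
      filter_upwards [hQ.eventually_le_const one_pos] with z hz
      have := mul_le_mul_of_nonneg_right (le_trans (le_abs_self _) (hσ' z.1 s)) h.density.pos.le
      linarith
    have hM : ∀ k : ℕ, ∀ᶠ z in inProb P H,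
        |locMoment (fun u => u ^ k * halfKernel K s u ^ 2) z.2.2 (sampleX W z.1 z.2.1)
          (sigmaHatSq R (sampleX W z.1 z.2.1) (sampleM est fold W z.1 z.2.1))| ≤
        r⁻¹ * (B * B) * (1 + Cs * fX 0) := by
      intro k
      filter_upwards [hQb, hHz, hpilot.eventually_pos, tendsto_fst_inProb.eventually hδ.pos]
        with z hz ⟨hz1, hz2⟩ ⟨hz3, _, hn⟩ hz4
      have hn' : (0 : ℝ) < z.1 := by exact_mod_cast hn
      refine le_trans ?_ (mul_le_mul_of_nonneg_left hz (by positivity))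
      refine (abs_locMoment_le _ hz3 _ _).trans ?_
      simp only [locMoment, Finset.mul_sum]
      refine Finset.sum_le_sum fun i _ => ?_
      rw [abs_of_nonneg (sigmaHatSq_nonneg R _ _ i)]
      set σ := sigmaHatSq R (sampleX W z.1 z.2.1) (sampleM est fold W z.1 z.2.1) i
      have hσ0 : 0 ≤ σ := sigmaHatSq_nonneg R _ _ i
      set x := sampleX W z.1 z.2.1 i
      by_cases hx : x ∈ s.region ∧ |x| ≤ z.2.2
      · have h1 : b (x / δ z.1) = 1 := by
          have h2 : x / δ z.1 ∈ s.region := by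
            cases s
            · simp only [Side.region, Set.mem_Ici] at hx ⊢
              exact div_nonneg hx.1 hz4.le
            · simp only [Side.region, Set.mem_Iio] at hx ⊢
              exact div_neg_of_neg_of_pos hx.1 hz4
          have h3 : x / δ z.1 ∈ Set.Icc (-1 : ℝ) 1 := by
            rw [Set.mem_Icc, ← abs_le, abs_div, abs_of_pos hz4, div_le_one hz4]
            exact hx.2.trans hz2
          rw [hb, Set.indicator_of_mem h2, Set.indicator_of_mem h3]
        rw [h1]
        have h4 := (halfKernel_sq_window hB s k).bound (x / z.2.2)
        have h5 : ((z.1 : ℝ) * z.2.2)⁻¹ ≤ r⁻¹ * ((z.1 : ℝ) * δ z.1)⁻¹ := by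
          rw [← mul_inv]
          refine inv_anti₀ (by positivity) ?_
          nlinarith
        calc _ ≤ (r⁻¹ * ((z.1 : ℝ) * δ z.1)⁻¹) * ((B * B) * σ) := by gcongr
          _ = _ := by ring
      · rw [(halfKernel_sq_window hB s k).eq_zero_of_side (halfKernel_sq_eq_zero s k) hz3 hx]
        have h6 : 0 ≤ b (x / δ z.1) := by
          rw [hb]
          exact Set.indicator_nonneg (fun _ _ => Set.indicator_nonneg (fun _ _ => zero_le_one) _) _
        simp only [abs_zero, zero_mul, mul_zero]
        positivity
    have hG := (hpilot.tendsto_inv_locGram h.sample h.density h.kernel s p).1 (Fin.last p)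
    have hrate := hpilot.rate.inv_tendsto_atTop
    have hkl : ∀ k l : Fin (p + 1), Tendsto (fun z =>
        locMoment (fun u => u ^ ((k : ℕ) + (l : ℕ)) * halfKernel K s u ^ 2) z.2.2
          (sampleX W z.1 z.2.1)
          (sigmaHatSq R (sampleX W z.1 z.2.1) (sampleM est fold W z.1 z.2.1)) *
        (((z.1 : ℝ) * z.2.2 ^ (2 * p + 1))⁻¹ *
          ((locGram K s p z.2.2 (sampleX W z.1 z.2.1))⁻¹ (Fin.last p) k *
          (locGram K s p z.2.2 (sampleX W z.1 z.2.1))⁻¹ (Fin.last p) l)))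
        (inProb P H) (𝓝 0) := by
      intro k l
      refine tendsto_mul_bounded (hM _) ?_
      have := hrate.mul ((hG k).mul (hG l))
      rwa [zero_mul] at this
    have h5 := (tendsto_finsetSum Finset.univ fun k _ =>
      tendsto_finsetSum Finset.univ fun l _ => hkl k l).const_mul ((p.factorial : ℝ) ^ 2)
    simp only [Finset.sum_const_zero, mul_zero] at h5
    refine h5.congr' ?_
    filter_upwards [hpilot.eventually_pos] with z ⟨hz, _, hn⟩
    have hn' : (0 : ℝ) < z.1 := by exact_mod_cast hn
    rw [sum_sideWeight_sq_mul K p _ s hz]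
    simp only [Fin.val_last, Finset.mul_sum]
    refine Finset.sum_congr rfl fun k _ => Finset.sum_congr rfl fun l _ => ?_
    have hpow : z.2.2 ^ (2 * p + 1) = (z.2.2 ^ p) ^ 2 * z.2.2 := by ring
    rw [hpow]
    field_simp
  have h1 := (side .plus).add (side .minus)
  rw [add_zero] at h1
  refine h1.congr' ?_
  filter_upwards [hpilot.eventually_pos] with z ⟨hz, _, _⟩
  rw [seSq_eq K R p _ hz]

end VarianceEstimator

/-! ### The global polynomial fit -/

section GlobalFit

universe u

variable {Ω : ℕ → Type u} [∀ n, MeasurableSpace (Ω n)] {P : ∀ n, Measure (Ω n)}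
  [∀ n, IsProbabilityMeasure (P n)] {PX : Measure ℝ} [IsProbabilityMeasure PX] {fX K : ℝ → ℝ}
  {d : ℕ → ℕ} {κ : ∀ n, Kernel ℝ (ℝ × (Fin (d n) → ℝ))} [∀ n, IsMarkovKernel (κ n)]
  {W : ∀ n, Fin n → Ω n → Obs (d n)} {S : ℕ} {fold : ∀ n, Ω n → Fin n → Fin S}
  {est : ∀ n, (I : Finset (Fin n)) → (I → Obs (d n)) → (Fin (d n) → ℝ) → ℝ}
  {T : ∀ n, Set ((Fin (d n) → ℝ) → ℝ)} {ηbar : ∀ n, (Fin (d n) → ℝ) → ℝ}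

theorem IsSample.tendsto_average (hS : IsSample P PX κ W fold) {φ : ℝ → ℝ} (hφ : Measurable φ)
    {B : ℝ} (hB : ∀ t, |φ t| ≤ B) (H : ℕ → Set ℝ) :
    Tendsto (fun z => (z.1 : ℝ)⁻¹ * ∑ i, φ (sampleX W z.1 z.2.1 i)) (inProb P H)
      (𝓝 (∫ t, φ t ∂PX)) := by
  have hinv : Tendsto (fun n : ℕ => (n : ℝ)⁻¹ * ∫ t, φ t ^ 2 ∂PX) atTop
      (𝓝 (0 * ∫ t, φ t ^ 2 ∂PX)) :=
    tendsto_inv_atTop_nhds_zero_nat.mul_const (∫ t, φ t ^ 2 ∂PX)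
  have h3 := hS.tendsto_of_lintegral_sq (F := fun n _ w => (n : ℝ)⁻¹ *
      (∑ i, φ (w i).1 - n * ∫ t, φ t ∂PX))
    (fun n _ => by
      refine ((Finset.measurable_fun_sum _ fun i _ => hφ.comp ?_).sub_const _).const_mul _
      fun_prop)
    (β := fun n => (n : ℝ)⁻¹ * ∫ t, φ t ^ 2 ∂PX)
    (by simpa using hinv) (by
      filter_upwards [eventually_gt_atTop 0] with n hn0 _
      have hn' : (0 : ℝ) < n := by exact_mod_cast hn0
      have h4 := lintegral_sq_sum_sub_integral_le (n := n) (PX := PX) (κ := κ n) Finset.univ hφ hB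
      simp only [Finset.card_univ, Fintype.card_fin] at h4
      simp only [mul_pow]
      simp_rw [ENNReal.ofReal_mul (sq_nonneg (n : ℝ)⁻¹)]
      rw [lintegral_const_mul' _ _ ENNReal.ofReal_ne_top]
      refine (mul_le_mul_right h4 _).trans ?_
      rw [← ENNReal.ofReal_mul (by positivity)]
      refine ENNReal.ofReal_le_ofReal (le_of_eq ?_)
      field_simp) H
  have h4 := h3.add_const (∫ t, φ t ∂PX)
  rw [zero_add] at h4
  refine h4.congr' ?_
  filter_upwards [tendsto_fst_inProb.eventually (eventually_gt_atTop 0)] with z hz0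
  have hn' : (z.1 : ℝ) ≠ 0 := by positivity
  simp only [sampleX, runX]
  field_simp
  ring

/-- The first-stage errors vanish in mean square. -/
theorem IsModel.tendsto_errAt_sq (h : IsModel P PX fX K κ W fold est T ηbar) (H : ℕ → Set ℝ) :
    Tendsto (fun z => (z.1 : ℝ)⁻¹ * ∑ i, errAt est ηbar fold W z.1 z.2.1 i ^ 2)
      (inProb P H) (𝓝 0) := by
  obtain ⟨c, hc0, hc1, hc⟩ := h.conc.exists_bound
  obtain ⟨C, q, hmom⟩ := h.exists_moments
  have hm : ∀ n (φ : Fin n → Fin S) i, Measurable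
      (truncErr (κ n) (c n) (stageErr (est n) (ηbar n) φ (φ i)) i) := fun n φ i =>
    measurable_truncErr (measurable_stageErr (h.est_meas n) (hmom n).meas φ _) _ i
  have h1 := h.sample.tendsto_of_lintegral_abs (F := fun n φ w => ∑ i, (n : ℝ)⁻¹ *
      truncErr (κ n) (c n) (stageErr (est n) (ηbar n) φ (φ i)) i w ^ 2)
    (fun n φ => Finset.measurable_fun_sum _ fun i _ => ((hm n φ i).pow_const 2).const_mul _)
    hc0 (by
      filter_upwards [eventually_gt_atTop 0] with n hn φ
      have hn' : (n : ℝ) ≠ 0 := by positivity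
      have h2 := lintegral_sum_weighted_sq_le (PX := PX) (κ := κ n) (hm n φ) (fun i =>
        Eventually.of_forall fun w => lintegral_truncErr_sq_le (freeOf_stageErr (est n) (ηbar n) rfl)
          (c n) w) (a := fun _ _ => (n : ℝ)⁻¹) (fun _ => measurable_const)
        (fun _ _ => by positivity)
      refine (lintegral_mono fun w => ?_).trans (h2.trans (le_of_eq ?_))
      · rw [abs_of_nonneg (Finset.sum_nonneg fun i _ => by positivity)]
      · simp [hn']) H
  refine h1.congr' ?_
  filter_upwards [h.eventually_good H, tendsto_fst_inProb.eventually hc] with z ⟨hT, hX⟩ hcz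
  rw [Finset.mul_sum]
  refine Finset.sum_congr rfl fun i _ => ?_
  have hcs : condSq (κ z.1) (stageErr (est z.1) (ηbar z.1) (fold z.1 z.2.1) (fold z.1 z.2.1 i)) i
      (fun k => W z.1 k z.2.1) ≤ ENNReal.ofReal (c z.1) := hcz _ (hT _) _ (hX i).1
  rw [truncErr, if_pos hcs]
  rfl

/-- Points near the cutoff in the interior of the side belong to the support, and the side is a
neighborhood of them. -/
theorem IsModel.measure_side_pos (h : IsModel P PX fX K κ W fold est T ηbar) (s : Side) {A : ℝ}
    (hA : PX.support ⊆ Set.Icc (-A) A) : 0 < PX (s.region ∩ Set.Icc (-A) A) := by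
  obtain ⟨ρ, hρ, hsub⟩ := h.density.exists_Icc_subset_support
  have h1 : ∀ x ∈ Set.Icc (-ρ) ρ, s.region ∈ 𝓝 x → 0 < PX (s.region ∩ Set.Icc (-A) A) := by
    intro x hx hs
    have h2 : 0 < PX s.region := (Measure.mem_support_iff_forall x).1 (hsub hx) _ hs
    have h3 : ∀ᵐ x ∂PX, x ∈ Set.Icc (-A) A := by
      filter_upwards [PX.support_mem_ae] with x hx using hA hx
    rwa [Set.inter_comm, Measure.measure_inter_eq_of_ae h3]
  cases s
  · exact h1 (ρ / 2) ⟨by linarith, by linarith⟩ (Ici_mem_nhds (by linarith))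
  · exact h1 (-(ρ / 2)) ⟨by linarith, by linarith⟩ (Iio_mem_nhds (by linarith))

/-- The estimated first stage does not affect the global polynomial fit asymptotically. -/
theorem IsModel.tendsto_gammaHat (h : IsModel P PX fX K κ W fold est T ηbar) (s : Side)
    (H : ℕ → Set ℝ) :
    Tendsto (fun z => gammaHat s (sampleX W z.1 z.2.1) (sampleM est fold W z.1 z.2.1) -
      gammaHat s (sampleX W z.1 z.2.1) (adjustedSample (ηbar z.1) fun i => W z.1 i z.2.1))
      (inProb P H) (𝓝 0) := by
  -- Bounded support lets the monomials be cut off at `A`, so the law of large numbers is needed for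
  -- bounded functions only.
  obtain ⟨A, hA0, hA⟩ : ∃ A : ℝ, 0 < A ∧ PX.support ⊆ Set.Icc (-A) A := by
    obtain ⟨A, hA⟩ := h.bdd.subset_closedBall 0
    refine ⟨|A| + 1, by positivity, hA.trans ?_⟩
    rw [Real.closedBall_eq_Icc]
    have := le_abs_self A
    exact Set.Icc_subset_Icc (by linarith) (by linarith)
  set D : Set ℝ := s.region ∩ Set.Icc (-A) A with hD
  have hDm : MeasurableSet D := s.measurableSet_region.inter measurableSet_Icc
  set φ : ℕ → ℝ → ℝ := fun k => D.indicator fun t => t ^ k with hφ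
  have hφm : ∀ k, Measurable (φ k) := fun k => (measurable_id.pow_const k).indicator hDm
  have hφb : ∀ k t, |φ k t| ≤ A ^ k := by
    intro k t
    by_cases ht : t ∈ D
    · simp only [hφ, Set.indicator_of_mem ht, abs_pow]
      exact pow_le_pow_left₀ (abs_nonneg _) (abs_le.2 ht.2) k
    · simp only [hφ, Set.indicator_of_notMem ht, abs_zero]
      positivity
  have hpow : ∀ k t, t ∈ Set.Icc (-A) A → sidePow (fun _ => 1) s k t = φ k t := by
    intro k t ht
    by_cases h1 : t ∈ s.region
    · simp [sidePow, halfKernel, hφ, h1, show t ∈ D from ⟨h1, ht⟩]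
    · have : t ∉ D := fun h2 => h1 h2.1
      simp [sidePow, halfKernel, hφ, h1, this]
  set w : ℝ → ℝ := fun t => fX t * D.indicator (fun _ => 1) t with hw
  have hwφ : ∀ k t, t ^ k * w t = fX t * φ k t := by
    intro k t
    by_cases ht : t ∈ D <;> simp [hw, hφ, ht, mul_comm]
  have hfX : Integrable fX := by
    obtain ⟨hm, h0, hPX, -⟩ := h.density
    refine ⟨hm.aestronglyMeasurable, ?_⟩
    rw [hasFiniteIntegral_iff_ofReal (Eventually.of_forall h0)]
    have h1 : PX Set.univ = ∫⁻ x, ENNReal.ofReal (fX x) := by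
      conv_lhs => rw [hPX]
      rw [withDensity_apply _ MeasurableSet.univ, Measure.restrict_univ]
    rw [← h1, measure_univ]
    exact ENNReal.one_lt_top
  have hint : ∀ k : ℕ, Integrable fun t => t ^ k * w t := by
    intro k
    simp only [hwφ]
    simpa only [mul_comm] using hfX.bdd_mul (c := A ^ k) (hφm k).aestronglyMeasurable
      (Eventually.of_forall fun t => by simpa using hφb k t)
  have hlim : ∀ k, ∫ t, φ k t ∂PX = ∫ t, t ^ k * w t := fun k => by
    rw [h.density.integral_eq]
    simp only [hwφ]
  have hG0 : (hankel w 4).PosDef := by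
    refine hankel_posDef hint (fun t => mul_nonneg (h.density.2.1 t)
      (Set.indicator_nonneg (fun _ _ => zero_le_one) _)) ?_ 4
    have h1 := hlim 0
    simp only [pow_zero, one_mul] at h1
    rw [← h1]
    simp only [hφ, pow_zero]
    rw [integral_indicator hDm]
    simp only [integral_const, smul_eq_mul, mul_one, measureReal_restrict_apply_univ]
    exact ENNReal.toReal_pos (h.measure_side_pos s hA).ne' (measure_ne_top _ _)
  have hX : ∀ᶠ z in inProb P H, ∀ i, sampleX W z.1 z.2.1 i ∈ Set.Icc (-A) A :=
    (h.eventually_good H).mono fun z hz i => hA (hz.2 i).1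
  have hgram : ∀ i j : Fin 5, Tendsto
      (fun z => locGram (fun _ => 1) s 4 1 (sampleX W z.1 z.2.1) i j) (inProb P H)
      (𝓝 (hankel w 4 i j)) := by
    intro i j
    have h1 := h.sample.tendsto_average (hφm ((i : ℕ) + (j : ℕ))) (hφb _) H
    rw [hlim] at h1
    refine h1.congr' ?_
    filter_upwards [hX] with z hz
    simp only [locGram, Matrix.of_apply, locMoment, mul_one, div_one]
    congr 1
    exact Finset.sum_congr rfl fun k _ => (hpow _ _ (hz k)).symm
  have hinv := (tendsto_matrix_inv hgram hG0.det_pos.ne').1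
  have herr := (Real.continuous_sqrt.tendsto 0).comp (h.tendsto_errAt_sq H)
  rw [Real.sqrt_zero] at herr
  -- The Cauchy–Schwarz inequality bounds these moments by the mean square of the first-stage
  -- errors; no smoothness of the first stage enters.
  have hmom : ∀ k : ℕ, Tendsto (fun z => locMoment (sidePow (fun _ => 1) s k) 1
      (sampleX W z.1 z.2.1) (errAt est ηbar fold W z.1 z.2.1)) (inProb P H) (𝓝 0) := by
    intro k
    rw [tendsto_zero_iff_abs_tendsto_zero]
    refine squeeze_zero' (Eventually.of_forall fun _ => abs_nonneg _) ?_
      (by have h0 := herr.const_mul (A ^ k); rwa [mul_zero] at h0)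
    filter_upwards [hX, tendsto_fst_inProb.eventually (eventually_gt_atTop 0)] with z hz hn
    have hn' : (0 : ℝ) < z.1 := by exact_mod_cast hn
    set e := errAt est ηbar fold W z.1 z.2.1
    simp only [Function.comp]
    have h1 : |∑ i, sidePow (fun _ => 1) s k (sampleX W z.1 z.2.1 i / 1) * e i| ≤
        A ^ k * ∑ i, |e i| := by
      rw [Finset.mul_sum]
      refine (Finset.abs_sum_le_sum_abs _ _).trans (Finset.sum_le_sum fun i _ => ?_)
      rw [div_one, hpow k _ (hz i), abs_mul]
      exact mul_le_mul_of_nonneg_right (hφb _ _) (abs_nonneg _)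
    have h2 : (z.1 : ℝ)⁻¹ * ∑ i, |e i| ≤ √((z.1 : ℝ)⁻¹ * ∑ i, e i ^ 2) := by
      refine Real.le_sqrt_of_sq_le ?_
      have h3 := sq_sum_le_card_mul_sum_sq (s := Finset.univ) (f := fun i => |e i|)
      simp only [sq_abs, Finset.card_univ, Fintype.card_fin] at h3
      rw [mul_pow]
      calc _ ≤ ((z.1 : ℝ)⁻¹) ^ 2 * (z.1 * ∑ i, e i ^ 2) := by gcongr
        _ = _ := by field_simp
    rw [locMoment, mul_one, abs_mul, abs_of_pos (by positivity)]
    calc _ ≤ (z.1 : ℝ)⁻¹ * (A ^ k * ∑ i, |e i|) := by gcongr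
      _ = A ^ k * ((z.1 : ℝ)⁻¹ * ∑ i, |e i|) := by ring
      _ ≤ _ := mul_le_mul_of_nonneg_left h2 (by positivity)
  have h1 := (tendsto_finsetSum Finset.univ fun k _ =>
    (hinv (Fin.last 4) k).mul (hmom (k : ℕ))).const_mul ((4 : ℕ).factorial : ℝ)
  simp only [mul_zero, Finset.sum_const_zero] at h1
  refine h1.congr fun z => ?_
  have h2 : ∀ k : ℕ, locMoment (sidePow (fun _ => 1) s k) 1 (sampleX W z.1 z.2.1)
      (errAt est ηbar fold W z.1 z.2.1) =
      locMoment (sidePow (fun _ => 1) s k) 1 (sampleX W z.1 z.2.1) (sampleM est fold W z.1 z.2.1) -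
      locMoment (sidePow (fun _ => 1) s k) 1 (sampleX W z.1 z.2.1)
        (adjustedSample (ηbar z.1) fun i => W z.1 i z.2.1) := fun k => by
    rw [← locMoment_sub]
    congr 1
    funext i
    simp only [sampleM, crossFitted, errAt, stageErr, adjusted, adjustedSample]
    ring
  simp only [gammaHat_eq, betaHat_eq _ _ _ _ one_pos, one_pow, inv_one, mul_one, Fin.val_last]
  rw [← mul_sub]
  congr 1
  simp only [Matrix.mulVec, dotProduct, ← Finset.sum_sub_distrib, ← mul_sub, h2]

end GlobalFit

/-! ### Orders of magnitude -/

/-- The rounded-up binary logarithm is at most `log n / log 2 + 1`, and any positive power outgrows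
it. -/
theorem tendsto_clog_sq_div {β : ℝ} (hβ : 0 < β) :
    Tendsto (fun n : ℕ => ((3 * Nat.clog 2 n : ℕ) + 3 : ℝ) ^ 2 / (n : ℝ) ^ β) atTop (𝓝 0) := by
  have h1 : Tendsto (fun n : ℕ => Real.log n / (n : ℝ) ^ (β / 2)) atTop (𝓝 0) :=
    ((isLittleO_log_rpow_atTop (half_pos hβ)).tendsto_div_nhds_zero).comp
      tendsto_natCast_atTop_atTop
  have h2 : Tendsto (fun n : ℕ => (n : ℝ) ^ (-(β / 2))) atTop (𝓝 0) :=
    (tendsto_rpow_neg_atTop (half_pos hβ)).comp tendsto_natCast_atTop_atTop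
  have h3 := (((h1.const_mul (3 / Real.log 2)).add (h2.const_mul 6)).pow 2)
  simp only [mul_zero, add_zero, ne_eq, OfNat.ofNat_ne_zero, not_false_eq_true, zero_pow] at h3
  refine squeeze_zero' (Eventually.of_forall fun n => by positivity) ?_ h3
  filter_upwards [eventually_gt_atTop 0] with n hn
  have hn' : (0 : ℝ) < n := by exact_mod_cast hn
  have h4 : (Nat.clog 2 n : ℝ) ≤ Real.log n / Real.log 2 + 1 := by
    have h5 : Nat.clog 2 n ≤ Nat.log 2 n + 1 :=
      Nat.clog_le_of_le_pow (Nat.lt_pow_succ_log_self one_lt_two n).le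
    have h6 := Real.natLog_le_logb n 2
    rw [Real.logb] at h6
    have h7 : (Nat.clog 2 n : ℝ) ≤ Nat.log 2 n + 1 := by exact_mod_cast h5
    push_cast at h6
    linarith
  have h8 : (n : ℝ) ^ β = ((n : ℝ) ^ (β / 2)) ^ 2 := by
    rw [← Real.rpow_natCast, ← Real.rpow_mul hn'.le]; norm_num
  rw [h8, ← div_pow]
  refine pow_le_pow_left₀ (by positivity) ?_ 2
  rw [Real.rpow_neg hn'.le, div_le_iff₀ (by positivity)]
  push_cast
  have h9 : (3 / Real.log 2 * (Real.log n / (n : ℝ) ^ (β / 2)) + 6 * ((n : ℝ) ^ (β / 2))⁻¹) *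
      (n : ℝ) ^ (β / 2) = 3 * (Real.log n / Real.log 2) + 6 := by
    have : 0 < Real.log 2 := Real.log_pos one_lt_two
    field_simp
  rw [h9]
  linarith

theorem mul_rpow_neg_pow {n : ℕ} (hn : 0 < n) (γ : ℝ) (k : ℕ) :
    (n : ℝ) * ((n : ℝ) ^ (-γ)) ^ k = (n : ℝ) ^ (1 - γ * k) := by
  have hn' : (0 : ℝ) < n := by exact_mod_cast hn
  rw [← Real.rpow_natCast, ← Real.rpow_mul hn'.le, Real.rpow_sub hn', Real.rpow_one, neg_mul,
    Real.rpow_neg hn'.le, div_eq_mul_inv]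

theorem tendsto_mul_rpow_neg_pow {γ : ℝ} {k : ℕ} (h : γ * k < 1) :
    Tendsto (fun n : ℕ => (n : ℝ) * ((n : ℝ) ^ (-γ)) ^ k) atTop atTop := by
  refine ((tendsto_rpow_atTop (sub_pos.2 h)).comp tendsto_natCast_atTop_atTop).congr' ?_
  filter_upwards [eventually_gt_atTop 0] with n hn using (mul_rpow_neg_pow hn γ k).symm

theorem tendsto_natCast_rpow_neg {γ : ℝ} (h : 0 < γ) :
    Tendsto (fun n : ℕ => (n : ℝ) ^ (-γ)) atTop (𝓝 0) :=
  (tendsto_rpow_neg_atTop h).comp tendsto_natCast_atTop_atTop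

theorem eventually_natCast_rpow_pos (γ : ℝ) : ∀ᶠ n : ℕ in atTop, 0 < (n : ℝ) ^ γ := by
  filter_upwards [eventually_gt_atTop 0] with n hn
  have hn' : (0 : ℝ) < n := by exact_mod_cast hn
  positivity

theorem rpow_mul_mem_Icc {Q q₁ q₂ e y : ℝ} (h1 : 0 < q₁) (hQ : Q ∈ Set.Icc q₁ q₂) (he : 0 ≤ e)
    (hy : 0 ≤ y) : Q ^ e * y ∈ Set.Icc (q₁ ^ e * y) (q₂ ^ e * y) :=
  ⟨mul_le_mul_of_nonneg_right (Real.rpow_le_rpow h1.le hQ.1 he) hy,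
    mul_le_mul_of_nonneg_right (Real.rpow_le_rpow (h1.le.trans hQ.1) hQ.2 he) hy⟩

theorem div_mem_Icc {N D a A b B : ℝ} (ha : 0 < a) (hb : 0 < b) (hN : N ∈ Set.Icc a A)
    (hD : D ∈ Set.Icc b B) : N / D ∈ Set.Icc (a / B) (A / b) := by
  have hD0 : 0 < D := hb.trans_le hD.1
  exact ⟨div_le_div₀ (ha.le.trans hN.1) hN.1 hD0 hD.2,
    div_le_div₀ ((ha.le.trans hN.1).trans hN.2) hN.2 hb hD.1⟩

/-- The initial and the pilot bandwidth share this form: a ratio of quantities bounded above and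
away from zero, raised to a power. -/
theorem rate_mem_Icc {k m V Q B J q₁ q₂ j₁ j₂ e y : ℝ} (hk : 0 < k) (hB : 0 < B) (hq : 0 < q₁)
    (hj : 0 < j₁) (he : 0 ≤ e) (hy : 0 ≤ y) (hQ : m * V * Q ∈ Set.Icc q₁ q₂)
    (hJ : J ∈ Set.Icc j₁ j₂) : (k * m * V * Q / (2 * B ^ 2 * J)) ^ e * y ∈
      Set.Icc ((k * q₁ / (2 * B ^ 2 * j₂)) ^ e * y) ((k * q₂ / (2 * B ^ 2 * j₁)) ^ e * y) := by
  have hj₂ := hj.trans_le (hJ.1.trans hJ.2)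
  refine rpow_mul_mem_Icc (by positivity) (div_mem_Icc (by positivity) (by positivity) ?_
    ⟨mul_le_mul_of_nonneg_left hJ.1 (by positivity),
      mul_le_mul_of_nonneg_left hJ.2 (by positivity)⟩) he hy
  rw [show k * m * V * Q = k * (m * V * Q) by ring]
  exact ⟨mul_le_mul_of_nonneg_left hQ.1 hk.le, mul_le_mul_of_nonneg_left hQ.2 hk.le⟩

/-- Once the error is below `1 / (2 C)`, the triangle inequality keeps `|J|` between `1 / (2 C)` and
`2 C`. -/
theorem eventually_sq_mem_Icc {ι : Type*} {l : Filter ι} {J J₀ : ι → ℝ} {C : ℝ} (hC : 0 < C)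
    (hJ : Tendsto (fun z => J z - J₀ z) l (𝓝 0)) (h0 : ∀ᶠ z in l, |J₀ z| ∈ Set.Icc (1 / C) C) :
    ∀ᶠ z in l, J z ^ 2 ∈ Set.Icc ((1 / (2 * C)) ^ 2) ((2 * C) ^ 2) := by
  have h1 : (0 : ℝ) < 1 / (2 * C) := by positivity
  filter_upwards [hJ.abs.eventually_le_const (show |(0 : ℝ)| < 1 / (2 * C) by simpa using h1), h0]
    with z hz ⟨hz1, hz2⟩
  have h2 := abs_sub_abs_le_abs_sub (J₀ z) (J z)
  have h3 := abs_sub_abs_le_abs_sub (J z) (J₀ z)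
  rw [abs_sub_comm (J₀ z)] at h2
  have h4 : 1 / C = 2 * (1 / (2 * C)) := by field_simp
  rw [← sq_abs (J z)]
  exact ⟨pow_le_pow_left₀ h1.le (by linarith) 2, pow_le_pow_left₀ (abs_nonneg _) (by linarith) 2⟩

/-! ### The three bandwidth steps -/

section Steps

universe u

variable {Ω : ℕ → Type u} [∀ n, MeasurableSpace (Ω n)] {P : ∀ n, Measure (Ω n)}
  [∀ n, IsProbabilityMeasure (P n)] {PX : Measure ℝ} [IsProbabilityMeasure PX] {fX K : ℝ → ℝ}
  {d : ℕ → ℕ} {κ : ∀ n, Kernel ℝ (ℝ × (Fin (d n) → ℝ))} [∀ n, IsMarkovKernel (κ n)]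
  {W : ∀ n, Fin n → Ω n → Obs (d n)} {S : ℕ} {fold : ∀ n, Ω n → Fin n → Fin S}
  {est : ∀ n, (I : Finset (Fin n)) → (I → Obs (d n)) → (Fin (d n) → ℝ) → ℝ}
  {T : ∀ n, Set ((Fin (d n) → ℝ) → ℝ)} {ηbar : ∀ n, (Fin (d n) → ℝ) → ℝ} {R : ℕ} {v : ℕ → ℝ}
  {H : ℕ → Set ℝ}

/-- Squeezing between multiples of `n^(-γ)`; divergence holds because `n^(1 - γ k)` has a positive
exponent. -/
theorem tendsto_of_mem_Icc_rpow {A : (Σ n, Ω n × ℝ) → ℝ} {a a' γ : ℝ} (ha : 0 < a) (hγ : 0 < γ)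
    {k : ℕ} (hk : γ * k < 1) (hA : ∀ᶠ z in inProb P H,
      A z ∈ Set.Icc (a * (z.1 : ℝ) ^ (-γ)) (a' * (z.1 : ℝ) ^ (-γ))) :
    Tendsto A (inProb P H) (𝓝 0) ∧ Tendsto (fun z => (z.1 : ℝ) * A z ^ k) (inProb P H) atTop := by
  have hpos := (tendsto_fst_inProb (P := P) (H := H)).eventually (eventually_natCast_rpow_pos (-γ))
  constructor
  · refine squeeze_zero' (g := fun z : Σ n, Ω n × ℝ => a' * (z.1 : ℝ) ^ (-γ)) ?_
      (hA.mono fun z hz => hz.2)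
      (by simpa using (tendsto_inProb_self (tendsto_natCast_rpow_neg hγ)).const_mul a')
    filter_upwards [hA, hpos] with z hz hz0 using (by positivity : 0 ≤ a * _).trans hz.1
  · refine tendsto_atTop_mono' _ ?_ (((tendsto_mul_rpow_neg_pow hk).comp
      tendsto_fst_inProb).const_mul_atTop (show 0 < a ^ k by positivity))
    filter_upwards [hA, hpos] with z hz hz0
    have h1 : (a * (z.1 : ℝ) ^ (-γ)) ^ k ≤ A z ^ k := pow_le_pow_left₀ (by positivity) hz.1 k
    rw [mul_pow] at h1
    calc a ^ k * ((z.1 : ℝ) * ((z.1 : ℝ) ^ (-γ)) ^ k) =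
        (z.1 : ℝ) * (a ^ k * ((z.1 : ℝ) ^ (-γ)) ^ k) := by ring
      _ ≤ _ := mul_le_mul_of_nonneg_left h1 (Nat.cast_nonneg _)

theorem IsBandwidth.isLocalSeq {k : ℕ} (hk : 0 < k) {h : ℕ → ℝ} (hh : IsBandwidth k h) :
    IsLocalSeq h where
  pos := Eventually.of_forall hh.1
  zero := hh.2.1
  rate := by
    refine tendsto_atTop_mono' _ ?_ hh.2.2
    filter_upwards [hh.2.1.eventually_le_const one_pos] with n hn
    exact mul_le_mul_of_nonneg_left
      ((pow_le_pow_of_le_one (hh.1 n).le hn hk).trans (by rw [pow_one])) (Nat.cast_nonneg _)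

theorem IsModel.exists_seSq_bounds (h : IsModel P PX fX K κ W fold est T ηbar)
    {δ : ℕ → ℝ} (hδ : IsLocalSeq δ) (hR : 0 < R) (p : ℕ) (v : Fin (p + 1)) :
    ∃ a A, 0 < a ∧ ∀ H, ∀ᶠ z in inProb P H, (z.1 : ℝ) * δ z.1 ^ (2 * (v : ℕ) + 1) *
      seSq K R p v (δ z.1) (sampleX W z.1 z.2.1) (sampleM est fold W z.1 z.2.1) ∈ Set.Icc a A := by
  obtain ⟨C, hC, hσ⟩ := h.exists_sideVar_bounds
  have hf := h.density.pos
  have h1 := varConst_pos h.kernel p v .plus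
  have h2 := varConst_pos h.kernel p v .minus
  set c₁ := varConst K p v .plus / fX 0 with hc₁
  set c₂ := varConst K p v .minus / fX 0 with hc₂
  have h3 : 0 < c₁ := by positivity
  have h4 : 0 < c₂ := by positivity
  -- The lower bound keeps the contribution of the right side and lets that of the left side absorb
  -- the error; the upper bound has slack one.
  refine ⟨c₁ * (1 / C), c₁ * C + c₂ * C + 1, by positivity, fun H => ?_⟩
  have h5 := h.tendsto_seSq hδ hR p v (H := H)
  have h6 : 0 < c₂ * (1 / C) := by positivity
  filter_upwards [h5.eventually_le_const one_pos,
    h5.eventually_const_le (show -(c₂ * (1 / C)) < 0 by linarith)] with z hz1 hz2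
  have e1 := mul_le_mul_of_nonneg_left (hσ z.1 .plus).1 h3.le
  have e2 := mul_le_mul_of_nonneg_left (hσ z.1 .plus).2 h3.le
  have e3 := mul_le_mul_of_nonneg_left (hσ z.1 .minus).1 h4.le
  have e4 := mul_le_mul_of_nonneg_left (hσ z.1 .minus).2 h4.le
  constructor <;> linarith

/-- The order of magnitude of the initial bandwidth. -/
theorem IsModel.exists_cHat_bounds (h : IsModel P PX fX K κ W fold est T ηbar) (hR : 0 < R)
    (hv : IsBandwidth 1 v) {C : ℝ} (hC : 0 < C) (hγ : HoldsWPA1 P fun n =>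
      {ω | |gammaHat .plus (sampleX W n ω) (adjustedSample (ηbar n) fun i => W n i ω) -
          gammaHat .minus (sampleX W n ω) (adjustedSample (ηbar n) fun i => W n i ω)| ∈
        Set.Icc (1 / C) C}) :
    ∃ a A, 0 < a ∧ ∀ H, ∀ᶠ z in inProb P H,
      cHat K R (v z.1) (sampleX W z.1 z.2.1) (sampleM est fold W z.1 z.2.1) ∈
        Set.Icc (a * (z.1 : ℝ) ^ (-(1 / 9) : ℝ)) (A * (z.1 : ℝ) ^ (-(1 / 9) : ℝ)) := by
  obtain ⟨s₁, s₂, hs₁, hs⟩ := h.exists_seSq_bounds (hv.isLocalSeq one_pos) hR 3 (Fin.last 3)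
  have hB := biasConst_last_pos h.kernel 3
  refine ⟨(7 * s₁ / (2 * biasConst K 3 (Fin.last 3) ^ 2 * (2 * C) ^ 2)) ^ (1 / 9 : ℝ),
    (7 * s₂ / (2 * biasConst K 3 (Fin.last 3) ^ 2 * (1 / (2 * C)) ^ 2)) ^ (1 / 9 : ℝ),
    Real.rpow_pos_of_pos (by positivity) _, fun H => ?_⟩
  have h1 := (h.tendsto_gammaHat .plus H).sub (h.tendsto_gammaHat .minus H)
  rw [sub_zero] at h1
  have h2 := eventually_sq_mem_Icc
    (J := fun z : Σ n, Ω n × ℝ =>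
      gammaHat .plus (sampleX W z.1 z.2.1) (sampleM est fold W z.1 z.2.1) -
      gammaHat .minus (sampleX W z.1 z.2.1) (sampleM est fold W z.1 z.2.1))
    (J₀ := fun z : Σ n, Ω n × ℝ => gammaHat .plus (sampleX W z.1 z.2.1)
        (adjustedSample (ηbar z.1) fun i => W z.1 i z.2.1) -
      gammaHat .minus (sampleX W z.1 z.2.1)
        (adjustedSample (ηbar z.1) fun i => W z.1 i z.2.1))
    hC (h1.congr fun z => by ring) (eventually_inProb_of_holds hγ)
  filter_upwards [hs H, h2] with z hz1 hz2
  exact rate_mem_Icc (by norm_num) hB hs₁ (by positivity) (by norm_num)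
    (Real.rpow_nonneg (Nat.cast_nonneg _) _) hz1 hz2

/-- A pilot bandwidth together with the bounds that make the derivative estimates and their standard
errors well behaved. -/
structure IsStepPilot (P : ∀ n, Measure (Ω n)) (PX : Measure ℝ) (W : ∀ n, Fin n → Ω n → Obs (d n))
    (K : ℝ → ℝ) (κ : ∀ n, Kernel ℝ (ℝ × (Fin (d n) → ℝ))) (T : ∀ n, Set ((Fin (d n) → ℝ) → ℝ))
    (ηbar : ∀ n, (Fin (d n) → ℝ) → ℝ) (p : ℕ) (H : ℕ → Set ℝ) : Prop where
  pilot : IsPilot P PX W K p H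
  deriv : ∃ hi : ℕ → ℝ, (∀ᶠ n in atTop, ∀ k ∈ H n, k ≤ hi n) ∧ (∀ᶠ n in atTop, 0 < hi n) ∧
    Tendsto hi atTop (𝓝 0) ∧ FirstStageDerivatives PX.support κ T ηbar hi
  order : ∃ δ : ℕ → ℝ, IsLocalSeq δ ∧ ∃ r > 0, ∀ᶠ n in atTop, ∀ k ∈ H n, r * δ n ≤ k ∧ k ≤ δ n

theorem IsModel.tendsto_betaHat_of_step (h : IsModel P PX fX K κ W fold est T ηbar) {p : ℕ}
    (hp : p = 2 ∨ p = 3) (hstep : IsStepPilot P PX W K κ T ηbar p H) (s : Side) :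
    Tendsto (fun z => betaHat K p (Fin.last p) s z.2.2 (sampleX W z.1 z.2.1)
      (sampleM est fold W z.1 z.2.1) - betaPop (κ z.1) (adjusted (ηbar z.1)) p s)
      (inProb P H) (𝓝 0) := by
  obtain ⟨hi, h1, h2, h3, h4⟩ := hstep.deriv
  exact h.tendsto_betaHat hp hstep.pilot h1 h2 h3 h4 s

theorem IsModel.tendsto_seSq_of_step (h : IsModel P PX fX K κ W fold est T ηbar) (hR : 0 < R)
    {p : ℕ} (hstep : IsStepPilot P PX W K κ T ηbar p H) :
    Tendsto (fun z => seSq K R p (Fin.last p) z.2.2 (sampleX W z.1 z.2.1)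
      (sampleM est fold W z.1 z.2.1)) (inProb P H) (𝓝 0) := by
  obtain ⟨δ, h1, r, h2, h3⟩ := hstep.order
  exact h.tendsto_seSq_zero h1 hR hstep.pilot h2 h3

theorem seSq_nonneg {n : ℕ} (K : ℝ → ℝ) (R p : ℕ) (v : Fin (p + 1)) (h : ℝ) (x m : Fin n → ℝ) :
    0 ≤ seSq K R p v h x m :=
  Finset.sum_nonneg fun i _ => mul_nonneg (sq_nonneg _) (sigmaHatSq_nonneg R x m i)

/-- The order of magnitude of the pilot bandwidth. -/
theorem IsModel.exists_bHat_bounds (h : IsModel P PX fX K κ W fold est T ηbar) (hR : 0 < R)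
    (hv : IsBandwidth 1 v) {C : ℝ} (hC : 0 < C)
    (hβ : ∀ n, |betaPop (κ n) (adjusted (ηbar n)) 3 .plus +
      betaPop (κ n) (adjusted (ηbar n)) 3 .minus| ∈ Set.Icc (1 / C) C) :
    ∃ a A, 0 < a ∧ ∀ H, IsStepPilot P PX W K κ T ηbar 3 H → ∀ᶠ z in inProb P H,
      bHat K R (v z.1) z.2.2 (sampleX W z.1 z.2.1) (sampleM est fold W z.1 z.2.1) ∈
        Set.Icc (a * (z.1 : ℝ) ^ (-(1 / 7) : ℝ)) (A * (z.1 : ℝ) ^ (-(1 / 7) : ℝ)) := by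
  obtain ⟨s₁, s₂, hs₁, hs⟩ := h.exists_seSq_bounds (hv.isLocalSeq one_pos) hR 2 (Fin.last 2)
  have hB := biasConst_last_pos h.kernel 2
  -- The summand `3` bounds the regularization term, as the squared standard error is eventually at
  -- most one.
  refine ⟨(5 * s₁ / (2 * biasConst K 2 (Fin.last 2) ^ 2 * ((2 * C) ^ 2 + 3))) ^ (1 / 7 : ℝ),
    (5 * s₂ / (2 * biasConst K 2 (Fin.last 2) ^ 2 * (1 / (2 * C)) ^ 2)) ^ (1 / 7 : ℝ),
    Real.rpow_pos_of_pos (by positivity) _, fun H hstep => ?_⟩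
  have h1 := (h.tendsto_betaHat_of_step (.inr rfl) hstep .plus).add
    (h.tendsto_betaHat_of_step (.inr rfl) hstep .minus)
  rw [add_zero] at h1
  have h2 := eventually_sq_mem_Icc
    (J := fun z : Σ n, Ω n × ℝ => betaHat K 3 (Fin.last 3) .plus z.2.2 (sampleX W z.1 z.2.1)
        (sampleM est fold W z.1 z.2.1) +
      betaHat K 3 (Fin.last 3) .minus z.2.2 (sampleX W z.1 z.2.1) (sampleM est fold W z.1 z.2.1))
    (J₀ := fun z : Σ n, Ω n × ℝ => betaPop (κ z.1) (adjusted (ηbar z.1)) 3 .plus +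
      betaPop (κ z.1) (adjusted (ηbar z.1)) 3 .minus)
    hC (h1.congr fun z => by ring) (Eventually.of_forall fun z => hβ z.1)
  filter_upwards [hs H, h2, (h.tendsto_seSq_of_step hR hstep).eventually_le_const one_pos]
    with z hz1 hz2 hz3
  have hz4 := seSq_nonneg K R 3 (Fin.last 3) z.2.2 (sampleX W z.1 z.2.1)
    (sampleM est fold W z.1 z.2.1)
  exact rate_mem_Icc (by norm_num) hB hs₁ (by positivity) (by norm_num)
    (Real.rpow_nonneg (Nat.cast_nonneg _) _) hz1 ⟨by linarith [hz2.1], by linarith [hz2.2]⟩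

theorem continuousAt_iteratedDeriv_two {f : ℝ → ℝ} {x : ℝ} (hf : ContDiffAt ℝ 2 f x) :
    ContinuousAt (iteratedDeriv 2 f) x := by
  have h1 := (hf.iteratedFDeriv_right (m := 0) (i := 2) (by norm_num)).continuousAt
  exact (ContinuousMultilinearMap.apply ℝ (fun _ : Fin 2 => ℝ) ℝ
    (fun _ => 1)).continuous.continuousAt.comp h1

/-- The adjustment does not change the jump in the second derivative of the conditional mean. -/
theorem IsModel.exists_betaPop_fst (h : IsModel P PX fX K κ W fold est T ηbar) (n : ℕ) :
    ∃ c, ∀ s, betaPop (κ n) Prod.fst 2 s = betaPop (κ n) (adjusted (ηbar n)) 2 s + c := by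
  obtain ⟨ρ, hρ, hsub⟩ := h.density.exists_Icc_subset_support
  obtain ⟨-, hint, hη⟩ := h.admissible n _ (h.mem n)
  obtain ⟨C, L, q, -, -, hreg⟩ := h.reg
  set g := condMean (κ n) (adjusted (ηbar n)) with hg
  set gη := condMean (κ n) fun w => ηbar n w.2 with hgη
  -- The mean of the adjustment is twice continuously differentiable at the cutoff, so it shifts
  -- both one-sided second derivatives by the same amount.
  refine ⟨iteratedDeriv 2 gη 0, fun s => ?_⟩
  obtain ⟨c, -, hlim, -⟩ := exists_outcome_expansion (hreg n).1 ((hreg n).2.1 2 (by simp)).1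
    ((hreg n).2.1 4 (by simp)).2 hρ hsub s (.inl rfl)
  have hle : s.filter ≤ 𝓝 (0 : ℝ) := by
    cases s
    · exact nhdsWithin_le_nhds
    · exact nhdsWithin_le_nhds
  have h1 := hlim.add ((continuousAt_iteratedDeriv_two hη).tendsto.mono_left hle)
  refine Tendsto.limUnder_eq (h1.congr' ?_)
  have h2 : ∀ᶠ x in s.filter, x ∈ sideSet s (ρ / 2) := sideSet_mem_filter s (by linarith)
  filter_upwards [h2, hle (hη.eventually (by simp))] with x hx hxη
  have hxρ : Set.Icc (-ρ) ρ \ {0} ∈ 𝓝 x := by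
    have h3 := abs_le.1 hx.2.2
    exact inter_mem (Icc_mem_nhds (by linarith) (by linarith))
      (isOpen_compl_singleton.mem_nhds hx.2.1)
  have hgx : ContDiffAt ℝ 2 g x := ((hreg n).1.contDiffAt (mem_of_superset hxρ
    (Set.sdiff_subset_sdiff_left hsub))).of_le (by norm_num)
  rw [← iteratedDeriv_fun_add hgx hxη]
  refine Filter.EventuallyEq.iteratedDeriv_eq 2 ?_
  filter_upwards [hxρ] with y hy
  have hy' := hsub hy.1
  have h4 : g y = condMean (κ n) Prod.fst y - gη y :=
    integral_sub (h.integrable n y hy') (hint y hy')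
  rw [h4]
  ring

/-- The main bandwidth is asymptotically equivalent to its target. -/
theorem IsModel.tendsto_hHat_div (h : IsModel P PX fX K κ W fold est T ηbar) (hR : 0 < R)
    (hv : IsBandwidth 1 v) {C : ℝ} (hC : 0 < C)
    (hβ : ∀ n, |betaPop (κ n) (adjusted (ηbar n)) 2 .plus -
      betaPop (κ n) (adjusted (ηbar n)) 2 .minus| ∈ Set.Icc (1 / C) C)
    (hstep : IsStepPilot P PX W K κ T ηbar 2 H) :
    Tendsto (fun z => hHat K R (v z.1) z.2.2 (sampleX W z.1 z.2.1)
      (sampleM est fold W z.1 z.2.1) / hAMSE K fX (κ z.1) (ηbar z.1) z.1) (inProb P H) (𝓝 1) := by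
  obtain ⟨Cs, hCs, hσ⟩ := h.exists_sideVar_bounds
  have hf := h.density.pos
  have hB : biasConst K 1 0 ≠ 0 := by
    rw [biasConst_one_zero]; exact div_ne_zero (nuBar_ne_zero h.kernel) two_ne_zero
  have hkap : 0 < kappaBar K := by
    rw [← varConst_one_zero h.kernel .plus]; exact varConst_pos h.kernel 1 0 .plus
  set J₀ : (Σ n, Ω n × ℝ) → ℝ := fun z => betaPop (κ z.1) (adjusted (ηbar z.1)) 2 .plus -
    betaPop (κ z.1) (adjusted (ηbar z.1)) 2 .minus with hJ₀
  set J : (Σ n, Ω n × ℝ) → ℝ := fun z => betaHat K 2 (Fin.last 2) .plus z.2.2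
      (sampleX W z.1 z.2.1) (sampleM est fold W z.1 z.2.1) -
    betaHat K 2 (Fin.last 2) .minus z.2.2 (sampleX W z.1 z.2.1)
      (sampleM est fold W z.1 z.2.1) with hJ
  set se : (Σ n, Ω n × ℝ) → ℝ := fun z => seSq K R 2 (Fin.last 2) z.2.2 (sampleX W z.1 z.2.1)
    (sampleM est fold W z.1 z.2.1) with hse
  set N : (Σ n, Ω n × ℝ) → ℝ := fun z => z.1 * v z.1 * seSq K R 1 0 (v z.1) (sampleX W z.1 z.2.1)
    (sampleM est fold W z.1 z.2.1) with hN
  set V : (Σ n, Ω n × ℝ) → ℝ := fun z => asymVar K fX (κ z.1) (ηbar z.1) with hV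
  have hJ₀pos : ∀ z, 1 / C ≤ |J₀ z| := fun z => (hβ z.1).1
  have hJ₀sq : ∀ z, 0 < J₀ z ^ 2 := fun z =>
    sq_pos_of_ne_zero (abs_pos.1 ((by positivity : 0 < 1 / C).trans_le (hJ₀pos z)))
  have hVeq : ∀ z, V z = kappaBar K / fX 0 * (sideVar κ ηbar .plus z.1 +
    sideVar κ ηbar .minus z.1) := fun z => rfl
  set V₀ := kappaBar K / fX 0 * (1 / Cs) with hV₀
  have hV₀pos : 0 < V₀ := by positivity
  have hVpos : ∀ z, V₀ ≤ V z := fun z => by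
    rw [hVeq]
    refine mul_le_mul_of_nonneg_left ?_ (by positivity)
    have := (hσ z.1 .minus).1
    have h0 : 0 < 1 / Cs := by positivity
    linarith [(hσ z.1 .plus).1]
  have hNV : Tendsto (fun z => N z - V z) (inProb P H) (𝓝 0) := by
    have h1 := h.tendsto_seSq (hv.isLocalSeq one_pos) hR 1 0 (H := H)
    refine h1.congr fun z => ?_
    rw [varConst_one_zero h.kernel, varConst_one_zero h.kernel, hVeq]
    simp only [hN, Fin.val_zero, mul_zero, zero_add, pow_one]
    ring
  -- Population quantities vary with `n` and need not converge, so ratios are compared; this is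
  -- possible because they stay away from zero.
  have hNV1 : Tendsto (fun z => N z / V z) (inProb P H) (𝓝 1) := by
    have h1 := (tendsto_mul_bounded (f := fun z => (V z)⁻¹) (C := V₀⁻¹)
      (Eventually.of_forall fun z => by
        rw [abs_of_pos (inv_pos.2 (hV₀pos.trans_le (hVpos z)))]
        exact inv_anti₀ hV₀pos (hVpos z)) hNV).add_const 1
    rw [zero_add] at h1
    refine h1.congr fun z => ?_
    have := (hV₀pos.trans_le (hVpos z)).ne'
    field_simp
    ring
  have hJJ : Tendsto (fun z => J z / J₀ z) (inProb P H) (𝓝 1) := by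
    have h0 := (h.tendsto_betaHat_of_step (.inl rfl) hstep .plus).sub
      (h.tendsto_betaHat_of_step (.inl rfl) hstep .minus)
    rw [sub_zero] at h0
    have h1 := (tendsto_mul_bounded (f := fun z => (J₀ z)⁻¹) (C := (1 / C)⁻¹)
      (Eventually.of_forall fun z => by
        rw [abs_inv]
        exact inv_anti₀ (by positivity) (hJ₀pos z)) h0).add_const 1
    rw [zero_add] at h1
    refine h1.congr fun z => ?_
    have h2 : J₀ z ≠ 0 := fun h3 => by simpa [h3] using hJ₀sq z
    have h3 : betaHat K 2 (Fin.last 2) .plus z.2.2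
          (sampleX W z.1 z.2.1) (sampleM est fold W z.1 z.2.1) -
        betaPop (κ z.1) (adjusted (ηbar z.1)) 2 .plus -
        (betaHat K 2 (Fin.last 2) .minus z.2.2 (sampleX W z.1 z.2.1)
          (sampleM est fold W z.1 z.2.1) - betaPop (κ z.1) (adjusted (ηbar z.1)) 2 .minus) =
        J z - J₀ z := by simp only [hJ, hJ₀]; ring
    rw [h3]
    field_simp
    ring
  have hden : Tendsto (fun z => (J z ^ 2 + 3 * se z) / J₀ z ^ 2) (inProb P H) (𝓝 1) := by
    have h1 := tendsto_mul_bounded (f := fun z => (J₀ z ^ 2)⁻¹) (C := ((1 / C) ^ 2)⁻¹)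
      (Eventually.of_forall fun z => by
        rw [abs_of_pos (inv_pos.2 (hJ₀sq z)), ← sq_abs (J₀ z)]
        exact inv_anti₀ (by positivity) (pow_le_pow_left₀ (by positivity) (hJ₀pos z) 2))
      (h.tendsto_seSq_of_step hR hstep)
    have h2 := (hJJ.pow 2).add (h1.const_mul 3)
    simp only [one_pow, mul_zero, add_zero] at h2
    refine h2.congr fun z => ?_
    simp only [div_pow, hse]
    ring
  have hratio := (hNV1.div hden one_ne_zero).rpow_const (p := (1 / 5 : ℝ)) (.inr (by norm_num))
  rw [div_one, Real.one_rpow] at hratio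
  refine hratio.congr' ?_
  filter_upwards [tendsto_fst_inProb.eventually (eventually_natCast_rpow_pos (-(1 / 5)))]
    with z hz
  obtain ⟨c, hc⟩ := h.exists_betaPop_fst z.1
  have hbase : biasBase K (κ z.1) = biasConst K 1 0 * J₀ z := by
    rw [biasBase, hc, hc, biasConst_one_zero]
    simp only [hJ₀]
    ring
  have hh : hHat K R (v z.1) z.2.2 (sampleX W z.1 z.2.1) (sampleM est fold W z.1 z.2.1) =
      (N z / (4 * biasConst K 1 0 ^ 2 * (J z ^ 2 + 3 * se z))) ^ (1 / 5 : ℝ) *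
        (z.1 : ℝ) ^ (-(1 / 5) : ℝ) := rfl
  have ht : hAMSE K fX (κ z.1) (ηbar z.1) z.1 =
      (V z / (4 * biasBase K (κ z.1) ^ 2)) ^ (1 / 5 : ℝ) * (z.1 : ℝ) ^ (-(1 / 5) : ℝ) := rfl
  have hV' : 0 < V z := hV₀pos.trans_le (hVpos z)
  have hse0 : 0 ≤ se z := seSq_nonneg _ _ _ _ _ _ _
  rw [hh, ht, hbase, mul_div_mul_right _ _ hz.ne', ← Real.div_rpow _ (by positivity)]
  · congr 1
    have hb2 : biasConst K 1 0 ^ 2 ≠ 0 := pow_ne_zero 2 hB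
    have hj := hJ₀sq z
    rw [mul_pow, Pi.div_apply]
    -- If the estimated denominator vanishes, both sides are zero, since division by zero gives
    -- zero.
    by_cases hd : J z ^ 2 + 3 * se z = 0
    · simp [hd]
    · have hV1 := hV'.ne'
      have hj1 := hj.ne'
      field_simp
  · have hN0 : 0 ≤ N z := mul_nonneg (mul_nonneg (Nat.cast_nonneg _) (hv.1 z.1).le)
      (seSq_nonneg _ _ _ _ _ _ _)
    positivity

end Steps

/-! ### Chaining the steps with estimated pilots -/

section Chain

universe u

variable {Ω : ℕ → Type u} [∀ n, MeasurableSpace (Ω n)] {P : ∀ n, Measure (Ω n)}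
  [∀ n, IsProbabilityMeasure (P n)] {PX : Measure ℝ} [IsProbabilityMeasure PX] {fX K : ℝ → ℝ}
  {d : ℕ → ℕ} {κ : ∀ n, Kernel ℝ (ℝ × (Fin (d n) → ℝ))} [∀ n, IsMarkovKernel (κ n)]
  {W : ∀ n, Fin n → Ω n → Obs (d n)} {S : ℕ} {fold : ∀ n, Ω n → Fin n → Fin S}
  {est : ∀ n, (I : Finset (Fin n)) → (I → Obs (d n)) → (Fin (d n) → ℝ) → ℝ}
  {T : ∀ n, Set ((Fin (d n) → ℝ) → ℝ)} {ηbar : ∀ n, (Fin (d n) → ℝ) → ℝ} {R : ℕ} {v : ℕ → ℝ}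

theorem isLocalSeq_mul_rpow {A γ : ℝ} (hA : 0 < A) (hγ : 0 < γ) (hγ1 : γ < 1) :
    IsLocalSeq fun n => A * (n : ℝ) ^ (-γ) where
  pos := (eventually_natCast_rpow_pos (-γ)).mono fun n hn => by positivity
  zero := by simpa using (tendsto_natCast_rpow_neg hγ).const_mul A
  rate := by
    have h1 := (tendsto_mul_rpow_neg_pow (γ := γ) (k := 1) (by simpa using hγ1)).const_mul_atTop hA
    refine h1.congr fun n => ?_
    rw [pow_one]
    ring

/-- The faster power wins whatever the constant. Bandwidths of order `n^(-1/7)` thus lie in windows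
of order `n^(-1/9)`, for which the derivative condition is available. -/
theorem eventually_mul_rpow_le (A : ℝ) {γ γ' : ℝ} (hγ : γ' < γ) :
    ∀ᶠ n : ℕ in atTop, A * (n : ℝ) ^ (-γ) ≤ 1 * (n : ℝ) ^ (-γ') := by
  have h1 := (tendsto_natCast_rpow_neg (sub_pos.2 hγ)).const_mul A
  rw [mul_zero] at h1
  filter_upwards [h1.eventually_le_const one_pos, eventually_gt_atTop 0] with n hn hn0
  have hn' : (0 : ℝ) < n := by exact_mod_cast hn0
  rw [show -γ = -(γ - γ') + -γ' by ring, Real.rpow_add hn', ← mul_assoc]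
  exact mul_le_mul_of_nonneg_right hn (by positivity)

theorem IsModel.isStepPilot_singleton (h : IsModel P PX fX K κ W fold est T ηbar) {p : ℕ}
    {b : ℕ → ℝ} (hb : IsBandwidth (2 * p + 1) b)
    (hD : FirstStageDerivatives PX.support κ T ηbar b) :
    IsStepPilot P PX W K κ T ηbar p fun n => Set.Icc (b n) (b n) := by
  obtain ⟨ρ, D, hρ⟩ := h.density.exists_densityBound
  have hpos : ∀ᶠ n in atTop, 0 < b n := Eventually.of_forall hb.1
  exact
    { pilot := isPilot_singleton h.kernel h.sample.measurable_sampleX hρ hpos hb.2.1 hb.2.2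
      deriv := ⟨b, Eventually.of_forall fun n k hk => hk.2, hpos, hb.2.1, hD⟩
      order := ⟨b, hb.isLocalSeq (by omega), 1, one_pos,
        Eventually.of_forall fun n k hk => ⟨by simpa using hk.1, hk.2⟩⟩ }

/-- Here `n h^(2p+1)` is a positive power of `n`, which beats the squared logarithm in the uniform
noise bound. The derivative condition may refer to a wider window, of order `n^(-γ')`. -/
theorem IsModel.isStepPilot_rpow (h : IsModel P PX fX K κ W fold est T ηbar)
    (hBV : BoundedVariationOn K (Set.Icc 0 1)) {p : ℕ} {a A B γ γ' : ℝ} (ha : 0 < a) (haA : a ≤ A)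
    (hγ : 0 < γ) (hp : γ * (2 * p + 1 : ℕ) < 1) (hγ' : 0 < γ') (hB : 0 < B)
    (hle : ∀ᶠ n : ℕ in atTop, A * (n : ℝ) ^ (-γ) ≤ B * (n : ℝ) ^ (-γ'))
    (hD : FirstStageDerivatives PX.support κ T ηbar fun n => B * (n : ℝ) ^ (-γ')) :
    IsStepPilot P PX W K κ T ηbar p fun n =>
      Set.Icc (a * (n : ℝ) ^ (-γ)) (A * (n : ℝ) ^ (-γ)) := by
  obtain ⟨ρ, D, hρ⟩ := h.density.exists_densityBound
  have hA := ha.trans_le haA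
  have hγ1 : γ < 1 := lt_of_le_of_lt (le_mul_of_one_le_right hγ.le (by simp)) hp
  refine
    { pilot := isPilot_uniform h.sample h.kernel hBV hρ (eventually_natCast_rpow_pos (-γ))
        (tendsto_natCast_rpow_neg hγ) ha haA (tendsto_mul_rpow_neg_pow hp) ?_
      deriv := ⟨_, hle.mono fun n hn k hk => hk.2.trans hn,
        (eventually_natCast_rpow_pos (-γ')).mono fun n hn => by positivity, ?_, hD⟩
      order := ⟨_, isLocalSeq_mul_rpow hA hγ hγ1, a / A, by positivity,
        Eventually.of_forall fun n k hk => ⟨?_, hk.2⟩⟩ }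
  · refine (tendsto_clog_sq_div (sub_pos.2 hp)).congr' ?_
    filter_upwards [eventually_gt_atTop 0] with n hn
    rw [mul_rpow_neg_pow hn]
  · simpa using (tendsto_natCast_rpow_neg hγ').const_mul B
  · rw [← mul_assoc, div_mul_cancel₀ a hA.ne']
    exact hk.1

theorem IsModel.tendsto_hHat_plugin (h : IsModel P PX fX K κ W fold est T ηbar) (hR : 0 < R)
    (hv : IsBandwidth 1 v) {C : ℝ} (hC : 0 < C)
    (hβ : ∀ n, |betaPop (κ n) (adjusted (ηbar n)) 2 .plus -
      betaPop (κ n) (adjusted (ηbar n)) 2 .minus| ∈ Set.Icc (1 / C) C) {H H' : ℕ → Set ℝ}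
    (hstep : IsStepPilot P PX W K κ T ηbar 2 H') {b : ∀ n, Ω n → ℝ}
    (hb : ∀ᶠ z in inProb P H, b z.1 z.2.1 ∈ H' z.1) :
    Tendsto (fun z : Σ n, Ω n × ℝ => hHat K R (v z.1) (b z.1 z.2.1) (sampleX W z.1 z.2.1)
      (sampleM est fold W z.1 z.2.1) / hAMSE K fX (κ z.1) (ηbar z.1) z.1) (inProb P H) (𝓝 1) :=
  Tendsto.comp (f := fun z : Σ n, Ω n × ℝ => (⟨z.1, z.2.1, b z.1 z.2.1⟩ : Σ n, Ω n × ℝ))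
    (g := fun z : Σ n, Ω n × ℝ => hHat K R (v z.1) z.2.2 (sampleX W z.1 z.2.1)
      (sampleM est fold W z.1 z.2.1) / hAMSE K fX (κ z.1) (ηbar z.1) z.1)
    (h.tendsto_hHat_div hR hv hC hβ hstep) (tendsto_plugin hb)

end Chain

end RDBandwidth

/-! ### Assembly of the theorem -/

open RDBandwidth in
theorem mainTheorem10
    -- number of folds, number of nearest neighbors, kernel function
    {S R : ℕ} (hR : 0 < R) (K : ℝ → ℝ) (hK : IsKernelFunction K)
    -- fixed distribution of the running variable, with bounded support
    (PX : Measure ℝ) [IsProbabilityMeasure PX] (fX : ℝ → ℝ) (hfX : HasRegularDensity PX fX)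
    (hbdd : Bornology.IsBounded PX.support)
    -- conditional distribution of (Y, Z) given X, which may depend on the sample size
    (d : ℕ → ℕ) (κ : ∀ n, Kernel ℝ (ℝ × (Fin (d n) → ℝ))) [∀ n, IsMarkovKernel (κ n)]
    (hY : ∀ n, ∀ x ∈ PX.support, Integrable (fun w => w.1) (κ n x))
    -- i.i.d. samples
    {Ω : ℕ → Type*} [∀ n, MeasurableSpace (Ω n)] (P : ∀ n, Measure (Ω n))
    [∀ n, IsProbabilityMeasure (P n)]
    (W : ∀ n, Fin n → Ω n → Obs (d n)) (hWmeas : ∀ n i, Measurable (W n i))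
    (hWindep : ∀ n, iIndepFun (W n) (P n))
    (hWlaw : ∀ n i, (P n).map (W n i) = PX.compProd (κ n))
    -- random split into folds of equal size (up to rounding), independent of the data
    (fold : ∀ n, Ω n → Fin n → Fin S) (hfmeas : ∀ n, Measurable (fold n))
    (hfindep : ∀ n, IndepFun (fold n) (fun ω i => W n i ω) (P n))
    (hfsize : ∀ n ω s,
      |((Finset.univ.filter fun i => fold n ω i = s).card : ℝ) - (n : ℝ) / S| < 1)
    -- first-stage estimator, a function of the data that it is given
    (est : ∀ n, (I : Finset (Fin n)) → (I → Obs (d n)) → (Fin (d n) → ℝ) → ℝ)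
    (hest : ∀ n I, Measurable (Function.uncurry (est n I)))
    -- realization sets and deterministic approximations
    (T : ∀ n, Set ((Fin (d n) → ℝ) → ℝ)) (ηbar : ∀ n, (Fin (d n) → ℝ) → ℝ)
    (hT : ∀ n, ∀ η ∈ T n, IsAdmissible PX.support (κ n) η) (hηbar : ∀ n, ηbar n ∈ T n)
    (hηhat : ∀ s, HoldsWPA1 P fun n =>
      {ω | etaHat (est n) (fold n ω) (fun i => W n i ω) s ∈ T n})
    (hconc : FirstStageConcentration PX.support κ T ηbar)
    (hreg : OutcomeRegularity PX.support κ ηbar)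
    -- preliminary bandwidth
    (v : ℕ → ℝ) (hv : IsBandwidth 1 v) (hfourth : FourthMomentBound PX.support κ T v)
    -- nondegeneracy of the global fit and of the one-sided derivatives
    (hγ : ∃ C > 0, HoldsWPA1 P fun n =>
      {ω | |gammaHat .plus (runX fun i => W n i ω) (adjustedSample (ηbar n) fun i => W n i ω) -
          gammaHat .minus (runX fun i => W n i ω) (adjustedSample (ηbar n) fun i => W n i ω)| ∈
        Set.Icc (1 / C) C})
    (hβ : ∃ C > 0, ∀ n, ∀ k ∈ ({2, 3} : Set ℕ),
      |betaPop (κ n) (adjusted (ηbar n)) k .plus -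
          (-1) ^ k * betaPop (κ n) (adjusted (ηbar n)) k .minus| ∈ Set.Icc (1 / C) C) :
    let X : ∀ n, Ω n → Fin n → ℝ := fun n ω => runX fun i => W n i ω
    let M : ∀ n, Ω n → Fin n → ℝ := fun n ω => crossFitted (est n) (fold n ω) fun i => W n i ω
    let cn : ∀ n, Ω n → ℝ := fun n ω => cHat K R (v n) (X n ω) (M n ω)
    -- Step 0
    (TendstoInProb P cn 0 ∧ DivergesInProb P fun n ω => n * cn n ω ^ 7) ∧
    -- Step 1, from any nonrandom bandwidth sequence `c`
    (∀ c : ℕ → ℝ, IsBandwidth 7 c → FirstStageDerivatives PX.support κ T ηbar c →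
      TendstoInProb P (fun n ω => bHat K R (v n) (c n) (X n ω) (M n ω)) 0 ∧
      DivergesInProb P fun n ω => n * bHat K R (v n) (c n) (X n ω) (M n ω) ^ 5) ∧
    -- Step 2, from any nonrandom bandwidth sequence `b`
    (∀ b : ℕ → ℝ, IsBandwidth 5 b → FirstStageDerivatives PX.support κ T ηbar b →
      TendstoInProb P (fun n ω =>
        hHat K R (v n) (b n) (X n ω) (M n ω) / hAMSE K fX (κ n) (ηbar n) n) 1) ∧
    -- all steps chained, with the estimated bandwidths as pilots
    (BoundedVariationOn K (Set.Icc 0 1) →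
      (∀ a > 0, FirstStageDerivatives PX.support κ T ηbar
        fun n => a * (n : ℝ) ^ (-(1 / 9) : ℝ)) →
      let bn : ∀ n, Ω n → ℝ := fun n ω => bHat K R (v n) (cn n ω) (X n ω) (M n ω)
      TendstoInProb P bn 0 ∧ (DivergesInProb P fun n ω => n * bn n ω ^ 5) ∧
      TendstoInProb P (fun n ω =>
        hHat K R (v n) (bn n ω) (X n ω) (M n ω) / hAMSE K fX (κ n) (ηbar n) n) 1) := by
  intro X M cn
  have h : IsModel P PX fX K κ W fold est T ηbar :=
    ⟨hK, hfX, hbdd, hY, ⟨hWmeas, hWindep, hWlaw, hfmeas, hfindep⟩, hfsize, hest, hT, hηbar, hηhat,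
      hconc, hreg⟩
  obtain ⟨Cγ, hCγ, hγ⟩ := hγ
  obtain ⟨C, hC, hβ⟩ := hβ
  have hβ3 : ∀ n, |betaPop (κ n) (adjusted (ηbar n)) 3 .plus +
      betaPop (κ n) (adjusted (ηbar n)) 3 .minus| ∈ Set.Icc (1 / C) C := fun n => by
    have h1 := hβ n 3 (by simp)
    rwa [show ((-1 : ℝ) ^ 3) = -1 by norm_num, neg_one_mul, sub_neg_eq_add] at h1
  have hβ2 : ∀ n, |betaPop (κ n) (adjusted (ηbar n)) 2 .plus -
      betaPop (κ n) (adjusted (ηbar n)) 2 .minus| ∈ Set.Icc (1 / C) C := fun n => by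
    have h1 := hβ n 2 (by simp)
    rwa [show ((-1 : ℝ) ^ 2) = 1 by norm_num, one_mul] at h1
  obtain ⟨a, A, ha, hcA⟩ := h.exists_cHat_bounds hR hv hCγ hγ
  obtain ⟨a', A', ha', hbA⟩ := h.exists_bHat_bounds hR hv hC hβ3
  -- Statements that involve no bandwidth coordinate are placed over a dummy one-point set, which
  -- only has to be nonempty.
  have hH : ∀ n : ℕ, ((fun _ => Set.Icc 0 0 : ℕ → Set ℝ) n).Nonempty := fun _ => ⟨0, by simp⟩
  simp only [tendstoInProb_iff hH, divergesInProb_iff hH]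
  refine ⟨tendsto_of_mem_Icc_rpow ha (by norm_num) (by norm_num) (hcA _), fun c hc hD => ?_,
    fun b hb hD => ?_, fun hBV hD => ?_⟩
  · have hcn : ∀ᶠ z : Σ n, Ω n × ℝ in inProb P fun _ => Set.Icc 0 0,
        c z.1 ∈ Set.Icc (c z.1) (c z.1) := Eventually.of_forall fun z => ⟨le_rfl, le_rfl⟩
    have hbn := (tendsto_plugin (H' := fun n => Set.Icc (c n) (c n)) (c := fun n _ => c n)
      hcn).eventually (hbA _ (h.isStepPilot_singleton (p := 3) hc hD))
    exact tendsto_of_mem_Icc_rpow ha' (by norm_num) (k := 5) (by norm_num) hbn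
  · have hbn : ∀ᶠ z : Σ n, Ω n × ℝ in inProb P fun _ => Set.Icc 0 0,
        b z.1 ∈ Set.Icc (b z.1) (b z.1) := Eventually.of_forall fun z => ⟨le_rfl, le_rfl⟩
    exact h.tendsto_hHat_plugin hR hv hC hβ2 (h.isStepPilot_singleton (p := 2) hb hD)
      (b := fun n _ => b n) hbn
  -- The maximum ensures that the lower constant does not exceed the upper one.
  · have hcn : ∀ᶠ z : Σ n, Ω n × ℝ in inProb P fun _ => Set.Icc 0 0, cn z.1 z.2.1 ∈
        Set.Icc (a * (z.1 : ℝ) ^ (-(1 / 9) : ℝ)) (max a A * (z.1 : ℝ) ^ (-(1 / 9) : ℝ)) :=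
      (hcA _).mono fun z hz => ⟨hz.1, hz.2.trans
        (mul_le_mul_of_nonneg_right (le_max_right _ _) (by positivity))⟩
    have hApos : 0 < max a A := ha.trans_le (le_max_left _ _)
    -- At order three with exponent `1 / 9`, `n h^7` is of order `n^(2/9)`.
    have hstep3 := h.isStepPilot_rpow hBV (p := 3) (γ := 1 / 9) (γ' := 1 / 9) ha (le_max_left a A) (by norm_num) (by norm_num)
      (by norm_num) hApos (Eventually.of_forall fun n => le_rfl) (hD _ hApos)
    have hbn := (tendsto_plugin (H' := fun n : ℕ => Set.Icc (a * (n : ℝ) ^ (-(1 / 9) : ℝ))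
      (max a A * (n : ℝ) ^ (-(1 / 9) : ℝ))) hcn).eventually (hbA _ hstep3)
    have hbn' : ∀ᶠ z : Σ n, Ω n × ℝ in inProb P fun _ => Set.Icc 0 0,
        bHat K R (v z.1) (cn z.1 z.2.1) (X z.1 z.2.1) (M z.1 z.2.1) ∈
        Set.Icc (a' * (z.1 : ℝ) ^ (-(1 / 7) : ℝ)) (max a' A' * (z.1 : ℝ) ^ (-(1 / 7) : ℝ)) :=
      hbn.mono fun z hz => ⟨hz.1, hz.2.trans
        (mul_le_mul_of_nonneg_right (le_max_right _ _) (by positivity))⟩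
    -- At order two with exponent `1 / 7`, `n h^5` is of order `n^(2/7)`; the derivative condition
    -- is taken from the wider window `n^(-1/9)`.
    have hstep2 := h.isStepPilot_rpow hBV (p := 2) (γ := 1 / 7) (γ' := 1 / 9) ha' (le_max_left a' A') (by norm_num)
      (by norm_num) (by norm_num) one_pos (eventually_mul_rpow_le _ (by norm_num)) (hD 1 one_pos)
    obtain ⟨h1, h2⟩ := tendsto_of_mem_Icc_rpow ha' (by norm_num) (k := 5) (by norm_num) hbn
    exact ⟨h1, h2, h.tendsto_hHat_plugin hR hv hC hβ2 hstep2
      (b := fun n ω => bHat K R (v n) (cn n ω) (X n ω) (M n ω)) hbn'⟩
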